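/- Let $\mathbb K$ be a commutative ring; all modules are over $\mathbb K$ and $\otimes=\otimes_{\mathbb K}$. "Graded" means $\mathbb Z$-graded, $|x|$ is the degree of a homogeneous element and $|x|_n=|x|+n$. We use Sweedler's notation with homogeneous components, $\Delta(x)=x'\otimes x''=x^{(1)}\otimes x^{(2)}$, and similarly for iterated comultiplications. **Data on $A$.** Let $A$ be a graded Hopf algebra (comultiplication and counit are graded algebra homomorphisms, where $A\otimes A$ has the product $(x\otimes u)(y\otimes v)=(-1)^{|u||y|}xy\otimes uv$) with counit $\varepsilon$ and antipode $s_A$, cocommutative in the sense that $x'\otimes x''=(-1)^{|x'||x''|}x''\otimes x'$. Let $n\in\mathbb Z$ and let $\rho:A\times A\to A$ be a Fox pairing of degree $n$, i.e. a bilinear map with $\rho(A^p,A^q)\subset A^{p+q+n}$, $\rho(x,yz)=\rho(x,y)z+\varepsilon(y)\rho(x,z)$ and $\rho(xy,z)=\rho(x,z)\varepsilon(y)+x\rho(y,z)$. Assume that $\rho$ is antisymmetric: $(-1)^{|x|_n|y|_n}s_A^{-1}\rho(s_A(y),s_A(x))=-\rho(x,y)$ for homogeneous $x,y$. Define $\digamma:A^{\otimes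 3}\to A^{\otimes 3}$ on homogeneous $x,y,z$ by $$\digamma(x,y,z)=(-1)^{e}\; y'\,s_A(r')\,x'\otimes z'\,s_A(q')\,r''\otimes q'',\qquad r=\rho(x'',y''),\quad q=\rho(r''',z''),$$ $$e=|y'||x|_n+|z'|\,(|x''|+|y''|)+(|x'|+|z'|)\,|r'|+|r''||q'| .$$ Let $\mathsf P_{n}(x_1\otimes x_2\otimes x_3)=(-1)^{|x_3|_n|x_1|_n+|x_3|_n|x_2|_n}\,x_3\otimes x_1\otimes x_2$ for homogeneous $x_1,x_2,x_3$, and $\mathsf P=\mathsf P_0$. The tritensor map of $\rho$ is $$\{\!\{-,-,-\}\!\}=\sum_{i=0}^{2}\mathsf P^{i}\circ\digamma\circ\mathsf P_{n}^{-i}\in\operatorname{End}(A^{\otimes 3}),\qquad \{\!\{-,-,-\}\!\}=\{\!\{-,-,-\}\!\}^{\ell}\otimes\{\!\{-,-,-\}\!\}^{m}\otimes\{\!\{-,-,-\}\!\}^{r}.$$ The pairing $\rho$ is called Gerstenhaber if its tritensor map is zero. **Data on $B$.** Let $B$ be a commutative (ungraded) Hopf algebra with counit $\varepsilon$ and antipode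 $s=s_B$. Put $I=\operatorname{Ker}\varepsilon$, $p_B(b)=b-\varepsilon(b)1\bmod I^2\in I/I^2$, and let $\mathfrak g$ be the module of derivations $\mu:B\to\mathbb K$, i.e. linear maps with $\mu(bc)=\varepsilon(b)\mu(c)+\varepsilon(c)\mu(b)$. Let $t\in B$ be trace-like: $t'\otimes t''=t''\otimes t'$, and the map $\mathfrak g\to I/I^2$, $\mu\mapsto\mu(t')\,p_B(t'')$, is an isomorphism. For $b\in B$ let $\overline b\in\mathfrak g$ be the preimage of $p_B(b)$ under this isomorphism, and set $b\bullet c=\overline b(c)$ and $b\curlyvee c=(b'\bullet c'')\,b''s(c')$ for $b,c\in B$. **The representation algebra.** Let $A_B$ be the graded algebra generated by symbols $x_b$ ($x\in A$, $b\in B$), with $|x_b|=|x|$ for homogeneous $x$, bilinear in $x$ and $b$, subject to the relations $(xy)_b=x_{b'}y_{b''}$, $(1_A)_b=\varepsilon(b)$, $x_{bc}=x'_b x''_c$, $x_{1_B}=\varepsilon(x)$, and $x_by_c=(-1)^{|x||y|}y_cx_b$ for homogeneous $x,y$. **Brackets.** An $n$-graded bracket in a graded algebra $C$ is a bilinear map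 $\{-,-\}:C\times C\to C$ with $\{C^p,C^q\}\subset C^{p+q+n}$ and, for homogeneous $x,y,z$, $\{x,yz\}=\{x,y\}z+(-1)^{|x|_n|y|}y\{x,z\}$ and $\{xy,z\}=x\{y,z\}+(-1)^{|y||z|_n}\{x,z\}y$. It is antisymmetric if $\{x,y\}=-(-1)^{|x|_n|y|_n}\{y,x\}$, and an antisymmetric $n$-graded bracket is Gerstenhaber of degree $n$ if $$(-1)^{|x|_n|z|_n}\{x,\{y,z\}\}+(-1)^{|x|_n|y|_n}\{y,\{z,x\}\}+(-1)^{|y|_n|z|_n}\{z,\{x,y\}\}=0$$ for all homogeneous $x,y,z$. **Theorem.** There is a unique $n$-graded bracket $\{-,-\}$ in $A_B$ such that for all $x,y\in A$ and $b,c\in B$ $$\{x_b,y_c\}=(-1)^{|x''||y'|_n}\,(c''\bullet b^{(2)})\,\rho(x',y')_{s(b^{(3)})\,b^{(1)}}\,x''_{b^{(4)}}\,y''_{c'} ,$$ and this bracket is antisymmetric. It has the following properties. 1. Let $p=t+s(t)$. For all homogeneous $x,y,z\in A$ and all $b,c,d\in B$, $$(-1)^{|x|_n|z|_n}\{x_b,\{y_c,z_d\}\}+(-1)^{|z|_n|y|_n}\{z_d,\{x_b,y_c\}\}+(-1)^{|y|_n|x|_n}\{y_c,\{z_d,x_b\}\}$$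 $$=-(-1)^{|x''|(|y'|+|z'|)+|y''||z'|_n+|x|_n|z|_n}\,\{\!\{x',y',z'\}\!\}^{\ell}_{p^{(1)}}\,\{\!\{x',y',z'\}\!\}^{m}_{p^{(5)}}\,\{\!\{x',y',z'\}\!\}^{r}_{p^{(3)}}\;x''_{b\curlyvee p^{(2)}}\,y''_{c\curlyvee p^{(6)}}\,z''_{d\curlyvee p^{(4)}} .$$ 2. If $\rho$ is Gerstenhaber, then the bracket $\{-,-\}$ is Gerstenhaber of degree $n$. -/

import Mathlib

open scoped TensorProduct DirectSum

noncomputable section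

namespace FoxRep

/-! ### Signs on graded modules -/

section Signs

variable {K A M : Type*} [CommRing K] [Ring A] [Algebra K A] [AddCommGroup M] [Module K M]
variable (𝒜 : ℤ → Submodule K A) [GradedAlgebra 𝒜]

/-- The linear map equal to `f p` on the homogeneous part `𝒜 p`, for every `p`. -/
def gradedLift (f : ℤ → A →ₗ[K] M) : A →ₗ[K] M :=
  DirectSum.toModule K ℤ M (fun p => f p ∘ₗ (𝒜 p).subtype) ∘ₗ
    (DirectSum.decomposeLinearEquiv 𝒜).toLinearMap

theorem gradedLift_of_mem (f : ℤ → A →ₗ[K] M) {p : ℤ} {x : A} (hx : x ∈ 𝒜 p) :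
    gradedLift 𝒜 f x = f p x := by
  lift x to 𝒜 p using hx
  simp [gradedLift]

/-- `x ↦ (-1) ^ (e |x|) x` for homogeneous `x`. -/
def degSign (e : ℤ → ℤ) : A →ₗ[K] A :=
  gradedLift 𝒜 fun p => (e p).negOnePow • LinearMap.id

theorem degSign_of_mem (e : ℤ → ℤ) {p : ℤ} {x : A} (hx : x ∈ 𝒜 p) :
    degSign 𝒜 e x = (e p).negOnePow • x := by
  simp [degSign, gradedLift_of_mem 𝒜 _ hx]

/-- The signed flip `x ⊗ y ↦ (-1) ^ (|x|ₙ |y|ₙ) y ⊗ x` for homogeneous `x`, `y`, where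
`|x|ₙ = |x| + n`. For `n = 0` this is the usual graded flip. -/
def signedFlip (n : ℤ) : A ⊗[K] A →ₗ[K] A ⊗[K] A :=
  TensorProduct.lift (gradedLift 𝒜 fun p =>
    ((TensorProduct.mk K A A) ∘ₗ (degSign 𝒜 fun q => (p + n) * (q + n))).flip)

theorem signedFlip_of_mem (n : ℤ) {p q : ℤ} {x y : A} (hx : x ∈ 𝒜 p) (hy : y ∈ 𝒜 q) :
    signedFlip 𝒜 n (x ⊗ₜ y) = ((p + n) * (q + n)).negOnePow • (y ⊗ₜ[K] x) := by
  simp [signedFlip, gradedLift_of_mem 𝒜 _ hx, degSign_of_mem 𝒜 _ hy]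

end Signs

/-! ### Graded Hopf algebras -/

/-- A graded Hopf algebra: a graded algebra and a coalgebra whose comultiplication and counit are
graded algebra homomorphisms (for the graded, i.e. signed, product on `A ⊗ A`), with a graded
antipode. -/
class GradedHopfAlgebra {K A : Type*} [CommRing K] [Ring A] [Algebra K A]
    (𝒜 : ℤ → Submodule K A) [GradedAlgebra 𝒜] [Coalgebra K A] where
  comul_mem : ∀ (p : ℤ) (x : A), x ∈ 𝒜 p → Coalgebra.comul (R := K) x ∈
    ⨆ u : ℤ, LinearMap.range (TensorProduct.map (𝒜 u).subtype (𝒜 (p - u)).subtype)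
  counit_eq_zero : ∀ (p : ℤ) (x : A), x ∈ 𝒜 p → p ≠ 0 → Coalgebra.counit (R := K) x = 0
  comul_one : Coalgebra.comul (R := K) (1 : A) = 1 ⊗ₜ[K] 1
  comul_mul : ∀ x y : A,
    GradedTensorProduct.of K 𝒜 𝒜 (Coalgebra.comul (R := K) (x * y)) =
      GradedTensorProduct.of K 𝒜 𝒜 (Coalgebra.comul (R := K) x) *
        GradedTensorProduct.of K 𝒜 𝒜 (Coalgebra.comul (R := K) y)
  counit_one : Coalgebra.counit (R := K) (1 : A) = 1
  counit_mul : ∀ x y : A, Coalgebra.counit (R := K) (x * y) =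
    Coalgebra.counit (R := K) x * Coalgebra.counit (R := K) y
  /-- The antipode. -/
  antipode : A →ₗ[K] A
  antipode_mem : ∀ (p : ℤ) (x : A), x ∈ 𝒜 p → antipode x ∈ 𝒜 p
  mul_antipode_rTensor_comul :
    LinearMap.mul' K A ∘ₗ antipode.rTensor A ∘ₗ Coalgebra.comul =
      Algebra.linearMap K A ∘ₗ Coalgebra.counit
  mul_antipode_lTensor_comul :
    LinearMap.mul' K A ∘ₗ antipode.lTensor A ∘ₗ Coalgebra.comul =
      Algebra.linearMap K A ∘ₗ Coalgebra.counit

section GradedHopf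

variable {K A : Type*} [CommRing K] [Ring A] [Algebra K A]
variable (𝒜 : ℤ → Submodule K A) [GradedAlgebra 𝒜] [Coalgebra K A]

/-- Graded cocommutativity: `x' ⊗ x'' = (-1) ^ (|x'| |x''|) x'' ⊗ x'`. -/
def IsGradedCocommutative : Prop :=
  ∀ x : A, signedFlip 𝒜 0 (Coalgebra.comul (R := K) x) = Coalgebra.comul (R := K) x

/-- A finite expansion `t = ∑ i, fst i ⊗ snd i` with homogeneous entries, of recorded degrees.
For `t = Δ x` this is an expansion `Δ x = x' ⊗ x''` in Sweedler's notation. -/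
structure Expansion₂ (t : A ⊗[K] A) where
  size : ℕ
  fst : Fin size → A
  snd : Fin size → A
  deg₁ : Fin size → ℤ
  deg₂ : Fin size → ℤ
  fst_mem : ∀ i, fst i ∈ 𝒜 (deg₁ i)
  snd_mem : ∀ i, snd i ∈ 𝒜 (deg₂ i)
  sum_eq : ∑ i, fst i ⊗ₜ[K] snd i = t

/-- A finite expansion `t = ∑ i, fst i ⊗ (snd i ⊗ thd i)` with homogeneous entries, of recorded
degrees. -/
structure Expansion₃ (t : A ⊗[K] (A ⊗[K] A)) where
  size : ℕ
  fst : Fin size → A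
  snd : Fin size → A
  thd : Fin size → A
  deg₁ : Fin size → ℤ
  deg₂ : Fin size → ℤ
  deg₃ : Fin size → ℤ
  fst_mem : ∀ i, fst i ∈ 𝒜 (deg₁ i)
  snd_mem : ∀ i, snd i ∈ 𝒜 (deg₂ i)
  thd_mem : ∀ i, thd i ∈ 𝒜 (deg₃ i)
  sum_eq : ∑ i, fst i ⊗ₜ[K] (snd i ⊗ₜ[K] thd i) = t

/-! ### Fox pairings -/

/-- Fox pairings of degree `n`. -/
structure IsFoxPairing (n : ℤ) (ρ : A →ₗ[K] A →ₗ[K] A) : Prop where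
  map_mem : ∀ (p q : ℤ) (x y : A), x ∈ 𝒜 p → y ∈ 𝒜 q → ρ x y ∈ 𝒜 (p + q + n)
  map_mul_right : ∀ x y z : A, ρ x (y * z) = ρ x y * z + Coalgebra.counit (R := K) y • ρ x z
  map_mul_left : ∀ x y z : A, ρ (x * y) z = Coalgebra.counit (R := K) y • ρ x z + x * ρ y z

variable [GradedHopfAlgebra 𝒜]

/-- `ρ` is antisymmetric if its transpose `(x, y) ↦ (-1) ^ (|x|ₙ |y|ₙ) s⁻¹ (ρ (s y, s x))` equals
`-ρ`. (The antipode of a cocommutative graded Hopf algebra is an involution, so `Function.invFun`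
is its inverse.) -/
def IsAntisymmetricFoxPairing (n : ℤ) (ρ : A →ₗ[K] A →ₗ[K] A) : Prop :=
  ∀ (p q : ℤ) (x y : A), x ∈ 𝒜 p → y ∈ 𝒜 q →
    ((p + n) * (q + n)).negOnePow •
      Function.invFun (GradedHopfAlgebra.antipode 𝒜)
        (ρ (GradedHopfAlgebra.antipode 𝒜 y) (GradedHopfAlgebra.antipode 𝒜 x)) = -ρ x y

end GradedHopf

/-! ### The tritensor map -/

section Tritensor

variable {K A : Type*} [CommRing K] [Ring A] [Algebra K A]
variable (M : Type*) [AddCommGroup M] [Module K M]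

/-- `x ⊗ m ↦ f(x) ⊗ m` where `f(x) ∈ A ⊗ A`, re-bracketed to the right. -/
def splitHead (f : A →ₗ[K] A ⊗[K] A) : A ⊗[K] M →ₗ[K] A ⊗[K] (A ⊗[K] M) :=
  (TensorProduct.assoc K A A M).toLinearMap ∘ₗ f.rTensor M

/-- `x ⊗ (y ⊗ m) ↦ f(x ⊗ y) ⊗ m` where `f(x ⊗ y) ∈ A`. -/
def mergeHead (f : A ⊗[K] A →ₗ[K] A) : A ⊗[K] (A ⊗[K] M) →ₗ[K] A ⊗[K] M :=
  f.rTensor M ∘ₗ (TensorProduct.assoc K A A M).symm.toLinearMap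

variable (𝒜 : ℤ → Submodule K A) [GradedAlgebra 𝒜]

/-- `x ⊗ (y ⊗ m) ↦ (-1) ^ (|x|ₙ |y|ₙ) y ⊗ (x ⊗ m)`. -/
def swapHead (n : ℤ) : A ⊗[K] (A ⊗[K] M) →ₗ[K] A ⊗[K] (A ⊗[K] M) :=
  (TensorProduct.assoc K A A M).toLinearMap ∘ₗ (signedFlip 𝒜 n).rTensor M ∘ₗ
    (TensorProduct.assoc K A A M).symm.toLinearMap

/-- Apply a map to everything behind the first tensor factor. -/
def behind {M N : Type*} [AddCommGroup M] [Module K M] [AddCommGroup N] [Module K N]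
    (f : M →ₗ[K] N) : A ⊗[K] M →ₗ[K] A ⊗[K] N :=
  f.lTensor A

/-- The `n`-graded permutation `x₁ ⊗ x₂ ⊗ x₃ ↦ (-1) ^ t x₃ ⊗ x₁ ⊗ x₂` with
`t = |x₃|ₙ |x₁|ₙ + |x₃|ₙ |x₂|ₙ`. -/
def perm312 (n : ℤ) : Module.End K (A ⊗[K] (A ⊗[K] A)) :=
  swapHead A 𝒜 n ∘ₗ behind (signedFlip 𝒜 n)

/-- The `n`-graded permutation `x₁ ⊗ x₂ ⊗ x₃ ↦ (-1) ^ t x₂ ⊗ x₃ ⊗ x₁` with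
`t = |x₂|ₙ |x₁|ₙ + |x₃|ₙ |x₁|ₙ`; it is the inverse of `perm312`. -/
def perm231 (n : ℤ) : Module.End K (A ⊗[K] (A ⊗[K] A)) :=
  behind (signedFlip 𝒜 n) ∘ₗ swapHead A 𝒜 n

theorem signedFlip_signedFlip (n : ℤ) : signedFlip 𝒜 n ∘ₗ signedFlip 𝒜 n = LinearMap.id := by
  refine TensorProduct.ext' fun x y => ?_
  induction x using DirectSum.Decomposition.inductionOn 𝒜 with
  | zero => simp
  | add a b ha hb => simp only [TensorProduct.add_tmul, map_add, ha, hb]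
  | homogeneous x =>
    induction y using DirectSum.Decomposition.inductionOn 𝒜 with
    | zero => simp
    | add a b ha hb => simp only [TensorProduct.tmul_add, map_add, ha, hb]
    | homogeneous y =>
      rename_i i j
      rw [LinearMap.comp_apply, signedFlip_of_mem 𝒜 n x.2 y.2, LinearMap.map_smul_of_tower,
        signedFlip_of_mem 𝒜 n y.2 x.2, smul_smul, mul_comm (j + n), Int.units_mul_self]
      simp

theorem swapHead_swapHead (n : ℤ) : swapHead M 𝒜 n ∘ₗ swapHead M 𝒜 n = LinearMap.id := by
  have h : (signedFlip 𝒜 n).rTensor M ∘ₗ (signedFlip 𝒜 n).rTensor M = LinearMap.id := by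
    rw [← LinearMap.rTensor_comp, signedFlip_signedFlip, LinearMap.rTensor_id]
  ext1
  refine LinearMap.ext fun x => LinearMap.ext fun y => ?_
  have h' := fun z => LinearMap.congr_fun h z
  simp only [LinearMap.comp_apply, LinearMap.id_apply] at h'
  simp [swapHead, h']

theorem perm231_mul_perm312 (n : ℤ) : perm231 𝒜 n * perm312 𝒜 n = 1 := by
  have h : behind (A := A) (signedFlip 𝒜 n) ∘ₗ behind (signedFlip 𝒜 n) = LinearMap.id := by
    rw [behind, ← LinearMap.lTensor_comp, signedFlip_signedFlip, LinearMap.lTensor_id]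
  have h₂ := fun z => LinearMap.congr_fun (swapHead_swapHead A 𝒜 n) z
  have h₁ := fun z => LinearMap.congr_fun h z
  simp only [LinearMap.comp_apply, LinearMap.id_apply] at h₁ h₂
  ext1
  refine LinearMap.ext fun x => LinearMap.ext fun y => ?_
  simp [perm231, perm312, h₁, h₂]

theorem swapHead_of_mem (n : ℤ) {p q : ℤ} {x y : A} (hx : x ∈ 𝒜 p) (hy : y ∈ 𝒜 q) (m : M) :
    swapHead M 𝒜 n (x ⊗ₜ (y ⊗ₜ m)) =
      ((p + n) * (q + n)).negOnePow • (y ⊗ₜ[K] (x ⊗ₜ[K] m)) := by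
  simp only [swapHead, LinearMap.comp_apply, LinearEquiv.coe_coe, TensorProduct.assoc_symm_tmul,
    LinearMap.rTensor_tmul, signedFlip_of_mem 𝒜 n hx hy, ← TensorProduct.smul_tmul']
  exact (LinearMap.map_smul_of_tower (TensorProduct.assoc K A A M).toLinearMap _ _).trans (by simp)

theorem tmul_units_smul (u : ℤˣ) (x : A) (m : M) : x ⊗ₜ[K] (u • m) = u • (x ⊗ₜ[K] m) :=
  LinearMap.map_smul_of_tower (TensorProduct.mk K A M x) u m

theorem splitHead_of_expansion {f : A →ₗ[K] A ⊗[K] A} {x : A} (X : Expansion₂ 𝒜 (f x)) (m : M) :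
    splitHead M f (x ⊗ₜ m) = ∑ i, X.fst i ⊗ₜ[K] (X.snd i ⊗ₜ[K] m) := by
  simp [splitHead, ← X.sum_eq, TensorProduct.sum_tmul]

variable [Coalgebra K A]

theorem splitHead_twice {x : A}
    (X : Expansion₃ 𝒜 (Coalgebra.comul.lTensor A (Coalgebra.comul (R := K) x))) (m : M) :
    behind (splitHead M Coalgebra.comul) (splitHead M Coalgebra.comul (x ⊗ₜ m)) =
      ∑ i, X.fst i ⊗ₜ[K] (X.snd i ⊗ₜ[K] (X.thd i ⊗ₜ[K] m)) := by
  have h : ∀ t : A ⊗[K] A, behind (splitHead M Coalgebra.comul)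
      (TensorProduct.assoc K A A M (t ⊗ₜ m)) =
      (TensorProduct.assoc K A A M).toLinearMap.lTensor A
        (TensorProduct.assoc K A (A ⊗[K] A) M (Coalgebra.comul.lTensor A t ⊗ₜ m)) := by
    intro t
    induction t with
    | zero => simp
    | add t t' h h' => simp only [TensorProduct.add_tmul, map_add, h, h']
    | tmul a b => simp [behind, splitHead]
  have h' := h (Coalgebra.comul x)
  rw [← X.sum_eq] at h'
  simpa [splitHead, TensorProduct.sum_tmul] using h'

variable [GradedHopfAlgebra 𝒜]

/-- First part of `digamma`: `x ⊗ y ⊗ z ↦ ± y' ⊗ x' ⊗ z' ⊗ x'' ⊗ y'' ⊗ z''`. Exchanging two neighbours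
`u`, `v` contributes the sign `(-1) ^ (|u| |v|)`, and there is a further sign `(-1) ^ (n |y'|)`. -/
def digammaSplit (n : ℤ) :
    A ⊗[K] (A ⊗[K] A) →ₗ[K] A ⊗[K] (A ⊗[K] (A ⊗[K] (A ⊗[K] (A ⊗[K] A)))) :=
  let Δ : A →ₗ[K] A ⊗[K] A := Coalgebra.comul
  -- `y' ⊗ x' ⊗ z' ⊗ x'' ⊗ y'' ⊗ z''`
  behind (behind (swapHead (A ⊗[K] A) 𝒜 0)) ∘ₗ
  behind (behind (behind (swapHead A 𝒜 0))) ∘ₗ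
  -- `y' ⊗ x' ⊗ x'' ⊗ y'' ⊗ z' ⊗ z''`
  (degSign 𝒜 fun p => n * p).rTensor (A ⊗[K] (A ⊗[K] (A ⊗[K] (A ⊗[K] A)))) ∘ₗ
  swapHead (A ⊗[K] (A ⊗[K] (A ⊗[K] A))) 𝒜 0 ∘ₗ
  behind (swapHead (A ⊗[K] (A ⊗[K] A)) 𝒜 0) ∘ₗ
  -- `x' ⊗ x'' ⊗ y' ⊗ y'' ⊗ z' ⊗ z''`
  behind (behind (behind (behind Δ))) ∘ₗ
  behind (behind (splitHead A Δ)) ∘ₗ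
  splitHead (A ⊗[K] A) Δ

/-- Second part of `digamma`: `y ⊗ x ⊗ z ⊗ u ⊗ v ⊗ w ↦ ± y ⊗ r' ⊗ x ⊗ z ⊗ r'' ⊗ r''' ⊗ w` with
`r = ρ(u, v)`. -/
def digammaFst (ρ : A →ₗ[K] A →ₗ[K] A) :
    A ⊗[K] (A ⊗[K] (A ⊗[K] (A ⊗[K] (A ⊗[K] A)))) →ₗ[K]
      A ⊗[K] (A ⊗[K] (A ⊗[K] (A ⊗[K] (A ⊗[K] (A ⊗[K] A))))) :=
  let Δ : A →ₗ[K] A ⊗[K] A := Coalgebra.comul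
  -- `y ⊗ r' ⊗ x ⊗ z ⊗ r'' ⊗ r''' ⊗ w`
  behind (swapHead (A ⊗[K] (A ⊗[K] (A ⊗[K] A))) 𝒜 0) ∘ₗ
  behind (behind (swapHead (A ⊗[K] (A ⊗[K] A)) 𝒜 0)) ∘ₗ
  -- `y ⊗ x ⊗ z ⊗ r' ⊗ r'' ⊗ r''' ⊗ w`
  behind (behind (behind (behind (splitHead A Δ) ∘ₗ splitHead A Δ))) ∘ₗ
  behind (behind (behind (mergeHead A (TensorProduct.lift ρ))))

/-- Third part of `digamma`: `y ⊗ u ⊗ x ⊗ z ⊗ v ⊗ t ⊗ w ↦ ± y ⊗ u ⊗ x ⊗ z ⊗ q' ⊗ v ⊗ q''` with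
`q = ρ(t, w)`. -/
def digammaSnd (ρ : A →ₗ[K] A →ₗ[K] A) :
    Module.End K (A ⊗[K] (A ⊗[K] (A ⊗[K] (A ⊗[K] (A ⊗[K] (A ⊗[K] A)))))) :=
  behind (behind (behind (behind (swapHead A 𝒜 0 ∘ₗ
    behind (Coalgebra.comul ∘ₗ TensorProduct.lift ρ)))))

/-- Last part of `digamma`: `y ⊗ u ⊗ x ⊗ z ⊗ t ⊗ v ⊗ w ↦ y s(u) x ⊗ z s(t) v ⊗ w`. -/
def digammaMul :
    A ⊗[K] (A ⊗[K] (A ⊗[K] (A ⊗[K] (A ⊗[K] (A ⊗[K] A))))) →ₗ[K] A ⊗[K] (A ⊗[K] A) :=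
  let s : A →ₗ[K] A := GradedHopfAlgebra.antipode 𝒜
  let μ : A ⊗[K] A →ₗ[K] A := LinearMap.mul' K A
  behind (mergeHead A μ) ∘ₗ
  behind (mergeHead (A ⊗[K] A) μ) ∘ₗ
  behind (behind (s.rTensor (A ⊗[K] A))) ∘ₗ
  mergeHead (A ⊗[K] (A ⊗[K] (A ⊗[K] A))) μ ∘ₗ
  mergeHead (A ⊗[K] (A ⊗[K] (A ⊗[K] (A ⊗[K] A)))) μ ∘ₗ
  behind (s.rTensor (A ⊗[K] (A ⊗[K] (A ⊗[K] (A ⊗[K] A)))))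

/-- The map `Ϝ` attached to a Fox pairing `ρ` of degree `n`: with `r = ρ(x'', y'')` and
`q = ρ(r''', z'')` it sends `x ⊗ y ⊗ z` to `± y' s(r') x' ⊗ z' s(q') r'' ⊗ q''`. The formula with its
signs is `digamma_apply`. -/
def digamma (n : ℤ) (ρ : A →ₗ[K] A →ₗ[K] A) : Module.End K (A ⊗[K] (A ⊗[K] A)) :=
  digammaMul 𝒜 ∘ₗ digammaSnd 𝒜 ρ ∘ₗ digammaFst 𝒜 ρ ∘ₗ digammaSplit 𝒜 n

theorem digammaSplit_apply (n : ℤ) (x y z : A)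
    (X : Expansion₂ 𝒜 (Coalgebra.comul (R := K) x)) (Y : Expansion₂ 𝒜 (Coalgebra.comul (R := K) y))
    (Z : Expansion₂ 𝒜 (Coalgebra.comul (R := K) z)) :
    digammaSplit 𝒜 n (x ⊗ₜ (y ⊗ₜ z)) =
      ∑ i, ∑ j, ∑ k,
        (Y.deg₁ j * (X.deg₁ i + X.deg₂ i + n) + Z.deg₁ k * (X.deg₂ i + Y.deg₂ j)).negOnePow •
        (Y.fst j ⊗ₜ[K] (X.fst i ⊗ₜ[K] (Z.fst k ⊗ₜ[K]
          (X.snd i ⊗ₜ[K] (Y.snd j ⊗ₜ[K] Z.snd k))))) := by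
  unfold digammaSplit
  simp only [LinearMap.comp_apply]
  rw [splitHead_of_expansion (A ⊗[K] A) 𝒜 X]
  simp only [map_sum]
  refine Finset.sum_congr rfl fun i _ => ?_
  simp only [behind, LinearMap.lTensor_tmul]
  rw [splitHead_of_expansion A 𝒜 Y]
  simp only [map_sum, TensorProduct.tmul_sum]
  refine Finset.sum_congr rfl fun j _ => ?_
  simp only [LinearMap.lTensor_tmul]
  conv_lhs => rw [← Z.sum_eq]
  simp only [map_sum, TensorProduct.tmul_sum]
  refine Finset.sum_congr rfl fun k _ => ?_
  simp only [LinearMap.lTensor_tmul, LinearMap.rTensor_tmul, LinearMap.map_smul_of_tower,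
    tmul_units_smul,
    swapHead_of_mem _ 𝒜 0 (X.fst_mem i) (Y.fst_mem j),
    swapHead_of_mem _ 𝒜 0 (X.snd_mem i) (Y.fst_mem j),
    swapHead_of_mem _ 𝒜 0 (X.snd_mem i) (Z.fst_mem k),
    swapHead_of_mem _ 𝒜 0 (Y.snd_mem j) (Z.fst_mem k),
    degSign_of_mem 𝒜 _ (Y.fst_mem j), ← TensorProduct.smul_tmul', smul_smul,
    ← Int.negOnePow_add]
  congr 2
  ring

theorem digammaFst_apply (ρ : A →ₗ[K] A →ₗ[K] A) {p q : ℤ} (y : A) {x z : A} (u v w : A)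
    (hx : x ∈ 𝒜 p) (hz : z ∈ 𝒜 q)
    (R : Expansion₃ 𝒜 (Coalgebra.comul.lTensor A (Coalgebra.comul (R := K) (ρ u v)))) :
    digammaFst 𝒜 ρ (y ⊗ₜ (x ⊗ₜ (z ⊗ₜ (u ⊗ₜ (v ⊗ₜ w))))) =
      ∑ l, ((p + q) * R.deg₁ l).negOnePow •
        (y ⊗ₜ[K] (R.fst l ⊗ₜ[K] (x ⊗ₜ[K] (z ⊗ₜ[K]
          (R.snd l ⊗ₜ[K] (R.thd l ⊗ₜ[K] w)))))) := by
  have e₁ : mergeHead A (TensorProduct.lift ρ) (u ⊗ₜ (v ⊗ₜ w)) = ρ u v ⊗ₜ[K] w := by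
    simp [mergeHead]
  have e₂ := splitHead_twice A 𝒜 R w
  unfold digammaFst
  simp only [behind, LinearMap.comp_apply, LinearMap.lTensor_tmul] at e₂ ⊢
  rw [e₁, e₂]
  simp only [map_sum, TensorProduct.tmul_sum]
  refine Finset.sum_congr rfl fun l _ => ?_
  simp only [LinearMap.map_smul_of_tower, tmul_units_smul,
    swapHead_of_mem _ 𝒜 0 hx (R.fst_mem l), swapHead_of_mem _ 𝒜 0 hz (R.fst_mem l), smul_smul,
    ← Int.negOnePow_add]
  congr 2
  ring

theorem digammaSnd_apply (ρ : A →ₗ[K] A →ₗ[K] A) {p : ℤ} (y u x z : A) {v : A} (t w : A)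
    (hv : v ∈ 𝒜 p) (Q : Expansion₂ 𝒜 (Coalgebra.comul (R := K) (ρ t w))) :
    digammaSnd 𝒜 ρ (y ⊗ₜ (u ⊗ₜ (x ⊗ₜ (z ⊗ₜ (v ⊗ₜ (t ⊗ₜ w)))))) =
      ∑ m, (p * Q.deg₁ m).negOnePow •
        (y ⊗ₜ[K] (u ⊗ₜ[K] (x ⊗ₜ[K] (z ⊗ₜ[K]
          (Q.fst m ⊗ₜ[K] (v ⊗ₜ[K] Q.snd m)))))) := by
  simp only [digammaSnd, behind, LinearMap.comp_apply, LinearMap.lTensor_tmul,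
    TensorProduct.lift.tmul]
  conv_lhs => rw [← Q.sum_eq]
  simp only [map_sum, TensorProduct.tmul_sum, swapHead_of_mem _ 𝒜 0 hv (Q.fst_mem _),
    tmul_units_smul, add_zero]

theorem digammaMul_apply (y u x z t v w : A) :
    digammaMul (K := K) 𝒜 (y ⊗ₜ (u ⊗ₜ (x ⊗ₜ (z ⊗ₜ (t ⊗ₜ (v ⊗ₜ w)))))) =
      (y * GradedHopfAlgebra.antipode 𝒜 u * x) ⊗ₜ[K]
        ((z * GradedHopfAlgebra.antipode 𝒜 t * v) ⊗ₜ[K] w) := by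
  simp [digammaMul, behind, mergeHead]

/-- The explicit formula for `Ϝ`, for all homogeneous expansions `x' ⊗ x''`, `y' ⊗ y''`, `z' ⊗ z''`,
`r' ⊗ r'' ⊗ r'''` and `q' ⊗ q''`. -/
theorem digamma_apply (n : ℤ) (ρ : A →ₗ[K] A →ₗ[K] A) (x y z : A)
    (X : Expansion₂ 𝒜 (Coalgebra.comul (R := K) x)) (Y : Expansion₂ 𝒜 (Coalgebra.comul (R := K) y))
    (Z : Expansion₂ 𝒜 (Coalgebra.comul (R := K) z))
    (R : ∀ i j, Expansion₃ 𝒜 (Coalgebra.comul.lTensor A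
      (Coalgebra.comul (R := K) (ρ (X.snd i) (Y.snd j)))))
    (Q : ∀ i j k l, Expansion₂ 𝒜 (Coalgebra.comul (R := K) (ρ ((R i j).thd l) (Z.snd k)))) :
    digamma 𝒜 n ρ (x ⊗ₜ (y ⊗ₜ z)) =
      ∑ i, ∑ j, ∑ k, ∑ l, ∑ m,
        (Y.deg₁ j * (X.deg₁ i + X.deg₂ i + n) + Z.deg₁ k * (X.deg₂ i + Y.deg₂ j)
          + (X.deg₁ i + Z.deg₁ k) * (R i j).deg₁ l
          + (R i j).deg₂ l * (Q i j k l).deg₁ m).negOnePow •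
        ((Y.fst j * GradedHopfAlgebra.antipode 𝒜 ((R i j).fst l) * X.fst i) ⊗ₜ[K]
          ((Z.fst k * GradedHopfAlgebra.antipode 𝒜 ((Q i j k l).fst m) * (R i j).snd l) ⊗ₜ[K]
            (Q i j k l).snd m)) := by
  simp only [digamma, LinearMap.comp_apply]
  rw [digammaSplit_apply 𝒜 n x y z X Y Z]
  simp only [map_sum]
  refine Finset.sum_congr rfl fun i _ => Finset.sum_congr rfl fun j _ =>
    Finset.sum_congr rfl fun k _ => ?_
  rw [LinearMap.map_smul_of_tower, digammaFst_apply 𝒜 ρ _ _ _ _ (X.fst_mem i) (Z.fst_mem k) (R i j),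
    Finset.smul_sum]
  simp only [map_sum]
  refine Finset.sum_congr rfl fun l _ => ?_
  rw [smul_smul, LinearMap.map_smul_of_tower,
    digammaSnd_apply 𝒜 ρ _ _ _ _ _ _ ((R i j).snd_mem l) (Q i j k l), Finset.smul_sum]
  simp only [map_sum]
  refine Finset.sum_congr rfl fun m _ => ?_
  rw [smul_smul, LinearMap.map_smul_of_tower, digammaMul_apply, ← Int.negOnePow_add,
    ← Int.negOnePow_add]

/-- The tritensor map `∑ i ≤ 2, P₃₁₂ ^ i ∘ Ϝ ∘ P₃₁₂,ₙ ^ (-i)`. -/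
def tritensor (n : ℤ) (ρ : A →ₗ[K] A →ₗ[K] A) : Module.End K (A ⊗[K] (A ⊗[K] A)) :=
  ∑ i ∈ Finset.range 3, perm312 𝒜 0 ^ i * digamma 𝒜 n ρ * perm231 𝒜 n ^ i

/-- A Fox pairing is Gerstenhaber if its tritensor map vanishes. -/
def IsGerstenhaberFoxPairing (n : ℤ) (ρ : A →ₗ[K] A →ₗ[K] A) : Prop :=
  tritensor 𝒜 n ρ = 0

end Tritensor

/-! ### Trace-like elements -/

section TraceLike

variable (K : Type*) {B : Type*} [CommRing K] [CommRing B] [HopfAlgebra K B]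

variable (B) in
/-- The augmentation ideal `I = ker ε`. -/
def augIdeal : Ideal B := RingHom.ker (Bialgebra.counitAlgHom K B)

variable (B) in
/-- The projection `B → I / I ^ 2`, `b ↦ [b - ε(b)]`. -/
def toCot : B →ₗ[K] (augIdeal K B).Cotangent :=
  ((augIdeal K B).toCotangent.restrictScalars K) ∘ₗ
    LinearMap.codRestrict ((augIdeal K B).restrictScalars K)
      (LinearMap.id - Algebra.linearMap K B ∘ₗ Coalgebra.counit)
      (fun b => by simp [augIdeal, RingHom.mem_ker])

variable (B) in
/-- The module `𝔤` of derivations `B → K`, where `K` is a `B`-module through the counit. -/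
def derivations : Submodule K (B →ₗ[K] K) where
  carrier := {μ | ∀ b c : B, μ (b * c) =
    Coalgebra.counit (R := K) b * μ c + Coalgebra.counit (R := K) c * μ b}
  add_mem' {μ ν} hμ hν b c := by
    have h₁ := hμ b c
    have h₂ := hν b c
    simp only [LinearMap.add_apply, h₁, h₂]
    ring
  zero_mem' b c := by simp
  smul_mem' k μ hμ b c := by
    have h₁ := hμ b c
    simp only [LinearMap.smul_apply, h₁, smul_eq_mul]
    ring

/-- `t' ⊗ t'' = t'' ⊗ t'`. -/
def IsCosymmetric (t : B) : Prop :=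
  TensorProduct.comm K B B (Coalgebra.comul (R := K) t) = Coalgebra.comul (R := K) t

/-- The map `𝔤 → I / I ^ 2`, `μ ↦ μ(t') p(t'')`. -/
def traceMap (t : B) : derivations K B →ₗ[K] (augIdeal K B).Cotangent where
  toFun μ := TensorProduct.lid K _
    (TensorProduct.map (μ : B →ₗ[K] K) (toCot K B) (Coalgebra.comul (R := K) t))
  map_add' μ ν := by simp [TensorProduct.map_add_left]
  map_smul' k μ := by simp [TensorProduct.map_smul_left]

/-- Trace-like elements: cosymmetric and infinitesimally-nonsingular. -/
structure IsTraceLike (t : B) : Prop where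
  cosymmetric : IsCosymmetric K t
  bijective : Function.Bijective (traceMap K t)

variable {K}

/-- The form `b •ₜ c = b̄(c)`, where `b̄ ∈ 𝔤` is the preimage of `p(b)` under `traceMap`. -/
def traceForm {t : B} (ht : IsTraceLike K t) : B →ₗ[K] B →ₗ[K] K :=
  (derivations K B).subtype ∘ₗ
    (LinearEquiv.ofBijective (traceMap K t) ht.bijective).symm.toLinearMap ∘ₗ toCot K B

/-- `b ⋎ c = (b' • c'') b'' s(c')` -/
def curly (bul : B →ₗ[K] B →ₗ[K] K) : B →ₗ[K] B →ₗ[K] B :=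
  TensorProduct.curry <|
    (TensorProduct.lid K B).toLinearMap ∘ₗ
    -- `(b' • c'') ⊗ b'' s(c')`
    TensorProduct.map (TensorProduct.lift bul)
      (LinearMap.mul' K B ∘ₗ (HopfAlgebra.antipode K).lTensor B) ∘ₗ
    -- `(b' ⊗ c'') ⊗ (b'' ⊗ c')`
    (TensorProduct.tensorTensorTensorComm K B B B B).toLinearMap ∘ₗ
    -- `(b' ⊗ b'') ⊗ (c'' ⊗ c')`
    TensorProduct.map Coalgebra.comul
      ((TensorProduct.comm K B B).toLinearMap ∘ₗ Coalgebra.comul)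

/-- A finite expansion `Δ b = ∑ i, el i 0 ⊗ el i 1`. -/
structure Sweedler₂ (b : B) where
  size : ℕ
  el : Fin size → Fin 2 → B
  sum_eq : ∑ i, el i 0 ⊗ₜ[K] el i 1 = Coalgebra.comul (R := K) b

/-- A finite expansion of the iterated comultiplication
`b⁽¹⁾ ⊗ ⋯ ⊗ b⁽⁴⁾ = ∑ i, el i 0 ⊗ ⋯ ⊗ el i 3`. -/
structure Sweedler₄ (b : B) where
  size : ℕ
  el : Fin size → Fin 4 → B
  sum_eq : ∑ i, el i 0 ⊗ₜ[K] (el i 1 ⊗ₜ[K] (el i 2 ⊗ₜ[K] el i 3)) =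
    (Coalgebra.comul.lTensor B).lTensor B (Coalgebra.comul.lTensor B (Coalgebra.comul (R := K) b))

/-- A finite expansion of the iterated comultiplication
`b⁽¹⁾ ⊗ ⋯ ⊗ b⁽⁶⁾ = ∑ i, el i 0 ⊗ ⋯ ⊗ el i 5`. -/
structure Sweedler₆ (b : B) where
  size : ℕ
  el : Fin size → Fin 6 → B
  sum_eq : ∑ i, el i 0 ⊗ₜ[K] (el i 1 ⊗ₜ[K] (el i 2 ⊗ₜ[K] (el i 3 ⊗ₜ[K]
      (el i 4 ⊗ₜ[K] el i 5)))) =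
    (((Coalgebra.comul.lTensor B).lTensor B).lTensor B).lTensor B
      (((Coalgebra.comul.lTensor B).lTensor B).lTensor B
        ((Coalgebra.comul.lTensor B).lTensor B
          (Coalgebra.comul.lTensor B (Coalgebra.comul (R := K) b))))

end TraceLike

/-! ### Representation algebras -/

section RepresentationAlgebra

variable {K A : Type*} [CommRing K] [Ring A] [Algebra K A]
variable (𝒜 : ℤ → Submodule K A) [GradedAlgebra 𝒜] [Coalgebra K A]
variable (B : Type*) [CommRing B] [HopfAlgebra K B]

/-- The generator `x_b` of the free algebra on the symbols `x_b` modulo bilinearity, which is the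
tensor algebra of `A ⊗ B`. -/
def preGen : A →ₗ[K] B →ₗ[K] TensorAlgebra K (A ⊗[K] B) :=
  (TensorProduct.mk K A B).compr₂ (TensorAlgebra.ι K)

/-- The relations of `A_B` besides bilinearity, for an ungraded `B`. -/
inductive RepRel : TensorAlgebra K (A ⊗[K] B) → TensorAlgebra K (A ⊗[K] B) → Prop
  /-- `(xy)_b = x_{b'} y_{b''}` -/
  | mul_left (x y : A) (b : B) : RepRel (preGen B (x * y) b)
      (LinearMap.mul' K _ (TensorProduct.map (preGen B x) (preGen B y) (Coalgebra.comul (R := K) b)))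
  /-- `1_b = ε(b)` -/
  | one_left (b : B) : RepRel (preGen B (1 : A) b) (algebraMap K _ (Coalgebra.counit (R := K) b))
  /-- `x_{bc} = x'_b x''_c` -/
  | mul_right (x : A) (b c : B) : RepRel (preGen B x (b * c))
      (LinearMap.mul' K _ (TensorProduct.map ((preGen B).flip b) ((preGen B).flip c)
        (Coalgebra.comul (R := K) x)))
  /-- `x_1 = ε(x)` -/
  | one_right (x : A) : RepRel (preGen B x 1) (algebraMap K _ (Coalgebra.counit (R := K) x))
  /-- `x_b y_c = (-1) ^ (|x| |y|) y_c x_b` for homogeneous `x`, `y` -/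
  | comm (p q : ℤ) (x y : A) (b c : B) (hx : x ∈ 𝒜 p) (hy : y ∈ 𝒜 q) :
      RepRel (preGen B x b * preGen B y c) ((p * q).negOnePow • (preGen B y c * preGen B x b))

/-- The representation algebra `A_B`. -/
abbrev RepAlg : Type _ := RingQuot (RepRel 𝒜 B)

/-- The generator `x_b` of `A_B`. -/
def gen : A →ₗ[K] B →ₗ[K] RepAlg 𝒜 B :=
  (preGen B).compr₂ (RingQuot.mkAlgHom K (RepRel 𝒜 B)).toLinearMap

/-- The products `(x₁)_{b₁} ⋯ (x_k)_{b_k}` with all `x_i` homogeneous, of degree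
`|x₁| + ⋯ + |x_k|`. -/
inductive IsMonomial : ℤ → RepAlg 𝒜 B → Prop
  | one : IsMonomial 0 1
  | gen_mul (p q : ℤ) (x : A) (b : B) (m : RepAlg 𝒜 B) (hx : x ∈ 𝒜 p) (hm : IsMonomial q m) :
      IsMonomial (p + q) (gen 𝒜 B x b * m)

/-- The grading of `A_B` determined by `|x_b| = |x|`. -/
def repGrading (p : ℤ) : Submodule K (RepAlg 𝒜 B) :=
  Submodule.span K {m | IsMonomial 𝒜 B p m}

theorem mk_preGen (x : A) (b : B) :
    RingQuot.mkAlgHom K (RepRel 𝒜 B) (preGen B x b) = gen 𝒜 B x b := rfl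

theorem gen_mem {p : ℤ} {x : A} (hx : x ∈ 𝒜 p) (b : B) : gen 𝒜 B x b ∈ repGrading 𝒜 B p := by
  have h := IsMonomial.gen_mul p 0 x b 1 hx IsMonomial.one
  rw [mul_one, add_zero] at h
  exact Submodule.subset_span h

variable {𝒜 B} in
theorem IsMonomial.mul {p q : ℤ} {m m' : RepAlg 𝒜 B} (h : IsMonomial 𝒜 B p m)
    (h' : IsMonomial 𝒜 B q m') : IsMonomial 𝒜 B (p + q) (m * m') := by
  induction h with
  | one => simpa using h'
  | gen_mul r s x b m hx hm ih =>
    rw [mul_assoc, add_assoc]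
    exact IsMonomial.gen_mul _ _ _ _ _ hx ih

instance repGradedMonoid : SetLike.GradedMonoid (repGrading 𝒜 B) where
  one_mem := Submodule.subset_span IsMonomial.one
  mul_mem p q x y hx hy := by
    have h := Submodule.mul_mem_mul hx hy
    rw [repGrading, repGrading, Submodule.span_mul_span] at h
    refine Submodule.span_mono ?_ h
    rintro _ ⟨u, hu, v, hv, rfl⟩
    exact IsMonomial.mul hu hv

/-- The homogeneous component map on generators. -/
def homGen : A →ₗ[K] B →ₗ[K] ⨁ p, repGrading 𝒜 B p :=
  DirectSum.toModule K ℤ _ (fun p => LinearMap.mk₂ K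
    (fun (x : 𝒜 p) b => DirectSum.lof K ℤ (fun p => repGrading 𝒜 B p) p
      ⟨gen 𝒜 B (x : A) b, gen_mem 𝒜 B x.2 b⟩)
    (fun x y b => by rw [← map_add]; congr 1; ext; simp)
    (fun c x b => by rw [← map_smul]; congr 1; ext; simp)
    (fun x b c => by rw [← map_add]; congr 1; ext; simp)
    (fun c x b => by rw [← map_smul]; congr 1; ext; simp)) ∘ₗ
  (DirectSum.decomposeLinearEquiv 𝒜).toLinearMap

/-- `w` is the element `m` of degree `p`. -/
def IsPure (p : ℤ) (m : RepAlg 𝒜 B) (w : ⨁ p, repGrading 𝒜 B p) : Prop :=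
  ∃ h : m ∈ repGrading 𝒜 B p, w = DirectSum.lof K ℤ (fun p => repGrading 𝒜 B p) p ⟨m, h⟩

section IsPure

variable {𝒜 B}

theorem IsPure.unique {p : ℤ} {m : RepAlg 𝒜 B} {w w'} (h : IsPure 𝒜 B p m w)
    (h' : IsPure 𝒜 B p m w') : w = w' := by
  obtain ⟨_, rfl⟩ := h
  obtain ⟨_, rfl⟩ := h'
  rfl

theorem IsPure.zero (p : ℤ) : IsPure 𝒜 B p 0 0 :=
  ⟨Submodule.zero_mem _, (map_zero _).symm⟩

theorem IsPure.add {p : ℤ} {m m' : RepAlg 𝒜 B} {w w'} (h : IsPure 𝒜 B p m w)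
    (h' : IsPure 𝒜 B p m' w') : IsPure 𝒜 B p (m + m') (w + w') := by
  obtain ⟨h, rfl⟩ := h
  obtain ⟨h', rfl⟩ := h'
  exact ⟨Submodule.add_mem _ h h', (map_add _ _ _).symm⟩

theorem IsPure.smul {p : ℤ} {m : RepAlg 𝒜 B} {w} (k : K) (h : IsPure 𝒜 B p m w) :
    IsPure 𝒜 B p (k • m) (k • w) := by
  obtain ⟨h, rfl⟩ := h
  exact ⟨Submodule.smul_mem _ k h, (map_smul _ _ _).symm⟩

theorem IsPure.one : IsPure 𝒜 B 0 1 1 :=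
  ⟨SetLike.GradedOne.one_mem, rfl⟩

theorem IsPure.mul {p q : ℤ} {m m' : RepAlg 𝒜 B} {w w'} (h : IsPure 𝒜 B p m w)
    (h' : IsPure 𝒜 B q m' w') : IsPure 𝒜 B (p + q) (m * m') (w * w') := by
  obtain ⟨h, rfl⟩ := h
  obtain ⟨h', rfl⟩ := h'
  exact ⟨SetLike.GradedMul.mul_mem h h', DirectSum.of_mul_of _ _⟩

theorem IsPure.algebraMap (k : K) : IsPure 𝒜 B 0 (algebraMap K _ k) (algebraMap K _ k) := by
  rw [Algebra.algebraMap_eq_smul_one, Algebra.algebraMap_eq_smul_one]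
  exact IsPure.one.smul k

theorem IsPure.homGen {p : ℤ} {x : A} (hx : x ∈ 𝒜 p) (b : B) :
    IsPure 𝒜 B p (gen 𝒜 B x b) (homGen 𝒜 B x b) := by
  refine ⟨gen_mem 𝒜 B hx b, ?_⟩
  lift x to 𝒜 p using hx
  rw [FoxRep.homGen, LinearMap.comp_apply, LinearEquiv.coe_coe,
    DirectSum.decomposeLinearEquiv_apply, DirectSum.decompose_coe, ← DirectSum.lof_eq_of K,
    DirectSum.toModule_lof]
  rfl

end IsPure

/-- The lift of `homGen` to the tensor algebra. -/
def homLift : TensorAlgebra K (A ⊗[K] B) →ₐ[K] ⨁ p, repGrading 𝒜 B p :=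
  TensorAlgebra.lift K (TensorProduct.lift (homGen 𝒜 B))

theorem homLift_preGen (x : A) (b : B) :
    homLift 𝒜 B (preGen B x b) = homGen 𝒜 B x b := by
  simp [homLift, preGen]

variable [GradedHopfAlgebra 𝒜]

theorem homLift_rel {u v : TensorAlgebra K (A ⊗[K] B)} (h : RepRel 𝒜 B u v) :
    homLift 𝒜 B u = homLift 𝒜 B v := by
  have hq : ∀ {u v}, RepRel 𝒜 B u v → RingQuot.mkAlgHom K (RepRel 𝒜 B) u =
      RingQuot.mkAlgHom K (RepRel 𝒜 B) v := fun h => RingQuot.mkAlgHom_rel K h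
  have key : ∀ {u v} (p : ℤ), RepRel 𝒜 B u v →
      IsPure 𝒜 B p (RingQuot.mkAlgHom K (RepRel 𝒜 B) u) (homLift 𝒜 B u) →
      IsPure 𝒜 B p (RingQuot.mkAlgHom K (RepRel 𝒜 B) v) (homLift 𝒜 B v) →
      homLift 𝒜 B u = homLift 𝒜 B v := by
    intro u v p h h₁ h₂
    rw [hq h] at h₁
    exact h₁.unique h₂
  have pg : ∀ {p x} (_ : x ∈ 𝒜 p) (b : B), IsPure 𝒜 B p
      (RingQuot.mkAlgHom K (RepRel 𝒜 B) (preGen B x b)) (homLift 𝒜 B (preGen B x b)) := by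
    intro p x hx b
    rw [homLift_preGen, mk_preGen]
    exact IsPure.homGen hx b
  induction h with
  | mul_left x y b =>
    induction x using DirectSum.Decomposition.inductionOn 𝒜 with
    | zero => simp
    | add a c ha hc =>
      simp only [add_mul, map_add, LinearMap.add_apply, TensorProduct.map_add_left, ha, hc]
    | homogeneous x =>
      induction y using DirectSum.Decomposition.inductionOn 𝒜 with
      | zero => simp
      | add a c ha hc =>
        simp only [mul_add, map_add, LinearMap.add_apply, TensorProduct.map_add_right, ha, hc]
      | homogeneous y =>
        rename_i p q
        refine key (p + q) (.mul_left _ _ _) (pg (SetLike.GradedMul.mul_mem x.2 y.2) b) ?_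
        generalize Coalgebra.comul (R := K) b = t
        induction t with
        | zero => simpa using IsPure.zero _
        | add t t' h h' => simpa only [map_add] using h.add h'
        | tmul b c =>
          simpa only [TensorProduct.map_tmul, LinearMap.mul'_apply, map_mul] using
            (pg x.2 b).mul (pg y.2 c)
  | one_left b =>
    refine key 0 (.one_left _) (pg SetLike.GradedOne.one_mem b) ?_
    simpa only [AlgHom.commutes] using IsPure.algebraMap _
  | mul_right x b c =>
    induction x using DirectSum.Decomposition.inductionOn 𝒜 with
    | zero => simp
    | add a d ha hd => simp only [map_add, LinearMap.add_apply, ha, hd]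
    | homogeneous x =>
      rename_i p
      refine key p (.mul_right _ _ _) (pg x.2 _) ?_
      have hx := GradedHopfAlgebra.comul_mem (𝒜 := 𝒜) p x x.2
      generalize Coalgebra.comul (R := K) (x : A) = t at hx
      induction hx using Submodule.iSup_induction' with
      | mem u t ht =>
        obtain ⟨t, rfl⟩ := ht
        induction t with
        | zero => simpa using IsPure.zero _
        | add t t' h h' => simpa only [map_add] using h.add h'
        | tmul y z =>
          have h := (pg y.2 b).mul (pg z.2 c)
          rw [add_sub_cancel] at h
          simpa only [TensorProduct.map_tmul, LinearMap.mul'_apply, map_mul,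
            LinearMap.flip_apply, Submodule.coe_subtype] using h
      | zero => simpa using IsPure.zero _
      | add t t' _ _ h h' => simpa only [map_add] using h.add h'
  | one_right x =>
    induction x using DirectSum.Decomposition.inductionOn 𝒜 with
    | zero => simp
    | add a d ha hd => simp only [map_add, LinearMap.add_apply, ha, hd]
    | homogeneous x =>
      rename_i p
      refine key p (.one_right _) (pg x.2 _) ?_
      by_cases hp : p = 0
      · subst hp
        simpa only [AlgHom.commutes] using IsPure.algebraMap _
      · rw [GradedHopfAlgebra.counit_eq_zero (𝒜 := 𝒜) p x x.2 hp]
        simpa using IsPure.zero _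
  | comm p q x y b c hx hy =>
    refine key (p + q) (.comm p q x y b c hx hy) ?_ ?_
    · simpa only [map_mul] using (pg hx b).mul (pg hy c)
    · have h := (pg hy c).mul (pg hx b)
      rw [add_comm q p] at h
      rw [Units.smul_def, ← Int.cast_smul_eq_zsmul K, map_smul, map_smul, map_mul, map_mul]
      exact h.smul _

/-- `A_B` is a graded algebra. -/
instance repGradedAlgebra : GradedAlgebra (repGrading 𝒜 B) :=
  GradedAlgebra.ofAlgHom _
    (RingQuot.liftAlgHom K ⟨homLift 𝒜 B, fun _ _ h => homLift_rel 𝒜 B h⟩)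
    (by
      apply RingQuot.ringQuot_ext'
      apply TensorAlgebra.hom_ext
      refine TensorProduct.ext' fun x b => ?_
      change DirectSum.coeAlgHom _ (RingQuot.liftAlgHom K _
        (RingQuot.mkAlgHom K (RepRel 𝒜 B) (preGen B x b))) = gen 𝒜 B x b
      rw [RingQuot.liftAlgHom_mkAlgHom_apply, homLift_preGen]
      induction x using DirectSum.Decomposition.inductionOn 𝒜 with
      | zero => simp
      | add a d ha hd => simp only [map_add, LinearMap.add_apply, ha, hd]
      | homogeneous x =>
        obtain ⟨h, e⟩ := IsPure.homGen (B := B) x.2 b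
        rw [e, DirectSum.lof_eq_of, DirectSum.coeAlgHom_of])
    (by
      rintro p ⟨m, hm⟩
      suffices h : IsPure 𝒜 B p m
          (RingQuot.liftAlgHom K ⟨homLift 𝒜 B, fun _ _ h => homLift_rel 𝒜 B h⟩ m) by
        obtain ⟨_, e⟩ := h
        exact e
      induction hm using Submodule.span_induction with
      | mem m hm =>
        induction hm with
        | one => simpa using IsPure.one
        | gen_mul p q x b m hx hm ih =>
          rw [map_mul]
          refine IsPure.mul ?_ ih
          rw [← mk_preGen, RingQuot.liftAlgHom_mkAlgHom_apply, homLift_preGen]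
          exact IsPure.homGen hx b
      | zero => simpa using IsPure.zero _
      | add m m' _ _ h h' => simpa only [map_add] using h.add h'
      | smul k m _ h => simpa only [map_smul] using h.smul k)

end RepresentationAlgebra

/-! ### Brackets -/

section Brackets

variable {K C : Type*} [CommRing K] [Ring C] [Algebra K C]
variable (𝒞 : ℤ → Submodule K C) [GradedAlgebra 𝒞]

/-- `n`-graded brackets in a graded algebra. -/
structure IsGradedBracket (n : ℤ) (br : C →ₗ[K] C →ₗ[K] C) : Prop where
  map_mem : ∀ (p q : ℤ) (x y : C), x ∈ 𝒞 p → y ∈ 𝒞 q → br x y ∈ 𝒞 (p + q + n)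
  leibniz_right : ∀ (p q r : ℤ) (x y z : C), x ∈ 𝒞 p → y ∈ 𝒞 q → z ∈ 𝒞 r →
    br x (y * z) = br x y * z + ((p + n) * q).negOnePow • (y * br x z)
  leibniz_left : ∀ (p q r : ℤ) (x y z : C), x ∈ 𝒞 p → y ∈ 𝒞 q → z ∈ 𝒞 r →
    br (x * y) z = x * br y z + (q * (r + n)).negOnePow • (br x z * y)

/-- Antisymmetry of a bracket. -/
def IsAntisymmetricBracket (n : ℤ) (br : C →ₗ[K] C →ₗ[K] C) : Prop :=
  ∀ (p q : ℤ) (x y : C), x ∈ 𝒞 p → y ∈ 𝒞 q →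
    br x y = -(((p + n) * (q + n)).negOnePow • br y x)

/-- Gerstenhaber brackets of degree `n`: antisymmetric `n`-graded brackets satisfying the graded
Jacobi identity. -/
structure IsGerstenhaberBracket (n : ℤ) (br : C →ₗ[K] C →ₗ[K] C) : Prop
    extends IsGradedBracket 𝒞 n br where
  antisymm : IsAntisymmetricBracket 𝒞 n br
  jacobi : ∀ (p q r : ℤ) (x y z : C), x ∈ 𝒞 p → y ∈ 𝒞 q → z ∈ 𝒞 r →
    ((p + n) * (r + n)).negOnePow • br x (br y z)
      + ((p + n) * (q + n)).negOnePow • br y (br z x)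
      + ((q + n) * (r + n)).negOnePow • br z (br x y) = 0

end Brackets

/-! ### The two formulas -/

section Formulas

variable {K A : Type*} [CommRing K] [Ring A] [Algebra K A]
variable (𝒜 : ℤ → Submodule K A) [GradedAlgebra 𝒜] [Coalgebra K A]
variable {B : Type*} [CommRing B] [HopfAlgebra K B]

/-- The formula
`{x_b, y_c} = (-1) ^ (|x''| |y'|ₙ) (c'' • b⁽²⁾) ρ(x', y')_{s(b⁽³⁾) b⁽¹⁾} x''_{b⁽⁴⁾} y''_{c'}`,
for all `x`, `y`, `b`, `c` and all expansions of their comultiplications. -/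
def SatisfiesMainFormula (n : ℤ) (ρ : A →ₗ[K] A →ₗ[K] A) (bul : B →ₗ[K] B →ₗ[K] K)
    (br : RepAlg 𝒜 B →ₗ[K] RepAlg 𝒜 B →ₗ[K] RepAlg 𝒜 B) : Prop :=
  ∀ (x y : A) (b c : B)
    (X : Expansion₂ 𝒜 (Coalgebra.comul (R := K) x)) (Y : Expansion₂ 𝒜 (Coalgebra.comul (R := K) y))
    (β : Sweedler₄ (K := K) b) (γ : Sweedler₂ (K := K) c),
    br (gen 𝒜 B x b) (gen 𝒜 B y c) =
      ∑ i, ∑ j, ∑ k, ∑ l,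
        (X.deg₂ i * (Y.deg₁ j + n)).negOnePow • bul (γ.el l 1) (β.el k 1) •
          (gen 𝒜 B (ρ (X.fst i) (Y.fst j)) (HopfAlgebra.antipode K (β.el k 2) * β.el k 0) *
            gen 𝒜 B (X.snd i) (β.el k 3) * gen 𝒜 B (Y.snd j) (γ.el l 0))

/-- The formula for the Jacobiator, for all homogeneous `x`, `y`, `z`, all `b`, `c`, `d` and all
expansions:
`(-1) ^ (|x|ₙ |z|ₙ) {x_b, {y_c, z_d}} + (-1) ^ (|z|ₙ |y|ₙ) {z_d, {x_b, y_c}}`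
`+ (-1) ^ (|y|ₙ |x|ₙ) {y_c, {z_d, x_b}} = -(-1) ^ (|x''| |y' z'| + |y''| |z'|ₙ + |x|ₙ |z|ₙ)`
`T(x', y', z')ˡ_{p⁽¹⁾} T(x', y', z')ᵐ_{p⁽⁵⁾} T(x', y', z')ʳ_{p⁽³⁾} x''_{b ⋎ p⁽²⁾} y''_{c ⋎ p⁽⁶⁾} z''_{d ⋎ p⁽⁴⁾}`,
where `T = Tˡ ⊗ Tᵐ ⊗ Tʳ` is the tritensor map of `ρ` and `p` is a given element of `B`. -/
def SatisfiesJacobiatorFormula [GradedHopfAlgebra 𝒜] (n : ℤ) (ρ : A →ₗ[K] A →ₗ[K] A)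
    (bul : B →ₗ[K] B →ₗ[K] K) (p : B)
    (br : RepAlg 𝒜 B →ₗ[K] RepAlg 𝒜 B →ₗ[K] RepAlg 𝒜 B) : Prop :=
  ∀ (dx dy dz : ℤ) (x y z : A) (b c d : B), x ∈ 𝒜 dx → y ∈ 𝒜 dy → z ∈ 𝒜 dz →
    ∀ (X : Expansion₂ 𝒜 (Coalgebra.comul (R := K) x))
      (Y : Expansion₂ 𝒜 (Coalgebra.comul (R := K) y))
      (Z : Expansion₂ 𝒜 (Coalgebra.comul (R := K) z))
      (T : ∀ i j k, Expansion₃ 𝒜 (tritensor 𝒜 n ρ (X.fst i ⊗ₜ (Y.fst j ⊗ₜ Z.fst k))))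
      (P : Sweedler₆ (K := K) p),
    ((dx + n) * (dz + n)).negOnePow •
        br (gen 𝒜 B x b) (br (gen 𝒜 B y c) (gen 𝒜 B z d))
      + ((dz + n) * (dy + n)).negOnePow •
        br (gen 𝒜 B z d) (br (gen 𝒜 B x b) (gen 𝒜 B y c))
      + ((dy + n) * (dx + n)).negOnePow •
        br (gen 𝒜 B y c) (br (gen 𝒜 B z d) (gen 𝒜 B x b)) =
    -∑ i, ∑ j, ∑ k, ∑ l, ∑ h,
      (X.deg₂ i * (Y.deg₁ j + Z.deg₁ k) + Y.deg₂ j * (Z.deg₁ k + n)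
          + (dx + n) * (dz + n)).negOnePow •
        (gen 𝒜 B ((T i j k).fst l) (P.el h 0) * gen 𝒜 B ((T i j k).snd l) (P.el h 4) *
          gen 𝒜 B ((T i j k).thd l) (P.el h 2) *
          gen 𝒜 B (X.snd i) (curly bul b (P.el h 1)) *
          gen 𝒜 B (Y.snd j) (curly bul c (P.el h 5)) *
          gen 𝒜 B (Z.snd k) (curly bul d (P.el h 3)))

end Formulas

end FoxRep

end

open scoped TensorProduct DirectSum

noncomputable section

namespace FoxRep

open WithConv Coalgebra

theorem sum_counit_smul_left {K C : Type*} [CommRing K] [AddCommGroup C] [Module K C] [Coalgebra K C]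
    {ι : Type*} {c : C} (r : Coalgebra.Repr K c ι) :
    ∑ i ∈ r.index, Coalgebra.counit (R := K) (r.right i) • r.left i = c := by
  have h := congrArg (TensorProduct.rid K C) (Coalgebra.sum_tmul_counit_eq r)
  simpa only [map_sum, TensorProduct.rid_tmul, one_smul] using h

/-! ### Convolution algebras and their slots -/

section Slots

variable {K B L T T' : Type*} [CommRing K] [CommRing B] [HopfAlgebra K B]
variable [CommRing L] [Algebra K L] [Ring T] [Algebra K T] [Algebra L T] [IsScalarTower K L T]
variable [Ring T'] [Algebra K T'] [Algebra L T'] [IsScalarTower K L T']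

/-- The convolution algebra of linear maps `B → T`. -/
abbrev Cv (K B T : Type*) [CommRing K] [CommRing B] [HopfAlgebra K B] [Ring T] [Algebra K T] :
    Type _ := WithConv (B →ₗ[K] T)

section CvInstances

variable {K B T : Type*} [CommRing K] [CommRing B] [HopfAlgebra K B] [Ring T] [Algebra K T]

scoped instance : Ring (Cv K B T) := inferInstance

scoped instance : Mul (Cv K B T) := inferInstance

scoped instance : AddCommMonoid (Cv K B T) := inferInstance

scoped instance : AddCommGroup (Cv K B T) := inferInstance

scoped instance : Module K (Cv K B T) := inferInstance

scoped instance : Algebra K (Cv K B T) := inferInstance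

end CvInstances

instance : IsScalarTower K L (Cv K B T) where
  smul_assoc k l f := by
    refine WithConv.ext (LinearMap.ext fun b => ?_)
    exact smul_assoc k l (f.ofConv b)

theorem Cv.ext {f g : Cv K B T} (h : ∀ b, f.ofConv b = g.ofConv b) : f = g :=
  WithConv.ext (LinearMap.ext h)

theorem Cv.mul_apply {ι : Type*} {b : B} (r : Coalgebra.Repr K b ι) (f g : Cv K B T) :
    (f * g).ofConv b = ∑ i ∈ r.index, f.ofConv (r.left i) * g.ofConv (r.right i) :=
  r.convMul_apply f g

variable (L) in
/-- Constants in a convolution algebra. -/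
def Cv.const : T →ₐ[L] Cv K B T where
  toFun t := toConv ((Coalgebra.counit (R := K) (A := B)).smulRight t)
  map_one' := by
    refine Cv.ext fun b => ?_
    simp [Algebra.algebraMap_eq_smul_one]
  map_mul' s t := by
    refine Cv.ext fun b => ?_
    rw [Cv.mul_apply (ℛ K b)]
    conv_lhs => rw [← Coalgebra.sum_counit_smul (ℛ K b)]
    simp [smul_smul, mul_comm]
  map_zero' := by refine Cv.ext fun b => ?_; simp
  map_add' s t := by refine Cv.ext fun b => ?_; simp
  commutes' l := by
    refine Cv.ext fun b => ?_
    simp only [LinearMap.smulRight_apply, LinearMap.convAlgebraMap_apply]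
    rw [Algebra.algebraMap_eq_smul_one, Algebra.algebraMap_eq_smul_one, smul_comm]

theorem Cv.const_apply (t : T) (b : B) :
    (Cv.const L t : Cv K B T).ofConv b = Coalgebra.counit (R := K) b • t := rfl

theorem Cv.const_mul_apply (t : T) (f : Cv K B T) (b : B) :
    (Cv.const L t * f).ofConv b = t * f.ofConv b := by
  rw [Cv.mul_apply (ℛ K b)]
  conv_rhs => rw [← Coalgebra.sum_counit_smul (ℛ K b)]
  simp [Cv.const_apply, Finset.mul_sum]

theorem Cv.mul_const_apply (t : T) (f : Cv K B T) (b : B) :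
    (f * Cv.const L t).ofConv b = f.ofConv b * t := by
  rw [Cv.mul_apply (ℛ K b)]
  conv_rhs => rw [← sum_counit_smul_left (ℛ K b)]
  simp [Cv.const_apply, Finset.sum_mul]

/-- The central slot of a convolution algebra. -/
def Cv.top : Cv K B L →ₐ[L] Cv K B T where
  toFun f := toConv ((Algebra.linearMap L T).restrictScalars K ∘ₗ f.ofConv)
  map_one' := by
    refine Cv.ext fun b => ?_
    simp [← IsScalarTower.algebraMap_apply]
  map_mul' f g := by
    refine Cv.ext fun b => ?_
    rw [Cv.mul_apply (ℛ K b)]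
    simp [Cv.mul_apply (ℛ K b)]
  map_zero' := by refine Cv.ext fun b => ?_; simp
  map_add' s t := by refine Cv.ext fun b => ?_; simp
  commutes' l := by
    refine Cv.ext fun b => ?_
    simp [Algebra.smul_def, ← IsScalarTower.algebraMap_apply]

theorem Cv.top_apply (f : Cv K B L) (b : B) :
    (Cv.top f : Cv K B T).ofConv b = algebraMap L T (f.ofConv b) := rfl

theorem Cv.top_mul_const (f : Cv K B L) (t : T) :
    (Cv.top f : Cv K B T) * Cv.const L t = Cv.const L t * Cv.top f := by
  refine Cv.ext fun b => ?_
  rw [Cv.mul_const_apply, Cv.const_mul_apply, Cv.top_apply, Algebra.commutes]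

variable (K B L) in
/-- The group of `L`-points of `B`. -/
def Pt : Type _ := WithConv (B →ₐ[K] L)

/-- A point as an algebra homomorphism. -/
def Pt.hom (v : Pt K B L) : B →ₐ[K] L := WithConv.ofConv v

theorem Pt.ext {v w : Pt K B L} (h : ∀ b, v.hom b = w.hom b) : v = w :=
  WithConv.ext (AlgHom.ext h)

instance : Monoid (Pt K B L) := inferInstanceAs (Monoid (WithConv (B →ₐ[K] L)))

instance : Inv (Pt K B L) := ⟨fun v => toConv (v.hom.comp (HopfAlgebra.antipodeAlgHom K B))⟩

theorem Pt.inv_hom (v : Pt K B L) (b : B) : (v⁻¹).hom b = v.hom (HopfAlgebra.antipode K b) := rfl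

/-- A point as an element of the convolution algebra. -/
def Pt.lin : Pt K B L →* Cv K B L where
  toFun v := toConv v.hom.toLinearMap
  map_one' := rfl
  map_mul' _ _ := rfl

theorem Pt.lin_apply (v : Pt K B L) (b : B) : (Pt.lin v).ofConv b = v.hom b := rfl

theorem Pt.mul_hom {ι : Type*} {b : B} (r : Coalgebra.Repr K b ι) (v w : Pt K B L) :
    (v * w).hom b = ∑ i ∈ r.index, v.hom (r.left i) * w.hom (r.right i) :=
  Cv.mul_apply r (Pt.lin v) (Pt.lin w)

instance : Group (Pt K B L) where
  inv_mul_cancel v := by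
    refine Pt.ext fun b => ?_
    rw [Pt.mul_hom (ℛ K b)]
    simp only [Pt.inv_hom, ← map_mul, ← map_sum,
      HopfAlgebra.sum_antipode_mul_eq_algebraMap_counit (ℛ K b)]
    exact v.hom.commutes _

@[simp]
theorem Pt.lin_mul_inv (v : Pt K B L) : Pt.lin v * Pt.lin v⁻¹ = 1 := by
  rw [← map_mul, mul_inv_cancel, map_one]

@[simp]
theorem Pt.lin_inv_mul (v : Pt K B L) : Pt.lin v⁻¹ * Pt.lin v = 1 := by
  rw [← map_mul, inv_mul_cancel, map_one]

variable (L) in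
/-- The functional `bul b` with values in `L`. -/
def lam (bul : B →ₗ[K] B →ₗ[K] K) : B →ₗ[K] Cv K B L where
  toFun b := toConv (Algebra.linearMap K L ∘ₗ bul b)
  map_add' a b := by refine Cv.ext fun c => ?_; simp
  map_smul' k b := by
    refine Cv.ext fun c => ?_
    simp [Algebra.smul_def (A := L)]

theorem lam_apply (bul : B →ₗ[K] B →ₗ[K] K) (b c : B) :
    (lam L bul b).ofConv c = algebraMap K L (bul b c) := rfl

/-- The form `bul` between the slot `j` and the outermost slot. -/
def Om (bul : B →ₗ[K] B →ₗ[K] K) (j : Cv K B L →ₐ[L] T) : Cv K B T :=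
  toConv ((j.restrictScalars K).toLinearMap ∘ₗ lam L bul)

theorem Om_apply (bul : B →ₗ[K] B →ₗ[K] K) (j : Cv K B L →ₐ[L] T) (b : B) :
    (Om bul j).ofConv b = j (lam L bul b) := rfl

/-- Symmetric biderivations `B × B → K` which are invariant under conjugation. -/
structure IsBalanced (bul : B →ₗ[K] B →ₗ[K] K) : Prop where
  symm : ∀ b c, bul b c = bul c b
  leibniz : ∀ b c d, bul b (c * d) =
    Coalgebra.counit (R := K) c * bul b d + Coalgebra.counit (R := K) d * bul b c
  balanced : ∀ b c, ∑ i ∈ (ℛ K b).index, ∑ j ∈ (ℛ K c).index,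
      bul ((ℛ K b).right i) ((ℛ K c).right j) • ((ℛ K b).left i * (ℛ K c).left j) =
    ∑ i ∈ (ℛ K b).index, ∑ j ∈ (ℛ K c).index,
      bul ((ℛ K b).left i) ((ℛ K c).left j) • ((ℛ K b).right i * (ℛ K c).right j)

theorem IsBalanced.top_mul_Om {bul : B →ₗ[K] B →ₗ[K] K} (h : IsBalanced bul)
    (j : Cv K B L →ₐ[L] T) (v : Pt K B L) :
    Cv.top (Pt.lin v) * Cv.const L (j (Pt.lin v)) * Om bul j =
      Om bul j * (Cv.top (Pt.lin v) * Cv.const L (j (Pt.lin v))) := by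
  have key : ∀ p, ∑ i ∈ (ℛ K p).index, v.hom ((ℛ K p).left i) •
      (Pt.lin v * lam L bul ((ℛ K p).right i)) =
      ∑ i ∈ (ℛ K p).index, v.hom ((ℛ K p).right i) •
      (lam L bul ((ℛ K p).left i) * Pt.lin v) := by
    intro p
    refine Cv.ext fun b => ?_
    have h' := congrArg v.hom (h.balanced p b)
    simp only [map_sum, map_smul, map_mul] at h'
    simp only [ofConv_sum, ofConv_smul, LinearMap.sum_apply, LinearMap.smul_apply,
      Cv.mul_apply (ℛ K b), lam_apply, Pt.lin_apply, Finset.mul_sum, smul_eq_mul]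
    simp only [Algebra.smul_def] at h'
    refine Eq.trans (Finset.sum_congr rfl fun i _ => Finset.sum_congr rfl fun k _ => ?_)
      (h'.trans (Finset.sum_congr rfl fun i _ => Finset.sum_congr rfl fun k _ => ?_)) <;> ring
  refine Cv.ext fun p => ?_
  have := congrArg j (key p)
  simp only [map_sum, map_smul, map_mul] at this
  rw [mul_assoc, ← mul_assoc (Om bul j), Cv.mul_const_apply, Cv.mul_apply (ℛ K p),
    Cv.mul_apply (ℛ K p)]
  simp only [Cv.const_mul_apply, Cv.top_apply, Om_apply, Finset.sum_mul]
  refine Eq.trans (Finset.sum_congr rfl fun i _ => ?_)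
    (this.trans (Finset.sum_congr rfl fun i _ => ?_))
  · rw [Algebra.smul_def, Pt.lin_apply]
  · rw [Algebra.smul_def, Pt.lin_apply, ← mul_assoc, Algebra.commutes _ (j _)]

end Slots

/-! ### The universal bracket formula -/

section Fox

variable {K B L T : Type*} [CommRing K] [CommRing B] [HopfAlgebra K B]
variable [CommRing L] [Algebra K L] [Ring T] [Algebra K T]

theorem Sweedler₂.conv_apply {b : B} (β : Sweedler₂ (K := K) b) (f g : Cv K B T) :
    (f * g).ofConv b = ∑ k, f.ofConv (β.el k 0) * g.ofConv (β.el k 1) := by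
  rw [LinearMap.convMul_apply, ← β.sum_eq]
  simp

theorem Cv.mul_ofConv_comp {M : Type*} [AddCommGroup M] [Module K M] (f : Cv K B T) {g : Cv K B T}
    {p : M →ₗ[K] T} {q : B →ₗ[K] M} (h : g.ofConv = p ∘ₗ q) :
    (f * g).ofConv = (LinearMap.mul' K T ∘ₗ TensorProduct.map f.ofConv p) ∘ₗ
      (q.lTensor B ∘ₗ Coalgebra.comul) := by
  rw [← LinearMap.comp_assoc, LinearMap.comp_assoc (q.lTensor B), LinearMap.map_comp_lTensor, ← h]
  rfl

theorem Sweedler₄.conv_apply {b : B} (β : Sweedler₄ (K := K) b) (f g h l : Cv K B T) :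
    (f * (g * (h * l))).ofConv b = ∑ k, f.ofConv (β.el k 0) *
      (g.ofConv (β.el k 1) * (h.ofConv (β.el k 2) * l.ofConv (β.el k 3))) := by
  have e₁ : (h * l).ofConv = (LinearMap.mul' K T ∘ₗ TensorProduct.map h.ofConv l.ofConv) ∘ₗ
    Coalgebra.comul := rfl
  rw [Cv.mul_ofConv_comp f (Cv.mul_ofConv_comp g e₁), LinearMap.lTensor_comp]
  simp only [LinearMap.comp_apply]
  rw [← β.sum_eq]
  simp

theorem Sweedler₆.conv_apply {b : B} (β : Sweedler₆ (K := K) b) (f g h l m n : Cv K B T) :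
    (f * (g * (h * (l * (m * n))))).ofConv b = ∑ k, f.ofConv (β.el k 0) *
      (g.ofConv (β.el k 1) * (h.ofConv (β.el k 2) * (l.ofConv (β.el k 3) *
        (m.ofConv (β.el k 4) * n.ofConv (β.el k 5))))) := by
  have e₁ : (m * n).ofConv = (LinearMap.mul' K T ∘ₗ TensorProduct.map m.ofConv n.ofConv) ∘ₗ
    Coalgebra.comul := rfl
  rw [Cv.mul_ofConv_comp f (Cv.mul_ofConv_comp g (Cv.mul_ofConv_comp h (Cv.mul_ofConv_comp l e₁)))]
  simp only [LinearMap.lTensor_comp, LinearMap.comp_apply]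
  rw [← β.sum_eq]
  simp

theorem exists_sum_tmul {M N : Type*} [AddCommGroup M] [AddCommGroup N] [Module K M] [Module K N]
    (t : M ⊗[K] N) : ∃ (m : ℕ) (f : Fin m → M) (g : Fin m → N), ∑ i, f i ⊗ₜ[K] g i = t := by
  induction t with
  | zero => exact ⟨0, Fin.elim0, Fin.elim0, by simp⟩
  | tmul x y => exact ⟨1, fun _ => x, fun _ => y, by simp⟩
  | add t t' h h' =>
    obtain ⟨m, f, g, rfl⟩ := h
    obtain ⟨m', f', g', rfl⟩ := h'
    exact ⟨m + m', Fin.append f f', Fin.append g g', by simp [Fin.sum_univ_add]⟩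

theorem exists_sum_tmul_tmul {M N P : Type*} [AddCommGroup M] [AddCommGroup N] [AddCommGroup P]
    [Module K M] [Module K N] [Module K P] (t : M ⊗[K] (N ⊗[K] P)) :
    ∃ (m : ℕ) (f : Fin m → M) (g : Fin m → N) (h : Fin m → P),
      ∑ i, f i ⊗ₜ[K] (g i ⊗ₜ[K] h i) = t := by
  induction t with
  | zero => exact ⟨0, Fin.elim0, Fin.elim0, Fin.elim0, by simp⟩
  | tmul x t =>
    obtain ⟨m, f, g, rfl⟩ := exists_sum_tmul t
    exact ⟨m, fun _ => x, f, g, by simp [TensorProduct.tmul_sum]⟩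
  | add t t' h h' =>
    obtain ⟨m, f, g, k, rfl⟩ := h
    obtain ⟨m', f', g', k', rfl⟩ := h'
    exact ⟨m + m', Fin.append f f', Fin.append g g', Fin.append k k', by simp [Fin.sum_univ_add]⟩

theorem nonempty_sweedler₂ (b : B) : Nonempty (Sweedler₂ (K := K) b) := by
  obtain ⟨m, f, g, h⟩ := exists_sum_tmul (Coalgebra.comul (R := K) b)
  exact ⟨⟨m, fun i => ![f i, g i], h⟩⟩

theorem nonempty_sweedler₄ (b : B) : Nonempty (Sweedler₄ (K := K) b) := by
  suffices h : ∀ t : B ⊗[K] (B ⊗[K] (B ⊗[K] B)), ∃ (m : ℕ) (f : Fin m → Fin 4 → B),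
      ∑ i, f i 0 ⊗ₜ[K] (f i 1 ⊗ₜ[K] (f i 2 ⊗ₜ[K] f i 3)) = t by
    obtain ⟨m, f, h⟩ := h _
    exact ⟨⟨m, f, h⟩⟩
  intro t
  induction t with
  | zero => exact ⟨0, Fin.elim0, by simp⟩
  | tmul x t =>
    obtain ⟨m, f, g, h, rfl⟩ := exists_sum_tmul_tmul t
    exact ⟨m, fun i => ![x, f i, g i, h i], by simp [TensorProduct.tmul_sum]⟩
  | add t t' h h' =>
    obtain ⟨m, f, rfl⟩ := h
    obtain ⟨m', f', rfl⟩ := h'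
    exact ⟨m + m', Fin.append f f', by simp [Fin.sum_univ_add]⟩

variable (bul : B →ₗ[K] B →ₗ[K] K)

/-- The element `(c'' • b⁽²⁾) v(s(b⁽³⁾) b⁽¹⁾) φ(b⁽⁴⁾) χ(c')` as a function of `c` and `b`. -/
def foxLin (v : Pt K B L) (φ χ : Cv K B L) : Cv K B (Cv K B L) :=
  Cv.top χ * (Cv.const L (Pt.lin v) * Om bul (AlgHom.id L _) * Cv.const L (Pt.lin v⁻¹ * φ))

/-- The element `(c'' • b⁽²⁾) v(s(b⁽³⁾) b⁽¹⁾) g(b⁽⁴⁾) h(c')` as a function of `c` and `b`. -/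
def fox (v g h : Pt K B L) : Cv K B (Cv K B L) := foxLin bul v (Pt.lin g) (Pt.lin h)

theorem foxLin_apply (v : Pt K B L) (φ χ : Cv K B L) {b c : B} (β : Sweedler₄ (K := K) b)
    (γ : Sweedler₂ (K := K) c) :
    ((foxLin bul v φ χ).ofConv c).ofConv b = ∑ k, ∑ l, algebraMap K L (bul (γ.el l 1) (β.el k 1)) *
      (v.hom (HopfAlgebra.antipode K (β.el k 2) * β.el k 0) * φ.ofConv (β.el k 3) *
        χ.ofConv (γ.el l 0)) := by
  rw [foxLin, γ.conv_apply, ofConv_sum, LinearMap.sum_apply, Finset.sum_comm]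
  refine Finset.sum_congr rfl fun l _ => ?_
  rw [Cv.top_apply, Cv.mul_const_apply, Cv.const_mul_apply, Om_apply, ← Algebra.smul_def,
    ofConv_smul, LinearMap.smul_apply, AlgHom.id_apply, mul_assoc, β.conv_apply, smul_eq_mul,
    Finset.mul_sum]
  refine Finset.sum_congr rfl fun k _ => ?_
  rw [lam_apply, Pt.lin_apply, Pt.lin_apply, Pt.inv_hom, map_mul]
  ring

theorem fox_mul_right {bul : B →ₗ[K] B →ₗ[K] K} (hb : IsBalanced bul) (v g h k : Pt K B L) :
    fox bul (v * k) g (h * k) = fox bul v g h * Cv.top (Pt.lin k) := by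
  have h₁ := hb.top_mul_Om (AlgHom.id L (Cv K B L)) k
  simp only [AlgHom.id_apply] at h₁
  have h₂ := Cv.top_mul_const (K := K) (B := B) (Pt.lin k) (Pt.lin (K := K) (B := B) (L := L) v)
  have h₃ : Cv.const L (Pt.lin k) * Cv.const L (Pt.lin (k⁻¹ * v⁻¹) * Pt.lin g) =
      (Cv.const L (Pt.lin v⁻¹ * Pt.lin g) : Cv K B (Cv K B L)) := by
    rw [← map_mul, ← mul_assoc, ← map_mul, mul_inv_cancel_left]
  have h₄ := Cv.top_mul_const (K := K) (B := B) (Pt.lin k) (Pt.lin v⁻¹ * Pt.lin g)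
  simp only [fox, foxLin, mul_inv_rev, map_mul (Pt.lin (K := K) (B := B) (L := L)) v,
    map_mul (Pt.lin (K := K) (B := B) (L := L)) h]
  rw [map_mul, map_mul]
  calc _ = Cv.top (Pt.lin h) * (Cv.top (Pt.lin k) * Cv.const L (Pt.lin v)) * Cv.const L (Pt.lin k) *
        Om bul (AlgHom.id L _) * Cv.const L (Pt.lin (k⁻¹ * v⁻¹) * Pt.lin g) := by
        simp only [mul_assoc]
    _ = Cv.top (Pt.lin h) * Cv.const L (Pt.lin v) * (Cv.top (Pt.lin k) * Cv.const L (Pt.lin k) *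
        Om bul (AlgHom.id L _)) * Cv.const L (Pt.lin (k⁻¹ * v⁻¹) * Pt.lin g) := by
        rw [h₂]; simp only [mul_assoc]
    _ = Cv.top (Pt.lin h) * Cv.const L (Pt.lin v) * Om bul (AlgHom.id L _) *
        (Cv.top (Pt.lin k) * (Cv.const L (Pt.lin k) *
          Cv.const L (Pt.lin (k⁻¹ * v⁻¹) * Pt.lin g))) := by
        rw [h₁]; simp only [mul_assoc]
    _ = _ := by rw [h₃, h₄]; simp only [mul_assoc]

/-- Exchange of the two slots. -/
def Cv.flip : Cv K B (Cv K B L) →ₗ[K] Cv K B (Cv K B L) where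
  toFun f := toConv
    { toFun := fun b => toConv
        { toFun := fun c => (f.ofConv c).ofConv b
          map_add' := fun c d => by simp
          map_smul' := fun k c => by simp }
      map_add' := fun b c => by refine Cv.ext fun d => ?_; simp
      map_smul' := fun k c => by refine Cv.ext fun d => ?_; simp }
  map_add' f g := by refine Cv.ext fun b => Cv.ext fun c => ?_; simp
  map_smul' k f := by refine Cv.ext fun b => Cv.ext fun c => ?_; simp

theorem Cv.flip_apply (f : Cv K B (Cv K B L)) (b c : B) :
    ((Cv.flip f).ofConv b).ofConv c = (f.ofConv c).ofConv b := rfl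

theorem Cv.flip_mul (f g : Cv K B (Cv K B L)) : Cv.flip (f * g) = Cv.flip f * Cv.flip g := by
  refine Cv.ext fun b => Cv.ext fun c => ?_
  rw [Cv.flip_apply, Cv.mul_apply (ℛ K c), Cv.mul_apply (ℛ K b)]
  simp only [ofConv_sum, LinearMap.sum_apply, Cv.mul_apply (ℛ K b), Cv.mul_apply (ℛ K c),
    Cv.flip_apply]
  rw [Finset.sum_comm]

theorem Cv.flip_top (f : Cv K B L) : Cv.flip (Cv.top f) = Cv.const L f := by
  refine Cv.ext fun b => Cv.ext fun c => ?_
  rw [Cv.flip_apply, Cv.top_apply, Cv.const_apply, ofConv_smul, LinearMap.smul_apply,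
    LinearMap.convAlgebraMap_apply, smul_eq_mul, mul_comm, ← Algebra.smul_def]

theorem Cv.flip_const (f : Cv K B L) : Cv.flip (Cv.const L f) = Cv.top f := by
  rw [← Cv.flip_top]; rfl

theorem flip_Om {bul : B →ₗ[K] B →ₗ[K] K} (hb : IsBalanced bul) :
    Cv.flip (Om bul (AlgHom.id L _)) = Om bul (AlgHom.id L _) := by
  refine Cv.ext fun b => Cv.ext fun c => ?_
  rw [Cv.flip_apply, Om_apply, Om_apply, AlgHom.id_apply, AlgHom.id_apply, lam_apply, lam_apply,
    hb.symm]

theorem fox_symm {bul : B →ₗ[K] B →ₗ[K] K} (hb : IsBalanced bul) (w g h : Pt K B L) (b c : B) :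
    ((fox bul (g * w⁻¹ * h) g h).ofConv c).ofConv b = ((fox bul w h g).ofConv b).ofConv c := by
  have hO := hb.top_mul_Om (AlgHom.id L (Cv K B L)) h
  have hw := hb.top_mul_Om (AlgHom.id L (Cv K B L)) w
  simp only [AlgHom.id_apply] at hO hw
  have e₁ : Pt.lin (g * w⁻¹ * h)⁻¹ * Pt.lin g = Pt.lin h⁻¹ * Pt.lin w := by
    rw [← map_mul, ← map_mul]
    congr 1
    group
  have e₂ : Cv.const L (Pt.lin h) * Cv.const L (Pt.lin h⁻¹) = (1 : Cv K B (Cv K B L)) := by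
    rw [← map_mul, Pt.lin_mul_inv, map_one]
  have e₃ : Cv.const L (Pt.lin w⁻¹) * Cv.const L (Pt.lin w) = (1 : Cv K B (Cv K B L)) := by
    rw [← map_mul, Pt.lin_inv_mul, map_one]
  have e₄ : Cv.top (Pt.lin w) * Cv.top (Pt.lin w⁻¹) = (1 : Cv K B (Cv K B L)) := by
    rw [← map_mul, Pt.lin_mul_inv, map_one]
  have c₁ := fun f t => Cv.top_mul_const (K := K) (B := B) (L := L) (T := Cv K B L) f t
  rw [← Cv.flip_apply (fox bul w h g)]
  suffices e : fox bul (g * w⁻¹ * h) g h = Cv.flip (fox bul w h g) by rw [e]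
  rw [fox, fox, foxLin, foxLin, e₁]
  simp only [map_mul (Pt.lin (K := K) (B := B) (L := L)), map_mul (Cv.const (K := K) (B := B) L),
    Cv.flip_mul, Cv.flip_top, Cv.flip_const, flip_Om hb]
  calc _ = Cv.top (Pt.lin h) * (Cv.const L (Pt.lin g) * Cv.const L (Pt.lin w⁻¹)) *
        (Cv.const L (Pt.lin h) * Om bul (AlgHom.id L _) * Cv.const L (Pt.lin h⁻¹)) *
        Cv.const L (Pt.lin w) := by simp only [mul_assoc]
    _ = Cv.const L (Pt.lin g) * Cv.const L (Pt.lin w⁻¹) *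
        (Cv.top (Pt.lin h) * Cv.const L (Pt.lin h) * Om bul (AlgHom.id L _)) *
        Cv.const L (Pt.lin h⁻¹) * Cv.const L (Pt.lin w) := by
        rw [← map_mul, c₁, map_mul]; simp only [mul_assoc]
    _ = Cv.const L (Pt.lin g) * Cv.const L (Pt.lin w⁻¹) * Om bul (AlgHom.id L _) *
        Cv.top (Pt.lin h) * (Cv.const L (Pt.lin h) * Cv.const L (Pt.lin h⁻¹)) *
        Cv.const L (Pt.lin w) := by rw [hO]; simp only [mul_assoc]
    _ = Cv.const L (Pt.lin g) * Cv.const L (Pt.lin w⁻¹) * (Om bul (AlgHom.id L _) *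
        (Cv.top (Pt.lin w) * Cv.const L (Pt.lin w))) * Cv.top (Pt.lin w⁻¹) *
        Cv.top (Pt.lin h) := by
        have : Cv.top (Pt.lin w) * Cv.const L (Pt.lin w) * Cv.top (Pt.lin w⁻¹) =
            (Cv.const L (Pt.lin w) : Cv K B (Cv K B L)) := by
          rw [mul_assoc, ← c₁, ← mul_assoc, e₄, one_mul]
        rw [e₂, mul_one, mul_assoc _ _ (Cv.top (Pt.lin w⁻¹)), mul_assoc (Om _ _) _
          (Cv.top (Pt.lin w⁻¹)), this]
        simp only [mul_assoc, c₁]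
    _ = Cv.const L (Pt.lin g) * Cv.const L (Pt.lin w⁻¹) * (Cv.const L (Pt.lin w) *
        Cv.top (Pt.lin w)) * Om bul (AlgHom.id L _) * Cv.top (Pt.lin w⁻¹) *
        Cv.top (Pt.lin h) := by rw [← hw, c₁]; simp only [mul_assoc]
    _ = Cv.const L (Pt.lin g) * (Cv.const L (Pt.lin w⁻¹) * Cv.const L (Pt.lin w)) *
        Cv.top (Pt.lin w) * Om bul (AlgHom.id L _) * Cv.top (Pt.lin w⁻¹) *
        Cv.top (Pt.lin h) := by simp only [mul_assoc]
    _ = _ := by rw [e₃, mul_one]; simp only [mul_assoc]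

end Fox

/-! ### The form of a trace-like element -/

section TraceForm

variable {K B L T : Type*} [CommRing K] [CommRing B] [HopfAlgebra K B]
variable [CommRing L] [Algebra K L] [Ring T] [Algebra K T]

/-- Derivations along the counit. -/
def IsCounitDer {N : Type*} [AddCommGroup N] [Module K N] (D : B →ₗ[K] N) : Prop :=
  ∀ b c, D (b * c) = Coalgebra.counit (R := K) b • D c + Coalgebra.counit (R := K) c • D b

theorem IsCounitDer.map_one {N : Type*} [AddCommGroup N] [Module K N] {D : B →ₗ[K] N}
    (h : IsCounitDer D) : D 1 = 0 := by
  simpa using h 1 1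

theorem IsCounitDer.eq_zero {N : Type*} [AddCommGroup N] [Module K N] {D : B →ₗ[K] N}
    (h : IsCounitDer D) {b : B} (hb : b ∈ augIdeal K B ^ 2) : D b = 0 := by
  rw [pow_two] at hb
  refine Submodule.mul_induction_on hb (fun x hx y hy => ?_) (fun x y hx hy => ?_)
  · have hx' : Coalgebra.counit (R := K) x = 0 := hx
    have hy' : Coalgebra.counit (R := K) y = 0 := hy
    rw [h, hx', hy', zero_smul, zero_smul, add_zero]
  · rw [map_add, hx, hy, add_zero]

theorem IsCounitDer.congr {N : Type*} [AddCommGroup N] [Module K N] {D : B →ₗ[K] N}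
    (h : IsCounitDer D) {b c : B} (hbc : toCot K B b = toCot K B c) : D b = D c := by
  have h' := (augIdeal K B).toCotangent_eq.1 hbc
  have h₁ : ∀ k : K, D (algebraMap K B k) = 0 := fun k => by
    rw [Algebra.algebraMap_eq_smul_one, map_smul, h.map_one, smul_zero]
  have h₂ : D ((b - algebraMap K B (Coalgebra.counit b)) -
      (c - algebraMap K B (Coalgebra.counit c))) = 0 := h.eq_zero h'
  simp only [map_sub, h₁, sub_zero] at h₂
  exact sub_eq_zero.1 h₂

variable {t : B} (ht : IsTraceLike K t)

theorem traceForm_isCounitDer (b : B) : IsCounitDer (traceForm ht b) := fun c d =>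
  ((LinearEquiv.ofBijective (traceMap K t) ht.bijective).symm (toCot K B b)).2 c d

theorem IsCounitDer.eq_lid {N : Type*} [AddCommGroup N] [Module K N] {D : B →ₗ[K] N}
    (h : IsCounitDer D) (b : B) :
    D b = TensorProduct.lid K N (TensorProduct.map (traceForm ht b) D
      (Coalgebra.comul (R := K) t)) := by
  have e : toCot K B b = toCot K B (TensorProduct.lid K B
      ((traceForm ht b).rTensor B (Coalgebra.comul (R := K) t))) := by
    have h' : traceMap K t ((LinearEquiv.ofBijective (traceMap K t) ht.bijective).symm
        (toCot K B b)) = toCot K B b :=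
      LinearEquiv.apply_symm_apply (LinearEquiv.ofBijective (traceMap K t) ht.bijective) _
    rw [← h']
    change TensorProduct.lid K _ (TensorProduct.map (traceForm ht b) (toCot K B)
      (Coalgebra.comul (R := K) t)) = _
    generalize Coalgebra.comul (R := K) t = τ
    induction τ with
    | zero => simp
    | add x y hx hy => simp only [map_add, hx, hy]
    | tmul x y => simp
  rw [h.congr e]
  generalize Coalgebra.comul (R := K) t = τ
  induction τ with
  | zero => simp
  | add x y hx hy => simp only [map_add, hx, hy]
  | tmul x y => simp

theorem IsCosymmetric.conv_comm {t : B} (hc : IsCosymmetric K t) (f g : Cv K B T)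
    (h : ∀ b c, f.ofConv b * g.ofConv c = g.ofConv c * f.ofConv b) :
    (f * g).ofConv t = (g * f).ofConv t := by
  rw [LinearMap.convMul_apply, LinearMap.convMul_apply]
  conv_lhs => rw [← hc]
  generalize Coalgebra.comul (R := K) t = τ
  induction τ with
  | zero => simp
  | add x y hx hy => simp only [map_add, hx, hy]
  | tmul x y => simp [h]

theorem traceForm_symm (b c : B) : traceForm ht b c = traceForm ht c b := by
  rw [(traceForm_isCounitDer ht b).eq_lid ht c, (traceForm_isCounitDer ht c).eq_lid ht b]
  conv_lhs => rw [← ht.cosymmetric]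
  generalize Coalgebra.comul (R := K) t = τ
  induction τ with
  | zero => simp
  | add x y hx hy => simp only [map_add, hx, hy]
  | tmul x y => simp [mul_comm]

theorem IsCounitDer.eq_conv {D : Cv K B L} (h : IsCounitDer D.ofConv) (b : B) :
    D.ofConv b = (lam L (traceForm ht) b * D).ofConv t := by
  rw [h.eq_lid ht b, LinearMap.convMul_apply]
  generalize Coalgebra.comul (R := K) t = τ
  induction τ with
  | zero => simp
  | add x y hx hy => simp only [map_add, hx, hy]
  | tmul x y => simp [lam_apply, Algebra.smul_def]

/-- Twisted derivations: `D(bc) = D(b) q(c) + p(b) D(c)`. -/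
def IsPtDer (p q : Pt K B L) (D : Cv K B L) : Prop :=
  ∀ b c, D.ofConv (b * c) = D.ofConv b * q.hom c + p.hom b * D.ofConv c

theorem isPtDer_one {D : Cv K B L} : IsPtDer 1 1 D ↔ IsCounitDer D.ofConv := by
  have h : ∀ b, (1 : Pt K B L).hom b = algebraMap K L (Coalgebra.counit b) := fun b => rfl
  refine forall_congr' fun b => forall_congr' fun c => ?_
  rw [h, h, Algebra.smul_def, Algebra.smul_def, add_comm, mul_comm (D.ofConv b)]

theorem IsPtDer.pt_mul {p q : Pt K B L} {D : Cv K B L} (h : IsPtDer p q D) (v : Pt K B L) :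
    IsPtDer (v * p) (v * q) (Pt.lin v * D) := by
  intro b c
  rw [Cv.mul_apply ((ℛ K b).mul (ℛ K c)), Cv.mul_apply (ℛ K b), Cv.mul_apply (ℛ K c),
    Pt.mul_hom (ℛ K b), Pt.mul_hom (ℛ K c), Finset.sum_mul_sum, Finset.sum_mul_sum,
    ← Finset.sum_product', ← Finset.sum_product', ← Finset.sum_add_distrib]
  refine Finset.sum_congr rfl fun i _ => ?_
  simp only [Coalgebra.Repr.mul_left, Coalgebra.Repr.mul_right, Pt.lin_apply, h _ _, map_mul]
  ring

theorem IsPtDer.mul_pt {p q : Pt K B L} {D : Cv K B L} (h : IsPtDer p q D) (v : Pt K B L) :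
    IsPtDer (p * v) (q * v) (D * Pt.lin v) := by
  intro b c
  rw [Cv.mul_apply ((ℛ K b).mul (ℛ K c)), Cv.mul_apply (ℛ K b), Cv.mul_apply (ℛ K c),
    Pt.mul_hom (ℛ K b), Pt.mul_hom (ℛ K c), Finset.sum_mul_sum, Finset.sum_mul_sum,
    ← Finset.sum_product', ← Finset.sum_product', ← Finset.sum_add_distrib]
  refine Finset.sum_congr rfl fun i _ => ?_
  simp only [Coalgebra.Repr.mul_left, Coalgebra.Repr.mul_right, Pt.lin_apply, h _ _, map_mul]
  ring

theorem IsPtDer.conj {D : Cv K B L} (h : IsPtDer 1 1 D) (v : Pt K B L) :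
    IsPtDer 1 1 (Pt.lin v * D * Pt.lin v⁻¹) := by
  simpa using (h.pt_mul v).mul_pt v⁻¹

theorem IsPtDer.sum {ι : Type*} {p q : Pt K B L} {D : ι → Cv K B L} (s : Finset ι) (l : ι → L)
    (hD : ∀ i, IsPtDer p q (D i)) : IsPtDer p q (∑ i ∈ s, l i • D i) := by
  intro b c
  simp only [ofConv_sum, ofConv_smul, LinearMap.sum_apply, LinearMap.smul_apply, hD _ b c,
    smul_eq_mul, Finset.sum_mul, Finset.mul_sum, ← Finset.sum_add_distrib]
  exact Finset.sum_congr rfl fun i _ => by ring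

theorem IsPtDer.commutator {D E : Cv K B L} (hD : IsPtDer 1 1 D) (hE : IsPtDer 1 1 E) :
    IsPtDer 1 1 (D * E - E * D) := by
  have h1 : ∀ b, (1 : Pt K B L).hom b = algebraMap K L (Coalgebra.counit b) := fun b => rfl
  have key : ∀ {D E : Cv K B L}, IsPtDer 1 1 D → IsPtDer 1 1 E → ∀ b c, (D * E).ofConv (b * c) =
      (D * E).ofConv b * (1 : Pt K B L).hom c + D.ofConv b * E.ofConv c +
      E.ofConv b * D.ofConv c + (1 : Pt K B L).hom b * (D * E).ofConv c := by
    intro D E hD hE b c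
    have e₁ : ∀ (f : Cv K B L) (b : B), ∑ i ∈ (ℛ K b).index,
        (1 : Pt K B L).hom ((ℛ K b).left i) * f.ofConv ((ℛ K b).right i) = f.ofConv b := by
      intro f b
      exact (Cv.mul_apply (ℛ K b) (Pt.lin 1) f).symm.trans (by rw [_root_.map_one, one_mul])
    have e₂ : ∀ (f : Cv K B L) (b : B), ∑ i ∈ (ℛ K b).index,
        f.ofConv ((ℛ K b).left i) * (1 : Pt K B L).hom ((ℛ K b).right i) = f.ofConv b := by
      intro f b
      exact (Cv.mul_apply (ℛ K b) f (Pt.lin 1)).symm.trans (by rw [_root_.map_one, mul_one])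
    have e₃ : ∀ b : B, ∑ i ∈ (ℛ K b).index,
        (1 : Pt K B L).hom ((ℛ K b).left i) * (1 : Pt K B L).hom ((ℛ K b).right i) =
          (1 : Pt K B L).hom b := fun b => e₁ (Pt.lin 1) b
    rw [Cv.mul_apply ((ℛ K b).mul (ℛ K c)), Cv.mul_apply (ℛ K b), Cv.mul_apply (ℛ K c)]
    conv_rhs => rw [← e₃ c, ← e₃ b, ← e₁ E c, ← e₂ D b, ← e₁ E b, ← e₂ D c]
    simp only [Finset.sum_mul_sum, ← Finset.sum_product', ← Finset.sum_add_distrib]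
    refine Finset.sum_congr rfl fun i _ => ?_
    simp only [Coalgebra.Repr.mul_left, Coalgebra.Repr.mul_right, hD _ _, hE _ _]
    ring
  intro b c
  simp only [ofConv_sub, LinearMap.sub_apply, key hD hE, key hE hD]
  ring

theorem lam_isPtDer (b : B) : IsPtDer 1 1 (lam L (traceForm ht) b) := by
  rw [isPtDer_one]
  intro c d
  simp [lam_apply, traceForm_isCounitDer ht b c d, Algebra.smul_def]

theorem lam_conj (v : Pt K B L) (b c : B) :
    (Pt.lin v * lam L (traceForm ht) b * Pt.lin v⁻¹).ofConv c =
      (Pt.lin v⁻¹ * lam L (traceForm ht) c * Pt.lin v).ofConv b := by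
  have h₁ := isPtDer_one.1 ((lam_isPtDer (L := L) ht b).conj v)
  have h₂ := isPtDer_one.1 ((lam_isPtDer (L := L) ht c).conj v⁻¹)
  rw [inv_inv] at h₂
  rw [h₁.eq_conv ht, h₂.eq_conv ht, ← mul_assoc,
    ht.cosymmetric.conv_comm _ (Pt.lin v⁻¹) (fun _ _ => mul_comm _ _),
    ht.cosymmetric.conv_comm (lam L (traceForm ht) b) _ (fun _ _ => mul_comm _ _)]
  simp only [mul_assoc]

theorem isBalanced_traceForm : IsBalanced (traceForm ht) where
  symm := traceForm_symm ht
  leibniz b c d := by simpa using traceForm_isCounitDer ht b c d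
  balanced b c := by
    let v : Pt K B B := toConv (AlgHom.id K B)
    have hv : ∀ b, (Pt.lin v).ofConv b = b := fun b => rfl
    have e₁ : ∀ q c, ∑ j ∈ (ℛ K c).index,
        traceForm ht q ((ℛ K c).right j) • (ℛ K c).left j =
        ∑ j ∈ (ℛ K c).index, (Pt.lin v⁻¹ * lam B (traceForm ht) ((ℛ K c).left j) *
          Pt.lin v).ofConv q * (ℛ K c).right j := by
      intro q c
      have h := Cv.mul_apply (ℛ K c) (Pt.lin v * lam B (traceForm ht) q * Pt.lin v⁻¹) (Pt.lin v)
      rw [mul_assoc _ (Pt.lin v⁻¹), Pt.lin_inv_mul, mul_one, Cv.mul_apply (ℛ K c)] at h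
      simp only [lam_conj, hv, lam_apply] at h
      rw [← h]
      exact Finset.sum_congr rfl fun j _ => by rw [Algebra.smul_def, mul_comm]
    have e₂ : ∀ q b, ∑ i ∈ (ℛ K b).index, (ℛ K b).left i *
        (Pt.lin v⁻¹ * lam B (traceForm ht) q * Pt.lin v).ofConv ((ℛ K b).right i) =
        ∑ i ∈ (ℛ K b).index, traceForm ht ((ℛ K b).left i) q • (ℛ K b).right i := by
      intro q b
      have h := Cv.mul_apply (ℛ K b) (Pt.lin v)
        (Pt.lin v⁻¹ * lam B (traceForm ht) q * Pt.lin v)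
      rw [← mul_assoc, ← mul_assoc, Pt.lin_mul_inv, one_mul, Cv.mul_apply (ℛ K b)] at h
      simp only [hv, lam_apply] at h
      rw [← h]
      exact Finset.sum_congr rfl fun j _ => by rw [Algebra.smul_def, traceForm_symm]
    calc _ = ∑ i ∈ (ℛ K b).index, (ℛ K b).left i * ∑ j ∈ (ℛ K c).index,
          traceForm ht ((ℛ K b).right i) ((ℛ K c).right j) • (ℛ K c).left j := by
          simp only [Finset.mul_sum, mul_smul_comm]
      _ = ∑ j ∈ (ℛ K c).index, (∑ i ∈ (ℛ K b).index, (ℛ K b).left i *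
          (Pt.lin v⁻¹ * lam B (traceForm ht) ((ℛ K c).left j) * Pt.lin v).ofConv
            ((ℛ K b).right i)) * (ℛ K c).right j := by
          simp only [e₁, Finset.mul_sum, Finset.sum_mul, mul_assoc]
          exact Finset.sum_comm
      _ = _ := by
          simp only [e₂, Finset.sum_mul, smul_mul_assoc]
          exact Finset.sum_comm

/-- Comultiplication after the antipode. -/
theorem conv_antipode (f g : Cv K B L) (b : B) :
    (f * g).ofConv (HopfAlgebra.antipode K b) =
      (toConv (g.ofConv ∘ₗ HopfAlgebra.antipode K) *
        toConv (f.ofConv ∘ₗ HopfAlgebra.antipode K) : Cv K B L).ofConv b := by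
  let i₁ : Pt K B (B ⊗[K] B) := toConv Algebra.TensorProduct.includeLeft
  let i₂ : Pt K B (B ⊗[K] B) := toConv Algebra.TensorProduct.includeRight
  have h₀ : ∀ b, (i₁ * i₂).hom b = Coalgebra.comul (R := K) b := by
    intro b
    rw [Pt.mul_hom (ℛ K b), ← (ℛ K b).eq]
    exact Finset.sum_congr rfl fun i _ =>
      (Algebra.TensorProduct.tmul_mul_tmul _ _ _ _).trans (by simp)
  have h : Coalgebra.comul (R := K) (HopfAlgebra.antipode K b) = (i₂⁻¹ * i₁⁻¹).hom b := by
    rw [← h₀, ← Pt.inv_hom, mul_inv_rev]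
  have h' : (i₂⁻¹ * i₁⁻¹).hom b = ∑ i ∈ (ℛ K b).index,
      HopfAlgebra.antipode K ((ℛ K b).right i) ⊗ₜ[K]
        HopfAlgebra.antipode K ((ℛ K b).left i) := by
    rw [Pt.mul_hom (ℛ K b)]
    exact Finset.sum_congr rfl fun i _ =>
      (Algebra.TensorProduct.tmul_mul_tmul _ _ _ _).trans (by simp)
  rw [LinearMap.convMul_apply, h, h', Cv.mul_apply (ℛ K b)]
  simp [mul_comm]

theorem IsCounitDer.antipode {N : Type*} [AddCommGroup N] [Module K N] {D : B →ₗ[K] N}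
    (h : IsCounitDer D) (b : B) : D (HopfAlgebra.antipode K b) = -D b := by
  have e := congrArg D (HopfAlgebra.sum_antipode_mul_eq_algebraMap_counit (ℛ K b))
  have e₁ := congrArg D (Coalgebra.sum_counit_smul (ℛ K b))
  have e₂ := congrArg (D ∘ₗ HopfAlgebra.antipode K) (sum_counit_smul_left (ℛ K b))
  rw [Algebra.algebraMap_eq_smul_one, map_smul, h.map_one, smul_zero, map_sum] at e
  rw [map_sum] at e₁ e₂
  simp only [h _ _, HopfAlgebra.counit_antipode, Finset.sum_add_distrib, ← map_smul] at e
  rw [e₁] at e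
  simp only [map_smul, LinearMap.comp_apply] at e₂
  simp only [map_smul, e₂] at e
  exact eq_neg_of_add_eq_zero_right e

/-- The cubic form of `t + s(t)` on `I / I ^ 2` is dual to the Lie bracket. -/
theorem lam_mul_lam_mul_lam (b c d : B) :
    (lam L (traceForm ht) b * lam L (traceForm ht) d * lam L (traceForm ht) c).ofConv
        (t + HopfAlgebra.antipode K t) =
      (lam L (traceForm ht) d * lam L (traceForm ht) c -
        lam L (traceForm ht) c * lam L (traceForm ht) d).ofConv b := by
  have h := isPtDer_one.1 ((lam_isPtDer (L := L) ht d).commutator (lam_isPtDer ht c))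
  have hs : ∀ b, toConv ((lam L (traceForm ht) b).ofConv ∘ₗ HopfAlgebra.antipode K) =
      -lam L (traceForm ht) b := fun b => Cv.ext fun x =>
    (isPtDer_one.1 (lam_isPtDer (L := L) ht b)).antipode x
  have e : ∀ f : Cv K B L, toConv f.ofConv = f := fun f => rfl
  rw [h.eq_conv ht, map_add, conv_antipode, hs]
  have hs' : toConv ((lam L (traceForm ht) b * lam L (traceForm ht) d).ofConv ∘ₗ
      HopfAlgebra.antipode K) = lam L (traceForm ht) d * lam L (traceForm ht) b := by
    refine Cv.ext fun x => ?_
    change (lam L (traceForm ht) b * lam L (traceForm ht) d).ofConv (HopfAlgebra.antipode K x) = _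
    rw [conv_antipode, hs, hs, neg_mul_neg]
  rw [hs', neg_mul, mul_sub, ofConv_neg, ofConv_sub, LinearMap.neg_apply, LinearMap.sub_apply,
    ← mul_assoc, ← sub_eq_add_neg, ← mul_assoc, ht.cosymmetric.conv_comm (_ * _) (lam L _ b)
      (fun _ _ => mul_comm _ _), ← mul_assoc]

end TraceForm

section Universal

variable {K B L T : Type*} [CommRing K] [CommRing B] [HopfAlgebra K B]
variable [CommRing L] [Algebra K L] [Ring T] [Algebra K T]
variable (bul : B →ₗ[K] B →ₗ[K] K)

theorem conjLin_apply (f₁ f₂ φ χ : Cv K B L) {b c : B} (β : Sweedler₄ (K := K) b)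
    (γ : Sweedler₂ (K := K) c) :
    ((Cv.top χ * (Cv.const L f₁ * Om bul (AlgHom.id L _) * Cv.const L (f₂ * φ)) :
      Cv K B (Cv K B L)).ofConv c).ofConv b =
      ∑ k, ∑ l, bul (γ.el l 1) (β.el k 1) • (f₁.ofConv (β.el k 0) * f₂.ofConv (β.el k 2) *
        (φ.ofConv (β.el k 3) * χ.ofConv (γ.el l 0))) := by
  rw [γ.conv_apply, ofConv_sum, LinearMap.sum_apply, Finset.sum_comm]
  refine Finset.sum_congr rfl fun l _ => ?_
  rw [Cv.top_apply, Cv.mul_const_apply, Cv.const_mul_apply, Om_apply, ← Algebra.smul_def,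
    ofConv_smul, LinearMap.smul_apply, AlgHom.id_apply, mul_assoc, β.conv_apply, smul_eq_mul,
    Finset.mul_sum]
  refine Finset.sum_congr rfl fun k _ => ?_
  rw [lam_apply, Algebra.smul_def]
  ring

/-- The points of `B ⊗ B ⊗ B`. -/
def pt₁ : Pt K B (B ⊗[K] (B ⊗[K] B)) := toConv Algebra.TensorProduct.includeLeft

/-- A universal point. -/
def pt₂ : Pt K B (B ⊗[K] (B ⊗[K] B)) := toConv
  (Algebra.TensorProduct.includeRight.comp Algebra.TensorProduct.includeLeft)

/-- A universal point. -/
def pt₃ : Pt K B (B ⊗[K] (B ⊗[K] B)) := toConv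
  (Algebra.TensorProduct.includeRight.comp Algebra.TensorProduct.includeRight)

/-- The universal element `(c'' • b⁽²⁾) s(b⁽³⁾) b⁽¹⁾ ⊗ b⁽⁴⁾ ⊗ c'`. -/
def uni : B →ₗ[K] B →ₗ[K] B ⊗[K] (B ⊗[K] B) :=
  LinearMap.mk₂ K (fun b c => ((fox bul pt₁ pt₂ pt₃).ofConv c).ofConv b)
    (by simp) (by simp) (by simp) (by simp)

theorem uni_apply {b c : B} (β : Sweedler₄ (K := K) b) (γ : Sweedler₂ (K := K) c) :
    uni bul b c = ∑ k, ∑ l, bul (γ.el l 1) (β.el k 1) •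
      ((HopfAlgebra.antipode K (β.el k 2) * β.el k 0) ⊗ₜ[K] (β.el k 3 ⊗ₜ[K] γ.el l 0)) := by
  refine (foxLin_apply bul pt₁ (Pt.lin pt₂) (Pt.lin pt₃) β γ).trans ?_
  refine Finset.sum_congr rfl fun k _ => Finset.sum_congr rfl fun l _ => ?_
  rw [← Algebra.smul_def]
  congr 1
  change (_ ⊗ₜ[K] (1 : B ⊗[K] B)) * ((1 : B) ⊗ₜ[K] (_ ⊗ₜ[K] (1 : B))) *
    ((1 : B) ⊗ₜ[K] ((1 : B) ⊗ₜ[K] _)) = _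
  simp

/-- The map `a ⊗ b ⊗ c ↦ φ₁(a) φ₂(b) φ₃(c)`. -/
def tri (φ₁ φ₂ φ₃ : Cv K B T) : B ⊗[K] (B ⊗[K] B) →ₗ[K] T :=
  LinearMap.mul' K T ∘ₗ TensorProduct.map φ₁.ofConv
    (LinearMap.mul' K T ∘ₗ TensorProduct.map φ₂.ofConv φ₃.ofConv)

@[simp]
theorem tri_tmul (φ₁ φ₂ φ₃ : Cv K B T) (a b c : B) : tri φ₁ φ₂ φ₃ (a ⊗ₜ (b ⊗ₜ c)) =
    φ₁.ofConv a * (φ₂.ofConv b * φ₃.ofConv c) := by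
  simp [tri]

theorem tri_uni_pt (v : Pt K B L) (φ χ : Cv K B L) (b c : B) :
    tri (Pt.lin v) φ χ (uni bul b c) = ((foxLin bul v φ χ).ofConv c).ofConv b := by
  obtain ⟨β⟩ := nonempty_sweedler₄ (K := K) b
  obtain ⟨γ⟩ := nonempty_sweedler₂ (K := K) c
  rw [uni_apply bul β γ, foxLin_apply bul v φ χ β γ]
  simp only [map_sum, map_smul, tri_tmul, Pt.lin_apply]
  refine Finset.sum_congr rfl fun k _ => Finset.sum_congr rfl fun l _ => ?_
  rw [Algebra.smul_def, mul_assoc]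

theorem IsPtDer.antipode {u : Pt K B L} {A : Cv K B L} (hA : IsPtDer 1 1 A) (b : B) :
    (A * Pt.lin u).ofConv (HopfAlgebra.antipode K b) = -(Pt.lin u⁻¹ * A).ofConv b := by
  have hs : toConv (A.ofConv ∘ₗ HopfAlgebra.antipode K) = -A :=
    Cv.ext fun x => (isPtDer_one.1 hA).antipode x
  have hl : toConv ((Pt.lin u).ofConv ∘ₗ HopfAlgebra.antipode K) = Pt.lin u⁻¹ := rfl
  rw [conv_antipode, hs, hl, mul_neg, ofConv_neg, LinearMap.neg_apply]

theorem tri_uni_der {u : Pt K B L} {A : Cv K B L} (hA : IsPtDer 1 1 A) (g h : Pt K B L) (b c : B) :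
    tri (A * Pt.lin u) (Pt.lin g) (Pt.lin h) (uni bul b c) =
      ((Cv.top (Pt.lin h) * (Cv.const L A * (Cv.const L (Pt.lin u) * Om bul (AlgHom.id L _) *
        Cv.const L (Pt.lin u⁻¹)) - Cv.const L (Pt.lin u) * Om bul (AlgHom.id L _) *
        Cv.const L (Pt.lin u⁻¹) * Cv.const L A) * Cv.const L (Pt.lin g) :
        Cv K B (Cv K B L)).ofConv c).ofConv b := by
  obtain ⟨β⟩ := nonempty_sweedler₄ (K := K) b
  obtain ⟨γ⟩ := nonempty_sweedler₂ (K := K) c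
  have hd : IsPtDer u u (A * Pt.lin u) := by simpa using hA.mul_pt u
  have e : (Cv.top (Pt.lin h) * (Cv.const L A * (Cv.const L (Pt.lin u) * Om bul (AlgHom.id L _) *
        Cv.const L (Pt.lin u⁻¹)) - Cv.const L (Pt.lin u) * Om bul (AlgHom.id L _) *
        Cv.const L (Pt.lin u⁻¹) * Cv.const L A) * Cv.const L (Pt.lin g) :
        Cv K B (Cv K B L)) =
      Cv.top (Pt.lin h) * (Cv.const L (A * Pt.lin u) * Om bul (AlgHom.id L _) *
        Cv.const L (Pt.lin u⁻¹ * Pt.lin g)) -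
      Cv.top (Pt.lin h) * (Cv.const L (Pt.lin u) * Om bul (AlgHom.id L _) *
        Cv.const L ((Pt.lin u⁻¹ * A) * Pt.lin g)) := by
    simp only [map_mul, mul_sub, sub_mul, mul_assoc]
  rw [e, uni_apply bul β γ, ofConv_sub, LinearMap.sub_apply, ofConv_sub, LinearMap.sub_apply,
    conjLin_apply bul _ _ _ _ β γ, conjLin_apply bul _ _ _ _ β γ]
  simp only [map_sum, map_smul, tri_tmul, ← Finset.sum_sub_distrib, ← smul_sub]
  refine Finset.sum_congr rfl fun k _ => Finset.sum_congr rfl fun l _ => ?_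
  congr 1
  rw [hd, hA.antipode]
  simp only [Pt.lin_apply, Pt.inv_hom]
  ring

/-- The two terms of a Jacobiator in which two brackets meet in a common argument agree. -/
theorem tri_uni_comm (u w g h k : Pt K B L) (b c d : B) :
    tri (Pt.lin w) ((Cv.flip (fox bul u g h)).ofConv b) (Pt.lin k) (uni bul c d) =
      tri (Pt.lin u) (Pt.lin g) ((fox bul w h k).ofConv d) (uni bul b c) := by
  set N : Cv K B L := (Cv.flip (Cv.const L (Pt.lin u) * Om bul (AlgHom.id L _) *
    Cv.const L (Pt.lin u⁻¹ * Pt.lin g))).ofConv b with hN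
  have e : ∀ χ : Cv K B L, (Cv.flip (foxLin bul u (Pt.lin g) χ)).ofConv b = χ * N := by
    intro χ
    rw [foxLin, Cv.flip_mul, Cv.flip_top, Cv.const_mul_apply]
  have e' : foxLin bul w (Pt.lin h * N) (Pt.lin k) = fox bul w h k * Cv.const L N := by
    rw [fox, foxLin, foxLin, ← mul_assoc (Pt.lin w⁻¹), map_mul _ (Pt.lin w⁻¹ * Pt.lin h)]
    simp only [mul_assoc]
  rw [tri_uni_pt, tri_uni_pt, fox, e, e', Cv.mul_const_apply, ← Cv.flip_apply, e]

theorem Om_conj {bul : B →ₗ[K] B →ₗ[K] K} (hb : IsBalanced bul) [Algebra L T] [IsScalarTower K L T]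
    (j : Cv K B L →ₐ[L] T) (v : Pt K B L) :
    Cv.top (Pt.lin v) * Om bul j * Cv.top (Pt.lin v⁻¹) =
      Cv.const L (j (Pt.lin v⁻¹)) * Om bul j * Cv.const L (j (Pt.lin v)) := by
  have h := hb.top_mul_Om j v
  have e₁ : Cv.const L (j (Pt.lin v⁻¹)) * Cv.const L (j (Pt.lin v)) = (1 : Cv K B T) := by
    rw [← map_mul, ← map_mul, Pt.lin_inv_mul, map_one, map_one]
  have e₂ : Cv.top (Pt.lin v) * Cv.top (Pt.lin v⁻¹) = (1 : Cv K B T) := by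
    rw [← map_mul, Pt.lin_mul_inv, map_one]
  calc _ = Cv.const L (j (Pt.lin v⁻¹)) * (Cv.top (Pt.lin v) * Cv.const L (j (Pt.lin v)) *
        Om bul j) * Cv.top (Pt.lin v⁻¹) := by
        rw [Cv.top_mul_const, ← mul_assoc, ← mul_assoc, e₁, one_mul]
    _ = Cv.const L (j (Pt.lin v⁻¹)) * Om bul j * Cv.const L (j (Pt.lin v)) *
        (Cv.top (Pt.lin v) * Cv.top (Pt.lin v⁻¹)) := by
        rw [h, Cv.top_mul_const]; simp only [mul_assoc]
    _ = _ := by rw [e₂, mul_one]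

theorem top_inv_mul_Om_apply {bul : B →ₗ[K] B →ₗ[K] K} (hb : IsBalanced bul) [Algebra L T]
    [IsScalarTower K L T] (j : Cv K B L →ₐ[L] T) (g : Pt K B L) (p : B) :
    (Cv.top (Pt.lin g⁻¹) * Om bul j * Cv.const L (j (Pt.lin g))).ofConv p =
      j (toConv (g.hom.toLinearMap ∘ₗ (curly bul).flip p)) := by
  rw [Cv.mul_const_apply, Cv.mul_apply (ℛ K p), Finset.sum_mul]
  simp only [Cv.top_apply, Om_apply, ← Algebra.smul_def, ← map_smul, ← map_mul, ← map_sum]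
  congr 1
  refine Cv.ext fun b => ?_
  have e : curly bul b p = ∑ i ∈ (ℛ K p).index, ∑ k ∈ (ℛ K b).index,
      bul ((ℛ K b).left k) ((ℛ K p).right i) •
        ((ℛ K b).right k * HopfAlgebra.antipode K ((ℛ K p).left i)) := by
    simp only [curly, TensorProduct.curry_apply, LinearMap.comp_apply, TensorProduct.map_tmul,
      LinearEquiv.coe_coe]
    conv_lhs => rw [← (ℛ K b).eq, ← (ℛ K p).eq]
    simp [TensorProduct.sum_tmul, TensorProduct.tmul_sum]
  simp only [ofConv_sum, LinearMap.sum_apply, LinearMap.comp_apply, LinearMap.flip_apply, e,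
    smul_mul_assoc, ofConv_smul, LinearMap.smul_apply, AlgHom.toLinearMap_apply, map_sum, map_smul,
    map_mul]
  refine Finset.sum_congr rfl fun i _ => ?_
  rw [Cv.mul_apply (ℛ K b), Finset.smul_sum]
  refine Finset.sum_congr rfl fun k _ => ?_
  simp only [lam_apply, Pt.lin_apply, Pt.inv_hom, Algebra.smul_def, Algebra.algebraMap_self_apply]
  rw [hb.symm]
  ring

end Universal

section Triple

variable {K B L T : Type*} [CommRing K] [CommRing B] [HopfAlgebra K B]
variable [CommRing L] [Algebra K L] [Ring T] [Algebra K T] [Algebra L T] [IsScalarTower K L T]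

theorem IsCosymmetric.antipode {t : B} (ht : IsCosymmetric K t) :
    IsCosymmetric K (HopfAlgebra.antipode K t) := by
  let i₁ : Pt K B (B ⊗[K] B) := toConv Algebra.TensorProduct.includeLeft
  let i₂ : Pt K B (B ⊗[K] B) := toConv Algebra.TensorProduct.includeRight
  have h₁ : ∀ b, (Pt.lin i₁ * Pt.lin i₂).ofConv b = Coalgebra.comul (R := K) b := by
    intro b
    rw [Cv.mul_apply (ℛ K b), ← (ℛ K b).eq]
    refine Finset.sum_congr rfl fun i _ => ?_
    change (_ ⊗ₜ[K] (1 : B)) * ((1 : B) ⊗ₜ[K] _) = _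
    simp
  have h₂ : ∀ b, (Pt.lin i₂ * Pt.lin i₁).ofConv b =
      TensorProduct.comm K B B (Coalgebra.comul (R := K) b) := by
    intro b
    rw [Cv.mul_apply (ℛ K b), ← (ℛ K b).eq, map_sum]
    refine Finset.sum_congr rfl fun i _ => ?_
    change ((1 : B) ⊗ₜ[K] _) * (_ ⊗ₜ[K] (1 : B)) = _
    simp
  rw [IsCosymmetric, ← h₂, ← h₁, conv_antipode, conv_antipode]
  exact ht.conv_comm _ _ fun _ _ => mul_comm _ _

theorem IsCosymmetric.add {t u : B} (ht : IsCosymmetric K t) (hu : IsCosymmetric K u) :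
    IsCosymmetric K (t + u) := by
  rw [IsCosymmetric, map_add, map_add, ht, hu]

theorem Om_mul_const (bul : B →ₗ[K] B →ₗ[K] K) (j : Cv K B L →ₐ[L] T) {x : T}
    (h : ∀ f, j f * x = x * j f) : Om bul j * Cv.const L x = Cv.const L x * Om bul j := by
  refine Cv.ext fun b => ?_
  rw [Cv.mul_const_apply, Cv.const_mul_apply, Om_apply, h]

theorem top_mul_Om' {bul : B →ₗ[K] B →ₗ[K] K} (hb : IsBalanced bul)
    (j : Cv K B L →ₐ[L] T) (v : Pt K B L) :
    Cv.top (Pt.lin v) * Om bul j =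
      Cv.const L (j (Pt.lin v⁻¹)) * Om bul j * Cv.const L (j (Pt.lin v)) * Cv.top (Pt.lin v) := by
  have e : Cv.top (Pt.lin v⁻¹) * Cv.top (Pt.lin v) = (1 : Cv K B T) := by
    rw [← map_mul, Pt.lin_inv_mul, map_one]
  rw [← Om_conj hb, mul_assoc _ (Cv.top (Pt.lin v⁻¹)), e, mul_one]

theorem conv_conj {bul : B →ₗ[K] B →ₗ[K] K} (hb : IsBalanced bul) {p : B} (hp : IsCosymmetric K p)
    (j₁ j₂ j₃ : Cv K B L →ₐ[L] T) (h₁₂ : ∀ f g, j₁ f * j₂ g = j₂ g * j₁ f)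
    (h₁₃ : ∀ f g, j₁ f * j₃ g = j₃ g * j₁ f) (h₂₃ : ∀ f g, j₂ f * j₃ g = j₃ g * j₂ f)
    (u v g h k : Pt K B L) :
    (Cv.top (Pt.lin (h * u⁻¹ * g)) *
      ((Cv.top (Pt.lin g⁻¹) * Om bul j₁ * Cv.const L (j₁ (Pt.lin g))) *
      (Cv.top (Pt.lin v) *
      ((Cv.top (Pt.lin k⁻¹) * Om bul j₂ * Cv.const L (j₂ (Pt.lin k))) *
      (Cv.top (Pt.lin (k * v⁻¹ * u)) *
      (Cv.top (Pt.lin h⁻¹) * Om bul j₃ * Cv.const L (j₃ (Pt.lin h))))))) : Cv K B T).ofConv p =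
    j₁ (Pt.lin u) * j₂ (Pt.lin (k * v⁻¹ * u)) * j₃ (Pt.lin h) *
      (Om bul j₁ * Om bul j₂ * Om bul j₃ : Cv K B T).ofConv p *
      (j₁ (Pt.lin u⁻¹) * j₂ (Pt.lin (u⁻¹ * v)) * j₁ (Pt.lin g)) := by
  set P : Pt K B L →* Cv K B T := (Cv.top : Cv K B L →ₐ[L] Cv K B T).toMonoidHom.comp Pt.lin with hP
  have eP : ∀ x, Cv.top (Pt.lin x) = P x := fun _ => rfl
  set C : T →ₐ[L] Cv K B T := Cv.const L with hC
  set Ω₁ := Om bul j₁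
  set Ω₂ := Om bul j₂
  set Ω₃ := Om bul j₃
  have cP : ∀ x s, P x * C s = C s * P x := fun x s => Cv.top_mul_const _ _
  have cP' : ∀ x s X, P x * (C s * X) = C s * (P x * X) := fun x s X => by
    rw [← mul_assoc, cP, mul_assoc]
  have pm : ∀ x y, P x * P y = P (x * y) := fun x y => (map_mul P x y).symm
  have pm' : ∀ x y X, P x * (P y * X) = P (x * y) * X := fun x y X => by rw [← mul_assoc, pm]
  have o₁ : ∀ x X, P x * (Ω₁ * X) =
      C (j₁ (Pt.lin x⁻¹)) * (Ω₁ * (C (j₁ (Pt.lin x)) * (P x * X))) := fun x X => by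
    rw [← mul_assoc, ← eP, top_mul_Om' hb]; simp only [mul_assoc]; rfl
  have o₂ : ∀ x X, P x * (Ω₂ * X) =
      C (j₂ (Pt.lin x⁻¹)) * (Ω₂ * (C (j₂ (Pt.lin x)) * (P x * X))) := fun x X => by
    rw [← mul_assoc, ← eP, top_mul_Om' hb]; simp only [mul_assoc]; rfl
  have o₃ : ∀ x X, P x * (Ω₃ * X) =
      C (j₃ (Pt.lin x⁻¹)) * (Ω₃ * (C (j₃ (Pt.lin x)) * (P x * X))) := fun x X => by
    rw [← mul_assoc, ← eP, top_mul_Om' hb]; simp only [mul_assoc]; rfl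
  have q₁₂ : ∀ f X, C (j₁ f) * (Ω₂ * X) = Ω₂ * (C (j₁ f) * X) := fun f X => by
    rw [← mul_assoc, ← Om_mul_const bul j₂ fun g => (h₁₂ f g).symm, mul_assoc]
  have q₁₃ : ∀ f X, C (j₁ f) * (Ω₃ * X) = Ω₃ * (C (j₁ f) * X) := fun f X => by
    rw [← mul_assoc, ← Om_mul_const bul j₃ fun g => (h₁₃ f g).symm, mul_assoc]
  have q₂₁ : ∀ f X, Ω₁ * (C (j₂ f) * X) = C (j₂ f) * (Ω₁ * X) := fun f X => by
    rw [← mul_assoc, Om_mul_const bul j₁ fun g => (h₁₂ g f), mul_assoc]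
  have q₂₃ : ∀ f X, C (j₂ f) * (Ω₃ * X) = Ω₃ * (C (j₂ f) * X) := fun f X => by
    rw [← mul_assoc, ← Om_mul_const bul j₃ fun g => (h₂₃ f g).symm, mul_assoc]
  have q₃₁ : ∀ f X, Ω₁ * (C (j₃ f) * X) = C (j₃ f) * (Ω₁ * X) := fun f X => by
    rw [← mul_assoc, Om_mul_const bul j₁ fun g => (h₁₃ g f), mul_assoc]
  have q₃₂ : ∀ f X, Ω₂ * (C (j₃ f) * X) = C (j₃ f) * (Ω₂ * X) := fun f X => by
    rw [← mul_assoc, Om_mul_const bul j₂ fun g => (h₂₃ g f), mul_assoc]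
  have c₁₂ : ∀ f g X, C (j₁ f) * (C (j₂ g) * X) = C (j₂ g) * (C (j₁ f) * X) := fun f g X => by
    rw [← mul_assoc, ← map_mul, h₁₂, map_mul, mul_assoc]
  have c₁₃ : ∀ f g X, C (j₁ f) * (C (j₃ g) * X) = C (j₃ g) * (C (j₁ f) * X) := fun f g X => by
    rw [← mul_assoc, ← map_mul, h₁₃, map_mul, mul_assoc]
  have c₂₃ : ∀ f g X, C (j₂ f) * (C (j₃ g) * X) = C (j₃ g) * (C (j₂ f) * X) := fun f g X => by
    rw [← mul_assoc, ← map_mul, h₂₃, map_mul, mul_assoc]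
  have m₁ : ∀ x y X, C (j₁ (Pt.lin x)) * (C (j₁ (Pt.lin y)) * X) = C (j₁ (Pt.lin (x * y))) * X :=
    fun x y X => by rw [← mul_assoc, ← map_mul, ← map_mul, ← map_mul]
  have m₂ : ∀ x y X, C (j₂ (Pt.lin x)) * (C (j₂ (Pt.lin y)) * X) = C (j₂ (Pt.lin (x * y))) * X :=
    fun x y X => by rw [← mul_assoc, ← map_mul, ← map_mul, ← map_mul]
  have m₃ : ∀ x y X, C (j₃ (Pt.lin x)) * (C (j₃ (Pt.lin y)) * X) = C (j₃ (Pt.lin (x * y))) * X :=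
    fun x y X => by rw [← mul_assoc, ← map_mul, ← map_mul, ← map_mul]
  rw [← Cv.const_mul_apply (L := L), ← Cv.mul_const_apply (L := L)]
  have hc : ∀ X, (P h * X).ofConv p = (X * P h).ofConv p := fun X =>
    hp.conv_comm _ _ fun b c => Algebra.commutes _ _
  have e₀ : h * u⁻¹ * g = h * (u⁻¹ * g) := mul_assoc _ _ _
  simp only [eP]
  rw [e₀, ← pm]
  simp only [mul_assoc]
  rw [hc]
  congr 1
  rw [← hC, ← mul_one (_ * P h), ← mul_one (_ * C (_ * _))]
  generalize (1 : Cv K B T) = X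
  simp only [mul_assoc, map_mul C, pm', o₁, o₂, o₃, cP']
  simp only [m₁, m₂, m₃, mul_inv_rev, inv_inv, mul_assoc, inv_mul_cancel_left, mul_inv_cancel_left,
    mul_inv_cancel, inv_mul_cancel, mul_one, map_one, one_mul]
  simp only [q₁₂, q₁₃, q₂₁, q₂₃, q₃₁, q₃₂, c₁₂, c₁₃, c₂₃, m₁]

theorem algebraMap_mul_mul_mul {T : Type*} [Ring T] [Algebra L T] (x y z : L) (a b c : T) :
    algebraMap L T x * (a * (algebraMap L T y * (b * (algebraMap L T z * c)))) =
      x • y • z • (a * b * c) := by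
  rw [← Algebra.smul_def, ← Algebra.smul_def, ← Algebra.smul_def, Algebra.mul_smul_comm,
    Algebra.mul_smul_comm, Algebra.mul_smul_comm, mul_assoc]

theorem sum_conj {bul : B →ₗ[K] B →ₗ[K] K} (hb : IsBalanced bul) {p : B} (hp : IsCosymmetric K p)
    (π : Sweedler₆ (K := K) p)
    (j₁ j₂ j₃ : Cv K B L →ₐ[L] T) (h₁₂ : ∀ f g, j₁ f * j₂ g = j₂ g * j₁ f)
    (h₁₃ : ∀ f g, j₁ f * j₃ g = j₃ g * j₁ f) (h₂₃ : ∀ f g, j₂ f * j₃ g = j₃ g * j₂ f)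
    (u v g h k : Pt K B L) :
    ∑ i, (h * u⁻¹ * g).hom (π.el i 0) • v.hom (π.el i 2) • (k * v⁻¹ * u).hom (π.el i 4) •
      (j₁ (toConv (g.hom.toLinearMap ∘ₗ (curly bul).flip (π.el i 1))) *
        j₂ (toConv (k.hom.toLinearMap ∘ₗ (curly bul).flip (π.el i 3))) *
        j₃ (toConv (h.hom.toLinearMap ∘ₗ (curly bul).flip (π.el i 5)))) =
    j₁ (Pt.lin u) * j₂ (Pt.lin (k * v⁻¹ * u)) * j₃ (Pt.lin h) *
      (Om bul j₁ * Om bul j₂ * Om bul j₃ : Cv K B T).ofConv p *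
      (j₁ (Pt.lin u⁻¹) * j₂ (Pt.lin (u⁻¹ * v)) * j₁ (Pt.lin g)) := by
  rw [← conv_conj hb hp j₁ j₂ j₃ h₁₂ h₁₃ h₂₃, π.conv_apply]
  refine Finset.sum_congr rfl fun i _ => ?_
  rw [top_inv_mul_Om_apply hb, top_inv_mul_Om_apply hb, top_inv_mul_Om_apply hb]
  exact (algebraMap_mul_mul_mul _ _ _ _ _ _).symm

theorem conv_eval (bul : B →ₗ[K] B →ₗ[K] K) (j₁ j₂ j₃ : Cv K B L →ₐ[L] T) (ev : T →+ L)
    {f₁ f₂ f₃ : Cv K B L} (h : ∀ x y z, ev (j₁ (lam L bul x) * j₂ (lam L bul y) *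
      j₃ (lam L bul z)) = f₁.ofConv x * f₂.ofConv y * f₃.ofConv z) (p : B) :
    ev ((Om bul j₁ * Om bul j₂ * Om bul j₃).ofConv p) = (f₁ * f₂ * f₃).ofConv p := by
  rw [Cv.mul_apply (ℛ K p), Cv.mul_apply (ℛ K p), map_sum]
  refine Finset.sum_congr rfl fun i _ => ?_
  rw [Cv.mul_apply (ℛ K _), Cv.mul_apply (ℛ K _), Finset.sum_mul, Finset.sum_mul, map_sum]
  exact Finset.sum_congr rfl fun k _ => h _ _ _

theorem slot_conj {bul : B →ₗ[K] B →ₗ[K] K} (hb : IsBalanced bul)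
    (i₁ i₃ : Cv K B L →ₐ[L] T) (h₁₃ : ∀ f g, i₁ f * i₃ g = i₃ g * i₁ f) (ω : T)
    (u v g h k : Pt K B L) :
    Cv.const L (i₁ (Pt.lin u)) * Cv.top (Pt.lin (k * v⁻¹ * u)) * Cv.const L (i₃ (Pt.lin h)) *
      (Om bul i₁ * Cv.const L ω - Cv.const L ω * Om bul i₁) *
      (Cv.const L (i₁ (Pt.lin u⁻¹)) * Cv.top (Pt.lin (u⁻¹ * v)) * Cv.const L (i₁ (Pt.lin g))) =
    Cv.const L (i₃ (Pt.lin h)) * (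
      (Cv.top (Pt.lin k) * (Cv.const L (i₁ (Pt.lin v)) * Om bul i₁ *
        Cv.const L (i₁ (Pt.lin v⁻¹)))) *
      Cv.const L (i₁ (Pt.lin u) * ω * i₁ (Pt.lin u⁻¹)) -
      Cv.const L (i₁ (Pt.lin u) * ω * i₁ (Pt.lin u⁻¹)) *
      (Cv.top (Pt.lin k) * (Cv.const L (i₁ (Pt.lin v)) * Om bul i₁ *
        Cv.const L (i₁ (Pt.lin v⁻¹))))) * Cv.const L (i₁ (Pt.lin g)) := by
  set P : Pt K B L →* Cv K B T := (Cv.top : Cv K B L →ₐ[L] Cv K B T).toMonoidHom.comp Pt.lin with hP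
  have eP : ∀ x, Cv.top (Pt.lin x) = P x := fun _ => rfl
  set C : T →ₐ[L] Cv K B T := Cv.const L with hC
  set Ω := Om bul i₁
  have cP' : ∀ x s X, P x * (C s * X) = C s * (P x * X) := fun x s X => by
    rw [← mul_assoc, show P x * C s = C s * P x from Cv.top_mul_const _ _, mul_assoc]
  have pm' : ∀ x y X, P x * (P y * X) = P (x * y) * X := fun x y X => by rw [← mul_assoc, map_mul]
  have o : ∀ x X, P x * (Ω * X) =
      C (i₁ (Pt.lin x⁻¹)) * (Ω * (C (i₁ (Pt.lin x)) * (P x * X))) := fun x X => by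
    rw [← mul_assoc, ← eP, top_mul_Om' hb]; simp only [mul_assoc]; rfl
  have q : ∀ f X, Ω * (C (i₃ f) * X) = C (i₃ f) * (Ω * X) := fun f X => by
    rw [← mul_assoc, Om_mul_const bul i₁ fun g => (h₁₃ g f), mul_assoc]
  have c : ∀ f g X, C (i₁ f) * (C (i₃ g) * X) = C (i₃ g) * (C (i₁ f) * X) := fun f g X => by
    rw [← mul_assoc, ← map_mul, h₁₃, map_mul, mul_assoc]
  have m : ∀ x y X, C (i₁ (Pt.lin x)) * (C (i₁ (Pt.lin y)) * X) = C (i₁ (Pt.lin (x * y))) * X :=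
    fun x y X => by rw [← mul_assoc, ← map_mul, ← map_mul, ← map_mul]
  simp only [eP, mul_sub, sub_mul]
  congr 1
  all_goals
    rw [← mul_one (_ * C (i₁ (Pt.lin g)))]
    conv_rhs => rw [← mul_one (_ * C (i₁ (Pt.lin g)))]
    generalize (1 : Cv K B T) = X
    simp only [mul_assoc, map_mul C, pm', o, cP']
    simp only [m, mul_inv_rev, inv_inv, mul_assoc, inv_mul_cancel_left, mul_inv_cancel_left,
      mul_inv_cancel, inv_mul_cancel, mul_one, map_one, one_mul]
    simp only [q, c, m, mul_inv_cancel_left]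

/-- The slots of the triple convolution algebra; the outermost is `Cv.top`. -/
def slotIn : Cv K B L →ₐ[L] Cv K B (Cv K B (Cv K B L)) := (Cv.const L).comp (Cv.const L)

/-- The inclusion of the middle slot. -/
def slotMid : Cv K B L →ₐ[L] Cv K B (Cv K B (Cv K B L)) := (Cv.const L).comp Cv.top

/-- Evaluation of the three slots. -/
def slotEval (b c d : B) : Cv K B (Cv K B (Cv K B L)) →+ L where
  toFun f := ((f.ofConv d).ofConv c).ofConv b
  map_zero' := rfl
  map_add' _ _ := rfl

theorem slotEval_smul (b c d : B) (l : L) (f : Cv K B (Cv K B (Cv K B L))) :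
    slotEval b c d (l • f) = l * slotEval b c d f := rfl

theorem slot_apply (e f g : Cv K B L) (b c d : B) :
    (((slotIn e * Cv.top f * slotMid g : Cv K B (Cv K B (Cv K B L))).ofConv d).ofConv c).ofConv b =
      e.ofConv b * f.ofConv d * g.ofConv c := by
  change (((Cv.const L (Cv.const L e) * Cv.top f * Cv.const L (Cv.top g) :
    Cv K B (Cv K B (Cv K B L))).ofConv d).ofConv c).ofConv b = _
  rw [Cv.mul_const_apply, Cv.const_mul_apply, Cv.top_apply, mul_assoc, Cv.const_mul_apply,
    ← Algebra.smul_def, ofConv_smul, LinearMap.smul_apply, Cv.top_apply, Algebra.mul_smul_comm,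
    ← Algebra.commutes, ← Algebra.smul_def, ofConv_smul, ofConv_smul, LinearMap.smul_apply,
    LinearMap.smul_apply, smul_eq_mul, smul_eq_mul]
  ring

variable {t : B} (ht : IsTraceLike K t)

theorem Om_mul_Om_mul_Om :
    (Om (L := L) (traceForm ht) slotIn * Om (L := L) (traceForm ht) Cv.top *
      Om (L := L) (traceForm ht) slotMid : Cv K B (Cv K B (Cv K B (Cv K B L)))).ofConv (t + HopfAlgebra.antipode K t) =
    Om (L := L) (T := Cv K B (Cv K B L)) (traceForm ht) (Cv.const L) *
      Cv.const L (Om (traceForm ht) (AlgHom.id L (Cv K B L))) -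
      Cv.const L (Om (traceForm ht) (AlgHom.id L (Cv K B L))) *
        Om (L := L) (T := Cv K B (Cv K B L)) (traceForm ht) (Cv.const L) := by
  refine Cv.ext fun d => Cv.ext fun c => Cv.ext fun b => ?_
  have e₁ : (((Om (L := L) (T := Cv K B (Cv K B L)) (traceForm ht) (Cv.const L) *
      Cv.const L (Om (traceForm ht) (AlgHom.id L (Cv K B L)))).ofConv d).ofConv c).ofConv b =
      (lam L (traceForm ht) d * lam L (traceForm ht) c).ofConv b := by
    rw [Cv.mul_const_apply, Om_apply, Cv.const_mul_apply, Om_apply, AlgHom.id_apply]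
  have e₂ : (((Cv.const L (Om (traceForm ht) (AlgHom.id L (Cv K B L))) *
      Om (L := L) (T := Cv K B (Cv K B L)) (traceForm ht) (Cv.const L)).ofConv d).ofConv c).ofConv b
      = (lam L (traceForm ht) c * lam L (traceForm ht) d).ofConv b := by
    rw [Cv.const_mul_apply, Om_apply, Cv.mul_const_apply, Om_apply, AlgHom.id_apply]
  refine Eq.trans ?_ ((lam_mul_lam_mul_lam ht b c d).trans (congrArg₂ (· - ·) e₁ e₂).symm)
  change slotEval b c d ((Om (L := L) (traceForm ht) slotIn * Om (L := L) (traceForm ht) Cv.top *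
      Om (L := L) (traceForm ht) slotMid : Cv K B (Cv K B (Cv K B (Cv K B L)))).ofConv _) = _
  refine conv_eval (traceForm ht) slotIn Cv.top slotMid (slotEval b c d) (fun x y z => ?_) _
  refine (slot_apply _ _ _ b c d).trans ?_
  simp only [lam_apply, traceForm_symm ht]

theorem tri_uni_fox (u v g h k : Pt K B L) (b c d : B)
    (π : Sweedler₆ (K := K) (t + HopfAlgebra.antipode K t)) :
    tri ((fox (traceForm ht) v u k).ofConv d) (Pt.lin g) (Pt.lin h) (uni (traceForm ht) b c) =
      ∑ i, (h * u⁻¹ * g).hom (π.el i 0) * (g.hom (curly (traceForm ht) b (π.el i 1)) *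
        (v.hom (π.el i 2) * (k.hom (curly (traceForm ht) d (π.el i 3)) *
        ((k * v⁻¹ * u).hom (π.el i 4) * h.hom (curly (traceForm ht) c (π.el i 5)))))) := by
  have hb := isBalanced_traceForm ht
  set A : Cv K B L := ((Cv.top (Pt.lin k) * (Cv.const L (Pt.lin v) *
    Om (traceForm ht) (AlgHom.id L _) * Cv.const L (Pt.lin v⁻¹)) :
    Cv K B (Cv K B L))).ofConv d with hA
  have eA : (fox (traceForm ht) v u k).ofConv d = A * Pt.lin u := by
    rw [hA, ← Cv.mul_const_apply (L := L), fox, foxLin, map_mul]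
    simp only [mul_assoc]
  have dA : IsPtDer 1 1 A := by
    rw [hA, Cv.mul_apply (ℛ K d)]
    simp only [Cv.top_apply, ← Algebra.smul_def, Cv.mul_const_apply, Cv.const_mul_apply, Om_apply]
    exact IsPtDer.sum _ _ fun i => (lam_isPtDer ht _).conj v
  have eA' : (Cv.top (Pt.lin k) * (Cv.const L (Cv.const L (Pt.lin v)) *
      Om (L := L) (T := Cv K B (Cv K B L)) (traceForm ht) (Cv.const L) *
        Cv.const L (Cv.const L (Pt.lin v⁻¹))) : Cv K B (Cv K B (Cv K B L))).ofConv d =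
      Cv.const L A := by
    rw [hA, Cv.mul_apply (ℛ K d), Cv.mul_apply (ℛ K d), map_sum]
    refine Finset.sum_congr rfl fun i _ => ?_
    rw [Cv.mul_const_apply, Cv.const_mul_apply, Cv.mul_const_apply, Cv.const_mul_apply,
      Om_apply, Om_apply, AlgHom.id_apply, map_mul, map_mul, map_mul, Cv.top_apply, Cv.top_apply,
      AlgHom.commutes]
  rw [eA, tri_uni_der _ dA]
  have c₁ := sum_conj hb (ht.cosymmetric.add ht.cosymmetric.antipode) π (T := Cv K B (Cv K B (Cv K B L)))
    slotIn Cv.top slotMid (fun f g => (Cv.top_mul_const _ _).symm)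
    (fun f g => by
      change Cv.const L (Cv.const L f) * Cv.const L (Cv.top g) = Cv.const L (Cv.top g) *
        Cv.const L (Cv.const L f)
      rw [← map_mul, ← map_mul, Cv.top_mul_const])
    (fun f g => Cv.top_mul_const _ _) u v g h k
  have c₂ := slot_conj hb (T := Cv K B (Cv K B L)) (Cv.const L) Cv.top
    (fun f g => (Cv.top_mul_const _ _).symm) (Om (traceForm ht) (AlgHom.id L _)) u v g h k
  rw [Om_mul_Om_mul_Om] at c₁
  have e := congrArg (slotEval b c d) (c₁.trans c₂)
  refine Eq.trans ?_ (e.symm.trans ?_)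
  · change _ = (((Cv.const L _ * _ * Cv.const L _ :
      Cv K B (Cv K B (Cv K B L))).ofConv d).ofConv c).ofConv b
    conv_rhs => rw [Cv.mul_const_apply, Cv.const_mul_apply, ofConv_sub, LinearMap.sub_apply,
      Cv.mul_const_apply, Cv.const_mul_apply, eA', Cv.mul_const_apply, eA']
    rw [Cv.mul_const_apply]
  · rw [map_sum]
    refine Finset.sum_congr rfl fun i _ => ?_
    rw [slotEval_smul, slotEval_smul, slotEval_smul]
    refine (congrArg (fun z => _ * (_ * (_ * z))) (slot_apply _ _ _ b c d)).trans ?_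
    change (h * u⁻¹ * g).hom _ * (v.hom _ * ((k * v⁻¹ * u).hom _ *
      (g.hom (curly (traceForm ht) b _) * k.hom (curly (traceForm ht) d _) *
      h.hom (curly (traceForm ht) c _)))) = _
    ring

end Triple

/-! ### Signs -/

section Sign

variable (K : Type*) [CommRing K]

/-- The sign `(-1) ^ i`. -/
def sgn (i : ZMod 2) : K := if i = 0 then 1 else -1

theorem ZMod.two_cases (i : ZMod 2) : i = 0 ∨ i = 1 := by
  revert i
  decide

@[simp] theorem sgn_zero : sgn K 0 = 1 := rfl

@[simp] theorem sgn_one : sgn K 1 = -1 := rfl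

theorem sgn_add (i j : ZMod 2) : sgn K (i + j) = sgn K i * sgn K j := by
  rcases ZMod.two_cases i with rfl | rfl <;> rcases ZMod.two_cases j with rfl | rfl <;>
    simp [sgn, show (1 : ZMod 2) + 1 = 0 from rfl]

@[simp] theorem sgn_mul_self (i : ZMod 2) : sgn K i * sgn K i = 1 := by
  rcases ZMod.two_cases i with rfl | rfl <;> simp [sgn]

theorem negOnePow_smul {M : Type*} [AddCommGroup M] [Module K M] (e : ℤ) (x : M) :
    e.negOnePow • x = sgn K (e : ZMod 2) • x := by
  rcases Int.even_or_odd e with h | h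
  · rw [Int.negOnePow_even e h, (ZMod.intCast_eq_zero_iff_even).2 h]
    simp
  · rw [Int.negOnePow_odd e h, (ZMod.intCast_eq_one_iff_odd).2 h]
    simp [Units.smul_def]

end Sign

/-! ### Coalgebras with parity -/

section Parity

variable {K C M N : Type*} [CommRing K] [AddCommGroup C] [Module K C] [AddCommGroup M] [Module K M]
variable [AddCommGroup N] [Module K N]
variable [Coalgebra K C] [Coalgebra K M]

variable (K C) in
/-- A `ℤ/2`-grading of a coalgebra, given by the projection to the odd part. -/
structure Parity where
  odd : C →ₗ[K] C
  even : C →ₗ[K] C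
  even_add_odd : ∀ c, even c + odd c = c
  odd_odd : ∀ c, odd (odd c) = odd c
  counit_odd : ∀ c, counit (R := K) (odd c) = 0
  comul_odd : ∀ c, comul (R := K) (odd c) =
    TensorProduct.map odd even (comul c) + TensorProduct.map even odd (comul c)

namespace Parity

variable (α : Parity K C) (β : Parity K M)

/-- Elements of parity `i`. -/
def IsHom (i : ZMod 2) (c : C) : Prop := α.odd c = if i = 0 then 0 else c

theorem even_apply (c : C) : α.even c = c - α.odd c := eq_sub_of_add_eq (α.even_add_odd c)

theorem even_even (c : C) : α.even (α.even c) = α.even c := by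
  simp [even_apply, α.odd_odd]

theorem odd_even (c : C) : α.odd (α.even c) = 0 := by
  simp [even_apply, α.odd_odd]

theorem even_odd (c : C) : α.even (α.odd c) = 0 := by
  simp [even_apply, α.odd_odd]

theorem isHom_even (c : C) : α.IsHom 0 (α.even c) := α.odd_even c

theorem isHom_odd (c : C) : α.IsHom 1 (α.odd c) := α.odd_odd c

theorem counit_even (c : C) : counit (R := K) (α.even c) = counit (R := K) c := by
  simp [even_apply, α.counit_odd]

theorem comul_even (c : C) : comul (R := K) (α.even c) =
    TensorProduct.map α.even α.even (comul c) + TensorProduct.map α.odd α.odd (comul c) := by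
  have h : ∀ t : C ⊗[K] C, t - (TensorProduct.map α.odd α.even t + TensorProduct.map α.even α.odd t)
      = TensorProduct.map α.even α.even t + TensorProduct.map α.odd α.odd t := by
    intro t
    induction t with
    | zero => simp
    | add s t hs ht =>
      simp only [map_add]
      rw [add_add_add_comm _ _ (TensorProduct.map α.odd α.odd s), ← hs, ← ht]
      abel
    | tmul c d =>
      conv_lhs => rw [← α.even_add_odd c, ← α.even_add_odd d]
      simp only [TensorProduct.map_tmul, map_add, TensorProduct.add_tmul, TensorProduct.tmul_add,
        α.odd_odd, even_even, even_odd, odd_even, TensorProduct.zero_tmul, TensorProduct.tmul_zero]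
      abel
  rw [even_apply, map_sub, α.comul_odd, h]

/-- The automorphism `c ↦ (-1) ^ (q |c|) c`. -/
def tw (q : ZMod 2) : C →ₗ[K] C := α.even + sgn K q • α.odd

theorem tw_apply (q : ZMod 2) (c : C) : α.tw q c = α.even c + sgn K q • α.odd c := rfl

@[simp] theorem tw_zero : α.tw 0 = LinearMap.id :=
  LinearMap.ext fun c => by simp [tw_apply, α.even_add_odd]

variable {α β}

theorem IsHom.odd {i : ZMod 2} {c : C} (h : α.IsHom i c) :
    α.odd c = if i = 0 then 0 else c := h

theorem IsHom.even {i : ZMod 2} {c : C} (h : α.IsHom i c) :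
    α.even c = if i = 0 then c else 0 := by
  rw [even_apply, h.odd]
  split_ifs <;> simp

theorem IsHom.tw {i : ZMod 2} {c : C} (h : α.IsHom i c) (q : ZMod 2) :
    α.tw q c = sgn K (q * i) • c := by
  rw [tw_apply, h.even, h.odd]
  rcases ZMod.two_cases i with rfl | rfl <;> simp

theorem IsHom.counit {c : C} (h : α.IsHom 1 c) : counit (R := K) c = 0 := by
  rw [← show α.odd c = c from h, α.counit_odd]

variable (α β)

theorem hom_induction {p : C → Prop} (hom : ∀ i c, α.IsHom i c → p c)
    (add : ∀ c d, p c → p d → p (c + d)) (c : C) : p c := by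
  rw [← α.even_add_odd c]
  exact add _ _ (hom _ _ (α.isHom_even c)) (hom _ _ (α.isHom_odd c))

theorem tw_tw (q r : ZMod 2) (c : C) : α.tw q (α.tw r c) = α.tw (q + r) c := by
  refine α.hom_induction (p := fun c => α.tw q (α.tw r c) = α.tw (q + r) c) (fun i c h => ?_)
    (fun c d hc hd => by simp only [map_add, hc, hd]) c
  rw [h.tw, map_smul, h.tw, h.tw, smul_smul, ← sgn_add]
  congr 2
  ring

theorem counit_tw (q : ZMod 2) (c : C) : counit (R := K) (α.tw q c) = counit (R := K) c := by
  simp [tw_apply, counit_even, α.counit_odd]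

theorem comul_tw (q : ZMod 2) (c : C) : comul (R := K) (α.tw q c) =
    TensorProduct.map (α.tw q) (α.tw q) (comul c) := by
  rw [tw_apply, map_add, map_smul, α.comul_odd, α.comul_even]
  generalize comul (R := K) c = t
  induction t with
  | zero => simp
  | add s t hs ht =>
    simp only [map_add, smul_add] at hs ht ⊢
    rw [← hs, ← ht]
    abel
  | tmul c d =>
    simp only [TensorProduct.map_tmul, tw_apply, TensorProduct.add_tmul, TensorProduct.tmul_add,
      ← TensorProduct.smul_tmul', TensorProduct.tmul_smul, smul_smul, sgn_mul_self, one_smul,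
      smul_add]
    abel

/-- The signed flip. -/
def sflip : C ⊗[K] C →ₗ[K] C ⊗[K] C :=
  (TensorProduct.comm K C C).toLinearMap ∘ₗ
    (TensorProduct.map LinearMap.id α.even + TensorProduct.map (α.tw 1) α.odd)

theorem sflip_tmul {i j : ZMod 2} {c d : C} (hc : α.IsHom i c) (hd : α.IsHom j d) :
    α.sflip (c ⊗ₜ d) = sgn K (i * j) • (d ⊗ₜ[K] c) := by
  simp only [sflip, LinearMap.comp_apply, LinearMap.add_apply, TensorProduct.map_tmul, hd.even,
    hd.odd, hc.tw]
  rcases ZMod.two_cases j with rfl | rfl <;> simp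

/-- Graded cocommutativity. -/
def Cocomm : Prop := ∀ c, α.sflip (comul c) = comul (R := K) c

theorem tmul_hom_induction {p : C ⊗[K] M → Prop}
    (hom : ∀ i j c d, α.IsHom i c → β.IsHom j d → p (c ⊗ₜ d))
    (add : ∀ c d, p c → p d → p (c + d)) (t : C ⊗[K] M) : p t := by
  have h0 : p 0 := by
    simpa using hom 0 0 0 0 (map_zero α.odd) (map_zero β.odd)
  induction t with
  | zero => exact h0
  | add s t hs ht => exact add _ _ hs ht
  | tmul c d =>
    refine α.hom_induction (p := fun c => p (c ⊗ₜ d)) (fun i c hc => ?_)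
      (fun c c' h h' => by rw [TensorProduct.add_tmul]; exact add _ _ h h') c
    exact β.hom_induction (p := fun d => p (c ⊗ₜ d)) (fun j d hd => hom i j c d hc hd)
      (fun c c' h h' => by rw [TensorProduct.tmul_add]; exact add _ _ h h') d

/-- The tensor product with the signed comultiplication. -/
def _root_.FoxRep.SProd (_α : Parity K C) (_β : Parity K M) : Type _ := C ⊗[K] M

instance : AddCommGroup (SProd α β) := inferInstanceAs (AddCommGroup (C ⊗[K] M))

instance : Module K (SProd α β) := inferInstanceAs (Module K (C ⊗[K] M))

/-- The identification with the tensor product. -/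
def sp : C ⊗[K] M ≃ₗ[K] SProd α β := LinearEquiv.refl K (C ⊗[K] M)

/-- The pure tensors of `SProd α β`. -/
def stmul : C →ₗ[K] M →ₗ[K] SProd α β := (TensorProduct.mk K C M).compr₂ (sp α β).toLinearMap

theorem sp_tmul (c : C) (m : M) : sp α β (c ⊗ₜ m) = stmul α β c m := rfl

theorem sp_symm_stmul (c : C) (m : M) : (sp α β).symm (stmul α β c m) = c ⊗ₜ m := rfl

theorem stmul_ext {f g : SProd α β →ₗ[K] N} (h : ∀ c m, f (stmul α β c m) = g (stmul α β c m)) :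
    f = g :=
  TensorProduct.ext' h

/-- The signed regrouping `(c ⊗ d) ⊗ (m ⊗ n) ↦ ± (c ⊗ m) ⊗ (d ⊗ n)`. -/
def regroup : (C ⊗[K] C) ⊗[K] (M ⊗[K] M) →ₗ[K] SProd α β ⊗[K] SProd α β :=
  TensorProduct.map (sp α β).toLinearMap (sp α β).toLinearMap ∘ₗ
  (TensorProduct.tensorTensorTensorComm K C C M M).toLinearMap ∘ₗ
    (TensorProduct.map (TensorProduct.map LinearMap.id α.even) LinearMap.id +
      TensorProduct.map (TensorProduct.map LinearMap.id α.odd)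
        (TensorProduct.map (β.tw 1) LinearMap.id))

theorem regroup_tmul {j : ZMod 2} (c : C) {d : C} (hd : α.IsHom j d) (m n : M) :
    regroup α β ((c ⊗ₜ d) ⊗ₜ (m ⊗ₜ n)) =
      stmul α β c (β.tw j m) ⊗ₜ[K] stmul α β d n := by
  simp only [regroup, LinearMap.comp_apply, LinearMap.add_apply, TensorProduct.map_tmul, hd.even,
    hd.odd, LinearMap.id_apply]
  rcases ZMod.two_cases j with rfl | rfl <;> simp [sp_tmul]

instance : CoalgebraStruct K (SProd α β) where
  comul := regroup α β ∘ₗ TensorProduct.map comul comul ∘ₗ (sp α β).symm.toLinearMap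
  counit := (TensorProduct.lid K K).toLinearMap ∘ₗ TensorProduct.map counit counit ∘ₗ
    (sp α β).symm.toLinearMap

theorem comul_stmul (c : C) (m : M) : comul (R := K) (stmul α β c m) =
    regroup α β (comul c ⊗ₜ comul m) := rfl

theorem counit_stmul (c : C) (m : M) : counit (R := K) (stmul α β c m) =
    counit (R := K) c * counit (R := K) m := rfl

theorem SProd.hom_induction {p : SProd α β → Prop}
    (hom : ∀ i j c d, α.IsHom i c → β.IsHom j d → p (stmul α β c d))
    (add : ∀ c d, p c → p d → p (c + d)) (t : SProd α β) : p t :=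
  tmul_hom_induction α β (p := p) hom add t

/-- Elements of `C ⊗ C` are spanned by products of homogeneous elements. -/
theorem regroup_comul_ext {N : Type*} [AddCommGroup N] [Module K N]
    {f g : (C ⊗[K] C) ⊗[K] (M ⊗[K] M) →ₗ[K] N}
    (h : ∀ i j k l c d m n, α.IsHom i c → α.IsHom j d → β.IsHom k m → β.IsHom l n →
      f ((c ⊗ₜ d) ⊗ₜ (m ⊗ₜ n)) = g ((c ⊗ₜ d) ⊗ₜ (m ⊗ₜ n))) : f = g := by
  refine TensorProduct.ext' fun u v => ?_
  refine tmul_hom_induction α α (p := fun u => f (u ⊗ₜ v) = g (u ⊗ₜ v)) (fun i j c d hc hd => ?_)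
    (fun c c' h h' => by simp only [TensorProduct.add_tmul, map_add, h, h']) u
  exact tmul_hom_induction β β (p := fun v => f ((c ⊗ₜ d) ⊗ₜ v) = g ((c ⊗ₜ d) ⊗ₜ v))
    (fun k l m n hm hn => h i j k l c d m n hc hd hm hn)
    (fun c c' h h' => by simp only [TensorProduct.tmul_add, map_add, h, h']) v

/-- The odd part of a tensor product. -/
def sodd : SProd α β →ₗ[K] SProd α β :=
  TensorProduct.map α.odd β.even + TensorProduct.map α.even β.odd

/-- The even part of a tensor product. -/
def seven : SProd α β →ₗ[K] SProd α β :=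
  TensorProduct.map α.even β.even + TensorProduct.map α.odd β.odd

theorem sodd_stmul (c : C) (m : M) : sodd α β (stmul α β c m) =
    stmul α β (α.odd c) (β.even m) + stmul α β (α.even c) (β.odd m) := rfl

theorem seven_stmul (c : C) (m : M) : seven α β (stmul α β c m) =
    stmul α β (α.even c) (β.even m) + stmul α β (α.odd c) (β.odd m) := rfl

/-- The projections of `C ⊗ C` to its even and odd part. -/
def grading₂ (q : ZMod 2) : C ⊗[K] C →ₗ[K] C ⊗[K] C :=
  if q = 0 then TensorProduct.map α.even α.even + TensorProduct.map α.odd α.odd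
  else TensorProduct.map α.odd α.even + TensorProduct.map α.even α.odd

theorem grading₂_tmul (q : ZMod 2) {i j : ZMod 2} {c d : C} (hc : α.IsHom i c) (hd : α.IsHom j d) :
    α.grading₂ q (c ⊗ₜ d) = if q = i + j then c ⊗ₜ[K] d else 0 := by
  rcases ZMod.two_cases q with rfl | rfl <;> rcases ZMod.two_cases i with rfl | rfl <;>
    rcases ZMod.two_cases j with rfl | rfl <;>
    simp [grading₂, hc.even, hc.odd, hd.even, hd.odd, show (1 : ZMod 2) + 1 = 0 from rfl]

theorem grading₂_zero_comul (c : C) : α.grading₂ 0 (comul c) = comul (R := K) (α.even c) := by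
  simp [grading₂, comul_even]

theorem grading₂_one_comul (c : C) : α.grading₂ 1 (comul c) = comul (R := K) (α.odd c) := by
  simp [grading₂, comul_odd]

theorem IsHom.comul {α : Parity K C} {i : ZMod 2} {c : C} (h : α.IsHom i c) (q : ZMod 2) :
    α.grading₂ q (comul (R := K) c) = if q = i then Coalgebra.comul (R := K) c else 0 := by
  rcases ZMod.two_cases q with rfl | rfl <;> rcases ZMod.two_cases i with rfl | rfl <;>
    simp [grading₂_zero_comul, grading₂_one_comul, h.even, h.odd]

/-- The signed regrouping of triple tensors. -/
def regroup₃ : (C ⊗[K] (C ⊗[K] C)) ⊗[K] (M ⊗[K] (M ⊗[K] M)) →ₗ[K]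
    SProd α β ⊗[K] (SProd α β ⊗[K] SProd α β) :=
  TensorProduct.map (sp α β).toLinearMap (regroup α β) ∘ₗ
  (TensorProduct.tensorTensorTensorComm K C (C ⊗[K] C) M (M ⊗[K] M)).toLinearMap ∘ₗ
    (TensorProduct.map (TensorProduct.map LinearMap.id (α.grading₂ 0)) LinearMap.id +
      TensorProduct.map (TensorProduct.map LinearMap.id (α.grading₂ 1))
        (TensorProduct.map (β.tw 1) LinearMap.id))

theorem regroup₃_tmul {j : ZMod 2} (c : C) {t : C ⊗[K] C}
    (ht : ∀ q, α.grading₂ q t = if q = j then t else 0) (m : M) (u : M ⊗[K] M) :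
    regroup₃ α β ((c ⊗ₜ t) ⊗ₜ (m ⊗ₜ u)) =
      stmul α β c (β.tw j m) ⊗ₜ[K] regroup α β (t ⊗ₜ u) := by
  simp only [regroup₃, LinearMap.comp_apply, LinearMap.add_apply, TensorProduct.map_tmul, ht,
    LinearMap.id_apply]
  rcases ZMod.two_cases j with rfl | rfl <;> simp [sp_tmul]

theorem lTensor_comul_regroup : comul.lTensor (SProd α β) ∘ₗ regroup α β =
    regroup₃ α β ∘ₗ TensorProduct.map (comul.lTensor C) (comul.lTensor M) := by
  refine regroup_comul_ext α β fun i j k l c d m n hc hd hm hn => ?_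
  rw [LinearMap.comp_apply, regroup_tmul α β c hd, LinearMap.lTensor_tmul, comul_stmul,
    LinearMap.comp_apply, TensorProduct.map_tmul, LinearMap.lTensor_tmul, LinearMap.lTensor_tmul,
    regroup₃_tmul α β c hd.comul]

theorem rTensor_comul_regroup : (TensorProduct.assoc K _ _ _).toLinearMap ∘ₗ
      comul.rTensor (SProd α β) ∘ₗ regroup α β =
    regroup₃ α β ∘ₗ TensorProduct.map
      ((TensorProduct.assoc K _ _ _).toLinearMap ∘ₗ comul.rTensor C)
      ((TensorProduct.assoc K _ _ _).toLinearMap ∘ₗ comul.rTensor M) := by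
  refine regroup_comul_ext α β fun i j k l c d m n hc hd hm hn => ?_
  simp only [LinearMap.comp_apply, regroup_tmul α β c hd, LinearMap.rTensor_tmul, comul_stmul,
    TensorProduct.map_tmul, comul_tw]
  generalize comul (R := K) c = u
  generalize comul (R := K) m = v
  refine tmul_hom_induction α α (p := fun u => (TensorProduct.assoc K _ _ _).toLinearMap
    (regroup α β (u ⊗ₜ TensorProduct.map (β.tw j) (β.tw j) v) ⊗ₜ stmul α β d n) =
    regroup₃ α β ((TensorProduct.assoc K _ _ _).toLinearMap (u ⊗ₜ d) ⊗ₜ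
      (TensorProduct.assoc K _ _ _).toLinearMap (v ⊗ₜ n))) (fun a b x y hx hy => ?_)
    (fun c c' h h' => by simp only [TensorProduct.add_tmul, map_add, h, h']) u
  induction v with
  | zero => simp
  | add v w hv hw => simp only [TensorProduct.add_tmul, TensorProduct.tmul_add, map_add, hv, hw]
  | tmul z w =>
    simp only [TensorProduct.map_tmul, regroup_tmul α β x hy, LinearEquiv.coe_coe,
      TensorProduct.assoc_tmul]
    rw [regroup₃_tmul α β x (j := b + j) (fun q => grading₂_tmul α q hy hd), tw_tw,
      regroup_tmul α β y hd]

instance : Coalgebra K (SProd α β) where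
  coassoc := by
    refine stmul_ext α β fun c m => ?_
    have h₁ := LinearMap.congr_fun (rTensor_comul_regroup α β) (comul c ⊗ₜ comul m)
    have h₂ := LinearMap.congr_fun (lTensor_comul_regroup α β) (comul c ⊗ₜ comul m)
    simp only [LinearMap.comp_apply, LinearEquiv.coe_coe, TensorProduct.map_tmul, comul_stmul,
      Coalgebra.coassoc_apply] at h₁ h₂ ⊢
    rw [h₁, h₂]
  rTensor_counit_comp_comul := by
    refine stmul_ext α β fun c m => ?_
    have h : counit.rTensor (SProd α β) ∘ₗ regroup α β =
        (sp α β).toLinearMap.lTensor K ∘ₗ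
        TensorProduct.map (TensorProduct.lid K K).toLinearMap LinearMap.id ∘ₗ
        (TensorProduct.tensorTensorTensorComm K K C K M).toLinearMap ∘ₗ
        TensorProduct.map (counit.rTensor C) (counit.rTensor M) := by
      refine regroup_comul_ext α β fun i j k l c d m n hc hd hm hn => ?_
      simp [regroup_tmul α β c hd, counit_stmul, counit_tw, sp_tmul]
    have h' := LinearMap.congr_fun h (comul c ⊗ₜ comul m)
    simp only [LinearMap.comp_apply, TensorProduct.map_tmul, Coalgebra.rTensor_counit_comul] at h'
    rw [LinearMap.comp_apply, comul_stmul, h']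
    simp [sp_tmul]
  lTensor_counit_comp_comul := by
    refine stmul_ext α β fun c m => ?_
    have h : counit.lTensor (SProd α β) ∘ₗ regroup α β =
        (sp α β).toLinearMap.rTensor K ∘ₗ
        TensorProduct.map LinearMap.id (TensorProduct.lid K K).toLinearMap ∘ₗ
        (TensorProduct.tensorTensorTensorComm K C K M K).toLinearMap ∘ₗ
        TensorProduct.map (counit.lTensor C) (counit.lTensor M) := by
      refine regroup_comul_ext α β fun i j k l c d m n hc hd hm hn => ?_
      simp only [LinearMap.comp_apply, regroup_tmul α β c hd, LinearMap.lTensor_tmul, counit_stmul,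
        TensorProduct.map_tmul, LinearEquiv.coe_coe, TensorProduct.tensorTensorTensorComm_tmul,
        TensorProduct.lid_tmul, LinearMap.rTensor_tmul, LinearMap.id_apply, sp_tmul, smul_eq_mul]
      rcases ZMod.two_cases j with rfl | rfl
      · simp
      · simp [hd.counit]
    have h' := LinearMap.congr_fun h (comul c ⊗ₜ comul m)
    simp only [LinearMap.comp_apply, TensorProduct.map_tmul, Coalgebra.lTensor_counit_comul] at h'
    rw [LinearMap.comp_apply, comul_stmul, h']
    simp [sp_tmul]

end Parity

end Parity

namespace Parity

section Product

variable {K C M N : Type*} [CommRing K] [AddCommGroup C] [Module K C] [AddCommGroup M] [Module K M]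
variable [AddCommGroup N] [Module K N]
variable [Coalgebra K C] [Coalgebra K M] [Coalgebra K N]
variable (α : Parity K C) (β : Parity K M) (γ : Parity K N)

variable {α β} in
theorem IsHom.smul {i : ZMod 2} {c : C} (h : α.IsHom i c) (k : K) : α.IsHom i (k • c) := by
  rw [IsHom, map_smul, h.odd]
  split_ifs <;> simp

variable {α β} in
theorem IsHom.tw_isHom {i : ZMod 2} {c : C} (h : α.IsHom i c) (q : ZMod 2) :
    α.IsHom i (α.tw q c) := by
  rw [h.tw]
  exact h.smul _

variable {α β} in
theorem IsHom.sodd_stmul {i j : ZMod 2} {c : C} {m : M} (hc : α.IsHom i c) (hm : β.IsHom j m) :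
    sodd α β (stmul α β c m) = if i + j = 0 then 0 else stmul α β c m := by
  rw [Parity.sodd_stmul, hc.odd, hc.even, hm.odd, hm.even]
  rcases ZMod.two_cases i with rfl | rfl <;> rcases ZMod.two_cases j with rfl | rfl <;>
    simp [show (1 : ZMod 2) + 1 = 0 from rfl]

variable {α β} in
theorem IsHom.seven_stmul {i j : ZMod 2} {c : C} {m : M} (hc : α.IsHom i c) (hm : β.IsHom j m) :
    seven α β (stmul α β c m) = if i + j = 0 then stmul α β c m else 0 := by
  rw [Parity.seven_stmul, hc.odd, hc.even, hm.odd, hm.even]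
  rcases ZMod.two_cases i with rfl | rfl <;> rcases ZMod.two_cases j with rfl | rfl <;>
    simp [show (1 : ZMod 2) + 1 = 0 from rfl]

/-- The parity of a tensor product. -/
def prod : Parity K (SProd α β) where
  odd := sodd α β
  even := seven α β
  even_add_odd c := by
    refine SProd.hom_induction α β (p := fun c => seven α β c + sodd α β c = c)
      (fun i j c m hc hm => ?_) (fun c d hc hd => ?_) c
    · rw [hc.seven_stmul hm, hc.sodd_stmul hm]
      split_ifs <;> simp
    · rw [map_add, map_add, add_add_add_comm, hc, hd]
  odd_odd c := by
    refine SProd.hom_induction α β (p := fun c => sodd α β (sodd α β c) = sodd α β c)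
      (fun i j c m hc hm => ?_) (fun c d hc hd => by simp only [map_add, hc, hd]) c
    rw [hc.sodd_stmul hm]
    split_ifs
    · simp
    · rw [hc.sodd_stmul hm, if_neg ‹_›]
  counit_odd c := by
    refine SProd.hom_induction α β (p := fun c => counit (R := K) (sodd α β c) = 0)
      (fun i j c m hc hm => ?_) (fun c d hc hd => by simp only [map_add, hc, hd, add_zero]) c
    rw [sodd_stmul, map_add, counit_stmul, counit_stmul, α.counit_odd, β.counit_odd]
    simp
  comul_odd c := by
    have h : regroup α β ∘ₗ (TensorProduct.map (α.grading₂ 1) (β.grading₂ 0) +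
        TensorProduct.map (α.grading₂ 0) (β.grading₂ 1)) =
        (TensorProduct.map (sodd α β) (seven α β) + TensorProduct.map (seven α β) (sodd α β)) ∘ₗ
          regroup α β := by
      refine regroup_comul_ext α β fun i j k l c d m n hc hd hm hn => ?_
      simp only [LinearMap.comp_apply, LinearMap.add_apply, TensorProduct.map_tmul,
        grading₂_tmul α _ hc hd, grading₂_tmul β _ hm hn, regroup_tmul α β c hd,
        hc.sodd_stmul (hm.tw_isHom j), hc.seven_stmul (hm.tw_isHom j),
        hd.sodd_stmul hn, hd.seven_stmul hn]
      rcases ZMod.two_cases i with rfl | rfl <;> rcases ZMod.two_cases j with rfl | rfl <;>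
      rcases ZMod.two_cases k with rfl | rfl <;> rcases ZMod.two_cases l with rfl | rfl <;>
      simp [show (1 : ZMod 2) + 1 = 0 from rfl, regroup_tmul α β c hd]
    refine LinearMap.congr_fun (f := comul ∘ₗ sodd α β) (g := (TensorProduct.map (sodd α β)
      (seven α β) + TensorProduct.map (seven α β) (sodd α β)) ∘ₗ comul)
      (stmul_ext α β fun c m => ?_) c
    have h' := LinearMap.congr_fun h (comul c ⊗ₜ comul m)
    simp only [LinearMap.comp_apply] at h'
    rw [LinearMap.comp_apply, LinearMap.comp_apply, comul_stmul, ← h', sodd_stmul, map_add,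
      comul_stmul, comul_stmul, LinearMap.add_apply, map_add, TensorProduct.map_tmul,
      TensorProduct.map_tmul, grading₂_zero_comul, grading₂_zero_comul, grading₂_one_comul,
      grading₂_one_comul]

variable {α β} in
theorem IsHom.stmul {i j : ZMod 2} {c : C} {m : M} (hc : α.IsHom i c) (hm : β.IsHom j m) :
    (α.prod β).IsHom (i + j) (stmul α β c m) := hc.sodd_stmul hm

variable {α β} in
theorem Cocomm.prod (hα : α.Cocomm) (hβ : β.Cocomm) : (α.prod β).Cocomm := by
  intro c
  have h : (α.prod β).sflip ∘ₗ regroup α β = regroup α β ∘ₗ TensorProduct.map α.sflip β.sflip := by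
    refine regroup_comul_ext α β fun i j k l c d m n hc hd hm hn => ?_
    rw [LinearMap.comp_apply, LinearMap.comp_apply, regroup_tmul α β c hd,
      sflip_tmul _ (hc.stmul (hm.tw_isHom j)) (hd.stmul hn), TensorProduct.map_tmul,
      sflip_tmul _ hc hd, sflip_tmul _ hm hn, TensorProduct.smul_tmul_smul, map_smul,
      regroup_tmul α β d hc, hm.tw, hn.tw, map_smul, map_smul, TensorProduct.tmul_smul,
      ← TensorProduct.smul_tmul', smul_smul, smul_smul, ← sgn_add, ← sgn_add, ← sgn_add]
    congr 2
    clear hc hd hm hn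
    revert i j k l
    decide
  refine LinearMap.congr_fun (f := (α.prod β).sflip ∘ₗ comul) (g := comul)
    (stmul_ext α β fun c m => ?_) c
  have h' := LinearMap.congr_fun h (comul c ⊗ₜ comul m)
  rw [LinearMap.comp_apply, LinearMap.comp_apply, TensorProduct.map_tmul, hα, hβ] at h'
  exact h'

end Product

/-! ### Homomorphisms -/

section Hom

variable {K C D E S : Type*} [CommRing K] [AddCommGroup C] [Module K C] [AddCommGroup D] [Module K D]
variable [AddCommGroup E] [Module K E] [Ring S] [Algebra K S]
variable [Coalgebra K C] [Coalgebra K D] [Coalgebra K E]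
variable (α : Parity K C) (β : Parity K D) (γ : Parity K E)

variable (S) in
/-- Precomposition with a homomorphism of coalgebras. -/
def pull (φ : C →ₗc[K] D) : WithConv (D →ₗ[K] S) →ₐ[K] WithConv (C →ₗ[K] S) where
  toFun f := toConv (f.ofConv ∘ₗ φ.toLinearMap)
  map_one' := by
    refine WithConv.ext (LinearMap.ext fun c => ?_)
    simp
  map_mul' f g := by
    refine WithConv.ext (LinearMap.ext fun c => ?_)
    have h := CoalgHomClass.map_comp_comul_apply φ c
    simp only [LinearMap.convMul_apply, LinearMap.comp_apply]
    change LinearMap.mul' K S (TensorProduct.map f.ofConv g.ofConv (comul (φ c))) = _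
    rw [← h, ← LinearMap.comp_apply (TensorProduct.map f.ofConv g.ofConv), ← TensorProduct.map_comp]
    rfl
  map_zero' := rfl
  map_add' _ _ := rfl
  commutes' k := by
    refine WithConv.ext (LinearMap.ext fun c => ?_)
    simp

theorem pull_apply (φ : C →ₗc[K] D) (f : WithConv (D →ₗ[K] S)) (c : C) :
    (pull S φ f).ofConv c = f.ofConv (φ c) := rfl

/-- The sign automorphism. -/
def twHom (q : ZMod 2) : C →ₗc[K] C where
  __ := α.tw q
  counit_comp := LinearMap.ext fun c => α.counit_tw q c
  map_comp_comul := LinearMap.ext fun c => (α.comul_tw q c).symm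

/-- The projection to the first factor. -/
def fstHom : SProd α β →ₗc[K] C where
  __ := (TensorProduct.rid K C).toLinearMap ∘ₗ counit.lTensor C ∘ₗ (sp α β).symm.toLinearMap
  counit_comp := by
    refine stmul_ext α β fun c m => ?_
    simp [sp_symm_stmul, counit_stmul, mul_comm]
  map_comp_comul := by
    refine stmul_ext α β fun c m => ?_
    have h : TensorProduct.map ((TensorProduct.rid K C).toLinearMap ∘ₗ counit.lTensor C ∘ₗ
        (sp α β).symm.toLinearMap) ((TensorProduct.rid K C).toLinearMap ∘ₗ counit.lTensor C ∘ₗ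
        (sp α β).symm.toLinearMap) ∘ₗ regroup α β =
        (TensorProduct.rid K _).toLinearMap ∘ₗ TensorProduct.map LinearMap.id
          ((TensorProduct.lid K K).toLinearMap ∘ₗ TensorProduct.map counit counit) := by
      refine regroup_comul_ext α β fun i j k l c d m n hc hd hm hn => ?_
      simp [regroup_tmul α β c hd, sp_symm_stmul, counit_tw, ← TensorProduct.smul_tmul', smul_smul,
        TensorProduct.tmul_smul, mul_comm]
    have h' := LinearMap.congr_fun h (comul c ⊗ₜ comul m)
    have e : (TensorProduct.lid K K) (TensorProduct.map counit counit (comul (R := K) m)) =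
        counit (R := K) m := by
      have := congrArg (TensorProduct.lid K K) (LinearMap.congr_arg
        (f := counit.lTensor K) (Coalgebra.rTensor_counit_comul (R := K) m))
      rw [← LinearMap.comp_apply, LinearMap.lTensor_comp_rTensor] at this
      rw [this]
      simp
    simp only [LinearMap.comp_apply, TensorProduct.map_tmul, LinearEquiv.coe_coe, e] at h'
    simp only [LinearMap.comp_apply, comul_stmul, h', LinearEquiv.coe_coe, sp_symm_stmul]
    simp

theorem fstHom_stmul (c : C) (m : D) : fstHom α β (stmul α β c m) = counit (R := K) m • c := by
  change (TensorProduct.rid K C) (counit.lTensor C (c ⊗ₜ m)) = _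
  simp

/-- The projection to the second factor. -/
def sndHom : SProd α β →ₗc[K] D where
  __ := (TensorProduct.lid K D).toLinearMap ∘ₗ counit.rTensor D ∘ₗ (sp α β).symm.toLinearMap
  counit_comp := by
    refine stmul_ext α β fun c m => ?_
    simp [sp_symm_stmul, counit_stmul]
  map_comp_comul := by
    refine stmul_ext α β fun c m => ?_
    have h : TensorProduct.map ((TensorProduct.lid K D).toLinearMap ∘ₗ counit.rTensor D ∘ₗ
        (sp α β).symm.toLinearMap) ((TensorProduct.lid K D).toLinearMap ∘ₗ counit.rTensor D ∘ₗ
        (sp α β).symm.toLinearMap) ∘ₗ regroup α β =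
        (TensorProduct.lid K _).toLinearMap ∘ₗ TensorProduct.map
          ((TensorProduct.lid K K).toLinearMap ∘ₗ TensorProduct.map counit counit)
          LinearMap.id := by
      refine regroup_comul_ext α β fun i j k l c d m n hc hd hm hn => ?_
      rcases ZMod.two_cases j with rfl | rfl
      · simp [regroup_tmul α β c hd, sp_symm_stmul, ← TensorProduct.smul_tmul', smul_smul,
          TensorProduct.tmul_smul, mul_comm]
      · simp [regroup_tmul α β c hd, sp_symm_stmul, hd.counit]
    have h' := LinearMap.congr_fun h (comul c ⊗ₜ comul m)
    have e : (TensorProduct.lid K K) (TensorProduct.map counit counit (comul (R := K) c)) =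
        counit (R := K) c := by
      have := congrArg (TensorProduct.lid K K) (LinearMap.congr_arg
        (f := counit.lTensor K) (Coalgebra.rTensor_counit_comul (R := K) c))
      rw [← LinearMap.comp_apply, LinearMap.lTensor_comp_rTensor] at this
      rw [this]
      simp
    simp only [LinearMap.comp_apply, TensorProduct.map_tmul, LinearEquiv.coe_coe, e] at h'
    simp only [LinearMap.comp_apply, comul_stmul, h', LinearEquiv.coe_coe, sp_symm_stmul]
    simp

theorem sndHom_stmul (c : C) (m : D) : sndHom α β (stmul α β c m) = counit (R := K) c • m := by
  change (TensorProduct.lid K D) (counit.rTensor D (c ⊗ₜ m)) = _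
  simp

/-- Functoriality in the second factor. -/
def mapSnd (φ : D →ₗc[K] E) (hφ : ∀ d, φ (β.tw 1 d) = γ.tw 1 (φ d)) :
    SProd α β →ₗc[K] SProd α γ where
  __ := (sp α γ).toLinearMap ∘ₗ φ.toLinearMap.lTensor C ∘ₗ (sp α β).symm.toLinearMap
  counit_comp := by
    refine stmul_ext α β fun c m => ?_
    simp [sp_symm_stmul, counit_stmul, sp_tmul]
  map_comp_comul := by
    refine stmul_ext α β fun c m => ?_
    have h : TensorProduct.map
        ((sp α γ).toLinearMap ∘ₗ φ.toLinearMap.lTensor C ∘ₗ (sp α β).symm.toLinearMap)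
        ((sp α γ).toLinearMap ∘ₗ φ.toLinearMap.lTensor C ∘ₗ (sp α β).symm.toLinearMap) ∘ₗ
          regroup α β =
        regroup α γ ∘ₗ TensorProduct.map LinearMap.id
          (TensorProduct.map φ.toLinearMap φ.toLinearMap) := by
      refine regroup_comul_ext α β fun i j k l c d m n hc hd hm hn => ?_
      simp only [LinearMap.comp_apply, regroup_tmul α β c hd, TensorProduct.map_tmul,
        LinearEquiv.coe_coe, sp_symm_stmul, LinearMap.lTensor_tmul, sp_tmul, LinearMap.id_apply,
        regroup_tmul α γ c hd]
      rcases ZMod.two_cases j with rfl | rfl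
      · simp
      · rw [show φ.toLinearMap (β.tw 1 m) = γ.tw 1 (φ.toLinearMap m) from hφ m]
    have h' := LinearMap.congr_fun h (comul c ⊗ₜ comul m)
    have e : TensorProduct.map φ.toLinearMap φ.toLinearMap (comul m) = comul (R := K) (φ m) :=
      CoalgHomClass.map_comp_comul_apply φ m
    simp only [LinearMap.comp_apply, TensorProduct.map_tmul, e] at h'
    simp only [LinearMap.comp_apply, comul_stmul, h', LinearEquiv.coe_coe, sp_symm_stmul]
    rfl

theorem mapSnd_stmul (φ : D →ₗc[K] E) (hφ : ∀ d, φ (β.tw 1 d) = γ.tw 1 (φ d)) (c : C) (d : D) :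
    mapSnd α β γ φ hφ (stmul α β c d) = stmul α γ c (φ d) := rfl

end Hom

end Parity

/-! ### Convolution with values in a supercommutative algebra -/

section Super

variable {K C D M S : Type*} [CommRing K] [AddCommGroup C] [Module K C] [AddCommGroup M] [Module K M]
variable [AddCommGroup D] [Module K D] [Coalgebra K D]
variable [Coalgebra K C] [Coalgebra K M] [Ring S] [Algebra K S]

/-- Submodules of elements of parity `i` for a supercommutative algebra. -/
structure IsSuperComm (𝒮 : ZMod 2 → Submodule K S) : Prop where
  mul_mem : ∀ {i j : ZMod 2} {a b : S}, a ∈ 𝒮 i → b ∈ 𝒮 j → a * b ∈ 𝒮 (i + j)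
  comm : ∀ {i j : ZMod 2} {a b : S}, a ∈ 𝒮 i → b ∈ 𝒮 j → a * b = sgn K (i * j) • (b * a)

namespace Parity

variable (α : Parity K C) (β : Parity K M) (δ : Parity K D) (𝒮 : ZMod 2 → Submodule K S)

/-- Maps of parity `d`. -/
def HasParity (d : ZMod 2) (f : C →ₗ[K] S) : Prop :=
  ∀ i c, α.IsHom i c → f c ∈ 𝒮 (i + d)

variable {α β δ 𝒮}

theorem HasParity.tw {d : ZMod 2} {f : C →ₗ[K] S} (h : α.HasParity 𝒮 d f) (q : ZMod 2) :
    α.HasParity 𝒮 d (f ∘ₗ α.tw q) := fun i c hc => by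
  rw [LinearMap.comp_apply, hc.tw, map_smul]
  exact Submodule.smul_mem _ _ (h i c hc)

theorem HasParity.comp {d : ZMod 2} {f : C →ₗ[K] S} (h : α.HasParity 𝒮 d f) {φ : D →ₗ[K] C}
    (hφ : ∀ c, α.odd (φ c) = φ (δ.odd c)) : δ.HasParity 𝒮 d (f ∘ₗ φ) := fun i c hc => by
  refine h i _ ?_
  rw [IsHom, hφ, hc.odd]
  split_ifs <;> simp

theorem hasParity_of_stmul {d : ZMod 2} {f : SProd α β →ₗ[K] S}
    (h : ∀ i j c m, α.IsHom i c → β.IsHom j m → f (stmul α β c m) ∈ 𝒮 (i + j + d)) :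
    (α.prod β).HasParity 𝒮 d f := by
  have key : ∀ c, f ((α.prod β).even c) ∈ 𝒮 (0 + d) ∧ f ((α.prod β).odd c) ∈ 𝒮 (1 + d) := by
    intro c
    refine SProd.hom_induction α β (p := fun c => f ((α.prod β).even c) ∈ 𝒮 (0 + d) ∧
      f ((α.prod β).odd c) ∈ 𝒮 (1 + d)) (fun i j c m hc hm => ?_) (fun c c' h h' => ?_) c
    · have h' := h i j c m hc hm
      rw [(hc.stmul hm).even, (hc.stmul hm).odd]
      rcases ZMod.two_cases (i + j) with e | e <;> rw [e] at h' ⊢ <;> simpa using h'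
    · simp only [map_add]
      exact ⟨Submodule.add_mem _ h.1 h'.1, Submodule.add_mem _ h.2 h'.2⟩
  intro i c hc
  have hk := key c
  rw [hc.even, hc.odd] at hk
  rcases ZMod.two_cases i with rfl | rfl
  · simpa using hk.1
  · simpa using hk.2

theorem HasParity.mul (hS : IsSuperComm 𝒮) {d e : ZMod 2} {f g : WithConv (C →ₗ[K] S)}
    (hf : α.HasParity 𝒮 d f.ofConv) (hg : α.HasParity 𝒮 e g.ofConv) :
    α.HasParity 𝒮 (d + e) (f * g).ofConv := fun i c hc => by
  have key : ∀ t : C ⊗[K] C, LinearMap.mul' K S (TensorProduct.map f.ofConv g.ofConv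
      (α.grading₂ i t)) ∈ 𝒮 (i + (d + e)) := by
    intro t
    refine tmul_hom_induction α α (p := fun t => LinearMap.mul' K S (TensorProduct.map f.ofConv
      g.ofConv (α.grading₂ i t)) ∈ 𝒮 (i + (d + e))) (fun j k a a' ha ha' => ?_)
      (fun t t' h h' => ?_) t
    · rw [grading₂_tmul α i ha ha']
      split_ifs with h
      · rw [TensorProduct.map_tmul, LinearMap.mul'_apply, h, add_add_add_comm]
        exact hS.mul_mem (hf j a ha) (hg k a' ha')
      · simp
    · simp only [map_add]
      exact Submodule.add_mem _ h h'
  have h := key (comul c)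
  rw [hc.comul, if_pos rfl] at h
  exact h

theorem conv_supercomm (hα : α.Cocomm) (hS : IsSuperComm 𝒮) {d e : ZMod 2}
    {f g : WithConv (C →ₗ[K] S)} (hf : α.HasParity 𝒮 d f.ofConv) (hg : α.HasParity 𝒮 e g.ofConv) :
    f * g = sgn K (d * e) • (pull S (α.twHom d) g * pull S (α.twHom e) f) := by
  refine WithConv.ext (LinearMap.ext fun c => ?_)
  have key : ∀ t : C ⊗[K] C, LinearMap.mul' K S (TensorProduct.map f.ofConv g.ofConv (α.sflip t)) =
      sgn K (d * e) • LinearMap.mul' K S (TensorProduct.map (g.ofConv ∘ₗ α.tw d)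
        (f.ofConv ∘ₗ α.tw e) t) := by
    intro t
    refine tmul_hom_induction α α (p := fun t => LinearMap.mul' K S (TensorProduct.map f.ofConv
      g.ofConv (α.sflip t)) = sgn K (d * e) • LinearMap.mul' K S (TensorProduct.map
      (g.ofConv ∘ₗ α.tw d) (f.ofConv ∘ₗ α.tw e) t)) (fun j k c c' hc hc' => ?_)
      (fun t t' h h' => ?_) t
    · rw [sflip_tmul α hc hc', map_smul, map_smul, TensorProduct.map_tmul, TensorProduct.map_tmul,
        LinearMap.mul'_apply, LinearMap.mul'_apply, LinearMap.comp_apply, LinearMap.comp_apply,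
        hc.tw, hc'.tw, map_smul, map_smul, hS.comm (hf k c' hc') (hg j c hc), smul_mul_smul_comm,
        smul_smul, smul_smul, ← sgn_add, ← sgn_add, ← sgn_add]
      congr 2
      clear hc hc' hf hg
      revert j k d e
      decide
    · simp only [map_add, smul_add, h, h']
  have h := key (comul c)
  rw [hα] at h
  exact h

theorem conv_comm_even (hα : α.Cocomm) (hS : IsSuperComm 𝒮) {e : ZMod 2}
    {f g : WithConv (C →ₗ[K] S)} (hf : α.HasParity 𝒮 0 f.ofConv) (hg : α.HasParity 𝒮 e g.ofConv) :
    g * f = pull S (α.twHom e) f * g := by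
  rw [conv_supercomm hα hS hg hf, mul_zero, sgn_zero, one_smul]
  congr 1
  refine WithConv.ext (LinearMap.ext fun c => ?_)
  rw [pull_apply]
  exact congrArg g.ofConv (LinearMap.congr_fun α.tw_zero c)

theorem pull_twHom_zero (f : WithConv (C →ₗ[K] S)) : pull S (α.twHom 0) f = f :=
  WithConv.ext (LinearMap.ext fun c => congrArg f.ofConv (LinearMap.congr_fun α.tw_zero c))

theorem pull_twHom_twHom (p q : ZMod 2) (f : WithConv (C →ₗ[K] S)) :
    pull S (α.twHom p) (pull S (α.twHom q) f) = pull S (α.twHom (q + p)) f :=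
  WithConv.ext (LinearMap.ext fun c => congrArg f.ofConv (α.tw_tw q p c))

theorem fstHom_odd (c : SProd α β) : α.odd (fstHom α β c) = fstHom α β ((α.prod β).odd c) := by
  refine LinearMap.congr_fun (f := α.odd ∘ₗ (fstHom α β).toLinearMap)
    (g := (fstHom α β).toLinearMap ∘ₗ (α.prod β).odd) (stmul_ext α β fun c m => ?_) c
  change α.odd (fstHom α β (stmul α β c m)) = fstHom α β (sodd α β (stmul α β c m))
  rw [Parity.sodd_stmul, map_add, fstHom_stmul, fstHom_stmul, fstHom_stmul, β.counit_odd,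
    β.counit_even, map_smul]
  simp

theorem sndHom_odd (c : SProd α β) : β.odd (sndHom α β c) = sndHom α β ((α.prod β).odd c) := by
  refine LinearMap.congr_fun (f := β.odd ∘ₗ (sndHom α β).toLinearMap)
    (g := (sndHom α β).toLinearMap ∘ₗ (α.prod β).odd) (stmul_ext α β fun c m => ?_) c
  change β.odd (sndHom α β (stmul α β c m)) = sndHom α β (sodd α β (stmul α β c m))
  rw [Parity.sodd_stmul, map_add, sndHom_stmul, sndHom_stmul, sndHom_stmul, α.counit_odd,
    α.counit_even, map_smul]
  simp

theorem tw_of_odd {φ : C →ₗ[K] D} (hφ : ∀ c, δ.odd (φ c) = φ (α.odd c)) (q : ZMod 2) (c : C) :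
    δ.tw q (φ c) = φ (α.tw q c) := by
  simp [tw_apply, even_apply, hφ]

/-- Expansions with homogeneous entries. -/
structure HomExpansion (α : Parity K C) (t : C ⊗[K] C) where
  size : ℕ
  fst : Fin size → C
  snd : Fin size → C
  deg₁ : Fin size → ZMod 2
  deg₂ : Fin size → ZMod 2
  fst_hom : ∀ i, α.IsHom (deg₁ i) (fst i)
  snd_hom : ∀ i, α.IsHom (deg₂ i) (snd i)
  sum_eq : ∑ i, fst i ⊗ₜ[K] snd i = t

theorem HomExpansion.conv_apply {c : C} (X : HomExpansion α (comul (R := K) c))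
    (f g : WithConv (C →ₗ[K] S)) :
    (f * g).ofConv c = ∑ i, f.ofConv (X.fst i) * g.ofConv (X.snd i) := by
  rw [LinearMap.convMul_apply]
  conv_lhs => rw [← X.sum_eq]
  simp

/-- The expansion of a comultiplication of a pure tensor. -/
theorem map_comul_stmul {N : Type*} [AddCommGroup N] [Module K N] {c : C} {m : M}
    (X : HomExpansion α (comul (R := K) c))
    (Y : HomExpansion β (comul (R := K) m)) (F : SProd α β ⊗[K] SProd α β →ₗ[K] N) :
    F (comul (stmul α β c m)) = ∑ i, ∑ j, sgn K (X.deg₂ i * Y.deg₁ j) •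
      F (stmul α β (X.fst i) (Y.fst j) ⊗ₜ stmul α β (X.snd i) (Y.snd j)) := by
  rw [comul_stmul]
  conv_lhs => rw [← X.sum_eq, ← Y.sum_eq]
  simp only [TensorProduct.sum_tmul, TensorProduct.tmul_sum, map_sum]
  rw [Finset.sum_comm]
  refine Finset.sum_congr rfl fun i _ => Finset.sum_congr rfl fun j _ => ?_
  rw [regroup_tmul α β _ (X.snd_hom i), (Y.fst_hom j).tw, map_smul, ← TensorProduct.smul_tmul',
    map_smul]

theorem conv_stmul {c : C} {m : M} (X : HomExpansion α (comul (R := K) c))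
    (Y : HomExpansion β (comul (R := K) m)) (f g : WithConv (SProd α β →ₗ[K] S)) :
    (f * g).ofConv (stmul α β c m) = ∑ i, ∑ j, sgn K (X.deg₂ i * Y.deg₁ j) •
      (f.ofConv (stmul α β (X.fst i) (Y.fst j)) * g.ofConv (stmul α β (X.snd i) (Y.snd j))) := by
  rw [LinearMap.convMul_apply]
  exact (map_comul_stmul X Y (LinearMap.mul' K S ∘ₗ TensorProduct.map f.ofConv g.ofConv)).trans
    (by simp)

theorem nonempty_homExpansion (α : Parity K C) (t : C ⊗[K] C) : Nonempty (HomExpansion α t) := by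
  refine tmul_hom_induction α α (p := fun t => Nonempty (HomExpansion α t))
    (fun i j c d hc hd => ⟨⟨1, fun _ => c, fun _ => d, fun _ => i, fun _ => j, fun _ => hc,
      fun _ => hd, by simp⟩⟩) (fun s t hs ht => ?_) t
  obtain ⟨X⟩ := hs
  obtain ⟨Y⟩ := ht
  refine ⟨⟨X.size + Y.size, Fin.append X.fst Y.fst, Fin.append X.snd Y.snd,
    Fin.append X.deg₁ Y.deg₁, Fin.append X.deg₂ Y.deg₂, fun i => ?_, fun i => ?_, ?_⟩⟩
  · refine Fin.addCases (fun i => ?_) (fun i => ?_) i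
    · simpa using X.fst_hom i
    · simpa using Y.fst_hom i
  · refine Fin.addCases (fun i => ?_) (fun i => ?_) i
    · simpa using X.snd_hom i
    · simpa using Y.snd_hom i
  · simp [Fin.sum_univ_add, X.sum_eq, Y.sum_eq]

/-- The product of maps on the two factors. -/
theorem pull_fst_mul_pull_snd (u : WithConv (C →ₗ[K] S)) (v : WithConv (M →ₗ[K] S)) (c : C) (m : M) :
    (pull S (fstHom α β) u * pull S (sndHom α β) v).ofConv (stmul α β c m) =
      u.ofConv c * v.ofConv m := by
  obtain ⟨X⟩ := nonempty_homExpansion α (comul (R := K) c)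
  obtain ⟨Y⟩ := nonempty_homExpansion β (comul (R := K) m)
  rw [conv_stmul X Y]
  have h : ∀ i j, sgn K (X.deg₂ i * Y.deg₁ j) • ((pull S (fstHom α β) u).ofConv
      (stmul α β (X.fst i) (Y.fst j)) * (pull S (sndHom α β) v).ofConv
      (stmul α β (X.snd i) (Y.snd j))) = u.ofConv (counit (R := K) (X.snd i) • X.fst i) *
        v.ofConv (counit (R := K) (Y.fst j) • Y.snd j) := by
    intro i j
    rw [pull_apply, pull_apply, fstHom_stmul, sndHom_stmul]
    rcases ZMod.two_cases (X.deg₂ i) with e | e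
    · rw [e]
      simp only [zero_mul, sgn_zero, one_smul, map_smul, smul_mul_smul_comm]
      rw [mul_comm]
    · have h1 := X.snd_hom i
      rw [e] at h1
      simp [h1.counit]
  simp only [h]
  simp only [← Finset.mul_sum, ← Finset.sum_mul, ← map_sum]
  congr 2
  · conv_rhs => rw [← (TensorProduct.rid K C).apply_symm_apply c]
    have := Coalgebra.lTensor_counit_comul (R := K) c
    rw [← X.sum_eq] at this
    have := congrArg (TensorProduct.rid K C) this
    simpa using this
  · have := Coalgebra.rTensor_counit_comul (R := K) m
    rw [← Y.sum_eq] at this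
    have := congrArg (TensorProduct.lid K M) this
    simpa using this

/-- The product of maps on the two factors, in the opposite order. -/
theorem pull_snd_mul_pull_fst (u : WithConv (C →ₗ[K] S)) (v : WithConv (M →ₗ[K] S)) (c : C) {m : M}
    {j : ZMod 2} (hm : β.IsHom j m) :
    (pull S (sndHom α β) v * pull S (fstHom α β) u).ofConv (stmul α β c m) =
      v.ofConv m * u.ofConv (α.tw j c) := by
  obtain ⟨X⟩ := nonempty_homExpansion α (comul (R := K) c)
  obtain ⟨Y⟩ := nonempty_homExpansion β (comul (R := K) m)
  have e₁ : ∑ i, counit (R := K) (X.fst i) • X.snd i = c := by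
    have := Coalgebra.rTensor_counit_comul (R := K) c
    rw [← X.sum_eq] at this
    simpa using congrArg (TensorProduct.lid K C) this
  have e₂ : ∑ i, counit (R := K) (Y.snd i) • Y.fst i = m := by
    have := Coalgebra.lTensor_counit_comul (R := K) m
    rw [← Y.sum_eq] at this
    simpa using congrArg (TensorProduct.rid K M) this
  rw [conv_stmul X Y]
  have h : ∀ i, ∑ k, sgn K (X.deg₂ i * Y.deg₁ k) • ((pull S (sndHom α β) v).ofConv
      (stmul α β (X.fst i) (Y.fst k)) * (pull S (fstHom α β) u).ofConv
      (stmul α β (X.snd i) (Y.snd k))) =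
        v.ofConv m * u.ofConv (α.tw j (counit (R := K) (X.fst i) • X.snd i)) := by
    intro i
    have e₃ : v.ofConv m * u.ofConv (α.tw j (counit (R := K) (X.fst i) • X.snd i)) =
        counit (R := K) (X.fst i) • (v.ofConv (β.tw (X.deg₂ i) m) * u.ofConv (X.snd i)) := by
      rw [map_smul, (X.snd_hom i).tw, mul_comm j, map_smul, map_smul, mul_smul_comm, mul_smul_comm,
        hm.tw, map_smul, smul_mul_assoc]
    rw [e₃]
    conv_rhs => rw [← e₂]
    simp only [map_sum, Finset.sum_mul, Finset.smul_sum]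
    refine Finset.sum_congr rfl fun k _ => ?_
    rw [pull_apply, pull_apply, fstHom_stmul, sndHom_stmul, map_smul (β.tw _), (Y.fst_hom k).tw]
    simp only [map_smul, smul_mul_assoc, mul_smul_comm, smul_smul]
    congr 1
    ring
  simp only [h, ← Finset.mul_sum, ← map_sum, e₁]

end Parity

end Super

/-! ### The parity of a graded Hopf algebra -/

section ParityHopf

variable {K A : Type*} [CommRing K] [Ring A] [Algebra K A]
variable (𝒜 : ℤ → Submodule K A) [GradedAlgebra 𝒜]

/-- The projection to the odd part. -/
def gradedOdd : A →ₗ[K] A := gradedLift 𝒜 fun p => if (p : ZMod 2) = 0 then 0 else LinearMap.id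

theorem gradedOdd_of_mem {p : ℤ} {x : A} (hx : x ∈ 𝒜 p) :
    gradedOdd 𝒜 x = if (p : ZMod 2) = 0 then 0 else x := by
  rw [gradedOdd, gradedLift_of_mem 𝒜 _ hx]
  split_ifs <;> rfl

theorem graded_induction {p : A → Prop} (hom : ∀ i x, x ∈ 𝒜 i → p x)
    (add : ∀ x y, p x → p y → p (x + y)) (x : A) : p x := by
  induction x using DirectSum.Decomposition.inductionOn 𝒜 with
  | zero => exact hom 0 0 (Submodule.zero_mem _)
  | add a b ha hb => exact add _ _ ha hb
  | homogeneous x => exact hom _ _ x.2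

variable [Coalgebra K A] [GradedHopfAlgebra 𝒜]

/-- The parity of a graded Hopf algebra. -/
def hopfParity : Parity K A where
  odd := gradedOdd 𝒜
  even := LinearMap.id - gradedOdd 𝒜
  even_add_odd c := by simp
  odd_odd c := by
    refine graded_induction 𝒜 (p := fun c => gradedOdd 𝒜 (gradedOdd 𝒜 c) = gradedOdd 𝒜 c)
      (fun p x hx => ?_) (fun x y hx hy => by simp only [map_add, hx, hy]) c
    rw [gradedOdd_of_mem 𝒜 hx]
    split_ifs with h
    · simp
    · rw [gradedOdd_of_mem 𝒜 hx, if_neg h]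
  counit_odd c := by
    refine graded_induction 𝒜 (p := fun c => counit (R := K) (gradedOdd 𝒜 c) = 0)
      (fun p x hx => ?_) (fun x y hx hy => by simp only [map_add, hx, hy, add_zero]) c
    rw [gradedOdd_of_mem 𝒜 hx]
    split_ifs with h
    · simp
    · exact GradedHopfAlgebra.counit_eq_zero (𝒜 := 𝒜) p x hx fun h' => h (by simp [h'])
  comul_odd c := by
    refine graded_induction 𝒜 (p := fun c => comul (R := K) (gradedOdd 𝒜 c) =
      TensorProduct.map (gradedOdd 𝒜) (LinearMap.id - gradedOdd 𝒜) (comul c) +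
        TensorProduct.map (LinearMap.id - gradedOdd 𝒜) (gradedOdd 𝒜) (comul c))
      (fun p x hx => ?_) (fun x y hx hy => by
        simp only [map_add, hx, hy]
        abel) c
    have key : ∀ t ∈ ⨆ u : ℤ, LinearMap.range (TensorProduct.map (𝒜 u).subtype
        (𝒜 (p - u)).subtype), (if (p : ZMod 2) = 0 then 0 else t) =
        TensorProduct.map (gradedOdd 𝒜) (LinearMap.id - gradedOdd 𝒜) t +
        TensorProduct.map (LinearMap.id - gradedOdd 𝒜) (gradedOdd 𝒜) t := by
      intro t ht
      induction ht using Submodule.iSup_induction' with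
      | zero => simp
      | add s t _ _ hs ht =>
        simp only [map_add]
        rw [add_add_add_comm, ← hs, ← ht]
        split_ifs <;> simp
      | mem u t ht =>
        obtain ⟨t, rfl⟩ := ht
        induction t with
        | zero => simp
        | add s t hs ht =>
          simp only [map_add]
          rw [add_add_add_comm, ← hs, ← ht]
          split_ifs <;> simp
        | tmul y z =>
          simp only [TensorProduct.map_tmul, Submodule.subtype_apply, LinearMap.sub_apply,
            LinearMap.id_apply, gradedOdd_of_mem 𝒜 y.2, gradedOdd_of_mem 𝒜 z.2]
          rw [Int.cast_sub]
          generalize (p : ZMod 2) = p'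
          generalize (u : ZMod 2) = u'
          rcases ZMod.two_cases p' with rfl | rfl <;> rcases ZMod.two_cases u' with rfl | rfl <;>
            simp
    rw [← key _ (GradedHopfAlgebra.comul_mem (𝒜 := 𝒜) p x hx), gradedOdd_of_mem 𝒜 hx]
    split_ifs <;> simp

theorem isHom_of_mem {p : ℤ} {x : A} (hx : x ∈ 𝒜 p) : (hopfParity 𝒜).IsHom (p : ZMod 2) x :=
  gradedOdd_of_mem 𝒜 hx

theorem hopfParity_tw_of_mem {p : ℤ} {x : A} (hx : x ∈ 𝒜 p) (q : ZMod 2) :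
    (hopfParity 𝒜).tw q x = sgn K (q * p) • x := (isHom_of_mem 𝒜 hx).tw q

theorem hopfParity_cocomm (hA : IsGradedCocommutative 𝒜) : (hopfParity 𝒜).Cocomm := by
  have h : (hopfParity 𝒜).sflip = signedFlip 𝒜 0 := by
    refine TensorProduct.ext' fun x y => ?_
    refine graded_induction 𝒜 (p := fun x => (hopfParity 𝒜).sflip (x ⊗ₜ y) =
      signedFlip 𝒜 0 (x ⊗ₜ y)) (fun p x hx => ?_)
      (fun x x' h h' => by simp only [TensorProduct.add_tmul, map_add, h, h']) x
    refine graded_induction 𝒜 (p := fun y => (hopfParity 𝒜).sflip (x ⊗ₜ y) =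
      signedFlip 𝒜 0 (x ⊗ₜ y)) (fun q y hy => ?_)
      (fun x x' h h' => by simp only [TensorProduct.tmul_add, map_add, h, h']) y
    rw [Parity.sflip_tmul _ (isHom_of_mem 𝒜 hx) (isHom_of_mem 𝒜 hy), signedFlip_of_mem 𝒜 0 hx hy,
      negOnePow_smul (K := K)]
    simp
  intro c
  rw [h]
  exact hA c

/-- The underlying homogeneous expansion modulo two. -/
def Expansion₂.hom {t : A ⊗[K] A} (X : Expansion₂ 𝒜 t) : (hopfParity 𝒜).HomExpansion t where
  size := X.size
  fst := X.fst
  snd := X.snd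
  deg₁ i := (X.deg₁ i : ZMod 2)
  deg₂ i := (X.deg₂ i : ZMod 2)
  fst_hom i := isHom_of_mem 𝒜 (X.fst_mem i)
  snd_hom i := isHom_of_mem 𝒜 (X.snd_mem i)
  sum_eq := X.sum_eq

end ParityHopf

/-! ### Representation algebras -/

section RepAlgInstances

variable {K A : Type*} [CommRing K] [Ring A] [Algebra K A]
variable {𝒜 : ℤ → Submodule K A} [Coalgebra K A]
variable {B : Type*} [CommRing B] [HopfAlgebra K B]

scoped instance : Ring (RepAlg 𝒜 B) := inferInstance

scoped instance : Mul (RepAlg 𝒜 B) := inferInstance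

scoped instance : Add (RepAlg 𝒜 B) := inferInstance

scoped instance : AddCommMonoid (RepAlg 𝒜 B) := inferInstance

scoped instance : AddCommGroup (RepAlg 𝒜 B) := inferInstance

scoped instance : Module K (RepAlg 𝒜 B) := inferInstance

scoped instance : SMul K (RepAlg 𝒜 B) := inferInstance

scoped instance : Algebra K (RepAlg 𝒜 B) := inferInstance

end RepAlgInstances

section RepAlg

variable {K A : Type*} [CommRing K] [Ring A] [Algebra K A]
variable (𝒜 : ℤ → Submodule K A) [Coalgebra K A]
variable (B : Type*) [CommRing B] [HopfAlgebra K B]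

/-- The generators `x_b` with fixed `x`. -/
def genConv (x : A) : Cv K B (RepAlg 𝒜 B) := toConv (gen 𝒜 B x)

theorem genConv_mul (x y : A) : genConv 𝒜 B (x * y) = genConv 𝒜 B x * genConv 𝒜 B y := by
  refine Cv.ext fun b => ?_
  have h := RingQuot.mkAlgHom_rel K (RepRel.mul_left (𝒜 := 𝒜) x y b)
  rw [LinearMap.convMul_apply]
  refine h.trans ?_
  generalize comul (R := K) b = t
  induction t with
  | zero => simp
  | add s t hs ht => simp only [map_add, hs, ht]
  | tmul c d => simp [mk_preGen, genConv]

theorem genConv_one : genConv 𝒜 B (1 : A) = 1 := by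
  refine Cv.ext fun b => ?_
  refine (RingQuot.mkAlgHom_rel K (RepRel.one_left (𝒜 := 𝒜) b)).trans ?_
  rw [AlgHom.commutes]
  rfl

/-- The maps `x ↦ x_b` as elements of a convolution algebra. -/
def chi : B →ₐ[K] WithConv (A →ₗ[K] RepAlg 𝒜 B) where
  toFun b := toConv ((gen 𝒜 B).flip b)
  map_zero' := by rw [map_zero]; rfl
  map_add' b c := by rw [map_add]; rfl
  map_one' := by
    refine WithConv.ext (LinearMap.ext fun x => ?_)
    refine (RingQuot.mkAlgHom_rel K (RepRel.one_right (𝒜 := 𝒜) (B := B) x)).trans ?_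
    rw [AlgHom.commutes]
    rfl
  map_mul' b c := by
    refine WithConv.ext (LinearMap.ext fun x => ?_)
    rw [LinearMap.convMul_apply]
    refine (RingQuot.mkAlgHom_rel K (RepRel.mul_right (𝒜 := 𝒜) x b c)).trans ?_
    generalize comul (R := K) x = t
    induction t with
    | zero => simp
    | add s t hs ht => simp only [map_add, hs, ht]
    | tmul c d => simp [mk_preGen]
  commutes' k := by
    refine WithConv.ext (LinearMap.ext fun x => ?_)
    refine (congrArg (fun b => gen 𝒜 B x b) (Algebra.algebraMap_eq_smul_one k)).trans ?_
    rw [map_smul]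
    refine (congrArg (k • ·) (RingQuot.mkAlgHom_rel K (RepRel.one_right (𝒜 := 𝒜) (B := B) x))).trans
      ?_
    rw [AlgHom.commutes]
    simp [Algebra.algebraMap_eq_smul_one, smul_smul]

theorem chi_apply (x : A) (b : B) : (chi 𝒜 B b).ofConv x = gen 𝒜 B x b := rfl

theorem gen_comm {p q : ℤ} {x y : A} (hx : x ∈ 𝒜 p) (hy : y ∈ 𝒜 q) (b c : B) :
    gen 𝒜 B x b * gen 𝒜 B y c = sgn K ((p : ZMod 2) * q) • (gen 𝒜 B y c * gen 𝒜 B x b) := by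
  have h := RingQuot.mkAlgHom_rel K (RepRel.comm (𝒜 := 𝒜) p q x y b c hx hy)
  rw [negOnePow_smul (K := K), map_smul, map_mul, map_mul, Int.cast_mul] at h
  exact h

/-- The elements of `A_B` of a given parity. -/
def repParity (i : ZMod 2) : Submodule K (RepAlg 𝒜 B) :=
  Submodule.span K {m | ∃ p : ℤ, (p : ZMod 2) = i ∧ IsMonomial 𝒜 B p m}

variable {B} in
theorem mem_repParity {p : ℤ} {m : RepAlg 𝒜 B} (h : m ∈ repGrading 𝒜 B p) :
    m ∈ repParity 𝒜 B (p : ZMod 2) := by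
  refine Submodule.span_mono ?_ h
  exact fun _ hm => ⟨p, rfl, hm⟩

theorem gen_mem_repParity [GradedAlgebra 𝒜] {p : ℤ} {x : A} (hx : x ∈ 𝒜 p) (b : B) :
    gen 𝒜 B x b ∈ repParity 𝒜 B (p : ZMod 2) := mem_repParity 𝒜 (gen_mem 𝒜 B hx b)

variable {𝒜 B} in
theorem gen_mul_comm_monomial {p q : ℤ} {x : A} (hx : x ∈ 𝒜 p) (b : B) {m : RepAlg 𝒜 B}
    (hm : IsMonomial 𝒜 B q m) :
    gen 𝒜 B x b * m = sgn K ((p : ZMod 2) * q) • (m * gen 𝒜 B x b) := by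
  induction hm with
  | one => simp
  | gen_mul r s y c m hy hm ih =>
    rw [← mul_assoc, gen_comm 𝒜 B hx hy, smul_mul_assoc, mul_assoc, ih, mul_smul_comm, smul_smul,
      ← sgn_add, Int.cast_add, mul_add, mul_assoc]

variable {𝒜 B} in
theorem IsMonomial.comm {p q : ℤ} {m m' : RepAlg 𝒜 B} (hm : IsMonomial 𝒜 B p m)
    (hm' : IsMonomial 𝒜 B q m') : m * m' = sgn K ((p : ZMod 2) * q) • (m' * m) := by
  induction hm with
  | one => simp
  | gen_mul r s y c m hy hm ih =>
    rw [mul_assoc, ih, mul_smul_comm, ← mul_assoc, gen_mul_comm_monomial hy c hm', smul_mul_assoc,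
      smul_smul, ← sgn_add, Int.cast_add, add_mul, mul_assoc, add_comm ((s : ZMod 2) * q)]

theorem isSuperComm [GradedAlgebra 𝒜] : IsSuperComm (repParity 𝒜 B) where
  mul_mem {i j a b} ha hb := by
    have h := Submodule.mul_mem_mul ha hb
    rw [repParity, repParity, Submodule.span_mul_span] at h
    refine Submodule.span_mono ?_ h
    rintro _ ⟨u, ⟨p, rfl, hp⟩, v, ⟨q, rfl, hq⟩, rfl⟩
    exact ⟨p + q, by push_cast; rfl, hp.mul hq⟩
  comm {i j a b} ha hb := by
    induction ha using Submodule.span_induction with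
    | zero => simp
    | add x y _ _ hx hy => rw [add_mul, mul_add, smul_add, hx, hy]
    | smul k x _ hx => rw [smul_mul_assoc, mul_smul_comm, hx, smul_comm]
    | mem x hx =>
      induction hb using Submodule.span_induction with
      | zero => simp
      | add y z _ _ hy hz => rw [add_mul, mul_add, smul_add, hy, hz]
      | smul k y _ hy => rw [smul_mul_assoc, mul_smul_comm, hy, smul_comm]
      | mem y hy =>
        obtain ⟨p, rfl, hp⟩ := hx
        obtain ⟨q, rfl, hq⟩ := hy
        exact hp.comm hq

variable [GradedAlgebra 𝒜]

/-- Maps agree on `A_B` if they agree on monomials. -/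
theorem rep_ext {N : Type*} [AddCommGroup N] [Module K N] [GradedHopfAlgebra 𝒜]
    {f g : RepAlg 𝒜 B →ₗ[K] N}
    (h : ∀ p m, IsMonomial 𝒜 B p m → f m = g m) : f = g := by
  refine LinearMap.ext fun m => ?_
  refine graded_induction (repGrading 𝒜 B) (p := fun m => f m = g m) (fun p m hm => ?_)
    (fun x y hx hy => by simp only [map_add, hx, hy]) m
  induction hm using Submodule.span_induction with
  | zero => simp
  | add x y _ _ hx hy => rw [map_add, map_add, hx, hy]
  | smul k x _ hx => rw [map_smul, map_smul, hx]
  | mem x hx => exact h p x hx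

variable [GradedHopfAlgebra 𝒜]

theorem hopfParity_hom_mem {i : ZMod 2} {x : A} (hx : (hopfParity 𝒜).IsHom i x) (S : Type*)
    [AddCommGroup S] [Module K S] (f : A →ₗ[K] S) (P : Submodule K S)
    (h : ∀ p : ℤ, (p : ZMod 2) = i → ∀ y ∈ 𝒜 p, f y ∈ P) : f x ∈ P := by
  have key : ∀ x, f (if i = 0 then (hopfParity 𝒜).even x else (hopfParity 𝒜).odd x) ∈ P := by
    intro x
    refine graded_induction 𝒜 (p := fun x => f (if i = 0 then (hopfParity 𝒜).even x
      else (hopfParity 𝒜).odd x) ∈ P) (fun p x hx => ?_) (fun x y hx hy => ?_) x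
    · rw [(isHom_of_mem 𝒜 hx).even, (isHom_of_mem 𝒜 hx).odd]
      by_cases e : (p : ZMod 2) = i
      · have := h p e x hx
        rw [e]
        split_ifs <;> exact this
      · rcases ZMod.two_cases (p : ZMod 2) with e1 | e1 <;>
        rcases ZMod.two_cases i with e2 | e2 <;> simp_all
    · split_ifs at hx hy ⊢ <;> rw [map_add, map_add] <;> exact Submodule.add_mem _ hx hy
  have h1 := key x
  rw [hx.even, hx.odd] at h1
  split_ifs at h1 <;> exact h1

theorem chi_hasParity (b : B) : (hopfParity 𝒜).HasParity (repParity 𝒜 B) 0 (chi 𝒜 B b).ofConv := by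
  intro i x hx
  refine hopfParity_hom_mem 𝒜 hx _ _ _ fun p hp y hy => ?_
  rw [← hp, add_zero]
  exact gen_mem_repParity 𝒜 B hy b

end RepAlg

/-! ### The antipode of a cocommutative graded Hopf algebra -/

section Antipode

variable {K A : Type*} [CommRing K] [Ring A] [Algebra K A]
variable (𝒜 : ℤ → Submodule K A) [GradedAlgebra 𝒜] [Coalgebra K A] [GradedHopfAlgebra 𝒜]

/-- The multiplication as a homomorphism of coalgebras. -/
def hopfMul : SProd (hopfParity 𝒜) (hopfParity 𝒜) →ₗc[K] A where
  __ := LinearMap.mul' K A ∘ₗ ((hopfParity 𝒜).sp (hopfParity 𝒜)).symm.toLinearMap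
  counit_comp := by
    refine Parity.stmul_ext _ _ fun x y => ?_
    simp [Parity.sp_symm_stmul, Parity.counit_stmul, GradedHopfAlgebra.counit_mul 𝒜]
  map_comp_comul := by
    set α := hopfParity 𝒜
    refine Parity.stmul_ext _ _ fun x y => ?_
    set m : SProd α α →ₗ[K] A := LinearMap.mul' K A ∘ₗ (α.sp α).symm.toLinearMap with hm
    have hm' : ∀ x y, m (α.stmul α x y) = x * y := fun x y => by
      rw [hm, LinearMap.comp_apply, LinearEquiv.coe_coe, Parity.sp_symm_stmul,
        LinearMap.mul'_apply]
    have key : ∀ u v : A ⊗[K] A, GradedTensorProduct.of K 𝒜 𝒜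
        (TensorProduct.map m m (α.regroup α (u ⊗ₜ v))) =
        GradedTensorProduct.of K 𝒜 𝒜 u * GradedTensorProduct.of K 𝒜 𝒜 v := by
      intro u v
      induction u with
      | zero => simp
      | add u u' h h' => simp only [TensorProduct.add_tmul, map_add, h, h', add_mul]
      | tmul a b =>
        induction v with
        | zero => simp
        | add v v' h h' => simp only [TensorProduct.tmul_add, map_add, h, h', mul_add]
        | tmul c d =>
          refine graded_induction 𝒜 (p := fun b => GradedTensorProduct.of K 𝒜 𝒜
            (TensorProduct.map m m (α.regroup α ((a ⊗ₜ b) ⊗ₜ (c ⊗ₜ d)))) =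
            GradedTensorProduct.of K 𝒜 𝒜 (a ⊗ₜ b) * GradedTensorProduct.of K 𝒜 𝒜 (c ⊗ₜ d))
            (fun p b hb => ?_) (fun x y hx hy => by
              simp only [TensorProduct.tmul_add, TensorProduct.add_tmul, map_add, add_mul, hx, hy])
            b
          refine graded_induction 𝒜 (p := fun c => GradedTensorProduct.of K 𝒜 𝒜
            (TensorProduct.map m m (α.regroup α ((a ⊗ₜ b) ⊗ₜ (c ⊗ₜ d)))) =
            GradedTensorProduct.of K 𝒜 𝒜 (a ⊗ₜ b) * GradedTensorProduct.of K 𝒜 𝒜 (c ⊗ₜ d))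
            (fun q c hc => ?_) (fun x y hx hy => by
              simp only [TensorProduct.tmul_add, TensorProduct.add_tmul, map_add, mul_add, hx, hy])
            c
          have h := GradedTensorProduct.tmul_coe_mul_coe_tmul (R := K) 𝒜 𝒜 a ⟨b, hb⟩ ⟨c, hc⟩ d
          refine Eq.trans ?_ h.symm
          rw [Parity.regroup_tmul α α a (isHom_of_mem 𝒜 hb), hopfParity_tw_of_mem 𝒜 hc, map_smul,
            TensorProduct.map_tmul, map_smul, hm', hm', ← TensorProduct.smul_tmul', map_smul]
          have := negOnePow_smul (K := K) (p * q)
            (GradedTensorProduct.of K 𝒜 𝒜 ((a * c) ⊗ₜ[K] (b * d)))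
          rw [Int.cast_mul] at this
          exact this.symm
    rw [LinearMap.comp_apply, LinearMap.comp_apply, Parity.comul_stmul, hm']
    refine (GradedTensorProduct.of K 𝒜 𝒜).injective ?_
    rw [key, GradedHopfAlgebra.comul_mul]

theorem hopfMul_stmul (x y : A) :
    hopfMul 𝒜 ((hopfParity 𝒜).stmul (hopfParity 𝒜) x y) = x * y := by
  change LinearMap.mul' K A (((hopfParity 𝒜).sp (hopfParity 𝒜)).symm
    ((hopfParity 𝒜).stmul (hopfParity 𝒜) x y)) = _
  rw [Parity.sp_symm_stmul, LinearMap.mul'_apply]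

/-- The antipode as an element of the convolution algebra. -/
def antipodeConv : WithConv (A →ₗ[K] A) := toConv (GradedHopfAlgebra.antipode 𝒜)

theorem id_mul_antipodeConv : (toConv LinearMap.id * antipodeConv 𝒜 : WithConv (A →ₗ[K] A)) = 1 :=
  WithConv.ext (LinearMap.ext fun x => by
    rw [LinearMap.convMul_apply]
    exact LinearMap.congr_fun GradedHopfAlgebra.mul_antipode_lTensor_comul x)

theorem antipodeConv_mul_id : (antipodeConv 𝒜 * toConv LinearMap.id : WithConv (A →ₗ[K] A)) = 1 :=
  WithConv.ext (LinearMap.ext fun x => by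
    rw [LinearMap.convMul_apply]
    exact LinearMap.congr_fun GradedHopfAlgebra.mul_antipode_rTensor_comul x)

theorem hopf_mul_inv (x y : A) : GradedHopfAlgebra.antipode 𝒜 (x * y) =
    (Parity.pull A (Parity.sndHom (hopfParity 𝒜) (hopfParity 𝒜)) (antipodeConv 𝒜) *
      Parity.pull A (Parity.fstHom (hopfParity 𝒜) (hopfParity 𝒜)) (antipodeConv 𝒜)).ofConv
      ((hopfParity 𝒜).stmul (hopfParity 𝒜) x y) := by
  set α := hopfParity 𝒜
  set F := Parity.pull A (Parity.fstHom α α)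
  set G := Parity.pull A (Parity.sndHom α α)
  set I : WithConv (A →ₗ[K] A) := toConv LinearMap.id
  have e : F I * G I = Parity.pull A (hopfMul 𝒜) I := by
    refine WithConv.ext (Parity.stmul_ext _ _ fun x y => ?_)
    rw [Parity.pull_fst_mul_pull_snd]
    exact (hopfMul_stmul 𝒜 x y).symm
  have h₁ : Parity.pull A (hopfMul 𝒜) (antipodeConv 𝒜) * (F I * G I) = 1 := by
    rw [e, ← map_mul, antipodeConv_mul_id, map_one]
  have h₂ : (F I * G I) * (G (antipodeConv 𝒜) * F (antipodeConv 𝒜)) = 1 := by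
    rw [mul_assoc, ← mul_assoc (G I), ← map_mul, id_mul_antipodeConv, map_one, one_mul, ← map_mul,
      id_mul_antipodeConv, map_one]
  rw [← left_inv_eq_right_inv h₁ h₂, Parity.pull_apply, hopfMul_stmul]
  rfl

theorem antipode_tw (q : ZMod 2) (x : A) : (hopfParity 𝒜).tw q (GradedHopfAlgebra.antipode 𝒜 x) =
    GradedHopfAlgebra.antipode 𝒜 ((hopfParity 𝒜).tw q x) := by
  refine graded_induction 𝒜 (p := fun x => (hopfParity 𝒜).tw q (GradedHopfAlgebra.antipode 𝒜 x) =
    GradedHopfAlgebra.antipode 𝒜 ((hopfParity 𝒜).tw q x)) (fun p x hx => ?_)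
    (fun x y hx hy => by simp only [map_add, hx, hy]) x
  rw [hopfParity_tw_of_mem 𝒜 hx, hopfParity_tw_of_mem 𝒜 (GradedHopfAlgebra.antipode_mem p x hx),
    map_smul]

theorem antipode_mul (x : A) {y : A} {j : ZMod 2} (hy : (hopfParity 𝒜).IsHom j y) :
    GradedHopfAlgebra.antipode 𝒜 (x * y) = GradedHopfAlgebra.antipode 𝒜 y *
      GradedHopfAlgebra.antipode 𝒜 ((hopfParity 𝒜).tw j x) := by
  rw [hopf_mul_inv, Parity.pull_snd_mul_pull_fst _ _ _ hy]
  rfl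

theorem antipode_one : GradedHopfAlgebra.antipode 𝒜 (1 : A) = 1 := by
  have h := LinearMap.congr_fun (GradedHopfAlgebra.mul_antipode_lTensor_comul (𝒜 := 𝒜)) (1 : A)
  simpa [GradedHopfAlgebra.comul_one 𝒜, GradedHopfAlgebra.counit_one 𝒜] using h

theorem antipode_antipode (hA : IsGradedCocommutative 𝒜) (x : A) :
    GradedHopfAlgebra.antipode 𝒜 (GradedHopfAlgebra.antipode 𝒜 x) = x := by
  set s : A →ₗ[K] A := GradedHopfAlgebra.antipode 𝒜 with hs
  have h₁ : antipodeConv 𝒜 * toConv (s ∘ₗ s) = 1 := by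
    refine WithConv.ext (LinearMap.ext fun x => ?_)
    have key : ∀ t : A ⊗[K] A, LinearMap.mul' K A (TensorProduct.map s (s ∘ₗ s)
        ((hopfParity 𝒜).sflip t)) = s (LinearMap.mul' K A (TensorProduct.map s LinearMap.id t)) := by
      intro t
      refine Parity.tmul_hom_induction (hopfParity 𝒜) (hopfParity 𝒜) (p := fun t =>
        LinearMap.mul' K A (TensorProduct.map s (s ∘ₗ s) ((hopfParity 𝒜).sflip t)) =
        s (LinearMap.mul' K A (TensorProduct.map s LinearMap.id t))) (fun i j x y hx hy => ?_)
        (fun t t' h h' => by simp only [map_add, h, h']) t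
      rw [Parity.sflip_tmul _ hx hy, map_smul, map_smul, TensorProduct.map_tmul,
        TensorProduct.map_tmul, LinearMap.mul'_apply, LinearMap.mul'_apply, LinearMap.comp_apply,
        LinearMap.id_apply, hs, antipode_mul 𝒜 _ hy, antipode_tw, hx.tw, map_smul, map_smul,
        mul_smul_comm, mul_comm i j]
    have h := key (comul x)
    rw [hopfParity_cocomm 𝒜 hA] at h
    rw [LinearMap.convMul_apply]
    refine h.trans ?_
    have h' := LinearMap.congr_fun (GradedHopfAlgebra.mul_antipode_rTensor_comul (𝒜 := 𝒜)) x
    rw [LinearMap.comp_apply, LinearMap.comp_apply] at h'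
    refine (congrArg s h').trans ?_
    rw [LinearMap.comp_apply, Algebra.linearMap_apply, Algebra.algebraMap_eq_smul_one, map_smul, hs,
      antipode_one, LinearMap.convOne_apply, Algebra.algebraMap_eq_smul_one]
  have h₂ := left_inv_eq_right_inv (id_mul_antipodeConv 𝒜) h₁
  exact (LinearMap.congr_fun (congrArg WithConv.ofConv h₂) x).symm

theorem gen_antipode {B : Type*} [CommRing B] [HopfAlgebra K B] (x : A) (b : B) :
    gen 𝒜 B (GradedHopfAlgebra.antipode 𝒜 x) b = gen 𝒜 B x (HopfAlgebra.antipode K b) := by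
  set f : A →ₗ[K] Cv K B (RepAlg 𝒜 B) :=
    { toFun := fun x => toConv (gen 𝒜 B x)
      map_add' := fun x y => by rw [map_add]; rfl
      map_smul' := fun k x => by rw [map_smul]; rfl } with hf
  set g : A →ₗ[K] Cv K B (RepAlg 𝒜 B) :=
    { toFun := fun x => toConv (gen 𝒜 B x ∘ₗ HopfAlgebra.antipode K)
      map_add' := fun x y => by rw [map_add]; rfl
      map_smul' := fun k x => by rw [map_smul]; rfl } with hg
  have h₁ : (toConv f * toConv (f ∘ₗ GradedHopfAlgebra.antipode 𝒜) :
      WithConv (A →ₗ[K] Cv K B (RepAlg 𝒜 B))) = 1 := by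
    refine WithConv.ext (LinearMap.ext fun x => ?_)
    have key : ∀ t : A ⊗[K] A, LinearMap.mul' K _ (TensorProduct.map f
        (f ∘ₗ GradedHopfAlgebra.antipode 𝒜) t) =
        f (LinearMap.mul' K A ((GradedHopfAlgebra.antipode 𝒜).lTensor A t)) := by
      intro t
      induction t with
      | zero => simp
      | add s t hs ht => simp only [map_add, hs, ht]
      | tmul x y => exact (genConv_mul 𝒜 B x _).symm
    rw [LinearMap.convMul_apply]
    refine (key _).trans ?_
    have h' := LinearMap.congr_fun (GradedHopfAlgebra.mul_antipode_lTensor_comul (𝒜 := 𝒜)) x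
    rw [LinearMap.comp_apply, LinearMap.comp_apply] at h'
    rw [h', LinearMap.comp_apply, Algebra.linearMap_apply, Algebra.algebraMap_eq_smul_one, map_smul,
      LinearMap.convOne_apply, Algebra.algebraMap_eq_smul_one]
    exact congrArg _ (genConv_one 𝒜 B)
  have h₂ : (toConv g * toConv f : WithConv (A →ₗ[K] Cv K B (RepAlg 𝒜 B))) = 1 := by
    refine WithConv.ext (LinearMap.ext fun x => Cv.ext fun b => ?_)
    have key : ∀ t : A ⊗[K] A, (LinearMap.mul' K _ (TensorProduct.map g f t)).ofConv b =
        ∑ i ∈ (ℛ K b).index, LinearMap.mul' K _ (TensorProduct.map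
          (chi 𝒜 B (HopfAlgebra.antipode K ((ℛ K b).left i))).ofConv
          (chi 𝒜 B ((ℛ K b).right i)).ofConv t) := by
      intro t
      induction t with
      | zero => simp
      | add s t hs ht =>
        simp only [map_add, ofConv_add, LinearMap.add_apply, hs, ht, Finset.sum_add_distrib]
      | tmul x y => exact Cv.mul_apply (ℛ K b) (g x) (f y)
    rw [LinearMap.convMul_apply]
    refine (key _).trans ?_
    simp only [← LinearMap.convMul_apply, ← map_mul]
    have e : ∑ i ∈ (ℛ K b).index, HopfAlgebra.antipode K ((ℛ K b).left i) * (ℛ K b).right i =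
        algebraMap K B (counit b) := HopfAlgebra.sum_antipode_mul_eq_algebraMap_counit (ℛ K b)
    rw [← LinearMap.sum_apply, ← ofConv_sum, ← map_sum, e, AlgHom.commutes]
    simp [Algebra.algebraMap_eq_smul_one, smul_comm (counit (R := K) b)]
  have h₃ := left_inv_eq_right_inv h₂ h₁
  have h₄ := LinearMap.congr_fun (congrArg WithConv.ofConv h₃) x
  exact (LinearMap.congr_fun (congrArg WithConv.ofConv h₄) b).symm

/-! ### Fox pairings and the antipode -/

variable {𝒜} {n : ℤ} {ρ : A →ₗ[K] A →ₗ[K] A}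

theorem IsFoxPairing.one_left (h : IsFoxPairing 𝒜 n ρ) (z : A) : ρ 1 z = 0 := by
  have := h.map_mul_left 1 1 z
  rw [mul_one, GradedHopfAlgebra.counit_one 𝒜, one_smul, one_mul] at this
  simpa using this

theorem IsFoxPairing.one_right (h : IsFoxPairing 𝒜 n ρ) (z : A) : ρ z 1 = 0 := by
  have := h.map_mul_right z 1 1
  rw [mul_one, GradedHopfAlgebra.counit_one 𝒜, one_smul, mul_one] at this
  simpa using this

theorem IsFoxPairing.antipode_right (h : IsFoxPairing 𝒜 n ρ) (z x : A) :
    ρ z (GradedHopfAlgebra.antipode 𝒜 x) =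
      -(toConv (ρ z) * antipodeConv 𝒜 : WithConv (A →ₗ[K] A)).ofConv x := by
  have key : ∀ t : A ⊗[K] A, ρ z (LinearMap.mul' K A
      ((GradedHopfAlgebra.antipode 𝒜).lTensor A t)) =
      LinearMap.mul' K A (TensorProduct.map (ρ z) (GradedHopfAlgebra.antipode 𝒜) t) +
      ρ z (GradedHopfAlgebra.antipode 𝒜 (TensorProduct.lid K A (counit.rTensor A t))) := by
    intro t
    induction t with
    | zero => simp
    | add s t hs ht =>
      simp only [map_add, hs, ht]
      abel
    | tmul x y => simp [h.map_mul_right]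
  have h₁ := key (comul x)
  have h' := LinearMap.congr_fun (GradedHopfAlgebra.mul_antipode_lTensor_comul (𝒜 := 𝒜)) x
  rw [LinearMap.comp_apply, LinearMap.comp_apply] at h'
  rw [h', LinearMap.comp_apply, Algebra.linearMap_apply, Algebra.algebraMap_eq_smul_one, map_smul,
    h.one_right, smul_zero, rTensor_counit_comul, TensorProduct.lid_tmul, one_smul] at h₁
  exact eq_neg_of_add_eq_zero_right h₁.symm

theorem IsFoxPairing.antipode_left (h : IsFoxPairing 𝒜 n ρ) (x z : A) :
    ρ (GradedHopfAlgebra.antipode 𝒜 x) z =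
      -(antipodeConv 𝒜 * toConv (ρ.flip z) : WithConv (A →ₗ[K] A)).ofConv x := by
  have key : ∀ t : A ⊗[K] A, ρ (LinearMap.mul' K A
      ((GradedHopfAlgebra.antipode 𝒜).rTensor A t)) z =
      LinearMap.mul' K A (TensorProduct.map (GradedHopfAlgebra.antipode 𝒜) (ρ.flip z) t) +
      ρ (GradedHopfAlgebra.antipode 𝒜 (TensorProduct.rid K A (counit.lTensor A t))) z := by
    intro t
    induction t with
    | zero => simp
    | add s t hs ht =>
      simp only [map_add, LinearMap.add_apply, hs, ht]
      abel
    | tmul x y =>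
      simp only [LinearMap.rTensor_tmul, LinearMap.mul'_apply, h.map_mul_left,
        TensorProduct.map_tmul, LinearMap.flip_apply, LinearMap.lTensor_tmul,
        TensorProduct.rid_tmul, map_smul, LinearMap.smul_apply]
      rw [add_comm]
  have h₁ := key (comul x)
  have h' := LinearMap.congr_fun (GradedHopfAlgebra.mul_antipode_rTensor_comul (𝒜 := 𝒜)) x
  rw [LinearMap.comp_apply, LinearMap.comp_apply] at h'
  rw [h', LinearMap.comp_apply, Algebra.linearMap_apply, Algebra.algebraMap_eq_smul_one, map_smul,
    LinearMap.smul_apply, h.one_left, smul_zero, lTensor_counit_comul, TensorProduct.rid_tmul,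
    one_smul] at h₁
  exact eq_neg_of_add_eq_zero_right h₁.symm

theorem IsAntisymmetricFoxPairing.apply (hA : IsGradedCocommutative 𝒜)
    (h : IsAntisymmetricFoxPairing 𝒜 n ρ) {p q : ℤ} {x y : A} (hx : x ∈ 𝒜 p) (hy : y ∈ 𝒜 q) :
    GradedHopfAlgebra.antipode 𝒜 (ρ x y) = -(sgn K (((p : ZMod 2) + n) * (q + n)) •
      ρ (GradedHopfAlgebra.antipode 𝒜 y) (GradedHopfAlgebra.antipode 𝒜 x)) := by
  have hs : Function.Surjective (GradedHopfAlgebra.antipode 𝒜 : A →ₗ[K] A) :=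
    fun x => ⟨_, antipode_antipode 𝒜 hA x⟩
  have h' := congrArg (GradedHopfAlgebra.antipode 𝒜) (h p q x y hx hy)
  rw [negOnePow_smul (K := K), map_smul, Function.rightInverse_invFun hs, map_neg] at h'
  rw [← neg_eq_iff_eq_neg, ← h']
  push_cast
  rfl

end Antipode

/-! ### Evaluation of convolution products on pure tensors -/

namespace Parity

section Evaluation

variable {K C M S : Type*} [CommRing K] [AddCommGroup C] [Module K C] [AddCommGroup M] [Module K M]
variable [Coalgebra K C] [Coalgebra K M] [Ring S] [Algebra K S]
variable {α : Parity K C} {β : Parity K M}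

theorem HomExpansion.sum_counit_fst {c : C} (X : HomExpansion α (comul (R := K) c)) :
    ∑ i, counit (R := K) (X.fst i) • X.snd i = c := by
  have := Coalgebra.rTensor_counit_comul (R := K) c
  rw [← X.sum_eq] at this
  simpa using congrArg (TensorProduct.lid K C) this

theorem HomExpansion.sum_counit_snd {c : C} (X : HomExpansion α (comul (R := K) c)) :
    ∑ i, counit (R := K) (X.snd i) • X.fst i = c := by
  have := Coalgebra.lTensor_counit_comul (R := K) c
  rw [← X.sum_eq] at this
  simpa using congrArg (TensorProduct.rid K C) this

theorem pull_fst_mul_apply {c : C} (X : HomExpansion α (comul (R := K) c)) (m : M)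
    (u : WithConv (C →ₗ[K] S)) (f : WithConv (SProd α β →ₗ[K] S)) :
    (pull S (fstHom α β) u * f).ofConv (stmul α β c m) =
      ∑ i, u.ofConv (X.fst i) * f.ofConv (stmul α β (X.snd i) m) := by
  obtain ⟨Y⟩ := nonempty_homExpansion β (comul (R := K) m)
  rw [conv_stmul X Y]
  refine Finset.sum_congr rfl fun i _ => ?_
  conv_rhs => rw [← Y.sum_counit_fst]
  simp only [map_sum, map_smul, Finset.mul_sum]
  refine Finset.sum_congr rfl fun j _ => ?_
  rw [pull_apply, fstHom_stmul, map_smul, smul_mul_assoc, mul_smul_comm]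
  rcases ZMod.two_cases (Y.deg₁ j) with e | e
  · simp [e]
  · have h := Y.fst_hom j
    rw [e] at h
    simp [h.counit]

theorem mul_pull_snd_apply (c : C) {m : M} (Y : HomExpansion β (comul (R := K) m))
    (v : WithConv (M →ₗ[K] S)) (f : WithConv (SProd α β →ₗ[K] S)) :
    (f * pull S (sndHom α β) v).ofConv (stmul α β c m) =
      ∑ j, f.ofConv (stmul α β c (Y.fst j)) * v.ofConv (Y.snd j) := by
  obtain ⟨X⟩ := nonempty_homExpansion α (comul (R := K) c)
  rw [conv_stmul X Y, Finset.sum_comm]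
  refine Finset.sum_congr rfl fun j _ => ?_
  conv_rhs => rw [← X.sum_counit_snd]
  simp only [map_sum, map_smul, LinearMap.sum_apply, LinearMap.smul_apply, Finset.sum_mul]
  refine Finset.sum_congr rfl fun i _ => ?_
  rw [pull_apply, sndHom_stmul, map_smul, smul_mul_assoc, mul_smul_comm]
  rcases ZMod.two_cases (X.deg₂ i) with e | e
  · simp [e]
  · have h := X.snd_hom i
    rw [e] at h
    simp [h.counit]

theorem pull_snd_mul_apply (c : C) {m : M} (Y : HomExpansion β (comul (R := K) m))
    (v : WithConv (M →ₗ[K] S)) (f : WithConv (SProd α β →ₗ[K] S)) :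
    (pull S (sndHom α β) v * f).ofConv (stmul α β c m) =
      ∑ j, v.ofConv (Y.fst j) * f.ofConv (stmul α β (α.tw (Y.deg₁ j) c) (Y.snd j)) := by
  obtain ⟨X⟩ := nonempty_homExpansion α (comul (R := K) c)
  rw [conv_stmul X Y, Finset.sum_comm]
  refine Finset.sum_congr rfl fun j _ => ?_
  conv_rhs => rw [← X.sum_counit_fst]
  simp only [map_sum, map_smul, LinearMap.sum_apply, LinearMap.smul_apply, Finset.mul_sum]
  refine Finset.sum_congr rfl fun i _ => ?_
  rw [pull_apply, sndHom_stmul, (X.snd_hom i).tw]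
  simp only [map_smul, LinearMap.smul_apply, smul_mul_assoc, mul_smul_comm, smul_smul]
  congr 1
  rw [mul_comm, mul_comm (Y.deg₁ j)]

theorem mul_pull_fst_apply {c : C} (X : HomExpansion α (comul (R := K) c)) (m : M)
    (u : WithConv (C →ₗ[K] S)) (f : WithConv (SProd α β →ₗ[K] S)) :
    (f * pull S (fstHom α β) u).ofConv (stmul α β c m) =
      ∑ i, f.ofConv (stmul α β (X.fst i) (β.tw (X.deg₂ i) m)) * u.ofConv (X.snd i) := by
  obtain ⟨Y⟩ := nonempty_homExpansion β (comul (R := K) m)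
  rw [conv_stmul X Y]
  refine Finset.sum_congr rfl fun i _ => ?_
  conv_rhs => rw [← Y.sum_counit_snd]
  simp only [map_sum, map_smul, Finset.sum_mul]
  refine Finset.sum_congr rfl fun j _ => ?_
  rw [pull_apply, fstHom_stmul, (Y.fst_hom j).tw]
  simp only [map_smul, smul_mul_assoc, mul_smul_comm, smul_smul]
  congr 1
  rw [mul_comm]

theorem IsHom.exists_expansion {p : ZMod 2} {c : C} (hc : α.IsHom p c) :
    ∃ X : HomExpansion α (Coalgebra.comul (R := K) c), ∀ i, X.deg₁ i + X.deg₂ i = p := by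
  obtain ⟨X⟩ := nonempty_homExpansion α (Coalgebra.comul (R := K) c)
  refine ⟨⟨X.size, fun i => if p = X.deg₁ i + X.deg₂ i then X.fst i else 0, X.snd,
    fun i => p - X.deg₂ i, X.deg₂, fun i => ?_, X.snd_hom, ?_⟩, fun i => sub_add_cancel _ _⟩
  · split_ifs with h
    · rw [h, add_sub_cancel_right]
      exact X.fst_hom i
    · simp [IsHom]
  · have h := hc.comul p
    rw [if_pos rfl] at h
    conv_rhs => rw [← h, ← X.sum_eq]
    rw [map_sum]
    refine Finset.sum_congr rfl fun i _ => ?_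
    rw [grading₂_tmul _ _ (X.fst_hom i) (X.snd_hom i)]
    split_ifs <;> simp

end Evaluation

end Parity

/-! ### Antisymmetry on the level of algebras -/

section Abstract

variable {K B R : Type*} [CommRing K] [CommRing B] [HopfAlgebra K B] [Ring R] [Algebra K R]

theorem antipode_invol (b : B) : HopfAlgebra.antipode K (HopfAlgebra.antipode K b) = b := by
  have h : toConv (AlgHom.id K B) = ((toConv (AlgHom.id K B) : Pt K B B)⁻¹)⁻¹ := (inv_inv _).symm
  exact (congrArg (fun v : Pt K B B => v.hom b) h).symm

theorem tri_uni_antisymm {bul : B →ₗ[K] B →ₗ[K] K} (hb : IsBalanced bul) (X Y Y' : B →ₐ[K] R)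
    (hXY : ∀ b c, X b * Y c = Y c * X b) (p q : Cv K B R)
    (hq : ∀ b e, Y' b * q.ofConv e = q.ofConv e * Y b)
    (hp : toConv (p.ofConv ∘ₗ HopfAlgebra.antipode K) =
      -(toConv (Y'.toLinearMap ∘ₗ HopfAlgebra.antipode K) * (q *
        toConv (X.toLinearMap ∘ₗ HopfAlgebra.antipode K)) : Cv K B R)) (b c : B) :
    tri p (toConv X.toLinearMap) (toConv Y.toLinearMap) (uni bul b c) =
      -tri q (toConv Y.toLinearMap) (toConv X.toLinearMap) (uni bul c b) := by
  set Ψ : B ⊗[K] (B ⊗[K] B) →ₗ[K] R := tri q (toConv X.toLinearMap) (toConv Y.toLinearMap) with hΨ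
  set w : Pt K B (B ⊗[K] (B ⊗[K] B)) := pt₁
  set g : Pt K B (B ⊗[K] (B ⊗[K] B)) := pt₂
  set h : Pt K B (B ⊗[K] (B ⊗[K] B)) := pt₃
  have hw : ∀ b, w.hom b = b ⊗ₜ (1 ⊗ₜ 1) := fun _ => rfl
  have hg : ∀ b, g.hom b = 1 ⊗ₜ (b ⊗ₜ 1) := fun _ => rfl
  have hh : ∀ b, h.hom b = 1 ⊗ₜ (1 ⊗ₜ b) := fun _ => rfl
  have e₁ : Ψ ∘ₗ tri (Pt.lin (g * w⁻¹ * h)) (Pt.lin g) (Pt.lin h) =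
      -tri p (toConv X.toLinearMap) (toConv Y.toLinearMap) := by
    refine TensorProduct.ext_threefold' fun e b c => ?_
    rw [← antipode_invol (K := K) e]
    generalize HopfAlgebra.antipode K e = e
    have hl : (g * w⁻¹ * h).hom (HopfAlgebra.antipode K e) = (h⁻¹ * (w * g⁻¹)).hom e := by
      rw [← Pt.inv_hom]
      congr 2
      group
    have hr : p.ofConv (HopfAlgebra.antipode K e) = -(toConv (Y'.toLinearMap ∘ₗ
        HopfAlgebra.antipode K) * (q * toConv (X.toLinearMap ∘ₗ HopfAlgebra.antipode K)) :
        Cv K B R).ofConv e := by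
      rw [← LinearMap.neg_apply, ← ofConv_neg, ← hp]
      rfl
    rw [LinearMap.comp_apply, tri_tmul, LinearMap.neg_apply, tri_tmul, Pt.lin_apply, hl, hr,
      Pt.mul_hom (ℛ K e), Cv.mul_apply (ℛ K e), Finset.sum_mul, map_sum, neg_mul, neg_neg,
      Finset.sum_mul]
    refine Finset.sum_congr rfl fun i _ => ?_
    rw [Pt.mul_hom (ℛ K _), Cv.mul_apply (ℛ K _), Finset.mul_sum, Finset.sum_mul, map_sum,
      Finset.mul_sum, Finset.sum_mul]
    refine Finset.sum_congr rfl fun k _ => ?_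
    simp only [Pt.lin_apply, Pt.inv_hom, hw, hg, hh, Algebra.TensorProduct.tmul_mul_tmul, one_mul,
      mul_one, hΨ, tri_tmul, LinearMap.comp_apply, AlgHom.toLinearMap_apply, map_mul]
    rw [← mul_assoc (Y' _), hq]
    simp only [mul_assoc]
    congr 1
    rw [← mul_assoc (Y _) (X _) (X b * _), ← hXY, mul_assoc, ← mul_assoc (Y _) (X b), ← hXY,
      mul_assoc]
  have e₂ : Ψ ∘ₗ tri (Pt.lin w) (Pt.lin h) (Pt.lin g) =
      tri q (toConv Y.toLinearMap) (toConv X.toLinearMap) := by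
    refine TensorProduct.ext_threefold' fun e b c => ?_
    rw [LinearMap.comp_apply, tri_tmul, tri_tmul]
    simp only [Pt.lin_apply, hw, hg, hh, Algebra.TensorProduct.tmul_mul_tmul, one_mul,
      mul_one, hΨ, tri_tmul, AlgHom.toLinearMap_apply, hXY]
  rw [← e₂, ← neg_eq_iff_eq_neg, ← LinearMap.neg_apply, ← e₁, LinearMap.comp_apply,
    LinearMap.comp_apply, tri_uni_pt, tri_uni_pt]
  exact congrArg Ψ (fox_symm hb w g h b c)

end Abstract

namespace Parity

section Slice

variable {K C M N S : Type*} [CommRing K] [AddCommGroup C] [Module K C] [AddCommGroup M] [Module K M]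
variable [AddCommGroup N] [Module K N]
variable [Coalgebra K C] [Coalgebra K M] [Coalgebra K N] [Ring S] [Algebra K S]
variable {α : Parity K C} {β : Parity K M} {γ : Parity K N}

/-- A map on a tensor product with fixed first argument. -/
def slice (f : WithConv (SProd α β →ₗ[K] S)) (c : C) : WithConv (M →ₗ[K] S) :=
  toConv (f.ofConv ∘ₗ stmul α β c)

theorem slice_apply (f : WithConv (SProd α β →ₗ[K] S)) (c : C) (m : M) :
    (slice f c).ofConv m = f.ofConv (stmul α β c m) := rfl

theorem slice_mul_snd (f : WithConv (SProd α β →ₗ[K] S)) (w : WithConv (M →ₗ[K] S)) (c : C) :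
    slice (f * pull S (sndHom α β) w) c = slice f c * w :=
  WithConv.ext (LinearMap.ext fun m => by
    obtain ⟨Y⟩ := nonempty_homExpansion β (comul (R := K) m)
    rw [Y.conv_apply]
    exact mul_pull_snd_apply c Y w f)

theorem slice_snd_mul (f : WithConv (SProd α β →ₗ[K] S)) (w : WithConv (M →ₗ[K] S)) {c : C}
    {p : ZMod 2} (hc : α.IsHom p c) :
    slice (pull S (sndHom α β) w * f) c = pull S (β.twHom p) w * slice f c :=
  WithConv.ext (LinearMap.ext fun m => by
    obtain ⟨Y⟩ := nonempty_homExpansion β (comul (R := K) m)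
    rw [Y.conv_apply]
    refine (pull_snd_mul_apply c Y w f).trans (Finset.sum_congr rfl fun j _ => ?_)
    rw [hc.tw, pull_apply, slice_apply]
    change _ = w.ofConv (β.tw p (Y.fst j)) * _
    rw [(Y.fst_hom j).tw]
    simp only [map_smul, LinearMap.smul_apply, smul_mul_assoc, mul_smul_comm, mul_comm p])

theorem fst_comp_mapSnd (φ : M →ₗc[K] N) (hφ : ∀ d, φ (β.tw 1 d) = γ.tw 1 (φ d))
    (u : WithConv (C →ₗ[K] S)) :
    pull S (mapSnd α β γ φ hφ) (pull S (fstHom α γ) u) = pull S (fstHom α β) u :=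
  WithConv.ext (stmul_ext _ _ fun c m => by
    rw [pull_apply, pull_apply, pull_apply, mapSnd_stmul, fstHom_stmul, fstHom_stmul,
      CoalgHomClass.counit_comp_apply])

theorem snd_comp_mapSnd (φ : M →ₗc[K] N) (hφ : ∀ d, φ (β.tw 1 d) = γ.tw 1 (φ d))
    (u : WithConv (N →ₗ[K] S)) :
    pull S (mapSnd α β γ φ hφ) (pull S (sndHom α γ) u) = pull S (sndHom α β) (pull S φ u) :=
  WithConv.ext (stmul_ext _ _ fun c m => by
    rw [pull_apply, pull_apply, pull_apply, pull_apply, mapSnd_stmul, sndHom_stmul, sndHom_stmul,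
      map_smul φ])

end Slice

end Parity

/-! ### Derivation properties on the level of algebras -/

section Abstract

variable {K B M R : Type*} [CommRing K] [CommRing B] [HopfAlgebra K B] [Ring R] [Algebra K R]
variable [CommRing M] [Algebra K M]

/-- A homomorphism as an element of a convolution algebra. -/
def AlgHom.cv (X : B →ₐ[K] R) : Cv K B R := toConv X.toLinearMap

theorem AlgHom.cv_apply (X : B →ₐ[K] R) (b : B) : (AlgHom.cv X).ofConv b = X b := rfl

/-- The map `m ⊗ (b ⊗ c ⊗ d) ↦ f(m) X(b) Y(c) Z(d)`. -/
def transfer (f : M →ₗ[K] R) (X Y Z : B →ₐ[K] R) : M ⊗[K] (B ⊗[K] (B ⊗[K] B)) →ₗ[K] R :=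
  LinearMap.mul' K R ∘ₗ TensorProduct.map f (tri (AlgHom.cv X) (AlgHom.cv Y) (AlgHom.cv Z))

theorem transfer_tmul (f : M →ₗ[K] R) (X Y Z : B →ₐ[K] R) (m : M) (b c d : B) :
    transfer f X Y Z (m ⊗ₜ (b ⊗ₜ (c ⊗ₜ d))) = f m * (X b * (Y c * Z d)) := by
  simp [transfer, AlgHom.cv_apply]

/-- The points of `M ⊗ (B ⊗ B ⊗ B)`. -/
def pt₀ (v : Pt K B M) : Pt K B (M ⊗[K] (B ⊗[K] (B ⊗[K] B))) :=
  toConv (Algebra.TensorProduct.includeLeft.comp v.hom)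

variable (M) in
/-- Universal points. -/
def ptR (v : Pt K B (B ⊗[K] (B ⊗[K] B))) : Pt K B (M ⊗[K] (B ⊗[K] (B ⊗[K] B))) :=
  toConv (Algebra.TensorProduct.includeRight.comp v.hom)

theorem ptR₁_hom (b : B) : (ptR M (pt₁ (K := K) (B := B))).hom b = 1 ⊗ₜ (b ⊗ₜ (1 ⊗ₜ 1)) := rfl

theorem ptR₂_hom (b : B) : (ptR M (pt₂ (K := K) (B := B))).hom b = 1 ⊗ₜ (1 ⊗ₜ (b ⊗ₜ 1)) := rfl

theorem ptR₃_hom (b : B) : (ptR M (pt₃ (K := K) (B := B))).hom b = 1 ⊗ₜ (1 ⊗ₜ (1 ⊗ₜ b)) := rfl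

/-- The bracket built from a pairing and two points. -/
def brk (bul : B →ₗ[K] B →ₗ[K] K) (p : Cv K B R) (X Y : B →ₐ[K] R) (b : B) : Cv K B R :=
  toConv (tri p (AlgHom.cv X) (AlgHom.cv Y) ∘ₗ uni bul b)

theorem brk_apply (bul : B →ₗ[K] B →ₗ[K] K) (p : Cv K B R) (X Y : B →ₐ[K] R) (b c : B) :
    (brk bul p X Y b).ofConv c = tri p (AlgHom.cv X) (AlgHom.cv Y) (uni bul b c) := rfl

theorem tri_uni_fox_apply (bul : B →ₗ[K] B →ₗ[K] K) (v g h : Pt K B M) (b c : B) :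
    tri (Pt.lin v) (Pt.lin g) (Pt.lin h) (uni bul b c) = ((fox bul v g h).ofConv c).ofConv b :=
  tri_uni_pt bul v (Pt.lin g) (Pt.lin h) b c

theorem tri_uni_mul_right {bul : B →ₗ[K] B →ₗ[K] K} (hb : IsBalanced bul) (v g h k : Pt K B M)
    (b c : B) : tri (Pt.lin (v * k)) (Pt.lin g) (Pt.lin (h * k)) (uni bul b c) =
      ∑ i ∈ (ℛ K c).index, tri (Pt.lin v) (Pt.lin g) (Pt.lin h) (uni bul b ((ℛ K c).left i)) *
        k.hom ((ℛ K c).right i) := by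
  rw [tri_uni_fox_apply, fox_mul_right hb, Cv.mul_apply (ℛ K c), ofConv_sum, LinearMap.sum_apply]
  refine Finset.sum_congr rfl fun i _ => ?_
  rw [Cv.top_apply, ← Algebra.commutes, ← Algebra.smul_def, tri_uni_fox_apply, mul_comm]
  rfl

theorem tri_uni_mul_left (bul : B →ₗ[K] B →ₗ[K] K) (v g h k : Pt K B M) (b c : B) :
    tri (Pt.lin v) (Pt.lin g) (Pt.lin (h * k)) (uni bul b c) =
      ∑ i ∈ (ℛ K c).index, h.hom ((ℛ K c).left i) *
        tri (Pt.lin v) (Pt.lin g) (Pt.lin k) (uni bul b ((ℛ K c).right i)) := by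
  rw [tri_uni_fox_apply, fox, foxLin, map_mul Pt.lin, map_mul Cv.top, mul_assoc,
    Cv.mul_apply (ℛ K c), ofConv_sum, LinearMap.sum_apply]
  refine Finset.sum_congr rfl fun i _ => ?_
  rw [Cv.top_apply, ← Algebra.smul_def, tri_uni_fox_apply]
  rfl

theorem brk_mul_right_aux {bul : B →ₗ[K] B →ₗ[K] K} (hb : IsBalanced bul) (X Y Z YZ : B →ₐ[K] R)
    (hXZ : ∀ b c, X b * Z c = Z c * X b) (hYZ : ∀ b c, Y b * Z c = Z c * Y b) (p : Cv K B R)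
    (hm : AlgHom.cv YZ = AlgHom.cv Y * AlgHom.cv Z) (v g h k : Pt K B M) (Ψ : M →ₗ[K] R)
    (hΨ : ∀ x y z w, Ψ (v.hom x * (g.hom y * (h.hom z * k.hom w))) =
      p.ofConv x * (X y * (Y z * Z w))) (b : B) :
    brk bul (p * AlgHom.cv Z) X YZ b = brk bul p X Y b * AlgHom.cv Z := by
  refine Cv.ext fun c => ?_
  have i₁ : tri (p * AlgHom.cv Z) (AlgHom.cv X) (AlgHom.cv YZ) =
      Ψ ∘ₗ tri (Pt.lin (v * k)) (Pt.lin g) (Pt.lin (h * k)) := by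
    refine TensorProduct.ext_threefold' fun x y z => ?_
    rw [LinearMap.comp_apply, tri_tmul, tri_tmul, Pt.lin_apply, Pt.lin_apply, Pt.lin_apply,
      Pt.mul_hom (ℛ K x), Pt.mul_hom (ℛ K z), Cv.mul_apply (ℛ K x), hm, Cv.mul_apply (ℛ K z)]
    simp only [Finset.sum_mul, Finset.mul_sum, map_sum]
    refine Finset.sum_congr rfl fun i _ => Finset.sum_congr rfl fun j _ => ?_
    rw [show ∀ a b c d e : M, a * b * (c * (d * e)) = a * (c * (d * (b * e))) from
      fun a b c d e => by ring, ← map_mul, hΨ, map_mul]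
    simp only [AlgHom.cv_apply]
    rw [mul_assoc]
    congr 1
    rw [← mul_assoc (Z _), ← hXZ, mul_assoc, ← mul_assoc (Z _), ← hYZ, mul_assoc]
  have i₂ : ∀ c d, Ψ (tri (Pt.lin v) (Pt.lin g) (Pt.lin h) c * k.hom d) =
      tri p (AlgHom.cv X) (AlgHom.cv Y) c * Z d := by
    intro c d
    refine LinearMap.congr_fun (f := Ψ ∘ₗ LinearMap.mulRight K (k.hom d) ∘ₗ
      tri (Pt.lin v) (Pt.lin g) (Pt.lin h)) (g := LinearMap.mulRight K (Z d) ∘ₗ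
      tri p (AlgHom.cv X) (AlgHom.cv Y)) (TensorProduct.ext_threefold' fun x y z => ?_) c
    simp only [LinearMap.comp_apply, LinearMap.mulRight_apply, tri_tmul, Pt.lin_apply,
      AlgHom.cv_apply, mul_assoc, hΨ]
  rw [brk_apply, i₁, LinearMap.comp_apply, tri_uni_mul_right hb, map_sum, Cv.mul_apply (ℛ K c)]
  exact Finset.sum_congr rfl fun i _ => i₂ _ _

theorem brk_mul_left_aux (bul : B →ₗ[K] B →ₗ[K] K) (X Y Y' Z YZ : B →ₐ[K] R)
    (hXY : ∀ b c, X b * Y c = Y c * X b) (q : Cv K B R)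
    (hq : ∀ b e, Y' b * q.ofConv e = q.ofConv e * Y b)
    (hm : AlgHom.cv YZ = AlgHom.cv Y * AlgHom.cv Z) (v g h k : Pt K B M) (Ψ : M →ₗ[K] R)
    (hΨ : ∀ x y z w, Ψ (v.hom x * (g.hom y * (h.hom z * k.hom w))) =
      q.ofConv x * (X y * (Y z * Z w))) (b : B) :
    brk bul q X YZ b = AlgHom.cv Y' * brk bul q X Z b := by
  refine Cv.ext fun c => ?_
  have i₁ : tri q (AlgHom.cv X) (AlgHom.cv YZ) =
      Ψ ∘ₗ tri (Pt.lin v) (Pt.lin g) (Pt.lin (h * k)) := by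
    refine TensorProduct.ext_threefold' fun x y z => ?_
    rw [LinearMap.comp_apply, tri_tmul, tri_tmul, Pt.lin_apply, Pt.lin_apply, Pt.lin_apply,
      Pt.mul_hom (ℛ K z), hm, Cv.mul_apply (ℛ K z)]
    simp only [Finset.mul_sum, map_sum]
    refine Finset.sum_congr rfl fun j _ => ?_
    simp only [hΨ, AlgHom.cv_apply]
  have i₂ : ∀ c d, Ψ (h.hom d * tri (Pt.lin v) (Pt.lin g) (Pt.lin k) c) =
      Y' d * tri q (AlgHom.cv X) (AlgHom.cv Z) c := by
    intro c d
    refine LinearMap.congr_fun (f := Ψ ∘ₗ LinearMap.mulLeft K (h.hom d) ∘ₗ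
      tri (Pt.lin v) (Pt.lin g) (Pt.lin k)) (g := LinearMap.mulLeft K (Y' d) ∘ₗ
      tri q (AlgHom.cv X) (AlgHom.cv Z)) (TensorProduct.ext_threefold' fun x y z => ?_) c
    simp only [LinearMap.comp_apply, LinearMap.mulLeft_apply, tri_tmul, Pt.lin_apply,
      AlgHom.cv_apply]
    rw [show ∀ a b c d : M, a * (b * (c * d)) = b * (c * (a * d)) from fun a b c d => by ring, hΨ,
      ← mul_assoc (Y' d), hq, mul_assoc, ← mul_assoc (Y d), ← hXY, mul_assoc]
  rw [brk_apply, i₁, LinearMap.comp_apply, tri_uni_mul_left, map_sum, Cv.mul_apply (ℛ K c)]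
  exact Finset.sum_congr rfl fun i _ => i₂ _ _

theorem transfer_pt (f : M →ₗ[K] R) (X Y Z : B →ₐ[K] R) (m : M) (b c d : B) :
    transfer f X Y Z ((m ⊗ₜ (1 ⊗ₜ (1 ⊗ₜ 1))) * ((ptR M (pt₁ (K := K) (B := B))).hom b *
      ((ptR M (pt₂ (K := K) (B := B))).hom c * (ptR M (pt₃ (K := K) (B := B))).hom d))) =
      f m * (X b * (Y c * Z d)) := by
  rw [ptR₁_hom, ptR₂_hom, ptR₃_hom, ← transfer_tmul]
  congr 1
  simp only [Algebra.TensorProduct.tmul_mul_tmul, one_mul, mul_one]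

theorem brk_mul {bul : B →ₗ[K] B →ₗ[K] K} (hb : IsBalanced bul) (X Y Y' Z YZ : B →ₐ[K] R)
    (hXY : ∀ b c, X b * Y c = Y c * X b) (hXZ : ∀ b c, X b * Z c = Z c * X b)
    (hYZ : ∀ b c, Y b * Z c = Z c * Y b) (p q : Cv K B R)
    (hq : ∀ b e, Y' b * q.ofConv e = q.ofConv e * Y b)
    (hm : AlgHom.cv YZ = AlgHom.cv Y * AlgHom.cv Z) (b : B) :
    brk bul (q + p * AlgHom.cv Z) X YZ b =
      AlgHom.cv Y' * brk bul q X Z b + brk bul p X Y b * AlgHom.cv Z := by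
  rw [← brk_mul_right_aux hb X Y Z YZ hXZ hYZ p hm (pt₀ (toConv (AlgHom.id K B))) (ptR B pt₁)
      (ptR B pt₂) (ptR B pt₃) (transfer p.ofConv X Y Z)
      (fun x y z w => transfer_pt p.ofConv X Y Z x y z w),
    ← brk_mul_left_aux bul X Y Y' Z YZ hXY q hq hm (pt₀ (toConv (AlgHom.id K B))) (ptR B pt₁)
      (ptR B pt₂) (ptR B pt₃) (transfer q.ofConv X Y Z)
      (fun x y z w => transfer_pt q.ofConv X Y Z x y z w)]
  refine Cv.ext fun c => ?_
  rw [ofConv_add, LinearMap.add_apply, brk_apply, brk_apply, brk_apply]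
  generalize uni bul b c = t
  refine LinearMap.congr_fun (f := tri (q + p * AlgHom.cv Z) (AlgHom.cv X) (AlgHom.cv YZ))
    (g := tri q (AlgHom.cv X) (AlgHom.cv YZ) +
      tri (p * AlgHom.cv Z) (AlgHom.cv X) (AlgHom.cv YZ))
      (TensorProduct.ext_threefold' fun x y z => ?_) t
  rw [LinearMap.add_apply, tri_tmul, tri_tmul, tri_tmul, ofConv_add, LinearMap.add_apply, add_mul]

theorem uni_mul {bul : B →ₗ[K] B →ₗ[K] K} (hd : ∀ b c d, bul (b * c) d =
    counit (R := K) b * bul c d + counit (R := K) c * bul b d) (b c d : B) :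
    uni bul b (c * d) = uni bul b c * (1 ⊗ₜ (1 ⊗ₜ d)) + uni bul b d * (1 ⊗ₜ (1 ⊗ₜ c)) := by
  obtain ⟨β⟩ := nonempty_sweedler₄ (K := K) b
  set F : B ⊗[K] B →ₗ[K] B ⊗[K] (B ⊗[K] B) := ∑ k, TensorProduct.lift (LinearMap.mk₂ K
    (fun c' c'' => bul c'' (β.el k 1) • ((HopfAlgebra.antipode K (β.el k 2) * β.el k 0) ⊗ₜ[K]
      (β.el k 3 ⊗ₜ[K] c')))
    (fun x y z => by simp only [TensorProduct.tmul_add, smul_add])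
    (fun x y z => by simp only [TensorProduct.tmul_smul, smul_comm x])
    (fun x y z => by simp only [map_add, LinearMap.add_apply, add_smul])
    (fun x y z => by simp only [map_smul, LinearMap.smul_apply, smul_assoc])) with hF
  have hF' : ∀ x y, F (x ⊗ₜ y) = ∑ k, bul y (β.el k 1) •
      ((HopfAlgebra.antipode K (β.el k 2) * β.el k 0) ⊗ₜ[K] (β.el k 3 ⊗ₜ[K] x)) := by
    intro x y
    simp [hF]
  have hu : ∀ c, uni bul b c = F (comul c) := by
    intro c
    obtain ⟨γ⟩ := nonempty_sweedler₂ (K := K) c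
    rw [uni_apply bul β γ, ← γ.sum_eq, map_sum, Finset.sum_comm]
    simp only [hF']
  have key : ∀ s t : B ⊗[K] B, F (s * t) =
      F s * (1 ⊗ₜ (1 ⊗ₜ TensorProduct.rid K B (counit.lTensor B t))) +
      F t * (1 ⊗ₜ (1 ⊗ₜ TensorProduct.rid K B (counit.lTensor B s))) := by
    intro s t
    induction s with
    | zero => simp
    | add s s' h h' =>
      simp only [add_mul, map_add, h, h', TensorProduct.tmul_add, mul_add]
      abel
    | tmul x y =>
      induction t with
      | zero => simp
      | add s s' h h' =>
        simp only [add_mul, map_add, h, h', TensorProduct.tmul_add, mul_add]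
        abel
      | tmul z w =>
        simp only [Algebra.TensorProduct.tmul_mul_tmul, hF', hd, LinearMap.lTensor_tmul,
          TensorProduct.rid_tmul, Finset.sum_mul, smul_mul_assoc, mul_one, add_smul,
          Finset.sum_add_distrib, TensorProduct.tmul_smul, mul_smul_comm]
        rw [Finset.smul_sum, Finset.smul_sum, add_comm]
        congr 1 <;> refine Finset.sum_congr rfl fun k _ => ?_
        · rw [smul_smul]
        · rw [smul_smul, mul_comm z]
  rw [hu, hu, hu, Bialgebra.comul_mul, key, lTensor_counit_comul, lTensor_counit_comul]
  simp

theorem brk_apply_mul {bul : B →ₗ[K] B →ₗ[K] K} (hd : ∀ b c d, bul (b * c) d =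
    counit (R := K) b * bul c d + counit (R := K) c * bul b d) (X Y Y' : B →ₐ[K] R)
    (hXY : ∀ b c, X b * Y c = Y c * X b) (hYY : ∀ b c, Y b * Y c = Y c * Y b) (p : Cv K B R)
    (hp : ∀ b e, Y' b * p.ofConv e = p.ofConv e * Y b) (b c d : B) :
    (brk bul p X Y b).ofConv (c * d) =
      Y' c * (brk bul p X Y b).ofConv d + (brk bul p X Y b).ofConv c * Y d := by
  have key : ∀ t d, tri p (AlgHom.cv X) (AlgHom.cv Y) (t * (1 ⊗ₜ (1 ⊗ₜ d))) =
      tri p (AlgHom.cv X) (AlgHom.cv Y) t * Y d := by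
    intro t d
    refine LinearMap.congr_fun (f := tri p (AlgHom.cv X) (AlgHom.cv Y) ∘ₗ
      LinearMap.mulRight K (1 ⊗ₜ (1 ⊗ₜ d))) (g := LinearMap.mulRight K (Y d) ∘ₗ
        tri p (AlgHom.cv X) (AlgHom.cv Y)) (TensorProduct.ext_threefold' fun x y z => ?_) t
    simp only [LinearMap.comp_apply, LinearMap.mulRight_apply, tri_tmul,
      Algebra.TensorProduct.tmul_mul_tmul, mul_one, AlgHom.cv_apply, map_mul, mul_assoc]
  have key' : ∀ t d, tri p (AlgHom.cv X) (AlgHom.cv Y) (t * (1 ⊗ₜ (1 ⊗ₜ d))) =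
      Y' d * tri p (AlgHom.cv X) (AlgHom.cv Y) t := by
    intro t d
    refine LinearMap.congr_fun (f := tri p (AlgHom.cv X) (AlgHom.cv Y) ∘ₗ
      LinearMap.mulRight K (1 ⊗ₜ (1 ⊗ₜ d))) (g := LinearMap.mulLeft K (Y' d) ∘ₗ
        tri p (AlgHom.cv X) (AlgHom.cv Y)) (TensorProduct.ext_threefold' fun x y z => ?_) t
    simp only [LinearMap.comp_apply, LinearMap.mulRight_apply, LinearMap.mulLeft_apply, tri_tmul,
      Algebra.TensorProduct.tmul_mul_tmul, mul_one, AlgHom.cv_apply, map_mul]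
    rw [← mul_assoc (Y' d), hp, mul_assoc, ← mul_assoc (Y d), ← hXY, mul_assoc, hYY]
  rw [brk_apply, uni_mul hd, map_add, key, key', add_comm]
  rfl

end Abstract

/-! ### The bracket of two generators -/

theorem tri_map {K B R R' : Type*} [CommRing K] [CommRing B] [HopfAlgebra K B] [Ring R]
    [Algebra K R] [Ring R'] [Algebra K R'] (f : R →ₐ[K] R') (p q r : Cv K B R)
    (t : B ⊗[K] (B ⊗[K] B)) :
    f (tri p q r t) = tri (toConv (f.toLinearMap ∘ₗ p.ofConv)) (toConv (f.toLinearMap ∘ₗ q.ofConv))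
      (toConv (f.toLinearMap ∘ₗ r.ofConv)) t := by
  refine LinearMap.congr_fun (f := f.toLinearMap ∘ₗ tri p q r)
    (TensorProduct.ext_threefold' fun x y z => ?_) t
  simp

theorem conv_even_comm {K A B C : Type*} [CommRing K] [Ring A] [Algebra K A]
    (𝒜 : ℤ → Submodule K A) [GradedAlgebra 𝒜] [Coalgebra K A] [CommRing B] [HopfAlgebra K B]
    [AddCommGroup C] [Module K C] [Coalgebra K C] {α : Parity K C} (hα : α.Cocomm) {f g : WithConv (C →ₗ[K] RepAlg 𝒜 B)}
    (hf : α.HasParity (repParity 𝒜 B) 0 f.ofConv) (hg : α.HasParity (repParity 𝒜 B) 0 g.ofConv) :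
    f * g = g * f := by
  rw [Parity.conv_comm_even hα (isSuperComm 𝒜 B) hg hf, Parity.pull_twHom_zero]

section Pair

variable {K A : Type*} [CommRing K] [Ring A] [Algebra K A]
variable (𝒜 : ℤ → Submodule K A) [GradedAlgebra 𝒜] [Coalgebra K A] [GradedHopfAlgebra 𝒜]
variable (B : Type*) [CommRing B] [HopfAlgebra K B]

/-- The signed tensor square. -/
abbrev Dbl : Type _ := SProd (hopfParity 𝒜) (hopfParity 𝒜)

/-- The parity of the signed tensor square. -/
abbrev dblParity : Parity K (Dbl 𝒜) := (hopfParity 𝒜).prod (hopfParity 𝒜)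

/-- The maps `x ↦ ± x_b`. -/
def chiTw (q : ZMod 2) : B →ₐ[K] WithConv (A →ₗ[K] RepAlg 𝒜 B) :=
  (Parity.pull _ ((hopfParity 𝒜).twHom q)).comp (chi 𝒜 B)

theorem chiTw_apply (q : ZMod 2) (b : B) (x : A) :
    (chiTw 𝒜 B q b).ofConv x = gen 𝒜 B ((hopfParity 𝒜).tw q x) b := rfl

theorem chiTw_zero (b : B) : chiTw 𝒜 B 0 b = chi 𝒜 B b := Parity.pull_twHom_zero _

theorem chiTw_hasParity (q : ZMod 2) (b : B) :
    (hopfParity 𝒜).HasParity (repParity 𝒜 B) 0 (chiTw 𝒜 B q b).ofConv :=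
  (chi_hasParity 𝒜 B b).tw q

theorem pull_tw_chiTw (q r : ZMod 2) (b : B) :
    Parity.pull _ ((hopfParity 𝒜).twHom q) (chiTw 𝒜 B r b) = chiTw 𝒜 B (r + q) b :=
  Parity.pull_twHom_twHom _ _ _

/-- The maps `x ⊗ m ↦ ± x_b ε(m)`. -/
def genFst {M : Type*} [AddCommGroup M] [Module K M] [Coalgebra K M] (β : Parity K M)
    (q : ZMod 2) : B →ₐ[K] WithConv (SProd (hopfParity 𝒜) β →ₗ[K] RepAlg 𝒜 B) :=
  (Parity.pull _ (Parity.fstHom _ _)).comp (chiTw 𝒜 B q)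

/-- The maps `x ⊗ y ↦ ± ε(x) y_b`. -/
def genSnd (q : ZMod 2) : B →ₐ[K] WithConv (Dbl 𝒜 →ₗ[K] RepAlg 𝒜 B) :=
  (Parity.pull _ (Parity.sndHom _ _)).comp (chiTw 𝒜 B q)

theorem genFst_apply {M : Type*} [AddCommGroup M] [Module K M] [Coalgebra K M] (β : Parity K M)
    (q : ZMod 2) (b : B) : genFst 𝒜 B β q b = Parity.pull _ (Parity.fstHom _ _) (chiTw 𝒜 B q b) :=
  rfl

theorem genSnd_apply (q : ZMod 2) (b : B) :
    genSnd 𝒜 B q b = Parity.pull _ (Parity.sndHom _ _) (chiTw 𝒜 B q b) := rfl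

theorem genFst_hasParity {M : Type*} [AddCommGroup M] [Module K M] [Coalgebra K M]
    (β : Parity K M) (q : ZMod 2) (b : B) :
    ((hopfParity 𝒜).prod β).HasParity (repParity 𝒜 B) 0 (genFst 𝒜 B β q b).ofConv :=
  (chiTw_hasParity 𝒜 B q b).comp Parity.fstHom_odd

theorem genSnd_hasParity (q : ZMod 2) (b : B) :
    (dblParity 𝒜).HasParity (repParity 𝒜 B) 0 (genSnd 𝒜 B q b).ofConv :=
  (chiTw_hasParity 𝒜 B q b).comp Parity.sndHom_odd

theorem pull_tw_genFst {M : Type*} [AddCommGroup M] [Module K M] [Coalgebra K M]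
    (β : Parity K M) (q r : ZMod 2) (b : B) :
    Parity.pull _ (((hopfParity 𝒜).prod β).twHom q) (genFst 𝒜 B β r b) =
      genFst 𝒜 B β (r + q) b := by
  rw [genFst_apply, genFst_apply, ← pull_tw_chiTw]
  exact WithConv.ext (LinearMap.ext fun c => congrArg (chiTw 𝒜 B r b).ofConv
    (Parity.tw_of_odd Parity.fstHom_odd q c).symm)

theorem pull_tw_genSnd (q r : ZMod 2) (b : B) :
    Parity.pull _ ((dblParity 𝒜).twHom q) (genSnd 𝒜 B r b) = genSnd 𝒜 B (r + q) b := by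
  rw [genSnd_apply, genSnd_apply, ← pull_tw_chiTw]
  exact WithConv.ext (LinearMap.ext fun c => congrArg (chiTw 𝒜 B r b).ofConv
    (Parity.tw_of_odd Parity.sndHom_odd q c).symm)

variable {𝒜} in
theorem dblParity_cocomm (hA : IsGradedCocommutative 𝒜) : (dblParity 𝒜).Cocomm :=
  (hopfParity_cocomm 𝒜 hA).prod (hopfParity_cocomm 𝒜 hA)

variable (ρ : A →ₗ[K] A →ₗ[K] A)

/-- A pairing as a map on the signed tensor square. -/
def pairing : Dbl 𝒜 →ₗ[K] A :=
  TensorProduct.lift ρ ∘ₗ ((hopfParity 𝒜).sp (hopfParity 𝒜)).symm.toLinearMap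

theorem pairing_stmul (x y : A) :
    pairing 𝒜 ρ ((hopfParity 𝒜).stmul (hopfParity 𝒜) x y) = ρ x y :=
  TensorProduct.lift.tmul (f' := ρ) x y

/-- The signed flip of the signed tensor square. -/
def flipDbl : Dbl 𝒜 →ₗ[K] Dbl 𝒜 :=
  ((hopfParity 𝒜).sp (hopfParity 𝒜)).toLinearMap ∘ₗ (hopfParity 𝒜).sflip ∘ₗ
    ((hopfParity 𝒜).sp (hopfParity 𝒜)).symm.toLinearMap

theorem flipDbl_stmul {i j : ZMod 2} {x y : A} (hx : (hopfParity 𝒜).IsHom i x)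
    (hy : (hopfParity 𝒜).IsHom j y) :
    flipDbl 𝒜 ((hopfParity 𝒜).stmul (hopfParity 𝒜) x y) =
      sgn K (i * j) • (hopfParity 𝒜).stmul (hopfParity 𝒜) y x :=
  Parity.sflip_tmul _ hx hy

/-- The maps `x ⊗ y ↦ ρ(x, y)_b`. -/
def rhoConv : Cv K B (WithConv (Dbl 𝒜 →ₗ[K] RepAlg 𝒜 B)) := toConv
  { toFun := fun b => toConv ((gen 𝒜 B).flip b ∘ₗ pairing 𝒜 ρ)
    map_add' := fun b c => by rw [map_add]; rfl
    map_smul' := fun k b => by rw [map_smul]; rfl }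

theorem rhoConv_apply (b : B) (x y : A) :
    ((rhoConv 𝒜 B ρ).ofConv b).ofConv ((hopfParity 𝒜).stmul (hopfParity 𝒜) x y) =
      gen 𝒜 B (ρ x y) b :=
  congrArg ((gen 𝒜 B).flip b) (pairing_stmul 𝒜 ρ x y)

/-- The maps `x ⊗ y ↦ (-1) ^ (|x|ₙ |y|ₙ) ρ(y, x)_b`. -/
def rhoConv' (n : ZMod 2) : Cv K B (WithConv (Dbl 𝒜 →ₗ[K] RepAlg 𝒜 B)) := toConv
  { toFun := fun b => toConv (((rhoConv 𝒜 B ρ).ofConv b).ofConv ∘ₗ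
      (sgn K n • (flipDbl 𝒜 ∘ₗ (dblParity 𝒜).tw n)))
    map_add' := fun b c => by rw [map_add]; rfl
    map_smul' := fun k b => by rw [map_smul]; rfl }

theorem rhoConv'_apply (n : ZMod 2) (b : B) {i j : ZMod 2} {x y : A}
    (hx : (hopfParity 𝒜).IsHom i x) (hy : (hopfParity 𝒜).IsHom j y) :
    ((rhoConv' 𝒜 B ρ n).ofConv b).ofConv ((hopfParity 𝒜).stmul (hopfParity 𝒜) x y) =
      sgn K ((i + n) * (j + n)) • gen 𝒜 B (ρ y x) b := by
  change ((rhoConv 𝒜 B ρ).ofConv b).ofConv (sgn K n • (flipDbl 𝒜 ((dblParity 𝒜).tw n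
    ((hopfParity 𝒜).stmul (hopfParity 𝒜) x y)))) = _
  rw [(hx.stmul hy).tw, map_smul, map_smul (flipDbl 𝒜), flipDbl_stmul _ hx hy, map_smul, map_smul,
    rhoConv_apply, smul_smul, smul_smul, ← sgn_add, ← sgn_add]
  congr 2
  clear hx hy
  revert i j n
  decide

variable {𝒜 ρ} {n : ℤ}

theorem IsFoxPairing.gen_mem (hρ : IsFoxPairing 𝒜 n ρ) {i j : ZMod 2} {x y : A}
    (hx : (hopfParity 𝒜).IsHom i x) (hy : (hopfParity 𝒜).IsHom j y) (b : B) :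
    gen 𝒜 B (ρ x y) b ∈ repParity 𝒜 B (i + j + n) := by
  refine hopfParity_hom_mem 𝒜 hx _ ((gen 𝒜 B).flip b ∘ₗ ρ.flip y) _ fun p hp x hx => ?_
  refine hopfParity_hom_mem 𝒜 hy _ ((gen 𝒜 B).flip b ∘ₗ ρ x) _ fun q hq y hy => ?_
  rw [← hp, ← hq]
  exact_mod_cast gen_mem_repParity 𝒜 B (hρ.map_mem p q x y hx hy) b

theorem rhoConv_hasParity (hρ : IsFoxPairing 𝒜 n ρ) (b : B) :
    (dblParity 𝒜).HasParity (repParity 𝒜 B) n ((rhoConv 𝒜 B ρ).ofConv b).ofConv :=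
  Parity.hasParity_of_stmul fun i j x y hx hy => by
    rw [rhoConv_apply]
    exact hρ.gen_mem B hx hy b

theorem rhoConv'_hasParity (hρ : IsFoxPairing 𝒜 n ρ) (b : B) :
    (dblParity 𝒜).HasParity (repParity 𝒜 B) n ((rhoConv' 𝒜 B ρ n).ofConv b).ofConv :=
  Parity.hasParity_of_stmul fun i j x y hx hy => by
    rw [rhoConv'_apply 𝒜 B ρ n b hx hy, add_comm i j]
    exact Submodule.smul_mem _ _ (hρ.gen_mem B hy hx b)

variable (ρ) in
theorem rhoConv_mul_apply {x y : A} (X : (hopfParity 𝒜).HomExpansion (comul (R := K) x))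
    (Y : (hopfParity 𝒜).HomExpansion (comul (R := K) y)) (m : ZMod 2) (b c d : B) :
    ((rhoConv 𝒜 B ρ).ofConv b * (genFst 𝒜 B (hopfParity 𝒜) m c * genSnd 𝒜 B 0 d)).ofConv
      ((hopfParity 𝒜).stmul (hopfParity 𝒜) x y) =
      ∑ i, ∑ j, sgn K (X.deg₂ i * (Y.deg₁ j + m)) • (gen 𝒜 B (ρ (X.fst i) (Y.fst j)) b *
        (gen 𝒜 B (X.snd i) c * gen 𝒜 B (Y.snd j) d)) := by
  rw [← mul_assoc, genSnd_apply, Parity.mul_pull_snd_apply x Y, Finset.sum_comm]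
  refine Finset.sum_congr rfl fun j _ => ?_
  rw [genFst_apply, Parity.mul_pull_fst_apply X, Finset.sum_mul]
  refine Finset.sum_congr rfl fun i _ => ?_
  rw [chiTw_apply, chiTw_apply, (Y.fst_hom j).tw, (X.snd_hom i).tw, Parity.tw_zero, map_smul,
    map_smul, rhoConv_apply, LinearMap.id_apply, map_smul, LinearMap.smul_apply,
    smul_mul_smul_comm, smul_mul_assoc, ← sgn_add, mul_assoc]
  congr 2
  ring

theorem rhoConv'_mul_apply (ρ : A →ₗ[K] A →ₗ[K] A) (m : ZMod 2) {p q : ZMod 2} {x y : A}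
    (hx : (hopfParity 𝒜).IsHom p x) (hy : (hopfParity 𝒜).IsHom q y) (b c d : B) :
    ((rhoConv' 𝒜 B ρ m).ofConv b * (genSnd 𝒜 B 0 c * genFst 𝒜 B (hopfParity 𝒜) m d)).ofConv
      ((hopfParity 𝒜).stmul (hopfParity 𝒜) x y) =
      sgn K ((p + m) * (q + m)) •
      ((rhoConv 𝒜 B ρ).ofConv b * (genFst 𝒜 B (hopfParity 𝒜) m c * genSnd 𝒜 B 0 d)).ofConv
      ((hopfParity 𝒜).stmul (hopfParity 𝒜) y x) := by
  obtain ⟨X, hX⟩ := hx.exists_expansion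
  obtain ⟨Y, hY⟩ := hy.exists_expansion
  rw [rhoConv_mul_apply B ρ Y X, Finset.sum_comm, ← mul_assoc, genFst_apply,
    Parity.mul_pull_fst_apply X, Finset.smul_sum]
  refine Finset.sum_congr rfl fun i _ => ?_
  rw [hy.tw, map_smul, map_smul, genSnd_apply, Parity.mul_pull_snd_apply _ Y, Finset.smul_sum,
    Finset.sum_mul, Finset.smul_sum]
  refine Finset.sum_congr rfl fun j _ => ?_
  rw [rhoConv'_apply 𝒜 B ρ m b (X.fst_hom i) (Y.fst_hom j), chiTw_apply, chiTw_apply,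
    (X.snd_hom i).tw, Parity.tw_zero, LinearMap.id_apply, map_smul, LinearMap.smul_apply,
    smul_mul_assoc, smul_mul_assoc, smul_mul_assoc, mul_smul_comm, smul_smul, smul_smul, smul_smul,
    ← sgn_add, ← sgn_add, ← sgn_add, mul_assoc, ← hX i, ← hY j]
  congr 2
  generalize X.deg₁ i = x₁
  generalize X.deg₂ i = x₂
  generalize Y.deg₁ j = y₁
  generalize Y.deg₂ j = y₂
  clear hx hy hX hY
  revert x₁ x₂ y₁ y₂ m
  decide

end Pair

/-- The composition with the antipode. -/
def Cv.antip {K B R : Type*} [CommRing K] [CommRing B] [HopfAlgebra K B] [Ring R] [Algebra K R]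
    (p : Cv K B R) : Cv K B R := toConv (p.ofConv ∘ₗ HopfAlgebra.antipode K)

/-- The map `b ↦ -Y(s(b')) q(b'') X(s(b'''))`. -/
def Cv.negConj {K B R : Type*} [CommRing K] [CommRing B] [HopfAlgebra K B] [Ring R] [Algebra K R]
    (Y : B →ₐ[K] R) (q : Cv K B R) (X : B →ₐ[K] R) : Cv K B R :=
  -((AlgHom.cv Y).antip * (q * (AlgHom.cv X).antip))

theorem brk_antisymm {K B R : Type*} [CommRing K] [CommRing B] [HopfAlgebra K B] [Ring R]
    [Algebra K R] {bul : B →ₗ[K] B →ₗ[K] K} (hb : IsBalanced bul) (X Y Y' : B →ₐ[K] R)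
    (hXY : ∀ b c, X b * Y c = Y c * X b) (p q : Cv K B R)
    (hq : ∀ b e, Y' b * q.ofConv e = q.ofConv e * Y b)
    (hp : p.antip = Cv.negConj Y' q X) (b c : B) :
    (brk bul p X Y b).ofConv c = -(brk bul q Y X c).ofConv b :=
  tri_uni_antisymm hb X Y Y' hXY p q hq hp b c

section Pair

variable {K A : Type*} [CommRing K] [Ring A] [Algebra K A]
variable {𝒜 : ℤ → Submodule K A} [GradedAlgebra 𝒜] [Coalgebra K A] [GradedHopfAlgebra 𝒜]
variable (B : Type*) [CommRing B] [HopfAlgebra K B]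
variable {ρ : A →ₗ[K] A →ₗ[K] A} {n : ℤ}

theorem dbl_ext {N : Type*} [AddCommGroup N] [Module K N] {f g : Dbl 𝒜 →ₗ[K] N}
    (h : ∀ p q x y, x ∈ 𝒜 p → y ∈ 𝒜 q → f ((hopfParity 𝒜).stmul (hopfParity 𝒜) x y) =
      g ((hopfParity 𝒜).stmul (hopfParity 𝒜) x y)) : f = g := by
  refine Parity.stmul_ext _ _ fun x y => ?_
  refine graded_induction 𝒜 (p := fun x => f ((hopfParity 𝒜).stmul (hopfParity 𝒜) x y) =
    g ((hopfParity 𝒜).stmul (hopfParity 𝒜) x y)) (fun p x hx => ?_)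
    (fun x x' h h' => by simp only [map_add, LinearMap.add_apply, h, h']) x
  exact graded_induction 𝒜 (p := fun y => f ((hopfParity 𝒜).stmul (hopfParity 𝒜) x y) =
    g ((hopfParity 𝒜).stmul (hopfParity 𝒜) x y)) (fun q y hy => h p q x y hx hy)
    (fun x x' h h' => by simp only [map_add, h, h']) y

theorem IsFoxPairing.antipode_antipode (hρ : IsFoxPairing 𝒜 n ρ) {x y : A}
    (X : (hopfParity 𝒜).HomExpansion (comul (R := K) x))
    (Y : (hopfParity 𝒜).HomExpansion (comul (R := K) y)) :
    ρ (GradedHopfAlgebra.antipode 𝒜 y) (GradedHopfAlgebra.antipode 𝒜 x) =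
      ∑ j, ∑ i, GradedHopfAlgebra.antipode 𝒜 (Y.fst j) * (ρ (Y.snd j) (X.fst i) *
        GradedHopfAlgebra.antipode 𝒜 (X.snd i)) := by
  rw [hρ.antipode_right, X.conv_apply, Finset.sum_comm, ← Finset.sum_neg_distrib]
  refine Finset.sum_congr rfl fun i _ => ?_
  change -(ρ (GradedHopfAlgebra.antipode 𝒜 y) (X.fst i) * _) = _
  rw [hρ.antipode_left, Y.conv_apply, neg_mul, neg_neg, Finset.sum_mul]
  exact Finset.sum_congr rfl fun j _ => mul_assoc _ _ _

theorem rhoConv'_conj_apply (ρ : A →ₗ[K] A →ₗ[K] A) (m : ZMod 2) {p q : ZMod 2} {x y : A}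
    (hx : (hopfParity 𝒜).IsHom p x)
    (X : (hopfParity 𝒜).HomExpansion (comul (R := K) x))
    (Y : (hopfParity 𝒜).HomExpansion (comul (R := K) y))
    (hX : ∀ i, X.deg₁ i + X.deg₂ i = p) (hY : ∀ i, Y.deg₁ i + Y.deg₂ i = q) (b c d : B) :
    (genSnd 𝒜 B m b * ((rhoConv' 𝒜 B ρ m).ofConv c * genFst 𝒜 B (hopfParity 𝒜) m d)).ofConv
      ((hopfParity 𝒜).stmul (hopfParity 𝒜) x y) =
      sgn K ((p + m) * (q + m)) • ∑ j, ∑ i, gen 𝒜 B (Y.fst j) b *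
        (gen 𝒜 B (ρ (Y.snd j) (X.fst i)) c * gen 𝒜 B (X.snd i) d) := by
  rw [genSnd_apply, Parity.pull_snd_mul_apply x Y, Finset.smul_sum]
  refine Finset.sum_congr rfl fun j _ => ?_
  rw [hx.tw, map_smul, LinearMap.smul_apply, map_smul, genFst_apply,
    Parity.mul_pull_fst_apply X, Finset.smul_sum, Finset.mul_sum, Finset.smul_sum]
  refine Finset.sum_congr rfl fun i _ => ?_
  rw [(Y.snd_hom j).tw, map_smul, map_smul, rhoConv'_apply 𝒜 B ρ m c (X.fst_hom i) (Y.snd_hom j),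
    chiTw_apply, chiTw_apply, (X.snd_hom i).tw, (Y.fst_hom j).tw, map_smul, map_smul,
    LinearMap.smul_apply, LinearMap.smul_apply]
  simp only [smul_mul_assoc, mul_smul_comm, smul_smul, ← sgn_add]
  congr 2
  rw [← hX i, ← hY j]
  generalize X.deg₁ i = x₁
  generalize X.deg₂ i = x₂
  generalize Y.deg₁ j = y₁
  generalize Y.deg₂ j = y₂
  clear hx hX hY
  revert x₁ x₂ y₁ y₂ m
  decide

theorem rhoConv_antipode (hA : IsGradedCocommutative 𝒜) (hρ : IsFoxPairing 𝒜 n ρ)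
    (hρa : IsAntisymmetricFoxPairing 𝒜 n ρ) :
    (rhoConv 𝒜 B ρ).antip = Cv.negConj (genSnd 𝒜 B n) (rhoConv' 𝒜 B ρ n)
      (genFst 𝒜 B (hopfParity 𝒜) n) := by
  refine Cv.ext fun e => WithConv.ext (dbl_ext fun p q x y hx hy => ?_)
  obtain ⟨X, hX⟩ := (isHom_of_mem 𝒜 hx).exists_expansion
  obtain ⟨Y, hY⟩ := (isHom_of_mem 𝒜 hy).exists_expansion
  have e₁ : gen 𝒜 B (ρ (GradedHopfAlgebra.antipode 𝒜 y) (GradedHopfAlgebra.antipode 𝒜 x)) e =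
      ∑ j, ∑ i, ((toConv (gen 𝒜 B (Y.fst j) ∘ₗ HopfAlgebra.antipode K) *
        (toConv (gen 𝒜 B (ρ (Y.snd j) (X.fst i))) *
          toConv (gen 𝒜 B (X.snd i) ∘ₗ HopfAlgebra.antipode K)) :
            Cv K B (RepAlg 𝒜 B))).ofConv e := by
    rw [hρ.antipode_antipode X Y]
    simp only [map_sum, LinearMap.sum_apply]
    refine Finset.sum_congr rfl fun j _ => Finset.sum_congr rfl fun i _ => ?_
    have h : ∀ x, toConv (gen 𝒜 B x ∘ₗ HopfAlgebra.antipode K) =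
        genConv 𝒜 B (GradedHopfAlgebra.antipode 𝒜 x) := fun x =>
      Cv.ext fun b => (gen_antipode 𝒜 x b).symm
    rw [h, h]
    change _ = (_ * (genConv 𝒜 B _ * _) : Cv K B (RepAlg 𝒜 B)).ofConv e
    rw [← genConv_mul, ← genConv_mul]
    rfl
  have e₂ : ((rhoConv 𝒜 B ρ).ofConv (HopfAlgebra.antipode K e)).ofConv
      ((hopfParity 𝒜).stmul (hopfParity 𝒜) x y) =
      -(sgn K (((p : ZMod 2) + n) * (q + n)) • gen 𝒜 B (ρ (GradedHopfAlgebra.antipode 𝒜 y)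
        (GradedHopfAlgebra.antipode 𝒜 x)) e) := by
    rw [rhoConv_apply, ← gen_antipode, hρa.apply hA hx hy, map_neg, map_smul]
    rfl
  refine e₂.trans ?_
  rw [e₁]
  have h₁ : ∀ a, ((AlgHom.cv (genSnd 𝒜 B n)).antip.ofConv ((ℛ K e).left a) *
      (rhoConv' 𝒜 B ρ n * (AlgHom.cv (genFst 𝒜 B (hopfParity 𝒜) n)).antip).ofConv
        ((ℛ K e).right a)).ofConv ((hopfParity 𝒜).stmul (hopfParity 𝒜) x y) =
      sgn K (((p : ZMod 2) + n) * (q + n)) • ∑ j, ∑ i,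
        gen 𝒜 B (Y.fst j) (HopfAlgebra.antipode K ((ℛ K e).left a)) *
        (toConv (gen 𝒜 B (ρ (Y.snd j) (X.fst i))) *
          toConv (gen 𝒜 B (X.snd i) ∘ₗ HopfAlgebra.antipode K) : Cv K B (RepAlg 𝒜 B)).ofConv
            ((ℛ K e).right a) := by
    intro a
    simp only [Cv.mul_apply (ℛ K ((ℛ K e).right a)), Finset.mul_sum, ofConv_sum,
      LinearMap.sum_apply]
    refine (Finset.sum_congr rfl fun i _ => rhoConv'_conj_apply B ρ n (isHom_of_mem 𝒜 hx) X Y hX hY _ _ _).trans ?_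
    rw [← Finset.smul_sum, Finset.sum_comm]
    congr 1
    refine Finset.sum_congr rfl fun j _ => ?_
    rw [Finset.sum_comm]
    rfl
  have h₂ : (((AlgHom.cv (genSnd 𝒜 B n)).antip * (rhoConv' 𝒜 B ρ n *
      (AlgHom.cv (genFst 𝒜 B (hopfParity 𝒜) n)).antip)).ofConv e).ofConv
        ((hopfParity 𝒜).stmul (hopfParity 𝒜) x y) =
      sgn K (((p : ZMod 2) + n) * (q + n)) • ∑ a ∈ (ℛ K e).index, ∑ j, ∑ i,
        gen 𝒜 B (Y.fst j) (HopfAlgebra.antipode K ((ℛ K e).left a)) *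
        (toConv (gen 𝒜 B (ρ (Y.snd j) (X.fst i))) *
          toConv (gen 𝒜 B (X.snd i) ∘ₗ HopfAlgebra.antipode K) : Cv K B (RepAlg 𝒜 B)).ofConv
            ((ℛ K e).right a) := by
    rw [Cv.mul_apply (ℛ K e), ofConv_sum, LinearMap.sum_apply, Finset.smul_sum]
    exact Finset.sum_congr rfl fun a _ => h₁ a
  refine congrArg Neg.neg (Eq.trans (congrArg (sgn K (((p : ZMod 2) + n) * (q + n)) • ·) ?_)
    h₂.symm)
  refine Eq.trans (Finset.sum_congr rfl fun j _ => ?_) Finset.sum_comm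
  refine Eq.trans (Finset.sum_congr rfl fun i _ => ?_) Finset.sum_comm
  rw [Cv.mul_apply (ℛ K e)]
  rfl

end Pair

namespace Parity

variable {K C M N S : Type*} [CommRing K] [AddCommGroup C] [Module K C] [AddCommGroup M] [Module K M]
variable [AddCommGroup N] [Module K N]
variable [Coalgebra K C] [Coalgebra K M] [Coalgebra K N] [Ring S] [Algebra K S]
variable {α : Parity K C} {β : Parity K M} {γ : Parity K N}

theorem pull_tw_snd (q : ZMod 2) (u : WithConv (M →ₗ[K] S)) :
    pull S ((α.prod β).twHom q) (pull S (sndHom α β) u) =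
      pull S (sndHom α β) (pull S (β.twHom q) u) :=
  WithConv.ext (LinearMap.ext fun c => congrArg u.ofConv (tw_of_odd sndHom_odd q c).symm)

theorem mapSnd_odd {φ : M →ₗc[K] N} (h : ∀ d, γ.odd (φ d) = φ (β.odd d))
    (hφ : ∀ d, φ (β.tw 1 d) = γ.tw 1 (φ d)) (c : SProd α β) :
    (α.prod γ).odd (mapSnd α β γ φ hφ c) = mapSnd α β γ φ hφ ((α.prod β).odd c) := by
  refine LinearMap.congr_fun (f := (α.prod γ).odd ∘ₗ (mapSnd α β γ φ hφ).toLinearMap)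
    (g := (mapSnd α β γ φ hφ).toLinearMap ∘ₗ (α.prod β).odd) (stmul_ext α β fun c m => ?_) c
  change sodd α γ (mapSnd α β γ φ hφ (stmul α β c m)) =
    mapSnd α β γ φ hφ (sodd α β (stmul α β c m))
  simp only [Parity.sodd_stmul, map_add, mapSnd_stmul, even_apply, map_sub, LinearMap.sub_apply, h]

end Parity

section GenBracket

variable {K A : Type*} [CommRing K] [Ring A] [Algebra K A]
variable (𝒜 : ℤ → Submodule K A) [GradedAlgebra 𝒜] [Coalgebra K A] [GradedHopfAlgebra 𝒜]
variable (B : Type*) [CommRing B] [HopfAlgebra K B]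
variable (ρ : A →ₗ[K] A →ₗ[K] A) (n : ℤ) (bul : B →ₗ[K] B →ₗ[K] K)

/-- The bracket of two generators as a map on the signed tensor square. -/
def pairBrk (b : B) : Cv K B (WithConv (Dbl 𝒜 →ₗ[K] RepAlg 𝒜 B)) :=
  brk bul (rhoConv 𝒜 B ρ) (genFst 𝒜 B (hopfParity 𝒜) n) (genSnd 𝒜 B 0) b

/-- The bracket of two generators. -/
def genBrk : A →ₗ[K] B →ₗ[K] A →ₗ[K] B →ₗ[K] RepAlg 𝒜 B :=
  LinearMap.mk₂ K (fun x b => LinearMap.mk₂ K (fun y c => ((pairBrk 𝒜 B ρ n bul b).ofConv c).ofConv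
      ((hopfParity 𝒜).stmul (hopfParity 𝒜) x y))
      (fun y y' c => by simp only [map_add])
      (fun k y c => by simp only [map_smul])
      (fun y c c' => by rw [map_add]; rfl)
      (fun k y c => by rw [map_smul]; rfl))
    (fun x x' b => by ext y c; simp)
    (fun k x b => by ext y c; simp)
    (fun x b b' => by
      ext y c
      simp only [LinearMap.mk₂_apply, LinearMap.add_apply, pairBrk, brk_apply, map_add]
      rfl)
    (fun k x b => by
      ext y c
      simp only [LinearMap.mk₂_apply, LinearMap.smul_apply, pairBrk, brk_apply, map_smul]
      rfl)

theorem genBrk_apply (x y : A) (b c : B) : genBrk 𝒜 B ρ n bul x b y c =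
    ((pairBrk 𝒜 B ρ n bul b).ofConv c).ofConv ((hopfParity 𝒜).stmul (hopfParity 𝒜) x y) := rfl

theorem genBrk_eq_sum {x y : A} {b c : B} (X : (hopfParity 𝒜).HomExpansion (comul (R := K) x))
    (Y : (hopfParity 𝒜).HomExpansion (comul (R := K) y)) (β : Sweedler₄ (K := K) b)
    (γ : Sweedler₂ (K := K) c) :
    genBrk 𝒜 B ρ n bul x b y c = ∑ i, ∑ j, ∑ k, ∑ l,
      sgn K (X.deg₂ i * (Y.deg₁ j + n)) • bul (γ.el l 1) (β.el k 1) •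
          (gen 𝒜 B (ρ (X.fst i) (Y.fst j)) (HopfAlgebra.antipode K (β.el k 2) * β.el k 0) *
            gen 𝒜 B (X.snd i) (β.el k 3) * gen 𝒜 B (Y.snd j) (γ.el l 0)) := by
  have h : ((pairBrk 𝒜 B ρ n bul b).ofConv c).ofConv
      ((hopfParity 𝒜).stmul (hopfParity 𝒜) x y) = ∑ k, ∑ l, bul (γ.el l 1) (β.el k 1) •
      ((rhoConv 𝒜 B ρ).ofConv (HopfAlgebra.antipode K (β.el k 2) * β.el k 0) *
        (genFst 𝒜 B (hopfParity 𝒜) n (β.el k 3) * genSnd 𝒜 B 0 (γ.el l 0))).ofConv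
          ((hopfParity 𝒜).stmul (hopfParity 𝒜) x y) := by
    rw [pairBrk, brk_apply, uni_apply bul β γ]
    simp only [map_sum, map_smul, tri_tmul, AlgHom.cv_apply, ofConv_sum, LinearMap.sum_apply,
      ofConv_smul, LinearMap.smul_apply]
  rw [genBrk_apply, h]
  simp only [rhoConv_mul_apply B ρ X Y, Finset.smul_sum]
  have e : ∀ (f : Fin β.size → Fin γ.size → Fin X.size → Fin Y.size → RepAlg 𝒜 B),
      ∑ k, ∑ l, ∑ i, ∑ j, f k l i j = ∑ i, ∑ j, ∑ k, ∑ l, f k l i j := by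
    intro f
    calc _ = ∑ k, ∑ i, ∑ l, ∑ j, f k l i j := Finset.sum_congr rfl fun _ _ => Finset.sum_comm
      _ = ∑ i, ∑ k, ∑ l, ∑ j, f k l i j := Finset.sum_comm
      _ = ∑ i, ∑ k, ∑ j, ∑ l, f k l i j := Finset.sum_congr rfl fun _ _ =>
        Finset.sum_congr rfl fun _ _ => Finset.sum_comm
      _ = _ := Finset.sum_congr rfl fun _ _ => Finset.sum_comm
  rw [e]
  refine Finset.sum_congr rfl fun i _ => Finset.sum_congr rfl fun j _ =>
    Finset.sum_congr rfl fun k _ => Finset.sum_congr rfl fun l _ => ?_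
  rw [smul_comm, mul_assoc]

variable {𝒜 B ρ n bul}

theorem exists_expansion₂ {p : ℤ} {x : A} (hx : x ∈ 𝒜 p) :
    ∃ X : Expansion₂ 𝒜 (comul (R := K) x), ∀ i, X.deg₁ i + X.deg₂ i = p := by
  have h := GradedHopfAlgebra.comul_mem (𝒜 := 𝒜) p x hx
  generalize comul (R := K) x = t at h
  have zero : ∃ X : Expansion₂ 𝒜 (0 : A ⊗[K] A), ∀ i, X.deg₁ i + X.deg₂ i = p :=
    ⟨⟨0, nofun, nofun, nofun, nofun, nofun, nofun, by simp⟩, nofun⟩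
  have add : ∀ s t : A ⊗[K] A, (∃ X : Expansion₂ 𝒜 s, ∀ i, X.deg₁ i + X.deg₂ i = p) →
      (∃ X : Expansion₂ 𝒜 t, ∀ i, X.deg₁ i + X.deg₂ i = p) →
      ∃ X : Expansion₂ 𝒜 (s + t), ∀ i, X.deg₁ i + X.deg₂ i = p := by
    rintro s t ⟨X, hX⟩ ⟨Y, hY⟩
    refine ⟨⟨X.size + Y.size, Fin.append X.fst Y.fst, Fin.append X.snd Y.snd,
      Fin.append X.deg₁ Y.deg₁, Fin.append X.deg₂ Y.deg₂, fun i => ?_, fun i => ?_, ?_⟩,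
      fun i => ?_⟩
    · refine Fin.addCases (fun i => ?_) (fun i => ?_) i
      · simpa using X.fst_mem i
      · simpa using Y.fst_mem i
    · refine Fin.addCases (fun i => ?_) (fun i => ?_) i
      · simpa using X.snd_mem i
      · simpa using Y.snd_mem i
    · simp [Fin.sum_univ_add, X.sum_eq, Y.sum_eq]
    · refine Fin.addCases (fun i => ?_) (fun i => ?_) i
      · simpa using hX i
      · simpa using hY i
  induction h using Submodule.iSup_induction' with
  | zero => exact zero
  | add s t _ _ hs ht => exact add s t hs ht
  | mem u t ht =>
    obtain ⟨t, rfl⟩ := ht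
    induction t with
    | zero =>
      rw [map_zero]
      exact zero
    | add s t hs ht =>
      rw [map_add]
      exact add _ _ hs ht
    | tmul y z =>
      exact ⟨⟨1, fun _ => y, fun _ => z, fun _ => u, fun _ => p - u, fun _ => y.2, fun _ => z.2,
        by simp⟩, fun _ => add_sub_cancel _ _⟩

theorem genBrk_mem (hρ : IsFoxPairing 𝒜 n ρ) {p q : ℤ} {x y : A} (hx : x ∈ 𝒜 p) (hy : y ∈ 𝒜 q)
    (b c : B) : genBrk 𝒜 B ρ n bul x b y c ∈ repGrading 𝒜 B (p + q + n) := by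
  obtain ⟨X, hX⟩ := exists_expansion₂ hx
  obtain ⟨Y, hY⟩ := exists_expansion₂ hy
  obtain ⟨β⟩ := nonempty_sweedler₄ (K := K) b
  obtain ⟨γ⟩ := nonempty_sweedler₂ (K := K) c
  rw [genBrk_eq_sum 𝒜 B ρ n bul (X.hom) (Y.hom) β γ]
  refine Submodule.sum_mem _ fun i _ => Submodule.sum_mem _ fun j _ => Submodule.sum_mem _
    fun k _ => Submodule.sum_mem _ fun l _ => Submodule.smul_mem _ _ (Submodule.smul_mem _ _ ?_)
  have h : p + q + n = X.deg₁ i + Y.deg₁ j + n + X.deg₂ i + Y.deg₂ j := by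
    rw [← hX i, ← hY j]
    ring
  rw [h]
  exact SetLike.mul_mem_graded (SetLike.mul_mem_graded (gen_mem 𝒜 B (hρ.map_mem _ _ _ _
    (X.fst_mem i) (Y.fst_mem j)) _) (gen_mem 𝒜 B (X.snd_mem i) _)) (gen_mem 𝒜 B (Y.snd_mem j) _)

theorem genBrk_antisymm (hA : IsGradedCocommutative 𝒜) (hρ : IsFoxPairing 𝒜 n ρ)
    (hρa : IsAntisymmetricFoxPairing 𝒜 n ρ) (hb : IsBalanced bul) {p q : ℤ} {x y : A}
    (hx : x ∈ 𝒜 p) (hy : y ∈ 𝒜 q) (b c : B) : genBrk 𝒜 B ρ n bul x b y c =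
      -(sgn K (((p : ZMod 2) + n) * (q + n)) • genBrk 𝒜 B ρ n bul y c x b) := by
  have h₁ := rhoConv_antipode B hA hρ hρa
  have h₂ : ∀ b e, genSnd 𝒜 B n b * (rhoConv' 𝒜 B ρ n).ofConv e =
      (rhoConv' 𝒜 B ρ n).ofConv e * genSnd 𝒜 B 0 b := fun b e => by
    rw [Parity.conv_comm_even (dblParity_cocomm hA) (isSuperComm 𝒜 B)
      (genSnd_hasParity 𝒜 B 0 b) (rhoConv'_hasParity B hρ e), pull_tw_genSnd, zero_add]
  have h₃ : ∀ b c, genFst 𝒜 B (hopfParity 𝒜) n b * genSnd 𝒜 B 0 c =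
      genSnd 𝒜 B 0 c * genFst 𝒜 B (hopfParity 𝒜) n b := fun b c =>
    conv_even_comm 𝒜 (dblParity_cocomm hA) (genFst_hasParity 𝒜 B _ _ _)
      (genSnd_hasParity 𝒜 B _ _)
  have h := brk_antisymm hb _ _ _ h₃ _ _ h₂ h₁ b c
  have h' : ∀ t, (tri (rhoConv' 𝒜 B ρ n) (AlgHom.cv (genSnd 𝒜 B 0))
      (AlgHom.cv (genFst 𝒜 B (hopfParity 𝒜) n)) t).ofConv
        ((hopfParity 𝒜).stmul (hopfParity 𝒜) x y) =
      sgn K (((p : ZMod 2) + n) * (q + n)) • (tri (rhoConv 𝒜 B ρ) (AlgHom.cv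
        (genFst 𝒜 B (hopfParity 𝒜) n)) (AlgHom.cv (genSnd 𝒜 B 0)) t).ofConv
        ((hopfParity 𝒜).stmul (hopfParity 𝒜) y x) := by
    intro t
    induction t with
    | zero => simp
    | add s t hs ht => rw [map_add, map_add, ofConv_add, ofConv_add, LinearMap.add_apply,
        LinearMap.add_apply, hs, ht, smul_add]
    | tmul e t =>
      induction t with
      | zero => simp
      | add s t hs ht => rw [TensorProduct.tmul_add, map_add, map_add, ofConv_add, ofConv_add,
          LinearMap.add_apply, LinearMap.add_apply, hs, ht, smul_add]
      | tmul c d =>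
        rw [tri_tmul, tri_tmul]
        exact rhoConv'_mul_apply B ρ n (isHom_of_mem 𝒜 hx) (isHom_of_mem 𝒜 hy) e c d
  rw [genBrk_apply, genBrk_apply]
  refine (congrArg (fun f : WithConv (Dbl 𝒜 →ₗ[K] RepAlg 𝒜 B) => f.ofConv
    ((hopfParity 𝒜).stmul (hopfParity 𝒜) x y)) h).trans ?_
  exact congrArg Neg.neg (h' _)

end GenBracket

/-- The composition of a map with an algebra homomorphism. -/
def Cv.mapHom {K B R R' : Type*} [CommRing K] [CommRing B] [HopfAlgebra K B] [Ring R]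
    [Algebra K R] [Ring R'] [Algebra K R'] (f : R →ₐ[K] R') (p : Cv K B R) : Cv K B R' :=
  toConv (f.toLinearMap ∘ₗ p.ofConv)

theorem Cv.mapHom_apply {K B R R' : Type*} [CommRing K] [CommRing B] [HopfAlgebra K B] [Ring R]
    [Algebra K R] [Ring R'] [Algebra K R'] (f : R →ₐ[K] R') (p : Cv K B R) (b : B) :
    (Cv.mapHom f p).ofConv b = f (p.ofConv b) := rfl

section Commuting

variable {K B R : Type*} [CommRing K] [CommRing B] [HopfAlgebra K B] [Ring R] [Algebra K R]

/-- Homomorphisms with commuting values. -/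
def AreCommuting (X Y : B →ₐ[K] R) : Prop := ∀ b c, X b * Y c = Y c * X b

/-- A map intertwining two homomorphisms. -/
def IsIntertwining (q : Cv K B R) (Y Y' : B →ₐ[K] R) : Prop :=
  ∀ b e, Y' b * q.ofConv e = q.ofConv e * Y b

theorem brk_mul_of_areCommuting {bul : B →ₗ[K] B →ₗ[K] K} (hb : IsBalanced bul)
    {X Y Y' Z YZ : B →ₐ[K] R} (hXY : AreCommuting X Y) (hXZ : AreCommuting X Z)
    (hYZ : AreCommuting Y Z) {p q : Cv K B R} (hq : IsIntertwining q Y Y')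
    (hm : AlgHom.cv YZ = AlgHom.cv Y * AlgHom.cv Z) (b : B) :
    brk bul (q + p * AlgHom.cv Z) X YZ b =
      AlgHom.cv Y' * brk bul q X Z b + brk bul p X Y b * AlgHom.cv Z :=
  brk_mul hb X Y Y' Z YZ hXY hXZ hYZ p q hq hm b

end Commuting

theorem brk_map {K B R R' : Type*} [CommRing K] [CommRing B] [HopfAlgebra K B] [Ring R]
    [Algebra K R] [Ring R'] [Algebra K R'] (bul : B →ₗ[K] B →ₗ[K] K) (f : R →ₐ[K] R')
    (p : Cv K B R) (X Y : B →ₐ[K] R) (b c : B) :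
    f ((brk bul p X Y b).ofConv c) = (brk bul (Cv.mapHom f p) (f.comp X)
      (f.comp Y) b).ofConv c :=
  tri_map f _ _ _ _

namespace Parity

variable {K C M S : Type*} [CommRing K] [AddCommGroup C] [Module K C] [AddCommGroup M] [Module K M]
variable [Coalgebra K C] [Coalgebra K M] [Ring S] [Algebra K S] {α : Parity K C} {β : Parity K M}

theorem slice_ext {f g : WithConv (SProd α β →ₗ[K] S)} (h : ∀ c, slice f c = slice g c) : f = g :=
  WithConv.ext (stmul_ext _ _ fun c m =>
    congrArg (fun f : WithConv (M →ₗ[K] S) => f.ofConv m) (h c))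

theorem slice_add (f g : WithConv (SProd α β →ₗ[K] S)) (c : C) :
    slice (f + g) c = slice f c + slice g c := rfl

theorem slice_sum {ι : Type*} (s : Finset ι) (f : ι → WithConv (SProd α β →ₗ[K] S)) (c : C) :
    slice (∑ i ∈ s, f i) c = ∑ i ∈ s, slice (f i) c := by
  refine WithConv.ext (LinearMap.ext fun m => ?_)
  simp only [slice_apply, ofConv_sum, LinearMap.sum_apply]

theorem ext_stmul {f g : WithConv (SProd α β →ₗ[K] S)}
    (h : ∀ c m, f.ofConv (stmul α β c m) = g.ofConv (stmul α β c m)) : f = g :=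
  WithConv.ext (stmul_ext _ _ h)

end Parity

section Triple

variable {K A : Type*} [CommRing K] [Ring A] [Algebra K A]
variable (𝒜 : ℤ → Submodule K A) [GradedAlgebra 𝒜] [Coalgebra K A] [GradedHopfAlgebra 𝒜]
variable (B : Type*) [CommRing B] [HopfAlgebra K B]

theorem hopfMul_odd (d : Dbl 𝒜) :
    (hopfParity 𝒜).odd (hopfMul 𝒜 d) = hopfMul 𝒜 ((dblParity 𝒜).odd d) := by
  refine LinearMap.congr_fun (f := (hopfParity 𝒜).odd ∘ₗ (hopfMul 𝒜).toLinearMap)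
    (g := (hopfMul 𝒜).toLinearMap ∘ₗ (dblParity 𝒜).odd) (dbl_ext fun p q x y hx hy => ?_) d
  change (hopfParity 𝒜).odd (hopfMul 𝒜 ((hopfParity 𝒜).stmul (hopfParity 𝒜) x y)) =
    hopfMul 𝒜 ((dblParity 𝒜).odd ((hopfParity 𝒜).stmul (hopfParity 𝒜) x y))
  rw [hopfMul_stmul, (isHom_of_mem 𝒜 (SetLike.mul_mem_graded hx hy)).odd,
    ((isHom_of_mem 𝒜 hx).stmul (isHom_of_mem 𝒜 hy)).odd, Int.cast_add]
  split_ifs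
  · rw [map_zero]
  · rw [hopfMul_stmul]

/-- The signed tensor cube. -/
abbrev Trp : Type _ := SProd (hopfParity 𝒜) (dblParity 𝒜)

/-- The map `x ⊗ y ⊗ z ↦ x ⊗ y`. -/
def proj₁₂ : Trp 𝒜 →ₗc[K] Dbl 𝒜 := Parity.mapSnd _ _ _ (Parity.fstHom _ _)
  fun d => (Parity.tw_of_odd Parity.fstHom_odd 1 d).symm

/-- The map `x ⊗ y ⊗ z ↦ x ⊗ z`. -/
def proj₁₃ : Trp 𝒜 →ₗc[K] Dbl 𝒜 := Parity.mapSnd _ _ _ (Parity.sndHom _ _)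
  fun d => (Parity.tw_of_odd Parity.sndHom_odd 1 d).symm

/-- The map `x ⊗ y ⊗ z ↦ x ⊗ y z`. -/
def mul₂₃ : Trp 𝒜 →ₗc[K] Dbl 𝒜 := Parity.mapSnd _ _ _ (hopfMul 𝒜)
  fun d => (Parity.tw_of_odd (hopfMul_odd 𝒜) 1 d).symm

section Slices

variable {S : Type*} [Ring S] [Algebra K S] (f : WithConv (Dbl 𝒜 →ₗ[K] S)) (x : A)

theorem slice_proj₁₂ : Parity.slice (Parity.pull S (proj₁₂ 𝒜) f) x =
    Parity.pull S (Parity.fstHom _ _) (Parity.slice f x) := rfl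

theorem slice_proj₁₃ : Parity.slice (Parity.pull S (proj₁₃ 𝒜) f) x =
    Parity.pull S (Parity.sndHom _ _) (Parity.slice f x) := rfl

theorem slice_mul₂₃ : Parity.slice (Parity.pull S (mul₂₃ 𝒜) f) x =
    Parity.pull S (hopfMul 𝒜) (Parity.slice f x) := rfl

end Slices

variable {ρ : A →ₗ[K] A →ₗ[K] A} {n : ℤ} {bul : B →ₗ[K] B →ₗ[K] K}

theorem rhoConv_mul (hρ : IsFoxPairing 𝒜 n ρ) :
    Cv.mapHom (Parity.pull _ (mul₂₃ 𝒜)) (rhoConv 𝒜 B ρ) =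
      Cv.mapHom (Parity.pull _ (proj₁₃ 𝒜)) (rhoConv 𝒜 B ρ) +
      Cv.mapHom (Parity.pull _ (proj₁₂ 𝒜)) (rhoConv 𝒜 B ρ) *
        AlgHom.cv ((Parity.pull _ (Parity.sndHom _ _)).comp (genSnd 𝒜 B 0)) := by
  refine Cv.ext fun b => Parity.slice_ext fun x => ?_
  rw [ofConv_add, LinearMap.add_apply, Cv.mul_apply (ℛ K b), Parity.slice_add, Parity.slice_sum]
  simp only [Cv.mapHom_apply, AlgHom.cv_apply, AlgHom.comp_apply, Parity.slice_mul_snd,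
    slice_proj₁₂, slice_proj₁₃, slice_mul₂₃]
  set R : B → WithConv (A →ₗ[K] RepAlg 𝒜 B) := fun b =>
    Parity.slice ((rhoConv 𝒜 B ρ).ofConv b) x with hR
  have e : Parity.pull _ (hopfMul 𝒜) (R b) = Parity.pull _ (Parity.sndHom _ _) (R b) +
      ∑ i ∈ (ℛ K b).index, Parity.pull _ (Parity.fstHom _ _) (R ((ℛ K b).left i)) *
        genSnd 𝒜 B 0 ((ℛ K b).right i) := by
    refine Parity.ext_stmul fun y z => ?_
    rw [ofConv_add, LinearMap.add_apply, ofConv_sum, LinearMap.sum_apply, Parity.pull_apply,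
      hopfMul_stmul, Parity.pull_apply, Parity.sndHom_stmul, map_smul]
    simp only [genSnd_apply, Parity.pull_fst_mul_pull_snd, hR, Parity.slice_apply, rhoConv_apply,
      chiTw_apply, Parity.tw_zero, LinearMap.id_apply]
    rw [hρ.map_mul_right, map_add, LinearMap.add_apply, map_smul, LinearMap.smul_apply, add_comm]
    congr 1
    refine (congrArg (fun f : Cv K B (RepAlg 𝒜 B) => f.ofConv b) (genConv_mul 𝒜 B _ _)).trans ?_
    rw [Cv.mul_apply (ℛ K b)]
    rfl
  exact e

variable {B}

theorem pairBrk_mul (hA : IsGradedCocommutative 𝒜) (hρ : IsFoxPairing 𝒜 n ρ) (hb : IsBalanced bul)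
    (b c : B) : Parity.pull _ (mul₂₃ 𝒜) ((pairBrk 𝒜 B ρ n bul b).ofConv c) =
      ∑ i ∈ (ℛ K c).index, (Parity.pull _ (Parity.sndHom _ _)
          (genFst 𝒜 B (hopfParity 𝒜) n ((ℛ K c).left i)) *
        Parity.pull _ (proj₁₃ 𝒜) ((pairBrk 𝒜 B ρ n bul b).ofConv ((ℛ K c).right i)) +
        Parity.pull _ (proj₁₂ 𝒜) ((pairBrk 𝒜 B ρ n bul b).ofConv ((ℛ K c).left i)) *
        Parity.pull _ (Parity.sndHom _ _) (genSnd 𝒜 B 0 ((ℛ K c).right i))) := by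
  have hA₃ := (hopfParity_cocomm 𝒜 hA).prod (dblParity_cocomm hA)
  set X := genFst 𝒜 B (dblParity 𝒜) n with hX
  set P := Parity.pull (RepAlg 𝒜 B) (Parity.sndHom (hopfParity 𝒜) (dblParity 𝒜)) with hP
  set Y := P.comp (genFst 𝒜 B (hopfParity 𝒜) 0) with hY
  set Y' := P.comp (genFst 𝒜 B (hopfParity 𝒜) n) with hY'
  set Z := P.comp (genSnd 𝒜 B 0) with hZ
  set YZ := P.comp ((Parity.pull _ (hopfMul 𝒜)).comp (chiTw 𝒜 B 0)) with hYZ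
  have pX : ∀ b, ((hopfParity 𝒜).prod (dblParity 𝒜)).HasParity (repParity 𝒜 B) 0 (X b).ofConv :=
    genFst_hasParity 𝒜 B _ _
  have pY : ∀ b, ((hopfParity 𝒜).prod (dblParity 𝒜)).HasParity (repParity 𝒜 B) 0 (Y b).ofConv :=
    fun b => (genFst_hasParity 𝒜 B (hopfParity 𝒜) 0 b).comp Parity.sndHom_odd
  have pZ : ∀ b, ((hopfParity 𝒜).prod (dblParity 𝒜)).HasParity (repParity 𝒜 B) 0 (Z b).ofConv :=
    fun b => (genSnd_hasParity 𝒜 B 0 b).comp Parity.sndHom_odd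
  have pq : ∀ b, ((hopfParity 𝒜).prod (dblParity 𝒜)).HasParity (repParity 𝒜 B) n
      (Parity.pull _ (proj₁₃ 𝒜) ((rhoConv 𝒜 B ρ).ofConv b)).ofConv :=
    fun b => (rhoConv_hasParity B hρ b).comp (Parity.mapSnd_odd Parity.sndHom_odd _)
  have hm : AlgHom.cv YZ = AlgHom.cv Y * AlgHom.cv Z := by
    refine Cv.ext fun c => ?_
    rw [Cv.mul_apply (ℛ K c)]
    simp only [AlgHom.cv_apply, hY, hZ, hYZ, AlgHom.comp_apply, ← map_mul, ← map_sum]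
    congr 1
    refine Parity.ext_stmul fun y z => ?_
    rw [Parity.pull_apply, hopfMul_stmul, chiTw_zero, chi_apply, ofConv_sum, LinearMap.sum_apply]
    refine (congrArg (fun f : Cv K B (RepAlg 𝒜 B) => f.ofConv c) (genConv_mul 𝒜 B _ _)).trans ?_
    rw [Cv.mul_apply (ℛ K c)]
    refine Finset.sum_congr rfl fun i _ => ?_
    rw [genFst_apply, genSnd_apply, Parity.pull_fst_mul_pull_snd, chiTw_zero, chiTw_zero]
    rfl
  have hq : IsIntertwining (Cv.mapHom (Parity.pull _ (proj₁₃ 𝒜)) (rhoConv 𝒜 B ρ)) Y Y' := by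
    intro b e
    rw [Cv.mapHom_apply, Parity.conv_comm_even hA₃ (isSuperComm 𝒜 B) (pY b) (pq e), hY, hY', AlgHom.comp_apply,
      AlgHom.comp_apply, hP, Parity.pull_tw_snd, pull_tw_genFst, zero_add]
  have hXY : AreCommuting X Y := fun b c => conv_even_comm 𝒜 hA₃ (pX b) (pY c)
  have hXZ : AreCommuting X Z := fun b c => conv_even_comm 𝒜 hA₃ (pX b) (pZ c)
  have hYZ' : AreCommuting Y Z := fun b c => conv_even_comm 𝒜 hA₃ (pY b) (pZ c)
  have key := brk_mul_of_areCommuting hb hXY hXZ hYZ'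
    (p := Cv.mapHom (Parity.pull _ (proj₁₂ 𝒜)) (rhoConv 𝒜 B ρ)) hq hm b
  have e₁ : (Parity.pull _ (mul₂₃ 𝒜)).comp (genFst 𝒜 B (hopfParity 𝒜) n) = X :=
    AlgHom.ext fun b => Parity.fst_comp_mapSnd _ _ _
  have e₂ : (Parity.pull _ (mul₂₃ 𝒜)).comp (genSnd 𝒜 B 0) = YZ :=
    AlgHom.ext fun b => Parity.snd_comp_mapSnd _ _ _
  have e₃ : (Parity.pull _ (proj₁₂ 𝒜)).comp (genFst 𝒜 B (hopfParity 𝒜) n) = X :=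
    AlgHom.ext fun b => Parity.fst_comp_mapSnd _ _ _
  have e₄ : (Parity.pull _ (proj₁₂ 𝒜)).comp (genSnd 𝒜 B 0) = Y :=
    AlgHom.ext fun b => Parity.snd_comp_mapSnd _ _ _
  have e₅ : (Parity.pull _ (proj₁₃ 𝒜)).comp (genFst 𝒜 B (hopfParity 𝒜) n) = X :=
    AlgHom.ext fun b => Parity.fst_comp_mapSnd _ _ _
  have e₆ : (Parity.pull _ (proj₁₃ 𝒜)).comp (genSnd 𝒜 B 0) = Z :=
    AlgHom.ext fun b => Parity.snd_comp_mapSnd _ _ _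
  simp only [pairBrk, brk_map, e₁, e₂, e₃, e₄, e₅, e₆]
  rw [rhoConv_mul 𝒜 B hρ, key, ofConv_add, LinearMap.add_apply, Cv.mul_apply (ℛ K c),
    Cv.mul_apply (ℛ K c), ← Finset.sum_add_distrib]
  rfl

theorem genBrk_mul (hA : IsGradedCocommutative 𝒜) (hρ : IsFoxPairing 𝒜 n ρ) (hb : IsBalanced bul)
    {p : ZMod 2} {x : A} (hx : (hopfParity 𝒜).IsHom p x) (b c : B) (y z : A) :
    genBrk 𝒜 B ρ n bul x b (y * z) c = ∑ i ∈ (ℛ K c).index,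
      (gen 𝒜 B ((hopfParity 𝒜).tw (p + n) y) ((ℛ K c).left i) *
        genBrk 𝒜 B ρ n bul x b z ((ℛ K c).right i) +
      genBrk 𝒜 B ρ n bul x b y ((ℛ K c).left i) * gen 𝒜 B z ((ℛ K c).right i)) := by
  have h := congrArg (fun f => Parity.slice f x) (pairBrk_mul 𝒜 hA hρ hb b c)
  rw [Parity.slice_sum] at h
  simp only [Parity.slice_add, Parity.slice_snd_mul _ _ hx, Parity.slice_mul_snd, pull_tw_genFst,
    slice_proj₁₂, slice_proj₁₃, slice_mul₂₃] at h
  have h' := congrArg (fun f => f.ofConv ((hopfParity 𝒜).stmul (hopfParity 𝒜) y z)) h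
  simp only [ofConv_sum, LinearMap.sum_apply, ofConv_add, LinearMap.add_apply, Parity.pull_apply,
    hopfMul_stmul, Parity.pull_fst_mul_pull_snd, Parity.slice_apply, chiTw_apply, Parity.tw_zero,
    LinearMap.id_apply, add_comm (n : ZMod 2), genFst_apply, genSnd_apply] at h'
  exact h'

end Triple

/-! ### Derivations of the representation algebra -/

section Lift

variable {K A : Type*} [CommRing K] [Ring A] [Algebra K A]
variable (𝒜 : ℤ → Submodule K A) [GradedAlgebra 𝒜] [Coalgebra K A]
variable (B : Type*) [CommRing B] [HopfAlgebra K B]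
variable {E : Type*} [Ring E] [Algebra K E]

/-- The homomorphism from the representation algebra with given values on the generators. -/
def repLift (Θ : A →ₗ[K] B →ₗ[K] E)
    (h₁ : ∀ x y b, Θ (x * y) b = (toConv (Θ x) * toConv (Θ y) : Cv K B E).ofConv b)
    (h₂ : ∀ b, Θ 1 b = algebraMap K E (counit b))
    (h₃ : ∀ x b c, Θ x (b * c) =
      (toConv (Θ.flip b) * toConv (Θ.flip c) : WithConv (A →ₗ[K] E)).ofConv x)
    (h₄ : ∀ x, Θ x 1 = algebraMap K E (counit x))
    (h₅ : ∀ (p q : ℤ) (x y : A) (b c : B), x ∈ 𝒜 p → y ∈ 𝒜 q →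
      Θ x b * Θ y c = sgn K ((p : ZMod 2) * q) • (Θ y c * Θ x b)) : RepAlg 𝒜 B →ₐ[K] E :=
  RingQuot.liftAlgHom K ⟨TensorAlgebra.lift K (TensorProduct.lift Θ), fun u v h => by
    have hg : ∀ x b, TensorAlgebra.lift K (TensorProduct.lift Θ) (preGen B x b) = Θ x b := by
      intro x b
      simp [preGen]
    induction h with
    | mul_left x y b =>
      rw [hg, h₁, LinearMap.convMul_apply]
      generalize comul (R := K) b = t
      induction t with
      | zero => simp
      | add s t hs ht => simp only [map_add, hs, ht]
      | tmul c d => simp [hg]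
    | one_left b => rw [hg, h₂, AlgHom.commutes]
    | mul_right x b c =>
      rw [hg, h₃, LinearMap.convMul_apply]
      generalize comul (R := K) x = t
      induction t with
      | zero => simp
      | add s t hs ht => simp only [map_add, hs, ht]
      | tmul c d => simp [hg]
    | one_right x => rw [hg, h₄, AlgHom.commutes]
    | comm p q x y b c hx hy =>
      rw [negOnePow_smul (K := K), map_smul, map_mul, map_mul, hg, hg, h₅ p q x y b c hx hy,
        Int.cast_mul]⟩

theorem repLift_gen (Θ : A →ₗ[K] B →ₗ[K] E) (h₁ h₂ h₃ h₄ h₅) (x : A) (b : B) :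
    repLift 𝒜 B Θ h₁ h₂ h₃ h₄ h₅ (gen 𝒜 B x b) = Θ x b := by
  rw [repLift, ← mk_preGen, RingQuot.liftAlgHom_mkAlgHom_apply]
  simp [preGen]

end Lift

section Derivations

variable {K A : Type*} [CommRing K] [Ring A] [Algebra K A]
variable (𝒜 : ℤ → Submodule K A) [Coalgebra K A]
variable (B : Type*) [CommRing B] [HopfAlgebra K B]

/-- Derivations of degree `e` of the representation algebra. -/
structure IsRepDer (e : ℤ) (D : RepAlg 𝒜 B →ₗ[K] RepAlg 𝒜 B) : Prop where
  map_mem : ∀ (q : ℤ) (u : RepAlg 𝒜 B), u ∈ repGrading 𝒜 B q → D u ∈ repGrading 𝒜 B (q + e)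
  leibniz : ∀ (q : ℤ) (u v : RepAlg 𝒜 B), u ∈ repGrading 𝒜 B q →
    D (u * v) = D u * v + sgn K ((e : ZMod 2) * q) • (u * D v)

variable {𝒜 B} {e : ℤ}

theorem IsRepDer.add {D D' : RepAlg 𝒜 B →ₗ[K] RepAlg 𝒜 B} (hD : IsRepDer 𝒜 B e D)
    (hD' : IsRepDer 𝒜 B e D') : IsRepDer 𝒜 B e (D + D') where
  map_mem q u hu := Submodule.add_mem _ (hD.map_mem q u hu) (hD'.map_mem q u hu)
  leibniz q u v hu := by
    simp only [LinearMap.add_apply, hD.leibniz q u v hu, hD'.leibniz q u v hu, add_mul, mul_add,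
      smul_add]
    abel

theorem IsRepDer.smul {D : RepAlg 𝒜 B →ₗ[K] RepAlg 𝒜 B} (hD : IsRepDer 𝒜 B e D) (k : K) :
    IsRepDer 𝒜 B e (k • D) where
  map_mem q u hu := Submodule.smul_mem _ _ (hD.map_mem q u hu)
  leibniz q u v hu := by
    simp only [LinearMap.smul_apply, hD.leibniz q u v hu, smul_add, smul_mul_assoc, mul_smul_comm,
      smul_comm k]

theorem IsRepDer.zero : IsRepDer 𝒜 B e 0 where
  map_mem q u hu := Submodule.zero_mem _
  leibniz q u v hu := by simp

theorem IsRepDer.sum {ι : Type*} (s : Finset ι) {D : ι → RepAlg 𝒜 B →ₗ[K] RepAlg 𝒜 B}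
    (hD : ∀ i, IsRepDer 𝒜 B e (D i)) : IsRepDer 𝒜 B e (∑ i ∈ s, D i) :=
  Finset.sum_induction _ _ (fun _ _ => .add) .zero fun i _ => hD i

theorem IsRepDer.cast {e e' : ℤ} {D : RepAlg 𝒜 B →ₗ[K] RepAlg 𝒜 B} (hD : IsRepDer 𝒜 B e D)
    (h : e = e') : IsRepDer 𝒜 B e' D := h ▸ hD

variable [GradedAlgebra 𝒜]

theorem mul_mem_comm {p q : ℤ} {u v : RepAlg 𝒜 B} (hu : u ∈ repGrading 𝒜 B p)
    (hv : v ∈ repGrading 𝒜 B q) : u * v = sgn K ((p : ZMod 2) * q) • (v * u) :=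
  (isSuperComm 𝒜 B).comm (mem_repParity 𝒜 hu) (mem_repParity 𝒜 hv)

theorem IsRepDer.map_one {D : RepAlg 𝒜 B →ₗ[K] RepAlg 𝒜 B} (hD : IsRepDer 𝒜 B e D) : D 1 = 0 := by
  have h := hD.leibniz 0 1 1 SetLike.GradedOne.one_mem
  simpa using h

/-- The multiple of a derivation by a homogeneous element. -/
theorem IsRepDer.mul {e q : ℤ} {w : RepAlg 𝒜 B} (hw : w ∈ repGrading 𝒜 B q)
    {D : RepAlg 𝒜 B →ₗ[K] RepAlg 𝒜 B} (hD : IsRepDer 𝒜 B e D) :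
    IsRepDer 𝒜 B (q + e) (LinearMap.mulLeft K w ∘ₗ D) where
  map_mem p u hu := by
    rw [add_left_comm]
    exact SetLike.mul_mem_graded hw (hD.map_mem p u hu)
  leibniz p u v hu := by
    simp only [LinearMap.comp_apply, LinearMap.mulLeft_apply, hD.leibniz p u v hu, mul_add,
      mul_smul_comm, ← mul_assoc]
    rw [mul_mem_comm hw hu, smul_mul_assoc, smul_smul, ← sgn_add, Int.cast_add, add_mul,
      add_comm ((q : ZMod 2) * p)]

variable [GradedHopfAlgebra 𝒜]

theorem IsRepDer.ext {D D' : RepAlg 𝒜 B →ₗ[K] RepAlg 𝒜 B} (hD : IsRepDer 𝒜 B e D)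
    (hD' : IsRepDer 𝒜 B e D')
    (h : ∀ q y c, y ∈ 𝒜 q → D (gen 𝒜 B y c) = D' (gen 𝒜 B y c)) : D = D' := by
  refine rep_ext 𝒜 B fun p m hm => ?_
  induction hm with
  | one => rw [hD.map_one, hD'.map_one]
  | gen_mul p q x b m hx hm ih =>
    rw [hD.leibniz p _ _ (gen_mem 𝒜 B hx b), hD'.leibniz p _ _ (gen_mem 𝒜 B hx b), ih, h p x b hx]

variable (𝒜 B) in
/-- The values of a derivation of degree `e` on the generators. -/
structure IsDerData (e : ℤ) (G : A →ₗ[K] B →ₗ[K] RepAlg 𝒜 B) : Prop where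
  mem : ∀ (q : ℤ) (y : A) (c : B), y ∈ 𝒜 q → G y c ∈ repGrading 𝒜 B (q + e)
  mul_left : ∀ y z, (toConv (G (y * z)) : Cv K B (RepAlg 𝒜 B)) =
    genConv 𝒜 B ((hopfParity 𝒜).tw e y) * toConv (G z) + toConv (G y) * genConv 𝒜 B z
  mul_right : ∀ c d, (toConv (G.flip (c * d)) : WithConv (A →ₗ[K] RepAlg 𝒜 B)) =
    chiTw 𝒜 B e c * toConv (G.flip d) + toConv (G.flip c) * chi 𝒜 B d

theorem IsDerData.one_left {G : A →ₗ[K] B →ₗ[K] RepAlg 𝒜 B} (hG : IsDerData 𝒜 B e G) (c : B) :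
    G 1 c = 0 := by
  have h := hG.mul_left 1 1
  rw [hopfParity_tw_of_mem 𝒜 SetLike.GradedOne.one_mem, Int.cast_zero, mul_zero, sgn_zero, one_smul,
    genConv_one, one_mul, mul_one, one_mul] at h
  exact congrArg (fun f : Cv K B (RepAlg 𝒜 B) => f.ofConv c) (left_eq_add.mp h)

theorem IsDerData.one_right {G : A →ₗ[K] B →ₗ[K] RepAlg 𝒜 B} (hG : IsDerData 𝒜 B e G) (y : A) :
    G y 1 = 0 := by
  have h := hG.mul_right 1 1
  rw [map_one (chi 𝒜 B), map_one (chiTw 𝒜 B e), one_mul, mul_one, one_mul] at h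
  have h' : G y 1 = G y 1 + G y 1 :=
    congrArg (fun f : WithConv (A →ₗ[K] RepAlg 𝒜 B) => f.ofConv y) h
  exact left_eq_add.mp h'

theorem matrix_ext_two {R : Type*} {M N : Matrix (Fin 2) (Fin 2) R} (h₁ : M 0 0 = N 0 0)
    (h₂ : M 0 1 = N 0 1) (h₃ : M 1 0 = N 1 0) (h₄ : M 1 1 = N 1 1) : M = N :=
  Matrix.ext (Fin.forall_fin_two.2 ⟨Fin.forall_fin_two.2 ⟨h₁, h₂⟩, Fin.forall_fin_two.2 ⟨h₃, h₄⟩⟩)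

/-- The triangular matrices with entries `± x_b` and `G x b`. -/
def triangular (e : ℤ) (G : A →ₗ[K] B →ₗ[K] RepAlg 𝒜 B) :
    A →ₗ[K] B →ₗ[K] Matrix (Fin 2) (Fin 2) (RepAlg 𝒜 B) :=
  LinearMap.mk₂ K (fun x b => !![gen 𝒜 B ((hopfParity 𝒜).tw e x) b, G x b; 0, gen 𝒜 B x b])
    (fun x x' b => matrix_ext_two (by simp) (by simp) (by simp) (by simp))
    (fun k x b => matrix_ext_two (by simp) (by simp) (by simp) (by simp))
    (fun x b b' => matrix_ext_two (by simp) (by simp) (by simp) (by simp))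
    (fun k x b => matrix_ext_two (by simp) (by simp) (by simp) (by simp))

theorem triangular_apply (e : ℤ) (G : A →ₗ[K] B →ₗ[K] RepAlg 𝒜 B) (x : A) (b : B) :
    triangular e G x b = !![gen 𝒜 B ((hopfParity 𝒜).tw e x) b, G x b; 0, gen 𝒜 B x b] := rfl

theorem tw_mul (e : ZMod 2) (x y : A) : (hopfParity 𝒜).tw e (x * y) =
    (hopfParity 𝒜).tw e x * (hopfParity 𝒜).tw e y := by
  refine graded_induction 𝒜 (p := fun x => (hopfParity 𝒜).tw e (x * y) =
    (hopfParity 𝒜).tw e x * (hopfParity 𝒜).tw e y) (fun p x hx => ?_)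
    (fun x x' h h' => by simp only [add_mul, map_add, h, h']) x
  refine graded_induction 𝒜 (p := fun y => (hopfParity 𝒜).tw e (x * y) =
    (hopfParity 𝒜).tw e x * (hopfParity 𝒜).tw e y) (fun q y hy => ?_)
    (fun x x' h h' => by simp only [mul_add, map_add, h, h']) y
  rw [hopfParity_tw_of_mem 𝒜 hx, hopfParity_tw_of_mem 𝒜 hy,
    hopfParity_tw_of_mem 𝒜 (SetLike.mul_mem_graded hx hy), smul_mul_smul_comm, ← sgn_add,
    Int.cast_add, mul_add]

/-- The homomorphism to triangular matrices. -/
def triangularHom {G : A →ₗ[K] B →ₗ[K] RepAlg 𝒜 B} (hG : IsDerData 𝒜 B e G) :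
    RepAlg 𝒜 B →ₐ[K] Matrix (Fin 2) (Fin 2) (RepAlg 𝒜 B) :=
  repLift 𝒜 B (triangular e G)
    (fun x y b => by
      have h₁ := congrArg (fun f => f.ofConv b) (genConv_mul 𝒜 B ((hopfParity 𝒜).tw e x)
        ((hopfParity 𝒜).tw e y))
      have h₂ := congrArg (fun f : Cv K B (RepAlg 𝒜 B) => f.ofConv b) (hG.mul_left x y)
      have h₃ := congrArg (fun f => f.ofConv b) (genConv_mul 𝒜 B x y)
      simp only [ofConv_add, LinearMap.add_apply, Cv.mul_apply (ℛ K b), ← tw_mul] at h₁ h₂ h₃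
      rw [Cv.mul_apply (ℛ K b)]
      refine matrix_ext_two ?_ ?_ ?_ ?_ <;>
        simp only [triangular_apply, Matrix.mul_fin_two, Matrix.sum_apply, Matrix.cons_val',
          Matrix.cons_val_zero, Matrix.cons_val_one, Matrix.of_apply, mul_zero, zero_mul, add_zero,
          zero_add, Finset.sum_const_zero, Finset.sum_add_distrib]
      · exact h₁
      · exact h₂
      · exact h₃)
    (fun b => by
      have h := congrArg (fun f => f.ofConv b) (genConv_one 𝒜 B)
      rw [triangular_apply, hG.one_left, hopfParity_tw_of_mem 𝒜 SetLike.GradedOne.one_mem,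
        Int.cast_zero, mul_zero, sgn_zero, one_smul]
      refine matrix_ext_two ?_ ?_ ?_ ?_ <;> simp [Matrix.algebraMap_matrix_apply]
      · exact h
      · exact h)
    (fun x b c => by
      obtain ⟨X⟩ := Parity.nonempty_homExpansion (hopfParity 𝒜) (comul (R := K) x)
      have h₁ := congrArg (fun f => f.ofConv x) (map_mul (chiTw 𝒜 B e) b c)
      have h₂ := congrArg (fun f => f.ofConv x) (hG.mul_right b c)
      have h₃ := congrArg (fun f => f.ofConv x) (map_mul (chi 𝒜 B) b c)
      simp only [ofConv_add, LinearMap.add_apply, X.conv_apply] at h₁ h₂ h₃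
      rw [X.conv_apply]
      refine matrix_ext_two ?_ ?_ ?_ ?_ <;>
        simp only [triangular_apply, LinearMap.flip_apply, Matrix.mul_fin_two, Matrix.sum_apply,
          Matrix.cons_val',
          Matrix.cons_val_zero, Matrix.cons_val_one, Matrix.of_apply, mul_zero, zero_mul, add_zero,
          zero_add, Finset.sum_const_zero, Finset.sum_add_distrib]
      · exact h₁
      · exact h₂
      · exact h₃)
    (fun x => by
      have h₁ := congrArg (fun f => f.ofConv x) (map_one (chiTw 𝒜 B e))
      have h₃ := congrArg (fun f => f.ofConv x) (map_one (chi 𝒜 B))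
      rw [triangular_apply, hG.one_right]
      refine matrix_ext_two ?_ ?_ ?_ ?_ <;> simp [Matrix.algebraMap_matrix_apply]
      · exact h₁
      · exact h₃)
    (fun p q x y b c hx hy => by
      have h₁ := gen_comm 𝒜 B hx hy b c
      have h₂ := mul_mem_comm (gen_mem 𝒜 B hx b) (hG.mem q y c hy)
      have h₃ := mul_mem_comm (hG.mem p x b hx) (gen_mem 𝒜 B hy c)
      rw [triangular_apply, triangular_apply, Matrix.mul_fin_two, Matrix.mul_fin_two,
        hopfParity_tw_of_mem 𝒜 hx, hopfParity_tw_of_mem 𝒜 hy]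
      refine matrix_ext_two ?_ ?_ ?_ ?_ <;>
        simp only [Matrix.smul_apply, Matrix.cons_val',
          Matrix.cons_val_zero, Matrix.cons_val_one, Matrix.of_apply, mul_zero, zero_mul, add_zero,
          zero_add, map_smul, LinearMap.smul_apply, smul_mul_assoc, mul_smul_comm, smul_zero, h₁,
          h₂, h₃, smul_smul, ← sgn_add, smul_add]
      · congr 2
        ring
      · rw [add_comm]
        congr 2 <;> push_cast <;> congr 1
        · generalize (e : ZMod 2) = e
          generalize (p : ZMod 2) = p
          generalize (q : ZMod 2) = q
          revert p q e
          decide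
        · generalize (e : ZMod 2) = e
          generalize (p : ZMod 2) = p
          generalize (q : ZMod 2) = q
          revert p q e
          decide)

theorem triangularHom_gen {G : A →ₗ[K] B →ₗ[K] RepAlg 𝒜 B} (hG : IsDerData 𝒜 B e G) (x : A)
    (b : B) : triangularHom hG (gen 𝒜 B x b) = triangular e G x b :=
  repLift_gen 𝒜 B _ _ _ _ _ _ _ _

theorem triangularHom_monomial {G : A →ₗ[K] B →ₗ[K] RepAlg 𝒜 B} (hG : IsDerData 𝒜 B e G) {q : ℤ}
    {m : RepAlg 𝒜 B} (hm : IsMonomial 𝒜 B q m) :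
    triangularHom hG m 0 0 = sgn K ((e : ZMod 2) * q) • m ∧ triangularHom hG m 1 0 = 0 ∧
      triangularHom hG m 1 1 = m ∧ triangularHom hG m 0 1 ∈ repGrading 𝒜 B (q + e) := by
  induction hm with
  | one => simp
  | gen_mul p q x b m hx hm ih =>
    obtain ⟨h₁, h₂, h₃, h₄⟩ := ih
    rw [map_mul, triangularHom_gen, triangular_apply, hopfParity_tw_of_mem 𝒜 hx]
    simp only [Matrix.mul_apply, Fin.sum_univ_two, Matrix.cons_val',
      Matrix.cons_val_zero, Matrix.cons_val_one, Matrix.of_apply, h₁, h₂, h₃, mul_zero, zero_mul,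
      add_zero, zero_add, true_and, map_smul, LinearMap.smul_apply, smul_mul_assoc]
    refine ⟨?_, Submodule.add_mem _ (Submodule.smul_mem _ _ ?_) ?_⟩
    · rw [mul_smul_comm, smul_smul, ← sgn_add, Int.cast_add, mul_add]
    · rw [add_assoc]
      exact SetLike.mul_mem_graded (gen_mem 𝒜 B hx b) h₄
    · rw [add_right_comm]
      exact SetLike.mul_mem_graded (hG.mem p x b hx) (Submodule.subset_span hm)

theorem exists_isRepDer {G : A →ₗ[K] B →ₗ[K] RepAlg 𝒜 B} (hG : IsDerData 𝒜 B e G) :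
    ∃ D, IsRepDer 𝒜 B e D ∧ ∀ y c, D (gen 𝒜 B y c) = G y c := by
  have h₁ : ∀ v, triangularHom hG v 1 1 = v := fun v =>
    LinearMap.congr_fun (rep_ext 𝒜 B (f := Matrix.entryLinearMap K _ 1 1 ∘ₗ
      (triangularHom hG).toLinearMap) (g := LinearMap.id)
      fun p m hm => (triangularHom_monomial hG hm).2.2.1) v
  refine ⟨Matrix.entryLinearMap K _ 0 1 ∘ₗ (triangularHom hG).toLinearMap,
    ⟨fun q u hu => ?_, fun q u v hu => ?_⟩, fun y c => ?_⟩
  · induction hu using Submodule.span_induction with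
    | zero => rw [map_zero]; exact Submodule.zero_mem _
    | add x y _ _ hx hy => rw [map_add]; exact Submodule.add_mem _ hx hy
    | smul k x _ hx => rw [map_smul]; exact Submodule.smul_mem _ _ hx
    | mem m hm => exact (triangularHom_monomial hG hm).2.2.2
  · induction hu using Submodule.span_induction with
    | zero => simp
    | add x y _ _ hx hy =>
      rw [add_mul, map_add, hx, hy, map_add, add_mul, add_mul, smul_add]
      abel
    | smul k x _ hx =>
      rw [smul_mul_assoc, map_smul, hx, map_smul, smul_add, smul_mul_assoc, smul_mul_assoc,
        smul_comm k]
    | mem m hm =>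
      change triangularHom hG (m * v) 0 1 = triangularHom hG m 0 1 * v +
        sgn K ((e : ZMod 2) * q) • (m * triangularHom hG v 0 1)
      rw [map_mul, Matrix.mul_apply, Fin.sum_univ_two, (triangularHom_monomial hG hm).1, h₁,
        smul_mul_assoc, add_comm]
  · change triangularHom hG (gen 𝒜 B y c) 0 1 = _
    rw [triangularHom_gen]
    rfl

end Derivations

theorem brk_apply_mul_of_areCommuting {K B R : Type*} [CommRing K] [CommRing B] [HopfAlgebra K B]
    [Ring R] [Algebra K R] {bul : B →ₗ[K] B →ₗ[K] K} (hd : ∀ b, IsCounitDer (bul b))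
    (hs : ∀ b c, bul b c = bul c b)
    {X Y Y' : B →ₐ[K] R} (hXY : AreCommuting X Y) (hYY : AreCommuting Y Y) {p : Cv K B R}
    (hp : IsIntertwining p Y Y') (b c d : B) : (brk bul p X Y b).ofConv (c * d) =
      Y' c * (brk bul p X Y b).ofConv d + (brk bul p X Y b).ofConv c * Y d :=
  brk_apply_mul (fun b c d => by rw [hs, hd, hs d, hs d]; rfl) X Y Y' hXY hYY p hp b c d

section Extension

variable {K A : Type*} [CommRing K] [Ring A] [Algebra K A]
variable {𝒜 : ℤ → Submodule K A} [GradedAlgebra 𝒜] [Coalgebra K A] [GradedHopfAlgebra 𝒜]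
variable {B : Type*} [CommRing B] [HopfAlgebra K B]

theorem exists_linear_isRepDer {M : Type*} [AddCommGroup M] [Module K M] {e : ℤ}
    (G : M →ₗ[K] A →ₗ[K] B →ₗ[K] RepAlg 𝒜 B) (hG : ∀ m, IsDerData 𝒜 B e (G m)) :
    ∃ D : M →ₗ[K] RepAlg 𝒜 B →ₗ[K] RepAlg 𝒜 B, (∀ m, IsRepDer 𝒜 B e (D m)) ∧
      ∀ m y c, D m (gen 𝒜 B y c) = G m y c := by
  choose D hD hDG using fun m => exists_isRepDer (hG m)
  exact ⟨⟨⟨D, fun m m' => (hD _).ext ((hD m).add (hD m')) fun q y c _ => by simp [hDG]⟩,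
    fun k m => (hD _).ext ((hD m).smul k) fun q y c _ => by simp [hDG]⟩, hD, hDG⟩

theorem exists_graded_isRepDer {M : Type*} [Ring M] [Algebra K M] (ℳ : ℤ → Submodule K M)
    [GradedAlgebra ℳ] {n : ℤ} (G : ℤ → M →ₗ[K] A →ₗ[K] B →ₗ[K] RepAlg 𝒜 B)
    (hG : ∀ p m, m ∈ ℳ p → IsDerData 𝒜 B (p + n) (G p m)) :
    ∃ D : M →ₗ[K] RepAlg 𝒜 B →ₗ[K] RepAlg 𝒜 B, ∀ p m, m ∈ ℳ p →
      IsRepDer 𝒜 B (p + n) (D m) ∧ ∀ y c, D m (gen 𝒜 B y c) = G p m y c := by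
  choose D hD hDG using fun p => exists_linear_isRepDer (G p ∘ₗ (ℳ p).subtype)
    fun m => hG p m m.2
  refine ⟨DirectSum.toModule K ℤ _ D ∘ₗ (DirectSum.decomposeLinearEquiv ℳ).toLinearMap,
    fun p m hm => ?_⟩
  have h : (DirectSum.toModule K ℤ _ D ∘ₗ (DirectSum.decomposeLinearEquiv ℳ).toLinearMap) m =
      D p ⟨m, hm⟩ := by
    lift m to ℳ p using hm
    rw [LinearMap.comp_apply, LinearEquiv.coe_coe, DirectSum.decomposeLinearEquiv_apply,
      DirectSum.decompose_coe, ← DirectSum.lof_eq_of K, DirectSum.toModule_lof]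
  rw [h]
  exact ⟨hD p _, hDG p _⟩

variable {ρ : A →ₗ[K] A →ₗ[K] A} {n : ℤ} {bul : B →ₗ[K] B →ₗ[K] K}

theorem genBrk_mul_right (hA : IsGradedCocommutative 𝒜) (hρ : IsFoxPairing 𝒜 n ρ)
    (hd : ∀ b, IsCounitDer (bul b)) (hs : ∀ b c, bul b c = bul c b) {p : ZMod 2} {x : A}
    (hx : (hopfParity 𝒜).IsHom p x) (b c d : B) :
    (toConv ((genBrk 𝒜 B ρ n bul x b).flip (c * d)) : WithConv (A →ₗ[K] RepAlg 𝒜 B)) =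
      chiTw 𝒜 B (n + p) c * toConv ((genBrk 𝒜 B ρ n bul x b).flip d) +
      toConv ((genBrk 𝒜 B ρ n bul x b).flip c) * chi 𝒜 B d := by
  have h₁ : IsIntertwining (rhoConv 𝒜 B ρ) (genSnd 𝒜 B 0) (genSnd 𝒜 B n) := fun b e => by
    rw [Parity.conv_comm_even (dblParity_cocomm hA) (isSuperComm 𝒜 B)
      (genSnd_hasParity 𝒜 B 0 b) (rhoConv_hasParity B hρ e), pull_tw_genSnd, zero_add]
  have h₂ : AreCommuting (R := WithConv (Dbl 𝒜 →ₗ[K] RepAlg 𝒜 B))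
      (genFst 𝒜 B (hopfParity 𝒜) n) (genSnd 𝒜 B 0) := fun b c =>
    conv_even_comm 𝒜 (dblParity_cocomm hA) (genFst_hasParity 𝒜 B _ _ b) (genSnd_hasParity 𝒜 B _ c)
  have h₃ : AreCommuting (R := WithConv (Dbl 𝒜 →ₗ[K] RepAlg 𝒜 B))
      (genSnd 𝒜 B 0) (genSnd 𝒜 B 0) := fun b c =>
    conv_even_comm 𝒜 (dblParity_cocomm hA) (genSnd_hasParity 𝒜 B _ b) (genSnd_hasParity 𝒜 B _ c)
  have h := congrArg (fun f => Parity.slice f x)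
    (brk_apply_mul_of_areCommuting hd hs h₂ h₃ h₁ b c d)
  simp only [Parity.slice_add, genSnd_apply, Parity.slice_snd_mul _ _ hx, Parity.slice_mul_snd,
    pull_tw_chiTw, chiTw_zero] at h
  exact h

theorem isDerData_genBrk (hA : IsGradedCocommutative 𝒜) (hρ : IsFoxPairing 𝒜 n ρ)
    (hb : IsBalanced bul) (hd : ∀ b, IsCounitDer (bul b)) (hs : ∀ b c, bul b c = bul c b) {p : ℤ}
    {x : A} (hx : x ∈ 𝒜 p) (b : B) : IsDerData 𝒜 B (p + n) (genBrk 𝒜 B ρ n bul x b) where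
  mem q y c hy := by
    rw [← add_assoc, add_comm q p]
    exact genBrk_mem hρ hx hy b c
  mul_left y z := Cv.ext fun c => by
    refine (genBrk_mul 𝒜 hA hρ hb (isHom_of_mem 𝒜 hx) b c y z).trans ?_
    rw [ofConv_add, LinearMap.add_apply, Cv.mul_apply (ℛ K c), Cv.mul_apply (ℛ K c),
      ← Finset.sum_add_distrib, Int.cast_add]
    rfl
  mul_right c d := by
    rw [genBrk_mul_right hA hρ hd hs (isHom_of_mem 𝒜 hx) b c d, Int.cast_add, add_comm (p : ZMod 2)]

theorem exists_derGen (hA : IsGradedCocommutative 𝒜) (hρ : IsFoxPairing 𝒜 n ρ)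
    (hb : IsBalanced bul) (hd : ∀ b, IsCounitDer (bul b)) (hs : ∀ b c, bul b c = bul c b) :
    ∃ D : A →ₗ[K] B →ₗ[K] RepAlg 𝒜 B →ₗ[K] RepAlg 𝒜 B, ∀ p x b, x ∈ 𝒜 p →
      IsRepDer 𝒜 B (p + n) (D x b) ∧
        ∀ y c, D x b (gen 𝒜 B y c) = genBrk 𝒜 B ρ n bul x b y c := by
  choose D hD using fun b => exists_graded_isRepDer 𝒜 (fun _ => (genBrk 𝒜 B ρ n bul).flip b)
    fun p x hx => isDerData_genBrk hA hρ hb hd hs hx b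
  have add : ∀ x b c, D (b + c) x = D b x + D c x := fun x b c => by
    refine graded_induction 𝒜 (p := fun x => D (b + c) x = D b x + D c x) (fun p x hx => ?_)
      (fun x y hx hy => ?_) x
    · refine (hD _ p x hx).1.ext ((hD b p x hx).1.add (hD c p x hx).1) fun q y d hy => ?_
      rw [LinearMap.add_apply, (hD _ p x hx).2, (hD _ p x hx).2, (hD _ p x hx).2, map_add]
      rfl
    · rw [map_add, map_add, map_add, hx, hy]
      abel
  have smul : ∀ (k : K) x b, D (k • b) x = k • D b x := fun k x b => by
    refine graded_induction 𝒜 (p := fun x => D (k • b) x = k • D b x) (fun p x hx => ?_)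
      (fun x y hx hy => ?_) x
    · refine (hD _ p x hx).1.ext ((hD b p x hx).1.smul k) fun q y d hy => ?_
      rw [LinearMap.smul_apply, (hD _ p x hx).2, (hD _ p x hx).2, map_smul]
      rfl
    · rw [map_add, map_add, hx, hy, smul_add]
  exact ⟨LinearMap.mk₂ K (fun x b => D b x) (fun x y b => map_add _ _ _)
    (fun k x b => map_smul _ _ _) (fun x b c => add x b c) (fun k x b => smul k x b),
    fun p x b hx => hD b p x hx⟩

end Extension

theorem leibniz_transpose {K S : Type*} [CommRing K] [Ring S] [Algebra K S] (n q s t : ZMod 2)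
    {u v w z : S} (h : v * w = sgn K (s * (t + (q + n))) • (w * v)) :
    u * z + sgn K (q * s) • (v * w) =
      -(sgn K ((q + s + n) * (t + n)) • (sgn K ((t + n) * q) •
        (u * -(sgn K ((t + n) * (s + n)) • z)) + -(sgn K ((t + n) * (q + n)) • w) * v)) := by
  rw [h]
  simp only [smul_add, mul_neg, neg_mul, smul_neg, mul_smul_comm, smul_mul_assoc, smul_smul,
    ← sgn_add, neg_add, neg_neg]
  have e₁ : ∀ n q s t : ZMod 2, (q + (s + n)) * (t + n) + ((t + n) * q + (t + n) * (s + n)) = 0 := by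
    decide
  have e₂ : ∀ n q s t : ZMod 2, q * s + s * (t + (q + n)) =
      (q + (s + n)) * (t + n) + (t + n) * (q + n) := by
    decide
  rw [add_assoc, e₁, e₂, sgn_zero, one_smul]

theorem leibniz_transpose' {K S : Type*} [CommRing K] [Ring S] [Algebra K S] (n q s t : ZMod 2)
    {u v w z : S} (h : v * w = sgn K (s * (t + (q + n))) • (w * v)) :
    -(sgn K ((t + n) * (q + s + n)) • (u * z + sgn K (q * s) • (v * w))) =
      sgn K ((t + n) * q) • (u * -(sgn K ((t + n) * (s + n)) • z)) +
        -(sgn K ((t + n) * (q + n)) • w) * v := by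
  rw [leibniz_transpose n q s t h, smul_neg, neg_neg, smul_smul, mul_comm (t + n) (q + s + n),
    sgn_mul_self, one_smul]

section Bracket

variable {K A : Type*} [CommRing K] [Ring A] [Algebra K A]
variable {𝒜 : ℤ → Submodule K A} [GradedAlgebra 𝒜] [Coalgebra K A] [GradedHopfAlgebra 𝒜]
variable {B : Type*} [CommRing B] [HopfAlgebra K B]

/-- The map `a ↦ y ↦ c ↦ ∓ D y c a` on elements `a` of degree `r`. -/
def transposeDer (n : ℤ) (D : A →ₗ[K] B →ₗ[K] RepAlg 𝒜 B →ₗ[K] RepAlg 𝒜 B) (r : ℤ) :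
    RepAlg 𝒜 B →ₗ[K] A →ₗ[K] B →ₗ[K] RepAlg 𝒜 B where
  toFun a := LinearMap.mk₂ K (fun y c => -(sgn K (((r : ZMod 2) + n) * n) •
      D ((hopfParity 𝒜).tw (r + n) y) c a))
    (fun y y' c => by simp only [map_add, LinearMap.add_apply, smul_add, neg_add])
    (fun k y c => by simp only [map_smul, LinearMap.smul_apply, smul_neg, smul_comm k])
    (fun y c c' => by simp only [map_add, LinearMap.add_apply, smul_add, neg_add])
    (fun k y c => by simp only [map_smul, LinearMap.smul_apply, smul_neg, smul_comm k])
  map_add' a a' := by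
    ext y c
    simp only [LinearMap.mk₂_apply, LinearMap.add_apply, map_add, smul_add, neg_add]
  map_smul' k a := by
    ext y c
    simp only [LinearMap.mk₂_apply, LinearMap.smul_apply, map_smul, smul_neg, smul_comm k,
      RingHom.id_apply]

theorem transposeDer_apply (n : ℤ) (D : A →ₗ[K] B →ₗ[K] RepAlg 𝒜 B →ₗ[K] RepAlg 𝒜 B) (r : ℤ)
    (a : RepAlg 𝒜 B) {q : ℤ} {y : A} (hy : y ∈ 𝒜 q) (c : B) :
    transposeDer n D r a y c = -(sgn K (((r : ZMod 2) + n) * (q + n)) • D y c a) := by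
  change -(sgn K (((r : ZMod 2) + n) * n) • D ((hopfParity 𝒜).tw (r + n) y) c a) = _
  rw [hopfParity_tw_of_mem 𝒜 hy, map_smul, LinearMap.smul_apply, LinearMap.smul_apply, smul_smul,
    ← sgn_add, ← mul_add, add_comm (n : ZMod 2) q]

variable {ρ : A →ₗ[K] A →ₗ[K] A} {n : ℤ} {bul : B →ₗ[K] B →ₗ[K] K}
variable {D : A →ₗ[K] B →ₗ[K] RepAlg 𝒜 B →ₗ[K] RepAlg 𝒜 B}

theorem derGen_mul (hA : IsGradedCocommutative 𝒜) (hρ : IsFoxPairing 𝒜 n ρ)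
    (hρa : IsAntisymmetricFoxPairing 𝒜 n ρ) (hb : IsBalanced bul)
    (hG : ∀ p x b, x ∈ 𝒜 p → IsDerData 𝒜 B (p + n) (genBrk 𝒜 B ρ n bul x b))
    (hD : ∀ p x b, x ∈ 𝒜 p → IsRepDer 𝒜 B (p + n) (D x b) ∧
        ∀ y c, D x b (gen 𝒜 B y c) = genBrk 𝒜 B ρ n bul x b y c)
    {q s : ℤ} {y z : A} (hy : y ∈ 𝒜 q) (hz : z ∈ 𝒜 s) (c : B) :
    D (y * z) c = ∑ i ∈ (ℛ K c).index,
      (LinearMap.mulLeft K (gen 𝒜 B y ((ℛ K c).left i)) ∘ₗ D z ((ℛ K c).right i) +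
        sgn K ((q : ZMod 2) * s) •
        (LinearMap.mulLeft K (gen 𝒜 B z ((ℛ K c).right i)) ∘ₗ D y ((ℛ K c).left i))) := by
  refine (hD _ _ c (SetLike.mul_mem_graded hy hz)).1.ext (IsRepDer.sum _ fun i => IsRepDer.add
    (((hD s z _ hz).1.mul (gen_mem 𝒜 B hy _)).cast (add_assoc _ _ _).symm)
    ((((hD q y _ hy).1.mul (gen_mem 𝒜 B hz _)).cast (by ring)).smul _)) fun t w d hw => ?_
  have h := congrArg (fun f : Cv K B (RepAlg 𝒜 B) => f.ofConv c) ((hG t w d hw).mul_left y z)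
  simp only [ofConv_add, LinearMap.add_apply, Cv.mul_apply (ℛ K c), ← Finset.sum_add_distrib] at h
  rw [(hD _ _ c (SetLike.mul_mem_graded hy hz)).2, genBrk_antisymm hA hρ hρa hb
    (SetLike.mul_mem_graded hy hz) hw]
  refine (congrArg (fun a => -(sgn K ((((q + s : ℤ) : ZMod 2) + n) * (t + n)) • a)) h).trans ?_
  rw [Finset.smul_sum, ← Finset.sum_neg_distrib, LinearMap.sum_apply]
  refine Finset.sum_congr rfl fun i _ => ?_
  have hc := mul_mem_comm (gen_mem 𝒜 B hz ((ℛ K c).right i))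
    ((hD q y ((ℛ K c).left i) hy).1.map_mem t _ (gen_mem 𝒜 B hw d))
  rw [Int.cast_add, Int.cast_add] at hc
  refine Eq.trans ?_ (leibniz_transpose (K := K) (u := gen 𝒜 B y ((ℛ K c).left i))
    (z := D z ((ℛ K c).right i) (gen 𝒜 B w d)) _ _ _ _ hc).symm
  rw [(hD q y _ hy).2, (hD s z _ hz).2, ← genBrk_antisymm hA hρ hρa hb hw hz,
    ← genBrk_antisymm hA hρ hρa hb hw hy, hopfParity_tw_of_mem 𝒜 hy, Int.cast_add, Int.cast_add]
  refine congrArg (fun a => -(sgn K (((q : ZMod 2) + s + n) * (t + n)) • (a +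
    genBrk 𝒜 B ρ n bul w d y ((ℛ K c).left i) * gen 𝒜 B z ((ℛ K c).right i)))) ?_
  rw [← smul_mul_assoc]
  refine congrArg (· * genBrk 𝒜 B ρ n bul w d z ((ℛ K c).right i)) ?_
  refine LinearMap.congr_fun (map_smul (gen 𝒜 B) _ y) _

theorem derGen_mul_right (hA : IsGradedCocommutative 𝒜) (hρ : IsFoxPairing 𝒜 n ρ)
    (hρa : IsAntisymmetricFoxPairing 𝒜 n ρ) (hb : IsBalanced bul)
    (hG : ∀ p x b, x ∈ 𝒜 p → IsDerData 𝒜 B (p + n) (genBrk 𝒜 B ρ n bul x b))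
    (hD : ∀ p x b, x ∈ 𝒜 p → IsRepDer 𝒜 B (p + n) (D x b) ∧
        ∀ y c, D x b (gen 𝒜 B y c) = genBrk 𝒜 B ρ n bul x b y c)
    {q : ℤ} {y : A} (hy : y ∈ 𝒜 q) (Y : Expansion₂ 𝒜 (comul (R := K) y))
    (hY : ∀ i, Y.deg₁ i + Y.deg₂ i = q) (c d : B) :
    D y (c * d) = ∑ i, (LinearMap.mulLeft K (gen 𝒜 B (Y.fst i) c) ∘ₗ D (Y.snd i) d +
        sgn K ((Y.deg₁ i : ZMod 2) * Y.deg₂ i) •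
        (LinearMap.mulLeft K (gen 𝒜 B (Y.snd i) d) ∘ₗ D (Y.fst i) c)) := by
  refine (hD _ _ _ hy).1.ext (IsRepDer.sum _ fun i => IsRepDer.add
    (((hD _ _ _ (Y.snd_mem i)).1.mul (gen_mem 𝒜 B (Y.fst_mem i) _)).cast (by rw [← hY i]; ring))
    ((((hD _ _ _ (Y.fst_mem i)).1.mul (gen_mem 𝒜 B (Y.snd_mem i) _)).cast
      (by rw [← hY i]; ring)).smul _)) fun t w e hw => ?_
  have h := congrArg (fun f => f.ofConv y) ((hG t w e hw).mul_right c d)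
  simp only [ofConv_add, LinearMap.add_apply, Y.hom.conv_apply, ← Finset.sum_add_distrib] at h
  rw [(hD _ _ _ hy).2, genBrk_antisymm hA hρ hρa hb hy hw]
  refine (congrArg (fun a => -(sgn K (((q : ZMod 2) + n) * (t + n)) • a)) h).trans ?_
  rw [Finset.smul_sum, ← Finset.sum_neg_distrib, LinearMap.sum_apply]
  refine Finset.sum_congr rfl fun i _ => ?_
  have hc := mul_mem_comm (gen_mem 𝒜 B (Y.snd_mem i) d)
    ((hD _ _ c (Y.fst_mem i)).1.map_mem t _ (gen_mem 𝒜 B hw e))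
  rw [Int.cast_add, Int.cast_add] at hc
  refine Eq.trans ?_ (leibniz_transpose (K := K) (u := gen 𝒜 B (Y.fst i) c)
    (z := D (Y.snd i) d (gen 𝒜 B w e)) _ _ _ _ hc).symm
  rw [(hD _ _ _ (Y.fst_mem i)).2, (hD _ _ _ (Y.snd_mem i)).2,
    ← genBrk_antisymm hA hρ hρa hb hw (Y.fst_mem i),
    ← genBrk_antisymm hA hρ hρa hb hw (Y.snd_mem i), ← hY i, Int.cast_add]
  refine congrArg (fun a => -(sgn K (((Y.deg₁ i : ZMod 2) + Y.deg₂ i + n) * (t + n)) • (a +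
    genBrk 𝒜 B ρ n bul w e (Y.fst i) c * gen 𝒜 B (Y.snd i) d))) ?_
  rw [← smul_mul_assoc]
  refine congrArg (· * genBrk 𝒜 B ρ n bul w e (Y.snd i) d) ?_
  refine (congrArg (fun x => gen 𝒜 B x c) (hopfParity_tw_of_mem 𝒜 (Y.fst_mem i) _)).trans ?_
  rw [Int.cast_add]
  exact LinearMap.congr_fun (map_smul (gen 𝒜 B) _ _) _

theorem isDerData_transposeDer (hA : IsGradedCocommutative 𝒜) (hρ : IsFoxPairing 𝒜 n ρ)
    (hρa : IsAntisymmetricFoxPairing 𝒜 n ρ) (hb : IsBalanced bul)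
    (hG : ∀ p x b, x ∈ 𝒜 p → IsDerData 𝒜 B (p + n) (genBrk 𝒜 B ρ n bul x b))
    (hD : ∀ p x b, x ∈ 𝒜 p → IsRepDer 𝒜 B (p + n) (D x b) ∧
        ∀ y c, D x b (gen 𝒜 B y c) = genBrk 𝒜 B ρ n bul x b y c)
    {r : ℤ} {a : RepAlg 𝒜 B} (ha : a ∈ repGrading 𝒜 B r) :
    IsDerData 𝒜 B (r + n) (transposeDer n D r a) where
  mem q y c hy := by
    rw [transposeDer_apply n D r a hy, add_left_comm]
    exact Submodule.neg_mem _ (Submodule.smul_mem _ _ ((hD q y c hy).1.map_mem r a ha))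
  mul_left y z := by
    refine graded_induction 𝒜 (p := fun y => (toConv (transposeDer n D r a (y * z)) :
        Cv K B (RepAlg 𝒜 B)) = genConv 𝒜 B ((hopfParity 𝒜).tw (r + n : ℤ) y) *
        toConv (transposeDer n D r a z) + toConv (transposeDer n D r a y) * genConv 𝒜 B z)
      (fun q y hy => ?_) (fun y y' h h' => ?_) y
    · refine graded_induction 𝒜 (p := fun z => (toConv (transposeDer n D r a (y * z)) :
          Cv K B (RepAlg 𝒜 B)) = genConv 𝒜 B ((hopfParity 𝒜).tw (r + n : ℤ) y) *
          toConv (transposeDer n D r a z) + toConv (transposeDer n D r a y) * genConv 𝒜 B z)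
        (fun s z hz => Cv.ext fun c => ?_) (fun z z' h h' => ?_) z
      · rw [ofConv_add, LinearMap.add_apply, Cv.mul_apply (ℛ K c), Cv.mul_apply (ℛ K c),
          ← Finset.sum_add_distrib]
        refine (transposeDer_apply n D r a (SetLike.mul_mem_graded hy hz) c).trans ?_
        rw [derGen_mul hA hρ hρa hb hG hD hy hz, LinearMap.sum_apply, Finset.smul_sum,
          ← Finset.sum_neg_distrib]
        refine Finset.sum_congr rfl fun i _ => ?_
        have hc := mul_mem_comm (gen_mem 𝒜 B hz ((ℛ K c).right i))
          ((hD q y ((ℛ K c).left i) hy).1.map_mem r a ha)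
        rw [Int.cast_add, Int.cast_add] at hc
        rw [Int.cast_add]
        refine (leibniz_transpose' (K := K) (u := gen 𝒜 B y ((ℛ K c).left i))
          (z := D z ((ℛ K c).right i) a) _ _ _ _ hc).trans ?_
        rw [← transposeDer_apply n D r a hy, ← transposeDer_apply n D r a hz,
          hopfParity_tw_of_mem 𝒜 hy, ← smul_mul_assoc, Int.cast_add]
        refine congrArg (· * transposeDer n D r a z ((ℛ K c).right i) +
          transposeDer n D r a y ((ℛ K c).left i) * gen 𝒜 B z ((ℛ K c).right i)) ?_
        exact (LinearMap.congr_fun (map_smul (gen 𝒜 B) _ y) _).symm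
      · simp only [mul_add, map_add, toConv_add, h, h', genConv] 
        abel
    · simp only [add_mul, map_add, toConv_add, h, h', genConv]
      abel
  mul_right c d := by
    refine WithConv.ext (LinearMap.ext fun y => ?_)
    refine graded_induction 𝒜 (p := fun y => transposeDer n D r a y (c * d) =
      (chiTw 𝒜 B (r + n : ℤ) c * toConv ((transposeDer n D r a).flip d) +
        toConv ((transposeDer n D r a).flip c) * chi 𝒜 B d).ofConv y)
      (fun q y hy => ?_) (fun y y' h h' => ?_) y
    · obtain ⟨Y, hY⟩ := exists_expansion₂ hy
      rw [ofConv_add, LinearMap.add_apply, Y.hom.conv_apply, Y.hom.conv_apply,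
        ← Finset.sum_add_distrib, transposeDer_apply n D r a hy,
        derGen_mul_right hA hρ hρa hb hG hD hy Y hY, LinearMap.sum_apply, Finset.smul_sum,
        ← Finset.sum_neg_distrib]
      refine Finset.sum_congr rfl fun i _ => ?_
      have hc := mul_mem_comm (gen_mem 𝒜 B (Y.snd_mem i) d)
        ((hD _ _ c (Y.fst_mem i)).1.map_mem r a ha)
      rw [Int.cast_add, Int.cast_add] at hc
      rw [← hY i, Int.cast_add]
      refine (leibniz_transpose' (K := K) (u := gen 𝒜 B (Y.fst i) c)
        (z := D (Y.snd i) d a) _ _ _ _ hc).trans ?_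
      rw [← transposeDer_apply n D r a (Y.fst_mem i), ← transposeDer_apply n D r a (Y.snd_mem i),
        ← smul_mul_assoc]
      refine congrArg (· * transposeDer n D r a (Y.snd i) d +
        transposeDer n D r a (Y.fst i) c * gen 𝒜 B (Y.snd i) d) ?_
      refine Eq.trans ?_ (congrArg (fun x => gen 𝒜 B x c)
        (hopfParity_tw_of_mem 𝒜 (Y.fst_mem i) _)).symm
      rw [Int.cast_add]
      exact (LinearMap.congr_fun (map_smul (gen 𝒜 B) _ _) _).symm
    · rw [map_add, LinearMap.add_apply, map_add, h, h']

end Bracket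

section Bracket

variable {K A : Type*} [CommRing K] [Ring A] [Algebra K A]
variable {𝒜 : ℤ → Submodule K A} [GradedAlgebra 𝒜] [Coalgebra K A] [GradedHopfAlgebra 𝒜]
variable {B : Type*} [CommRing B] [HopfAlgebra K B]

variable (𝒜 B) in
/-- The graded brackets in `A_B`, in terms of the derivations `{a, -}`. -/
structure IsRepBracket (n : ℤ) (br : RepAlg 𝒜 B →ₗ[K] RepAlg 𝒜 B →ₗ[K] RepAlg 𝒜 B) : Prop where
  isRepDer : ∀ (p : ℤ) (a : RepAlg 𝒜 B), a ∈ repGrading 𝒜 B p → IsRepDer 𝒜 B (p + n) (br a)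
  antisymm : ∀ (p q : ℤ) (a b : RepAlg 𝒜 B), a ∈ repGrading 𝒜 B p → b ∈ repGrading 𝒜 B q →
    br a b = -(sgn K (((p : ZMod 2) + n) * (q + n)) • br b a)

variable {n : ℤ} {br : RepAlg 𝒜 B →ₗ[K] RepAlg 𝒜 B →ₗ[K] RepAlg 𝒜 B}

theorem br_mul_left
    (hd : ∀ (p : ℤ) (a : RepAlg 𝒜 B), a ∈ repGrading 𝒜 B p → IsRepDer 𝒜 B (p + n) (br a))
    (hs : ∀ (p q : ℤ) (a : RepAlg 𝒜 B) (y : A) (c : B), a ∈ repGrading 𝒜 B p → y ∈ 𝒜 q →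
      br (gen 𝒜 B y c) a = -(sgn K (((q : ZMod 2) + n) * (p + n)) • br a (gen 𝒜 B y c)))
    {p q : ℤ} {u v : RepAlg 𝒜 B} (hu : u ∈ repGrading 𝒜 B p) (hv : v ∈ repGrading 𝒜 B q) :
    br (u * v) = LinearMap.mulLeft K u ∘ₗ br v +
      sgn K ((p : ZMod 2) * q) • (LinearMap.mulLeft K v ∘ₗ br u) := by
  refine (hd _ _ (SetLike.mul_mem_graded hu hv)).ext (IsRepDer.add
    (((hd q v hv).mul hu).cast (add_assoc _ _ _).symm)
    ((((hd p u hu).mul hv).cast (by ring)).smul _)) fun t y c hy => ?_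
  have hc := mul_mem_comm hv ((hd p u hu).map_mem t _ (gen_mem 𝒜 B hy c))
  rw [Int.cast_add, Int.cast_add] at hc
  refine Eq.trans ?_ (leibniz_transpose (K := K) (u := u) (z := br v (gen 𝒜 B y c)) _ _ _ _
    hc).symm
  rw [← hs _ _ _ _ _ hu hy, ← hs _ _ _ _ _ hv hy]
  have h := hs _ _ _ _ c (SetLike.mul_mem_graded hu hv) hy
  rw [(hd t _ (gen_mem 𝒜 B hy c)).leibniz p u v hu] at h
  have h' := congrArg (fun a => -(sgn K (((p : ZMod 2) + q + n) * (t + n)) • a)) h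
  rw [Int.cast_add, Int.cast_add, smul_neg, neg_neg, smul_smul, mul_comm (t + n : ZMod 2) (p + q + n),
    sgn_mul_self, one_smul] at h'
  rw [← h', add_comm (br (gen 𝒜 B y c) u * v)]

theorem IsRepBracket.of_gen
    (hd : ∀ (p : ℤ) (a : RepAlg 𝒜 B), a ∈ repGrading 𝒜 B p → IsRepDer 𝒜 B (p + n) (br a))
    (hs : ∀ (p q : ℤ) (a : RepAlg 𝒜 B) (y : A) (c : B), a ∈ repGrading 𝒜 B p → y ∈ 𝒜 q →
      br (gen 𝒜 B y c) a = -(sgn K (((q : ZMod 2) + n) * (p + n)) • br a (gen 𝒜 B y c))) :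
    IsRepBracket 𝒜 B n br where
  isRepDer := hd
  antisymm t p z u hz hu := by
    refine Submodule.span_induction (p := fun u _ => br z u =
      -(sgn K (((t : ZMod 2) + n) * (p + n)) • br u z)) (fun m hm => ?_) (by simp)
      (fun u v _ _ h h' => by
        rw [map_add, map_add, LinearMap.add_apply, h, h', smul_add, neg_add])
      (fun k u _ h => by
        rw [map_smul, map_smul, LinearMap.smul_apply, h, smul_neg, smul_comm k]) hu
    clear hu
    induction hm with
    | one =>
      have h := br_mul_left hd hs SetLike.GradedOne.one_mem SetLike.GradedOne.one_mem
      rw [mul_one, Int.cast_zero, mul_zero, sgn_zero, one_smul] at h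
      have h' := LinearMap.congr_fun h z
      simp only [LinearMap.add_apply, LinearMap.comp_apply, LinearMap.mulLeft_apply, one_mul,
        left_eq_add] at h'
      rw [(hd t z hz).map_one, h', smul_zero, neg_zero]
    | gen_mul q s x b m hx hm ih =>
      have hm' : m ∈ repGrading 𝒜 B s := Submodule.subset_span hm
      have hc := mul_mem_comm hm' ((hd q _ (gen_mem 𝒜 B hx b)).map_mem t z hz)
      rw [Int.cast_add, Int.cast_add] at hc
      rw [br_mul_left hd hs (gen_mem 𝒜 B hx b) hm', (hd t z hz).leibniz q _ _ (gen_mem 𝒜 B hx b),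
        Int.cast_add, Int.cast_add, ih]
      refine Eq.trans ?_ (leibniz_transpose' (K := K) (u := gen 𝒜 B x b) (z := br m z) _ _ _ _
        hc).symm
      rw [hs t q z x b hz hx, smul_neg, neg_neg, smul_smul, mul_comm (t + n : ZMod 2) (q + n),
        sgn_mul_self, one_smul, add_comm]

theorem IsRepBracket.mul_left (h : IsRepBracket 𝒜 B n br) {p q : ℤ} {u v : RepAlg 𝒜 B}
    (hu : u ∈ repGrading 𝒜 B p) (hv : v ∈ repGrading 𝒜 B q) :
    br (u * v) = LinearMap.mulLeft K u ∘ₗ br v +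
      sgn K ((p : ZMod 2) * q) • (LinearMap.mulLeft K v ∘ₗ br u) :=
  br_mul_left h.isRepDer (fun _ _ _ _ c ha hy => h.antisymm _ _ _ _ (gen_mem 𝒜 B hy c) ha) hu hv

theorem IsRepBracket.isGradedBracket (h : IsRepBracket 𝒜 B n br) :
    IsGradedBracket (repGrading 𝒜 B) n br where
  map_mem p q x y hx hy := by
    rw [add_comm p q, add_assoc]
    exact (h.isRepDer p x hx).map_mem q y hy
  leibniz_right p q r x y z hx hy hz := by
    rw [(h.isRepDer p x hx).leibniz q y z hy, negOnePow_smul (K := K)]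
    push_cast
    rfl
  leibniz_left p q r x y z hx hy hz := by
    rw [h.mul_left hx hy, negOnePow_smul (K := K), LinearMap.add_apply, LinearMap.smul_apply,
      LinearMap.comp_apply, LinearMap.comp_apply, LinearMap.mulLeft_apply, LinearMap.mulLeft_apply,
      mul_mem_comm hy ((h.isRepDer p x hx).map_mem r z hz), smul_smul, ← sgn_add]
    have e : ∀ p q r n : ZMod 2, p * q + q * (r + (p + n)) = q * (r + n) := by decide
    push_cast
    rw [e]

theorem IsRepBracket.isAntisymmetricBracket (h : IsRepBracket 𝒜 B n br) :
    IsAntisymmetricBracket (repGrading 𝒜 B) n br := fun p q x y hx hy => by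
  rw [h.antisymm p q x y hx hy, negOnePow_smul (K := K)]
  push_cast
  rfl

theorem IsGradedBracket.isRepDer (h : IsGradedBracket (repGrading 𝒜 B) n br) {p : ℤ}
    {a : RepAlg 𝒜 B} (ha : a ∈ repGrading 𝒜 B p) : IsRepDer 𝒜 B (p + n) (br a) where
  map_mem q u hu := by
    rw [add_left_comm, ← add_assoc]
    exact h.map_mem p q a u ha hu
  leibniz q u v hu := by
    refine graded_induction (repGrading 𝒜 B) (p := fun v => br a (u * v) =
      br a u * v + sgn K (((p + n : ℤ) : ZMod 2) * q) • (u * br a v)) (fun r v hv => ?_)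
      (fun v v' h h' => ?_) v
    · rw [h.leibniz_right p q r a u v ha hu hv, negOnePow_smul (K := K)]
      push_cast
      rfl
    · simp only [mul_add, map_add, smul_add, h, h']
      abel

theorem IsGradedBracket.ext {br' : RepAlg 𝒜 B →ₗ[K] RepAlg 𝒜 B →ₗ[K] RepAlg 𝒜 B}
    (h : IsGradedBracket (repGrading 𝒜 B) n br) (h' : IsGradedBracket (repGrading 𝒜 B) n br')
    (e : ∀ x b y c, br (gen 𝒜 B x b) (gen 𝒜 B y c) = br' (gen 𝒜 B x b) (gen 𝒜 B y c)) :
    br = br' := by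
  have one : ∀ {br : RepAlg 𝒜 B →ₗ[K] RepAlg 𝒜 B →ₗ[K] RepAlg 𝒜 B},
      IsGradedBracket (repGrading 𝒜 B) n br → ∀ r z, z ∈ repGrading 𝒜 B r → br 1 z = 0 := by
    intro br h r z hz
    have h := h.leibniz_left 0 0 r 1 1 z SetLike.GradedOne.one_mem SetLike.GradedOne.one_mem hz
    simpa using h
  have hgen : ∀ p x b, x ∈ 𝒜 p → br (gen 𝒜 B x b) = br' (gen 𝒜 B x b) := fun p x b hx =>
    (h.isRepDer (gen_mem 𝒜 B hx b)).ext (h'.isRepDer (gen_mem 𝒜 B hx b)) fun q y c _ => e x b y c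
  refine rep_ext 𝒜 B (N := RepAlg 𝒜 B →ₗ[K] RepAlg 𝒜 B) fun p m hm => ?_
  induction hm with
  | one =>
    refine LinearMap.ext fun z => graded_induction (repGrading 𝒜 B) (p := fun z => br 1 z =
      br' 1 z) (fun r z hz => ?_) (fun z z' h h' => by rw [map_add, map_add, h, h']) z
    rw [one h r z hz, one h' r z hz]
  | gen_mul p q x b m hx hm ih =>
    refine LinearMap.ext fun z => graded_induction (repGrading 𝒜 B)
      (p := fun z => br (gen 𝒜 B x b * m) z = br' (gen 𝒜 B x b * m) z) (fun r z hz => ?_)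
      (fun z z' h h' => by rw [map_add, map_add, h, h']) z
    rw [h.leibniz_left p q r _ m z (gen_mem 𝒜 B hx b) (Submodule.subset_span hm) hz,
      h'.leibniz_left p q r _ m z (gen_mem 𝒜 B hx b) (Submodule.subset_span hm) hz, ih,
      hgen p x b hx]

variable {ρ : A →ₗ[K] A →ₗ[K] A} {bul : B →ₗ[K] B →ₗ[K] K}

theorem exists_isRepBracket (hA : IsGradedCocommutative 𝒜) (hρ : IsFoxPairing 𝒜 n ρ)
    (hρa : IsAntisymmetricFoxPairing 𝒜 n ρ) (hb : IsBalanced bul)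
    (hd : ∀ b, IsCounitDer (bul b)) (hs : ∀ b c, bul b c = bul c b) :
    ∃ br : RepAlg 𝒜 B →ₗ[K] RepAlg 𝒜 B →ₗ[K] RepAlg 𝒜 B, IsRepBracket 𝒜 B n br ∧
      ∀ x b y c, br (gen 𝒜 B x b) (gen 𝒜 B y c) = genBrk 𝒜 B ρ n bul x b y c := by
  have hG : ∀ p x b, x ∈ 𝒜 p → IsDerData 𝒜 B (p + n) (genBrk 𝒜 B ρ n bul x b) :=
    fun p x b hx => isDerData_genBrk hA hρ hb hd hs hx b
  obtain ⟨D, hD⟩ := exists_derGen hA hρ hb hd hs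
  obtain ⟨br, hbr⟩ := exists_graded_isRepDer (repGrading 𝒜 B) (transposeDer n D)
    fun p a ha => isDerData_transposeDer hA hρ hρa hb hG hD ha
  have hgen : ∀ p x b, x ∈ 𝒜 p → br (gen 𝒜 B x b) = D x b := fun p x b hx =>
    (hbr p _ (gen_mem 𝒜 B hx b)).1.ext (hD p x b hx).1 fun q y c hy => by
      rw [(hbr p _ (gen_mem 𝒜 B hx b)).2, transposeDer_apply n D p _ hy, (hD q y c hy).2,
        (hD p x b hx).2, ← genBrk_antisymm hA hρ hρa hb hx hy]
  refine ⟨br, IsRepBracket.of_gen (fun p a ha => (hbr p a ha).1) fun p q a y c ha hy => ?_,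
    fun x b y c => ?_⟩
  · rw [hgen q y c hy, (hbr p a ha).2, transposeDer_apply n D p _ hy, smul_neg, neg_neg, smul_smul,
      mul_comm (q + n : ZMod 2), sgn_mul_self, one_smul]
  · refine graded_induction 𝒜 (p := fun x => br (gen 𝒜 B x b) (gen 𝒜 B y c) =
      genBrk 𝒜 B ρ n bul x b y c) (fun p x hx => ?_)
      (fun x x' h h' => by simp only [map_add, LinearMap.add_apply, h, h']) x
    rw [hgen p x b hx, (hD p x b hx).2]

theorem satisfiesMainFormula_iff : SatisfiesMainFormula 𝒜 n ρ bul br ↔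
    ∀ x b y c, br (gen 𝒜 B x b) (gen 𝒜 B y c) = genBrk 𝒜 B ρ n bul x b y c := by
  have e : ∀ (x y : A) (b c : B)
      (X : Expansion₂ 𝒜 (comul (R := K) x)) (Y : Expansion₂ 𝒜 (comul (R := K) y))
      (β : Sweedler₄ (K := K) b) (γ : Sweedler₂ (K := K) c), genBrk 𝒜 B ρ n bul x b y c =
      ∑ i, ∑ j, ∑ k, ∑ l,
        (X.deg₂ i * (Y.deg₁ j + n)).negOnePow • bul (γ.el l 1) (β.el k 1) •
          (gen 𝒜 B (ρ (X.fst i) (Y.fst j)) (HopfAlgebra.antipode K (β.el k 2) * β.el k 0) *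
            gen 𝒜 B (X.snd i) (β.el k 3) * gen 𝒜 B (Y.snd j) (γ.el l 0)) := by
    intro x y b c X Y β γ
    refine (genBrk_eq_sum 𝒜 B ρ n bul X.hom Y.hom β γ).trans ?_
    refine Finset.sum_congr rfl fun i _ => Finset.sum_congr rfl fun j _ =>
      Finset.sum_congr rfl fun k _ => Finset.sum_congr rfl fun l _ => ?_
    rw [negOnePow_smul (K := K)]
    push_cast
    rfl
  constructor
  · intro h x b y c
    refine graded_induction 𝒜 (p := fun x => br (gen 𝒜 B x b) (gen 𝒜 B y c) =
      genBrk 𝒜 B ρ n bul x b y c) (fun p x hx => ?_)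
      (fun x x' h h' => by simp only [map_add, LinearMap.add_apply, h, h']) x
    refine graded_induction 𝒜 (p := fun y => br (gen 𝒜 B x b) (gen 𝒜 B y c) =
      genBrk 𝒜 B ρ n bul x b y c) (fun q y hy => ?_)
      (fun y y' h h' => by simp only [map_add, LinearMap.add_apply, h, h']) y
    obtain ⟨X, -⟩ := exists_expansion₂ hx
    obtain ⟨Y, -⟩ := exists_expansion₂ hy
    obtain ⟨β⟩ := nonempty_sweedler₄ (K := K) b
    obtain ⟨γ⟩ := nonempty_sweedler₂ (K := K) c
    rw [h x y b c X Y β γ, e x y b c X Y β γ]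
  · intro h x y b c X Y β γ
    rw [h, e x y b c X Y β γ]

end Bracket

theorem leibniz_commutator {K S : Type*} [CommRing K] [Ring S] [Algebra K S] (e e' q : ZMod 2)
    (u v u₁ u₂ u₁₂ u₂₁ v₁ v₂ v₁₂ v₂₁ : S) :
    u₁₂ * v + sgn K (e * (q + e')) • (u₂ * v₁) +
        sgn K (e' * q) • (u₁ * v₂ + sgn K (e * q) • (u * v₁₂)) -
      sgn K (e * e') • (u₂₁ * v + sgn K (e' * (q + e)) • (u₁ * v₂) +
        sgn K (e * q) • (u₂ * v₁ + sgn K (e' * q) • (u * v₂₁))) =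
      (u₁₂ - sgn K (e * e') • u₂₁) * v +
        sgn K ((e + e') * q) • (u * (v₁₂ - sgn K (e * e') • v₂₁)) := by
  have h₁ : ∀ e e' q : ZMod 2, e * e' + e' * (q + e) = e' * q := by decide
  have h₂ : ∀ e e' q : ZMod 2, e * (q + e') = e * e' + e * q := by decide
  have h₃ : ∀ e e' q : ZMod 2, e' * q + e * q = (e + e') * q := by decide
  have h₄ : ∀ e e' q : ZMod 2, (e + e') * q + e * e' = e * e' + (e * q + e' * q) := by decide
  simp only [smul_add, smul_smul, ← sgn_add, sub_mul, mul_sub, smul_sub, smul_mul_assoc,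
    mul_smul_comm]
  rw [h₁, h₂, h₃, h₄]
  abel

section Jacobi

variable {K A : Type*} [CommRing K] [Ring A] [Algebra K A]
variable {𝒜 : ℤ → Submodule K A} [GradedAlgebra 𝒜] [Coalgebra K A] [GradedHopfAlgebra 𝒜]
variable {B : Type*} [CommRing B] [HopfAlgebra K B]

theorem IsRepDer.sub {e : ℤ} {D D' : RepAlg 𝒜 B →ₗ[K] RepAlg 𝒜 B} (hD : IsRepDer 𝒜 B e D)
    (hD' : IsRepDer 𝒜 B e D') : IsRepDer 𝒜 B e (D - D') where
  map_mem q u hu := Submodule.sub_mem _ (hD.map_mem q u hu) (hD'.map_mem q u hu)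
  leibniz q u v hu := by
    simp only [LinearMap.sub_apply, hD.leibniz q u v hu, hD'.leibniz q u v hu, sub_mul, mul_sub,
      smul_sub]
    abel

theorem IsRepDer.commutator {e e' : ℤ} {D D' : RepAlg 𝒜 B →ₗ[K] RepAlg 𝒜 B}
    (hD : IsRepDer 𝒜 B e D) (hD' : IsRepDer 𝒜 B e' D') :
    IsRepDer 𝒜 B (e + e') (D ∘ₗ D' - sgn K ((e : ZMod 2) * e') • (D' ∘ₗ D)) where
  map_mem q u hu := by
    refine Submodule.sub_mem _ ?_ (Submodule.smul_mem _ _ ?_)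
    · have h := hD.map_mem _ _ (hD'.map_mem q u hu)
      rwa [add_assoc, add_comm e'] at h
    · have h := hD'.map_mem _ _ (hD.map_mem q u hu)
      rwa [add_assoc] at h
  leibniz q u v hu := by
    simp only [LinearMap.sub_apply, LinearMap.smul_apply, LinearMap.comp_apply,
      hD'.leibniz q u v hu, hD.leibniz q u v hu, map_add, map_smul,
      hD.leibniz _ _ v (hD'.map_mem q u hu), hD'.leibniz _ _ v (hD.map_mem q u hu),
      hD.leibniz q u _ hu, hD'.leibniz q u _ hu, Int.cast_add]
    exact leibniz_commutator _ _ _ _ _ _ _ _ _ _ _ _ _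

variable {n : ℤ} {br : RepAlg 𝒜 B →ₗ[K] RepAlg 𝒜 B →ₗ[K] RepAlg 𝒜 B}

/-- The Jacobiator of elements of degrees `p`, `q`, `r`. -/
def jacobiator (n : ℤ) (br : RepAlg 𝒜 B →ₗ[K] RepAlg 𝒜 B →ₗ[K] RepAlg 𝒜 B) (p q r : ℤ)
    (x y z : RepAlg 𝒜 B) : RepAlg 𝒜 B :=
  sgn K (((p : ZMod 2) + n) * (r + n)) • br x (br y z) +
    sgn K (((p : ZMod 2) + n) * (q + n)) • br y (br z x) +
    sgn K (((q : ZMod 2) + n) * (r + n)) • br z (br x y)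

theorem jacobiator_rotate (p q r : ℤ) (x y z : RepAlg 𝒜 B) :
    jacobiator n br p q r x y z = jacobiator n br q r p y z x := by
  unfold jacobiator
  rw [mul_comm (q + n : ZMod 2) (p + n), mul_comm (r + n : ZMod 2) (p + n)]
  abel

theorem IsRepBracket.jacobiator_eq (h : IsRepBracket 𝒜 B n br) {p q r : ℤ} {x y z : RepAlg 𝒜 B}
    (hx : x ∈ repGrading 𝒜 B p) (hy : y ∈ repGrading 𝒜 B q) (hz : z ∈ repGrading 𝒜 B r) :
    jacobiator n br p q r x y z = sgn K (((p : ZMod 2) + n) * (r + n)) •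
      (br x ∘ₗ br y - sgn K (((p + n : ℤ) : ZMod 2) * (q + n : ℤ)) • (br y ∘ₗ br x) - br (br x y))
        z := by
  have hxy := (h.isRepDer p x hx).map_mem q y hy
  unfold jacobiator
  rw [h.antisymm r p z x hz hx, h.antisymm r _ z _ hz hxy, LinearMap.sub_apply,
    LinearMap.sub_apply, LinearMap.smul_apply, LinearMap.comp_apply, LinearMap.comp_apply, map_neg,
    map_smul]
  push_cast
  have e₁ : ∀ p q r n : ZMod 2, (p + n) * (q + n) + (r + n) * (p + n) =
    (p + n) * (r + n) + (p + n) * (q + n) := by decide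
  have e₂ : ∀ p q r n : ZMod 2, (q + n) * (r + n) + (r + n) * (q + (p + n) + n) =
    (p + n) * (r + n) := by decide
  simp only [smul_sub, smul_neg, smul_smul, ← sgn_add, e₁, e₂]
  abel

theorem IsRepBracket.jacobiator_eq_zero (h : IsRepBracket 𝒜 B n br) {p q : ℤ}
    {x y : RepAlg 𝒜 B} (hx : x ∈ repGrading 𝒜 B p) (hy : y ∈ repGrading 𝒜 B q)
    (hg : ∀ r z d, z ∈ 𝒜 r → jacobiator n br p q r x y (gen 𝒜 B z d) = 0) {r : ℤ}
    {z : RepAlg 𝒜 B} (hz : z ∈ repGrading 𝒜 B r) : jacobiator n br p q r x y z = 0 := by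
  have hxy := (h.isRepDer p x hx).map_mem q y hy
  have hD := ((h.isRepDer p x hx).commutator (h.isRepDer q y hy)).sub
    ((h.isRepDer _ _ hxy).cast (by ring))
  have hJ : br x ∘ₗ br y - sgn K (((p + n : ℤ) : ZMod 2) * (q + n : ℤ)) • (br y ∘ₗ br x) -
      br (br x y) = 0 := by
    refine hD.ext IsRepDer.zero fun r w d hw => ?_
    have h' := congrArg (fun a => sgn K (((p : ZMod 2) + n) * (r + n)) • a) (hg r w d hw)
    rwa [h.jacobiator_eq hx hy (gen_mem 𝒜 B hw d), smul_zero, smul_smul, sgn_mul_self,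
      one_smul] at h'
  rw [h.jacobiator_eq hx hy hz, hJ, LinearMap.zero_apply, smul_zero]

theorem IsRepBracket.isGerstenhaberBracket (h : IsRepBracket 𝒜 B n br)
    (hg : ∀ p q r x y z b c d, x ∈ 𝒜 p → y ∈ 𝒜 q → z ∈ 𝒜 r →
      jacobiator n br p q r (gen 𝒜 B x b) (gen 𝒜 B y c) (gen 𝒜 B z d) = 0) :
    IsGerstenhaberBracket (repGrading 𝒜 B) n br where
  toIsGradedBracket := h.isGradedBracket
  antisymm := h.isAntisymmetricBracket
  jacobi p q r x y z hx hy hz := by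
    have h₁ : jacobiator n br p q r x y z = 0 := by
      refine h.jacobiator_eq_zero hx hy (fun r z d hz => ?_) hz
      rw [jacobiator_rotate]
      refine h.jacobiator_eq_zero hy (gen_mem 𝒜 B hz d) (fun p x b hx => ?_) hx
      rw [jacobiator_rotate]
      exact h.jacobiator_eq_zero (gen_mem 𝒜 B hz d) (gen_mem 𝒜 B hx b)
        (fun q y c hy => hg _ _ _ _ _ _ _ _ _ hz hx hy) hy
    rw [negOnePow_smul (K := K), negOnePow_smul (K := K), negOnePow_smul (K := K)]
    push_cast
    exact h₁

end Jacobi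

section Abstract

variable {K B R : Type*} [CommRing K] [CommRing B] [HopfAlgebra K B] [Ring R] [Algebra K R]

/-- The bracket built from a pairing and two points, as a function of its first argument. -/
def brkLeft (bul : B →ₗ[K] B →ₗ[K] K) (p : Cv K B R) (X Y : B →ₐ[K] R) (c : B) : Cv K B R :=
  toConv (tri p (AlgHom.cv X) (AlgHom.cv Y) ∘ₗ (uni bul).flip c)

theorem brkLeft_apply (bul : B →ₗ[K] B →ₗ[K] K) (p : Cv K B R) (X Y : B →ₐ[K] R) (b c : B) :
    (brkLeft bul p X Y c).ofConv b = tri p (AlgHom.cv X) (AlgHom.cv Y) (uni bul b c) := rfl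

section Exchange

variable {L : Type*} [CommRing L] [Algebra K L]
variable (bul : B →ₗ[K] B →ₗ[K] K) (u w g h k : Pt K B L) (Ψ : L →ₗ[K] R)
variable {F G F' G' : Cv K B R} {X X' Y Z : B →ₐ[K] R}

theorem exchange_right_aux (hΨ : ∀ a a' x y z,
      Ψ (u.hom a * (w.hom a' * (g.hom x * (h.hom y * k.hom z)))) =
        F.ofConv a * G.ofConv a' * (X x * (Y y * Z z)))
    (hX : ∀ a x, X' x * G.ofConv a = G.ofConv a * X x) (b c d : B) :
    Ψ (tri (Pt.lin u) (Pt.lin g) ((fox bul w h k).ofConv d) (uni bul b c)) =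
      tri F (AlgHom.cv X') (brkLeft bul G Y Z d) (uni bul b c) := by
  generalize uni bul b c = t
  refine LinearMap.congr_fun (f := Ψ ∘ₗ tri (Pt.lin u) (Pt.lin g) ((fox bul w h k).ofConv d))
    (TensorProduct.ext_threefold' fun a x γ => ?_) t
  rw [LinearMap.comp_apply, tri_tmul, tri_tmul, ← tri_uni_fox_apply, brkLeft_apply]
  generalize uni bul γ d = s
  refine LinearMap.congr_fun (f := Ψ ∘ₗ LinearMap.mulLeft K ((Pt.lin u).ofConv a) ∘ₗ
      LinearMap.mulLeft K ((Pt.lin g).ofConv x) ∘ₗ tri (Pt.lin w) (Pt.lin h) (Pt.lin k))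
    (g := LinearMap.mulLeft K (F.ofConv a) ∘ₗ LinearMap.mulLeft K ((AlgHom.cv X').ofConv x) ∘ₗ
      tri G (AlgHom.cv Y) (AlgHom.cv Z)) (TensorProduct.ext_threefold' fun a' y z => ?_) s
  simp only [LinearMap.comp_apply, LinearMap.mulLeft_apply, tri_tmul, Pt.lin_apply,
    AlgHom.cv_apply]
  rw [mul_left_comm (g.hom x), hΨ, ← mul_assoc (X' x), hX, mul_assoc, mul_assoc]

theorem exchange_left_aux {κ : K} (hΨ : ∀ a a' x y z,
      Ψ (u.hom a * (w.hom a' * (g.hom x * (h.hom y * k.hom z)))) =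
        F.ofConv a * G.ofConv a' * (X x * (Y y * Z z)))
    (hF : ∀ a a', F.ofConv a * G.ofConv a' = κ • (G'.ofConv a' * F'.ofConv a)) (b c d : B) :
    Ψ (tri (Pt.lin w) ((Cv.flip (fox bul u g h)).ofConv b) (Pt.lin k) (uni bul c d)) =
      κ • tri G' (brk bul F' X Y b) (AlgHom.cv Z) (uni bul c d) := by
  generalize uni bul c d = t
  refine LinearMap.congr_fun (f := Ψ ∘ₗ tri (Pt.lin w) ((Cv.flip (fox bul u g h)).ofConv b)
      (Pt.lin k)) (g := κ • tri G' (brk bul F' X Y b) (AlgHom.cv Z))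
    (TensorProduct.ext_threefold' fun a' β z => ?_) t
  rw [LinearMap.comp_apply, LinearMap.smul_apply, tri_tmul, tri_tmul, Cv.flip_apply,
    ← tri_uni_fox_apply, brk_apply]
  generalize uni bul b β = s
  refine LinearMap.congr_fun (f := Ψ ∘ₗ LinearMap.mulLeft K ((Pt.lin w).ofConv a') ∘ₗ
      LinearMap.mulRight K ((Pt.lin k).ofConv z) ∘ₗ tri (Pt.lin u) (Pt.lin g) (Pt.lin h))
    (g := κ • (LinearMap.mulLeft K (G'.ofConv a') ∘ₗ
      LinearMap.mulRight K ((AlgHom.cv Z).ofConv z) ∘ₗ tri F' (AlgHom.cv X) (AlgHom.cv Y)))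
      (TensorProduct.ext_threefold' fun a x y => ?_) s
  simp only [LinearMap.comp_apply, LinearMap.smul_apply, LinearMap.mulLeft_apply,
    LinearMap.mulRight_apply, tri_tmul, Pt.lin_apply, AlgHom.cv_apply]
  rw [mul_assoc (u.hom a), mul_left_comm (w.hom a'), mul_assoc (g.hom x), hΨ, hF, smul_mul_assoc]
  simp only [mul_assoc]

end Exchange

variable (K B) in
/-- The two points of `B ⊗ B`. -/
def ptFst : Pt K B (B ⊗[K] B) := toConv Algebra.TensorProduct.includeLeft

variable (K B) in
/-- The second universal point. -/
def ptSnd : Pt K B (B ⊗[K] B) := toConv Algebra.TensorProduct.includeRight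

theorem transfer_pt₂ (f : B →ₗ[K] B →ₗ[K] R) (X Y Z : B →ₐ[K] R) (a a' x y z : B) :
    transfer (TensorProduct.lift f) X Y Z ((pt₀ (ptFst K B)).hom a * ((pt₀ (ptSnd K B)).hom a' *
      ((ptR (B ⊗[K] B) (pt₁ (K := K) (B := B))).hom x *
        ((ptR (B ⊗[K] B) (pt₂ (K := K) (B := B))).hom y *
          (ptR (B ⊗[K] B) (pt₃ (K := K) (B := B))).hom z)))) =
      f a a' * (X x * (Y y * Z z)) := by
  have e : (pt₀ (ptFst K B)).hom a * (pt₀ (ptSnd K B)).hom a' =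
      (a ⊗ₜ[K] a') ⊗ₜ[K] ((1 : B) ⊗ₜ[K] ((1 : B) ⊗ₜ[K] (1 : B))) := by
    refine Eq.trans (b := ((a ⊗ₜ[K] (1 : B)) ⊗ₜ[K] ((1 : B) ⊗ₜ[K] ((1 : B) ⊗ₜ[K] (1 : B)))) *
      (((1 : B) ⊗ₜ[K] a') ⊗ₜ[K] ((1 : B) ⊗ₜ[K] ((1 : B) ⊗ₜ[K] (1 : B))))) rfl ?_
    simp only [Algebra.TensorProduct.tmul_mul_tmul, one_mul, mul_one]
  refine (congrArg (transfer (TensorProduct.lift f) X Y Z)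
    ((mul_assoc _ _ _).symm.trans (congrArg (· * _) e))).trans ?_
  exact (transfer_pt _ X Y Z _ x y z).trans (by rw [TensorProduct.lift.tmul])

theorem brk_exchange_aux {L : Type*} [CommRing L] [Algebra K L] (bul : B →ₗ[K] B →ₗ[K] K)
    (u w g h k : Pt K B L) (Ψ : L →ₗ[K] R) {F G F' G' : Cv K B R} {X X' Y Z : B →ₐ[K] R} {κ : K}
    (hΨ : ∀ a a' x y z, Ψ (u.hom a * (w.hom a' * (g.hom x * (h.hom y * k.hom z)))) =
        F.ofConv a * G.ofConv a' * (X x * (Y y * Z z)))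
    (hX : IsIntertwining G X X')
    (hF : ∀ a a', F.ofConv a * G.ofConv a' = κ • (G'.ofConv a' * F'.ofConv a)) (b c d : B) :
    tri F (AlgHom.cv X') (brkLeft bul G Y Z d) (uni bul b c) =
      κ • tri G' (brk bul F' X Y b) (AlgHom.cv Z) (uni bul c d) := by
  rw [← exchange_right_aux bul u w g h k Ψ hΨ (fun a x => hX x a),
    ← exchange_left_aux bul u w g h k Ψ hΨ hF, tri_uni_comm]

/-- Two ways to insert a bracket into a bracket. -/
theorem brk_exchange (bul : B →ₗ[K] B →ₗ[K] K) {F G F' G' : Cv K B R} {X X' Y Z : B →ₐ[K] R}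
    {κ : K} (hX : IsIntertwining G X X')
    (hF : ∀ a a', F.ofConv a * G.ofConv a' = κ • (G'.ofConv a' * F'.ofConv a)) (b c d : B) :
    tri F (AlgHom.cv X') (brkLeft bul G Y Z d) (uni bul b c) =
      κ • tri G' (brk bul F' X Y b) (AlgHom.cv Z) (uni bul c d) := by
  have hΨ : ∀ a a' x y z, transfer (TensorProduct.lift
      ((LinearMap.mul K R).compl₁₂ F.ofConv G.ofConv)) X Y Z ((pt₀ (ptFst K B)).hom a *
      ((pt₀ (ptSnd K B)).hom a' * ((ptR (B ⊗[K] B) (pt₁ (K := K) (B := B))).hom x *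
        ((ptR (B ⊗[K] B) (pt₂ (K := K) (B := B))).hom y *
          (ptR (B ⊗[K] B) (pt₃ (K := K) (B := B))).hom z)))) =
      F.ofConv a * G.ofConv a' * (X x * (Y y * Z z)) :=
    transfer_pt₂ ((LinearMap.mul K R).compl₁₂ F.ofConv G.ofConv) X Y Z
  exact brk_exchange_aux bul (pt₀ (ptFst K B)) (pt₀ (ptSnd K B)) (ptR (B ⊗[K] B) pt₁)
    (ptR (B ⊗[K] B) pt₂) (ptR (B ⊗[K] B) pt₃) _ hΨ hX hF b c d

/-- The map `a ⊗ b ⊗ c ↦ V a b * Z c`. -/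
def bilTri (V : B →ₗ[K] B →ₗ[K] R) (Z : Cv K B R) : B ⊗[K] (B ⊗[K] B) →ₗ[K] R :=
  LinearMap.mul' K R ∘ₗ TensorProduct.map (TensorProduct.lift V) Z.ofConv ∘ₗ
    (TensorProduct.assoc K B B B).symm.toLinearMap

theorem bilTri_tmul (V : B →ₗ[K] B →ₗ[K] R) (Z : Cv K B R) (a b c : B) :
    bilTri V Z (a ⊗ₜ (b ⊗ₜ c)) = V a b * Z.ofConv c := by
  simp [bilTri]

/-- The value `∑ V(a₃ s(a₂⁽²⁾), s(a₁⁽²⁾) a₂⁽³⁾) X(a₁⁽³⁾) Y(a₁⁽¹⁾) Z(a₂⁽¹⁾)`. -/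
def triEval (V : B →ₗ[K] B →ₗ[K] R) (X Y Z : B →ₐ[K] R) (a₁ a₂ a₃ : B) : R :=
  ∑ i ∈ (ℛ K a₁).index, ∑ j ∈ (ℛ K ((ℛ K a₁).right i)).index,
  ∑ k ∈ (ℛ K a₂).index, ∑ l ∈ (ℛ K ((ℛ K a₂).right k)).index,
    V (a₃ * HopfAlgebra.antipode K ((ℛ K ((ℛ K a₂).right k)).left l))
      (HopfAlgebra.antipode K ((ℛ K ((ℛ K a₁).right i)).left j) *
        (ℛ K ((ℛ K a₂).right k)).right l) *
    (X ((ℛ K ((ℛ K a₁).right i)).right j) * (Y ((ℛ K a₁).left i) * Z ((ℛ K a₂).left k)))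

theorem bilTri_fox_aux {L : Type*} [CommRing L] [Algebra K L] {t : B} (ht : IsTraceLike K t)
    (u v g h k : Pt K B L) (Ψ : L →ₗ[K] R) (V : B →ₗ[K] B →ₗ[K] R) {X Y Z : B →ₐ[K] R}
    (hΨ : ∀ a a' x y z, Ψ (v.hom a * (u.hom a' * (g.hom x * (h.hom y * k.hom z)))) =
      V a a' * (X x * (Y y * Z z)))
    (hXZ : AreCommuting X Z) (hYZ : AreCommuting Y Z) {f : Cv K B R} {d : B}
    (hf : ∀ e, f.ofConv e = bilTri V (AlgHom.cv Z) (uni (traceForm ht) e d)) (b c : B) :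
    tri f (AlgHom.cv X) (AlgHom.cv Y) (uni (traceForm ht) b c) = Ψ (tri ((fox (traceForm ht) v u k).ofConv d) (Pt.lin g) (Pt.lin h)
        (uni (traceForm ht) b c)) := by
  generalize uni (traceForm ht) b c = s
  symm
  refine LinearMap.congr_fun (f := Ψ ∘ₗ tri ((fox (traceForm ht) v u k).ofConv d) (Pt.lin g)
    (Pt.lin h)) (TensorProduct.ext_threefold' fun e x y => ?_) s
  rw [LinearMap.comp_apply, tri_tmul, tri_tmul, ← tri_uni_fox_apply, hf]
  generalize uni (traceForm ht) e d = r
  refine LinearMap.congr_fun (f := Ψ ∘ₗ LinearMap.mulRight K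
      ((Pt.lin g).ofConv x * (Pt.lin h).ofConv y) ∘ₗ tri (Pt.lin v) (Pt.lin u) (Pt.lin k))
    (g := LinearMap.mulRight K ((AlgHom.cv X).ofConv x * (AlgHom.cv Y).ofConv y) ∘ₗ
      bilTri V (AlgHom.cv Z)) (TensorProduct.ext_threefold' fun a a' z => ?_) r
  simp only [LinearMap.comp_apply, LinearMap.mulRight_apply, tri_tmul, Pt.lin_apply,
    AlgHom.cv_apply, bilTri_tmul]
  rw [show ∀ a b c d e : L, a * (b * c) * (d * e) = a * (b * (d * (e * c))) from
    fun a b c d e => by ring, hΨ, mul_assoc, ← mul_assoc (Z z), ← hXZ, mul_assoc (X x), ← hYZ]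

theorem map_eq_triEval {L : Type*} [CommRing L] [Algebra K L] (u v g h k : Pt K B L)
    (Ψ : L →ₗ[K] R) (V : B →ₗ[K] B →ₗ[K] R) {X Y Z : B →ₐ[K] R}
    (hΨ : ∀ a a' x y z, Ψ (v.hom a * (u.hom a' * (g.hom x * (h.hom y * k.hom z)))) =
      V a a' * (X x * (Y y * Z z)))
    (hXY : AreCommuting X Y) (hXZ : AreCommuting X Z) (hYZ : AreCommuting Y Z)
    (a₁ a₂ a₃ x y z : B) :
    Ψ ((h * u⁻¹ * g).hom a₁ * (g.hom x * (v.hom a₃ * (k.hom z *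
      ((k * v⁻¹ * u).hom a₂ * h.hom y))))) =
      triEval V X Y Z a₁ a₂ a₃ * (X x * (Y y * Z z)) := by
  have e₁ : (h * u⁻¹ * g).hom a₁ = ∑ i ∈ (ℛ K a₁).index,
      ∑ j ∈ (ℛ K ((ℛ K a₁).right i)).index, h.hom ((ℛ K a₁).left i) *
        (u.hom (HopfAlgebra.antipode K ((ℛ K ((ℛ K a₁).right i)).left j)) *
          g.hom ((ℛ K ((ℛ K a₁).right i)).right j)) := by
    rw [mul_assoc, Pt.mul_hom (ℛ K a₁)]
    refine Finset.sum_congr rfl fun i _ => ?_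
    rw [Pt.mul_hom (ℛ K ((ℛ K a₁).right i)), Finset.mul_sum]
    rfl
  have e₂ : (k * v⁻¹ * u).hom a₂ = ∑ i ∈ (ℛ K a₂).index,
      ∑ j ∈ (ℛ K ((ℛ K a₂).right i)).index, k.hom ((ℛ K a₂).left i) *
        (v.hom (HopfAlgebra.antipode K ((ℛ K ((ℛ K a₂).right i)).left j)) *
          u.hom ((ℛ K ((ℛ K a₂).right i)).right j)) := by
    rw [mul_assoc, Pt.mul_hom (ℛ K a₂)]
    refine Finset.sum_congr rfl fun i _ => ?_
    rw [Pt.mul_hom (ℛ K ((ℛ K a₂).right i)), Finset.mul_sum]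
    rfl
  rw [e₁, e₂, triEval, Finset.sum_mul, map_sum, Finset.sum_mul (s := (ℛ K a₁).index)]
  refine Finset.sum_congr rfl fun i _ => ?_
  rw [Finset.sum_mul (s := (ℛ K ((ℛ K a₁).right i)).index), map_sum,
    Finset.sum_mul (s := (ℛ K ((ℛ K a₁).right i)).index)]
  refine Finset.sum_congr rfl fun j _ => ?_
  simp only [Finset.sum_mul, Finset.mul_sum, map_sum]
  refine Finset.sum_congr rfl fun l _ => Finset.sum_congr rfl fun m _ => ?_
  rw [show ∀ h₁ u₁ g₁ gx va kz k₂ v₂ u₂ hy : L, h₁ * (u₁ * g₁) * (gx * (va * (kz *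
      (k₂ * (v₂ * u₂) * hy)))) = va * v₂ * (u₁ * u₂ * (g₁ * gx * (h₁ * hy * (k₂ * kz)))) from
    fun _ _ _ _ _ _ _ _ _ _ => by ring]
  simp only [← map_mul]
  rw [hΨ]
  simp only [map_mul, mul_assoc]
  congr 2
  rw [← mul_assoc (X x), hXY, mul_assoc, ← mul_assoc (Z _) (X x), ← hXZ, mul_assoc,
    ← mul_assoc (Z _) (Y y), ← hYZ, mul_assoc]

theorem bilTri_fox_aux' {L : Type*} [CommRing L] [Algebra K L] {t : B} (ht : IsTraceLike K t)
    (u v g h k : Pt K B L) (Ψ : L →ₗ[K] R) (V : B →ₗ[K] B →ₗ[K] R) {X Y Z : B →ₐ[K] R}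
    (hΨ : ∀ a a' x y z, Ψ (v.hom a * (u.hom a' * (g.hom x * (h.hom y * k.hom z)))) =
      V a a' * (X x * (Y y * Z z)))
    (hXY : AreCommuting X Y) (hXZ : AreCommuting X Z) (hYZ : AreCommuting Y Z) {f : Cv K B R}
    {d : B} (hf : ∀ e, f.ofConv e = bilTri V (AlgHom.cv Z) (uni (traceForm ht) e d)) (b c : B)
    (π : Sweedler₆ (K := K) (t + HopfAlgebra.antipode K t)) :
    tri f (AlgHom.cv X) (AlgHom.cv Y) (uni (traceForm ht) b c) =
      ∑ i, triEval V X Y Z (π.el i 0) (π.el i 4) (π.el i 2) *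
        (X (curly (traceForm ht) b (π.el i 1)) * (Y (curly (traceForm ht) c (π.el i 5)) *
          Z (curly (traceForm ht) d (π.el i 3)))) := by
  rw [bilTri_fox_aux ht u v g h k Ψ V hΨ hXZ hYZ hf b c, tri_uni_fox ht _ _ _ _ _ b c d π, map_sum]
  exact Finset.sum_congr rfl fun i _ => map_eq_triEval u v g h k Ψ V hΨ hXY hXZ hYZ _ _ _ _ _ _

theorem bilTri_fox {t : B} (ht : IsTraceLike K t) (V : B →ₗ[K] B →ₗ[K] R) {X Y Z : B →ₐ[K] R}
    (hXY : AreCommuting X Y) (hXZ : AreCommuting X Z) (hYZ : AreCommuting Y Z) {f : Cv K B R}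
    {d : B} (hf : ∀ e, f.ofConv e = bilTri V (AlgHom.cv Z) (uni (traceForm ht) e d)) (b c : B)
    (π : Sweedler₆ (K := K) (t + HopfAlgebra.antipode K t)) :
    tri f (AlgHom.cv X) (AlgHom.cv Y) (uni (traceForm ht) b c) =
      ∑ i, triEval V X Y Z (π.el i 0) (π.el i 4) (π.el i 2) *
        (X (curly (traceForm ht) b (π.el i 1)) * (Y (curly (traceForm ht) c (π.el i 5)) *
          Z (curly (traceForm ht) d (π.el i 3)))) := by
  have hΨ : ∀ a a' x y z, transfer (TensorProduct.lift V) X Y Z ((pt₀ (ptFst K B)).hom a *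
      ((pt₀ (ptSnd K B)).hom a' * ((ptR (B ⊗[K] B) (pt₁ (K := K) (B := B))).hom x *
        ((ptR (B ⊗[K] B) (pt₂ (K := K) (B := B))).hom y *
          (ptR (B ⊗[K] B) (pt₃ (K := K) (B := B))).hom z)))) =
      V a a' * (X x * (Y y * Z z)) := transfer_pt₂ V X Y Z
  exact bilTri_fox_aux' ht (pt₀ (ptSnd K B)) (pt₀ (ptFst K B)) (ptR (B ⊗[K] B) pt₁)
    (ptR (B ⊗[K] B) pt₂) (ptR (B ⊗[K] B) pt₃) _ V hΨ hXY hXZ hYZ hf b c π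

end Abstract

namespace Parity

section Coslice

variable {K C M N S : Type*} [CommRing K] [AddCommGroup C] [Module K C] [AddCommGroup M] [Module K M]
variable [AddCommGroup N] [Module K N]
variable [Coalgebra K C] [Coalgebra K M] [Coalgebra K N] [Ring S] [Algebra K S]
variable {α : Parity K C} {β : Parity K M} {γ : Parity K N}

theorem HomExpansion.sum_counit_left {m : N} (Z : HomExpansion γ (comul (R := K) m)) (q : ZMod 2) :
    ∑ k, (sgn K (q * Z.deg₁ k) * counit (R := K) (Z.fst k)) • Z.snd k = m := by
  have h : ∀ k, sgn K (q * Z.deg₁ k) * counit (R := K) (Z.fst k) = counit (R := K) (Z.fst k) := by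
    intro k
    have hk := Z.fst_hom k
    rcases ZMod.two_cases (Z.deg₁ k) with e | e
    · rw [e, mul_zero, sgn_zero, one_mul]
    · rw [e] at hk
      rw [hk.counit, mul_zero]
  have h' := Coalgebra.rTensor_counit_comul (R := K) m
  rw [← Z.sum_eq] at h'
  simpa [h] using congrArg (TensorProduct.lid K N) h'

theorem HomExpansion.sum_counit_right {m : N} (Z : HomExpansion γ (comul (R := K) m))
    (q : ZMod 2) :
    ∑ k, (sgn K (q * Z.deg₁ k) * counit (R := K) (Z.snd k)) • Z.fst k = γ.tw q m := by
  have h' := Coalgebra.lTensor_counit_comul (R := K) m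
  rw [← Z.sum_eq] at h'
  have h := congrArg (fun t => γ.tw q (TensorProduct.rid K N t)) h'
  simp only [map_sum, LinearMap.lTensor_tmul, TensorProduct.rid_tmul, map_smul, one_smul,
    (Z.fst_hom _).tw] at h
  rw [← h]
  exact Finset.sum_congr rfl fun k _ => by rw [smul_smul, mul_comm]

theorem slice_mul {c : C} (X : HomExpansion α (comul (R := K) c))
    (f g : WithConv (SProd α β →ₗ[K] S)) :
    slice (f * g) c = ∑ i, pull S (β.twHom (X.deg₂ i)) (slice f (X.fst i)) * slice g (X.snd i) :=
  WithConv.ext (LinearMap.ext fun m => by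
    obtain ⟨Y⟩ := nonempty_homExpansion β (comul (R := K) m)
    rw [slice_apply, conv_stmul X Y, ofConv_sum, LinearMap.sum_apply]
    refine Finset.sum_congr rfl fun i _ => ?_
    rw [Y.conv_apply]
    refine Finset.sum_congr rfl fun j _ => ?_
    rw [pull_apply, slice_apply, slice_apply]
    change _ = f.ofConv (stmul α β (X.fst i) (β.tw (X.deg₂ i) (Y.fst j))) * _
    rw [(Y.fst_hom j).tw, map_smul, map_smul, smul_mul_assoc])

theorem conv_stmul_stmul {c : C} {m : M} {v : N} (X : HomExpansion α (comul (R := K) c))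
    (Y : HomExpansion β (comul (R := K) m)) (Z : HomExpansion γ (comul (R := K) v))
    (f g : WithConv (SProd α (β.prod γ) →ₗ[K] S)) :
    (f * g).ofConv (stmul α _ c (stmul β γ m v)) = ∑ i, ∑ j, ∑ k,
      sgn K (X.deg₂ i * (Y.deg₁ j + Z.deg₁ k) + Y.deg₂ j * Z.deg₁ k) •
      (f.ofConv (stmul α _ (X.fst i) (stmul β γ (Y.fst j) (Z.fst k))) *
        g.ofConv (stmul α _ (X.snd i) (stmul β γ (Y.snd j) (Z.snd k)))) := by
  rw [← slice_apply, slice_mul X, ofConv_sum, LinearMap.sum_apply]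
  refine Finset.sum_congr rfl fun i _ => ?_
  rw [conv_stmul Y Z]
  refine Finset.sum_congr rfl fun j _ => Finset.sum_congr rfl fun k _ => ?_
  rw [pull_apply, slice_apply]
  change sgn K _ • (f.ofConv (stmul α _ (X.fst i) ((β.prod γ).tw _ (stmul β γ _ _))) * _) = _
  rw [((Y.fst_hom j).stmul (Z.fst_hom k)).tw, map_smul, map_smul, smul_mul_assoc, smul_smul,
    ← sgn_add, add_comm, slice_apply]

/-- The map `c ⊗ m ↦ c ⊗ m ⊗ v`. -/
def insertThird (α : Parity K C) (β : Parity K M) (γ : Parity K N) (v : N) :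
    SProd α β →ₗ[K] SProd α (β.prod γ) :=
  (sp α (β.prod γ)).toLinearMap ∘ₗ ((stmul β γ).flip v).lTensor C ∘ₗ (sp α β).symm.toLinearMap

/-- A map on a triple tensor product with fixed third argument. -/
def coslice (f : WithConv (SProd α (β.prod γ) →ₗ[K] S)) (v : N) : WithConv (SProd α β →ₗ[K] S) :=
  toConv (f.ofConv ∘ₗ insertThird α β γ v)

theorem coslice_apply (f : WithConv (SProd α (β.prod γ) →ₗ[K] S)) (v : N) (c : C) (m : M) :
    (coslice f v).ofConv (stmul α β c m) = f.ofConv (stmul α _ c (stmul β γ m v)) := rfl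

/-- The projection `c ⊗ m ⊗ v ↦ c ⊗ m`. -/
def projLeft (α : Parity K C) (β : Parity K M) (γ : Parity K N) :
    SProd α (β.prod γ) →ₗc[K] SProd α β :=
  mapSnd α (β.prod γ) β (fstHom β γ) fun d => (tw_of_odd fstHom_odd 1 d).symm

theorem projLeft_stmul (c : C) (m : M) (v : N) :
    projLeft α β γ (stmul α _ c (stmul β γ m v)) = counit (R := K) v • stmul α β c m := by
  rw [projLeft, mapSnd_stmul, fstHom_stmul, map_smul]

theorem coslice_projLeft_mul (f : WithConv (SProd α β →ₗ[K] S))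
    (g : WithConv (SProd α (β.prod γ) →ₗ[K] S)) (v : N) :
    coslice (pull S (projLeft α β γ) f * g) v = f * coslice g v := by
  refine ext_stmul fun c m => ?_
  obtain ⟨X⟩ := nonempty_homExpansion α (comul (R := K) c)
  obtain ⟨Y⟩ := nonempty_homExpansion β (comul (R := K) m)
  obtain ⟨Z⟩ := nonempty_homExpansion γ (comul (R := K) v)
  rw [coslice_apply, conv_stmul_stmul X Y Z, conv_stmul X Y]
  refine Finset.sum_congr rfl fun i _ => Finset.sum_congr rfl fun j _ => ?_
  rw [coslice_apply]
  conv_rhs => rw [← Z.sum_counit_left (X.deg₂ i + Y.deg₂ j)]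
  simp only [map_sum, map_smul, Finset.mul_sum, Finset.smul_sum, mul_smul_comm]
  refine Finset.sum_congr rfl fun k _ => ?_
  rw [pull_apply, projLeft_stmul, map_smul, smul_mul_assoc, smul_smul, smul_smul, ← mul_assoc,
    ← sgn_add]
  congr 3
  ring

theorem coslice_mul_projLeft (f : WithConv (SProd α (β.prod γ) →ₗ[K] S))
    (g : WithConv (SProd α β →ₗ[K] S)) {r : ZMod 2} {v : N} (hv : γ.IsHom r v) :
    coslice (f * pull S (projLeft α β γ) g) v =
      coslice f v * pull S ((α.prod β).twHom r) g := by
  refine ext_stmul fun c m => ?_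
  obtain ⟨X⟩ := nonempty_homExpansion α (comul (R := K) c)
  obtain ⟨Y⟩ := nonempty_homExpansion β (comul (R := K) m)
  obtain ⟨Z⟩ := nonempty_homExpansion γ (comul (R := K) v)
  rw [coslice_apply, conv_stmul_stmul X Y Z, conv_stmul X Y]
  refine Finset.sum_congr rfl fun i _ => Finset.sum_congr rfl fun j _ => ?_
  have e : (coslice f v).ofConv (stmul α β (X.fst i) (Y.fst j)) *
      (pull S ((α.prod β).twHom r) g).ofConv (stmul α β (X.snd i) (Y.snd j)) =
      f.ofConv (stmul α _ (X.fst i) (stmul β γ (Y.fst j) (γ.tw (X.deg₂ i + Y.deg₂ j) v))) *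
        g.ofConv (stmul α β (X.snd i) (Y.snd j)) := by
    rw [pull_apply]
    change _ * g.ofConv ((α.prod β).tw r _) = _
    rw [((X.snd_hom i).stmul (Y.snd_hom j)).tw, hv.tw, coslice_apply]
    simp only [map_smul, mul_smul_comm, smul_mul_assoc, mul_comm r]
  rw [e, ← Z.sum_counit_right]
  simp only [map_sum, map_smul, Finset.sum_mul, Finset.smul_sum, smul_mul_assoc]
  refine Finset.sum_congr rfl fun k _ => ?_
  rw [pull_apply, projLeft_stmul, map_smul, mul_smul_comm, smul_smul, smul_smul, ← mul_assoc,
    ← sgn_add]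
  congr 3
  ring

end Coslice

end Parity

section Derivations

variable {K A : Type*} [CommRing K] [Ring A] [Algebra K A]
variable {𝒜 : ℤ → Submodule K A} [GradedAlgebra 𝒜] [Coalgebra K A] [GradedHopfAlgebra 𝒜]
variable {B : Type*} [CommRing B] [HopfAlgebra K B]
variable {C : Type*} [AddCommGroup C] [Module K C] [Coalgebra K C] {α : Parity K C}

theorem IsRepDer.leibniz_parity {e : ℤ} {D : RepAlg 𝒜 B →ₗ[K] RepAlg 𝒜 B} (hD : IsRepDer 𝒜 B e D)
    {i : ZMod 2} {u : RepAlg 𝒜 B} (hu : u ∈ repParity 𝒜 B i) (v : RepAlg 𝒜 B) :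
    D (u * v) = D u * v + sgn K ((e : ZMod 2) * i) • (u * D v) := by
  induction hu using Submodule.span_induction with
  | zero => simp
  | add x y _ _ hx hy =>
    simp only [add_mul, map_add, hx, hy, smul_add]
    abel
  | smul k x _ hx => simp only [smul_mul_assoc, map_smul, hx, smul_add, smul_comm k]
  | mem x hx =>
    obtain ⟨p, rfl, hp⟩ := hx
    exact hD.leibniz p x v (Submodule.subset_span hp)

/-- Composition with a linear map. -/
def postComp (D : RepAlg 𝒜 B →ₗ[K] RepAlg 𝒜 B) :
    WithConv (C →ₗ[K] RepAlg 𝒜 B) →ₗ[K] WithConv (C →ₗ[K] RepAlg 𝒜 B) where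
  toFun f := toConv (D ∘ₗ f.ofConv)
  map_add' f g := WithConv.ext (LinearMap.ext fun c => map_add D _ _)
  map_smul' k f := WithConv.ext (LinearMap.ext fun c => map_smul D _ _)

theorem postComp_apply (D : RepAlg 𝒜 B →ₗ[K] RepAlg 𝒜 B) (f : WithConv (C →ₗ[K] RepAlg 𝒜 B))
    (c : C) : (postComp D f).ofConv c = D (f.ofConv c) := rfl

theorem IsRepDer.postComp_mul {e : ℤ} {D : RepAlg 𝒜 B →ₗ[K] RepAlg 𝒜 B} (hD : IsRepDer 𝒜 B e D)
    {d : ZMod 2} {f : WithConv (C →ₗ[K] RepAlg 𝒜 B)} (hf : α.HasParity (repParity 𝒜 B) d f.ofConv)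
    (g : WithConv (C →ₗ[K] RepAlg 𝒜 B)) : postComp D (f * g) = postComp D f * g +
      sgn K (e * d) • (Parity.pull _ (α.twHom e) f * postComp D g) := by
  refine WithConv.ext (LinearMap.ext fun c => ?_)
  obtain ⟨X⟩ := Parity.nonempty_homExpansion α (comul (R := K) c)
  rw [postComp_apply, X.conv_apply, ofConv_add, LinearMap.add_apply, ofConv_smul,
    LinearMap.smul_apply, X.conv_apply, X.conv_apply, map_sum, Finset.smul_sum,
    ← Finset.sum_add_distrib]
  refine Finset.sum_congr rfl fun i _ => ?_
  rw [hD.leibniz_parity (hf _ _ (X.fst_hom i)), postComp_apply, postComp_apply, Parity.pull_apply]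
  change _ = _ + _ • (f.ofConv (α.tw e (X.fst i)) * _)
  rw [(X.fst_hom i).tw, map_smul, smul_mul_assoc, smul_smul, ← sgn_add]
  congr 3
  ring

end Derivations

section Abstract

variable {K B R : Type*} [CommRing K] [CommRing B] [HopfAlgebra K B] [Ring R] [Algebra K R]

/-- Composition with a linear map. -/
def Cv.mapLin (Δ : R →ₗ[K] R) (p : Cv K B R) : Cv K B R := toConv (Δ ∘ₗ p.ofConv)

/-- A twisted derivation applied to a product of three factors. -/
theorem tri_der {Δ : R →ₗ[K] R} {T : R →ₐ[K] R} {κ : K} {F : Cv K B R} {X Y : B →ₐ[K] R}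
    (hF : ∀ a u, Δ (F.ofConv a * u) = Δ (F.ofConv a) * u + κ • (T (F.ofConv a) * Δ u))
    (hX : ∀ x u, Δ (X x * u) = Δ (X x) * u + T (X x) * Δ u) (t : B ⊗[K] (B ⊗[K] B)) :
    Δ (tri F (AlgHom.cv X) (AlgHom.cv Y) t) =
      tri (Cv.mapLin Δ F) (AlgHom.cv X) (AlgHom.cv Y) t +
      κ • (tri (Cv.mapHom T F) (Cv.mapLin Δ (AlgHom.cv X)) (AlgHom.cv Y) t +
        tri (Cv.mapHom T F) (AlgHom.cv (T.comp X)) (Cv.mapLin Δ (AlgHom.cv Y)) t) := by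
  refine LinearMap.congr_fun (f := Δ ∘ₗ tri F (AlgHom.cv X) (AlgHom.cv Y))
    (g := tri (Cv.mapLin Δ F) (AlgHom.cv X) (AlgHom.cv Y) +
      κ • (tri (Cv.mapHom T F) (Cv.mapLin Δ (AlgHom.cv X)) (AlgHom.cv Y) +
        tri (Cv.mapHom T F) (AlgHom.cv (T.comp X)) (Cv.mapLin Δ (AlgHom.cv Y))))
    (TensorProduct.ext_threefold' fun a x y => ?_) t
  simp only [LinearMap.comp_apply, LinearMap.add_apply, LinearMap.smul_apply, tri_tmul, hF,
    AlgHom.cv_apply, hX, mul_add, smul_add]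
  rfl

end Abstract

/-- Composition with a linear map. -/
def precomp {K C D S : Type*} [CommRing K] [AddCommGroup C] [Module K C] [AddCommGroup D]
    [Module K D] [Ring S] [Algebra K S] (φ : C →ₗ[K] D) :
    WithConv (D →ₗ[K] S) →ₗ[K] WithConv (C →ₗ[K] S) where
  toFun f := toConv (f.ofConv ∘ₗ φ)
  map_add' _ _ := rfl
  map_smul' _ _ := rfl

/-- `coslice` as a linear map. -/
def cosliceₗ {K C M N S : Type*} [CommRing K] [AddCommGroup C] [Module K C] [AddCommGroup M]
    [Module K M] [AddCommGroup N] [Module K N] [Coalgebra K C] [Coalgebra K M] [Coalgebra K N]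
    [Ring S] [Algebra K S]
    (α : Parity K C) (β : Parity K M) (γ : Parity K N) (v : N) :
    WithConv (SProd α (β.prod γ) →ₗ[K] S) →ₗ[K] WithConv (SProd α β →ₗ[K] S) :=
  precomp (Parity.insertThird α β γ v)

section Triple

variable {K A : Type*} [CommRing K] [Ring A] [Algebra K A]
variable (𝒜 : ℤ → Submodule K A) [GradedAlgebra 𝒜] [Coalgebra K A] [GradedHopfAlgebra 𝒜]
variable (B : Type*) [CommRing B] [HopfAlgebra K B]

/-- The convolution algebra of the signed tensor cube. -/
abbrev TrpConv : Type _ := WithConv (Trp 𝒜 →ₗ[K] RepAlg 𝒜 B)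

/-- The parity of the signed tensor cube. -/
abbrev trpParity : Parity K (Trp 𝒜) := (hopfParity 𝒜).prod (dblParity 𝒜)

/-- The maps `x ⊗ y ⊗ z ↦ ± x_b ε(y) ε(z)`. -/
def gen₁ (q : ZMod 2) : B →ₐ[K] TrpConv 𝒜 B := genFst 𝒜 B (dblParity 𝒜) q

/-- The maps `x ⊗ y ⊗ z ↦ ± ε(x) y_b ε(z)`. -/
def gen₂ (q : ZMod 2) : B →ₐ[K] TrpConv 𝒜 B :=
  (Parity.pull _ (Parity.sndHom _ _)).comp (genFst 𝒜 B (hopfParity 𝒜) q)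

/-- The maps `x ⊗ y ⊗ z ↦ ε(x) ε(y) z_b`. -/
def gen₃ : B →ₐ[K] TrpConv 𝒜 B := (Parity.pull _ (Parity.sndHom _ _)).comp (genSnd 𝒜 B 0)

theorem gen₁_hasParity (q : ZMod 2) (b : B) :
    (trpParity 𝒜).HasParity (repParity 𝒜 B) 0 (gen₁ 𝒜 B q b).ofConv := genFst_hasParity 𝒜 B _ _ b

theorem gen₂_hasParity (q : ZMod 2) (b : B) :
    (trpParity 𝒜).HasParity (repParity 𝒜 B) 0 (gen₂ 𝒜 B q b).ofConv :=
  (genFst_hasParity 𝒜 B (hopfParity 𝒜) q b).comp Parity.sndHom_odd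

theorem gen₃_hasParity (b : B) :
    (trpParity 𝒜).HasParity (repParity 𝒜 B) 0 (gen₃ 𝒜 B b).ofConv :=
  (genSnd_hasParity 𝒜 B 0 b).comp Parity.sndHom_odd

variable {𝒜} in
theorem trpParity_cocomm (hA : IsGradedCocommutative 𝒜) : (trpParity 𝒜).Cocomm :=
  (hopfParity_cocomm 𝒜 hA).prod (dblParity_cocomm hA)

variable (ρ : A →ₗ[K] A →ₗ[K] A) (n : ℤ) (bul : B →ₗ[K] B →ₗ[K] K)

/-- The maps `x ⊗ y ⊗ z ↦ ρ(x, y)_b ε(z)`. -/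
def rho₁₂ : Cv K B (TrpConv 𝒜 B) := Cv.mapHom (Parity.pull _ (Parity.projLeft _ _ _)) (rhoConv 𝒜 B ρ)

/-- The maps `x ⊗ y ⊗ z ↦ ε(x) ρ(y, z)_b`. -/
def rho₂₃ : Cv K B (TrpConv 𝒜 B) := Cv.mapHom (Parity.pull _ (Parity.sndHom _ _)) (rhoConv 𝒜 B ρ)

/-- The map `x ⊗ y ⊗ z ↦ ρ(x, y) ⊗ z`. -/
def mergePairing : Trp 𝒜 →ₗ[K] Dbl 𝒜 :=
  ((hopfParity 𝒜).sp (hopfParity 𝒜)).toLinearMap ∘ₗ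
    TensorProduct.map (TensorProduct.lift ρ) LinearMap.id ∘ₗ
    (TensorProduct.assoc K A A A).symm.toLinearMap ∘ₗ
    ((hopfParity 𝒜).sp (hopfParity 𝒜)).symm.toLinearMap.lTensor A ∘ₗ
    ((hopfParity 𝒜).sp (dblParity 𝒜)).symm.toLinearMap

theorem mergePairing_stmul (x y z : A) :
    mergePairing 𝒜 ρ ((hopfParity 𝒜).stmul (dblParity 𝒜) x
      ((hopfParity 𝒜).stmul (hopfParity 𝒜) y z)) =
      (hopfParity 𝒜).stmul (hopfParity 𝒜) (ρ x y) z := by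
  change ((hopfParity 𝒜).sp (hopfParity 𝒜)) (TensorProduct.map (TensorProduct.lift ρ)
    LinearMap.id ((TensorProduct.assoc K A A A).symm (x ⊗ₜ (y ⊗ₜ z)))) = _
  rw [TensorProduct.assoc_symm_tmul, TensorProduct.map_tmul, TensorProduct.lift.tmul]
  rfl

/-- The maps `x ⊗ y ⊗ z ↦ {ρ(x, y)_b, z_d}`. -/
def pairBrkMerge (d : B) : Cv K B (TrpConv 𝒜 B) :=
  toConv (precomp (mergePairing 𝒜 ρ) ∘ₗ (brkLeft bul (rhoConv 𝒜 B ρ)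
    (genFst 𝒜 B (hopfParity 𝒜) n) (genSnd 𝒜 B 0) d).ofConv)

theorem pairBrkMerge_apply (b d : B) (x y z : A) : ((pairBrkMerge 𝒜 B ρ n bul d).ofConv b).ofConv
    ((hopfParity 𝒜).stmul (dblParity 𝒜) x ((hopfParity 𝒜).stmul (hopfParity 𝒜) y z)) =
      genBrk 𝒜 B ρ n bul (ρ x y) b z d :=
  congrArg ((pairBrk 𝒜 B ρ n bul b).ofConv d).ofConv (mergePairing_stmul 𝒜 ρ x y z)

/-- The part of `{x_b, {y_c, z_d}}` in which both pairings involve `y`. -/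
def nestBrk (b c d : B) : TrpConv 𝒜 B :=
  tri (rho₁₂ 𝒜 B ρ) (AlgHom.cv (gen₁ 𝒜 B n)) (brkLeft bul (rho₂₃ 𝒜 B ρ) (gen₂ 𝒜 B n) (gen₃ 𝒜 B) d)
    (uni bul b c)

/-- The part of `{{x_b, y_c}, z_d}` in which the pairing of `x` and `y` is paired with `z`. -/
def mergeBrk (b c d : B) : TrpConv 𝒜 B :=
  tri (pairBrkMerge 𝒜 B ρ n bul d) (AlgHom.cv (gen₁ 𝒜 B 0)) (AlgHom.cv (gen₂ 𝒜 B n)) (uni bul b c)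

variable {𝒜 B ρ n bul}

theorem pull_projLeft_genFst (q : ZMod 2) : (Parity.pull _ (Parity.projLeft (hopfParity 𝒜)
    (hopfParity 𝒜) (hopfParity 𝒜))).comp (genFst 𝒜 B (hopfParity 𝒜) q) = gen₁ 𝒜 B q :=
  AlgHom.ext fun _ => Parity.fst_comp_mapSnd _ _ _

theorem pull_projLeft_genSnd (q : ZMod 2) : (Parity.pull _ (Parity.projLeft (hopfParity 𝒜)
    (hopfParity 𝒜) (hopfParity 𝒜))).comp (genSnd 𝒜 B q) = gen₂ 𝒜 B q :=
  AlgHom.ext fun _ => Parity.snd_comp_mapSnd _ _ _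

theorem pull_tw_gen₁ (q r : ZMod 2) :
    (Parity.pull _ ((trpParity 𝒜).twHom q)).comp (gen₁ 𝒜 B r) = gen₁ 𝒜 B (r + q) :=
  AlgHom.ext fun b => pull_tw_genFst 𝒜 B _ q r b

theorem rho₁₂_hasParity (hρ : IsFoxPairing 𝒜 n ρ) (b : B) :
    (trpParity 𝒜).HasParity (repParity 𝒜 B) n ((rho₁₂ 𝒜 B ρ).ofConv b).ofConv :=
  (rhoConv_hasParity B hρ b).comp (Parity.mapSnd_odd Parity.fstHom_odd _)

theorem rho₂₃_hasParity (hρ : IsFoxPairing 𝒜 n ρ) (b : B) :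
    (trpParity 𝒜).HasParity (repParity 𝒜 B) n ((rho₂₃ 𝒜 B ρ).ofConv b).ofConv :=
  (rhoConv_hasParity B hρ b).comp Parity.sndHom_odd

/-- The maps `± ρ(x, y)_b ε(z)` and `± ε(x) ρ(y, z)_b`. -/
def twPair (n : ℤ) (F : Cv K B (TrpConv 𝒜 B)) : Cv K B (TrpConv 𝒜 B) :=
  Cv.mapHom (Parity.pull _ ((trpParity 𝒜).twHom n)) F

theorem nestBrk_eq (hA : IsGradedCocommutative 𝒜) (hρ : IsFoxPairing 𝒜 n ρ) (b c d : B) :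
    nestBrk 𝒜 B ρ n bul b c d = sgn K (n : ZMod 2) • tri (twPair n (rho₂₃ 𝒜 B ρ))
      (brk bul (twPair n (rho₁₂ 𝒜 B ρ)) (gen₁ 𝒜 B 0) (gen₂ 𝒜 B n) b) (AlgHom.cv (gen₃ 𝒜 B))
      (uni bul c d) := by
  have h₁ : IsIntertwining (rho₂₃ 𝒜 B ρ) (gen₁ 𝒜 B 0) (gen₁ 𝒜 B n) := by
    intro b e
    rw [Parity.conv_comm_even (trpParity_cocomm hA) (isSuperComm 𝒜 B) (gen₁_hasParity 𝒜 B 0 b)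
      (rho₂₃_hasParity hρ e)]
    have h := congrArg (fun f : B →ₐ[K] TrpConv 𝒜 B => f b) (pull_tw_gen₁ (𝒜 := 𝒜) (B := B) n 0)
    rw [zero_add] at h
    exact congrArg (· * _) h.symm
  have h₂ : ∀ a a', (rho₁₂ 𝒜 B ρ).ofConv a * (rho₂₃ 𝒜 B ρ).ofConv a' = sgn K (n : ZMod 2) •
      ((twPair n (rho₂₃ 𝒜 B ρ)).ofConv a' * (twPair n (rho₁₂ 𝒜 B ρ)).ofConv a) := by
    intro a a'
    rw [Parity.conv_supercomm (trpParity_cocomm hA) (isSuperComm 𝒜 B) (rho₁₂_hasParity hρ a)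
      (rho₂₃_hasParity hρ a')]
    have e : ∀ n : ZMod 2, n * n = n := by decide
    rw [e]
    rfl
  exact brk_exchange bul (R := TrpConv 𝒜 B) h₁ h₂ b c d

section Outer

variable {br : RepAlg 𝒜 B →ₗ[K] RepAlg 𝒜 B →ₗ[K] RepAlg 𝒜 B}

/-- Postcomposition with `{x_b, -}` of a product of three factors. -/
theorem postComp_tri (hρ : IsFoxPairing 𝒜 n ρ) {e : ℤ} {D : RepAlg 𝒜 B →ₗ[K] RepAlg 𝒜 B}
    (hD : IsRepDer 𝒜 B e D) (t : B ⊗[K] (B ⊗[K] B)) :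
    postComp D (tri (rhoConv 𝒜 B ρ) (AlgHom.cv (genFst 𝒜 B (hopfParity 𝒜) n))
      (AlgHom.cv (genSnd 𝒜 B 0)) t) =
    tri (Cv.mapLin (postComp D) (rhoConv 𝒜 B ρ)) (AlgHom.cv (genFst 𝒜 B (hopfParity 𝒜) n))
      (AlgHom.cv (genSnd 𝒜 B 0)) t + sgn K ((e : ZMod 2) * n) •
      (tri (Cv.mapHom (Parity.pull _ ((dblParity 𝒜).twHom e)) (rhoConv 𝒜 B ρ))
        (Cv.mapLin (postComp D) (AlgHom.cv (genFst 𝒜 B (hopfParity 𝒜) n)))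
        (AlgHom.cv (genSnd 𝒜 B 0)) t +
      tri (Cv.mapHom (Parity.pull _ ((dblParity 𝒜).twHom e)) (rhoConv 𝒜 B ρ))
        (AlgHom.cv ((Parity.pull _ ((dblParity 𝒜).twHom e)).comp
          (genFst 𝒜 B (hopfParity 𝒜) n)))
        (Cv.mapLin (postComp D) (AlgHom.cv (genSnd 𝒜 B 0))) t) := by
  refine tri_der (R := WithConv (Dbl 𝒜 →ₗ[K] RepAlg 𝒜 B)) (fun a u => ?_) (fun b u => ?_) t
  · exact hD.postComp_mul (rhoConv_hasParity B hρ a) u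
  · have h := hD.postComp_mul (genFst_hasParity 𝒜 B (hopfParity 𝒜) n b) u
    rwa [mul_zero, sgn_zero, one_smul] at h

end Outer

end Triple

section Nested

variable {K A : Type*} [CommRing K] [Ring A] [Algebra K A]
variable {𝒜 : ℤ → Submodule K A} [GradedAlgebra 𝒜] [Coalgebra K A] [GradedHopfAlgebra 𝒜]
variable {B : Type*} [CommRing B] [HopfAlgebra K B]
variable {ρ : A →ₗ[K] A →ₗ[K] A} {n : ℤ} {bul : B →ₗ[K] B →ₗ[K] K}
variable {br : RepAlg 𝒜 B →ₗ[K] RepAlg 𝒜 B →ₗ[K] RepAlg 𝒜 B}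

theorem dbl_hom_ext {f g : WithConv (Dbl 𝒜 →ₗ[K] RepAlg 𝒜 B)}
    (h : ∀ p q x y, x ∈ 𝒜 p → y ∈ 𝒜 q → f.ofConv ((hopfParity 𝒜).stmul (hopfParity 𝒜) x y) =
      g.ofConv ((hopfParity 𝒜).stmul (hopfParity 𝒜) x y)) : f = g :=
  WithConv.ext (dbl_ext h)

/-- `f` is given by `{w, g(-)} = -T f`. -/
def IsBrkOf (e : ZMod 2) (z : A) (f : TrpConv 𝒜 B) (g : WithConv (Dbl 𝒜 →ₗ[K] RepAlg 𝒜 B)) : Prop :=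
  g = (-1 : K) • Parity.pull _ ((dblParity 𝒜).twHom e) (cosliceₗ _ _ (hopfParity 𝒜) z f)

theorem postComp_rhoConv (hρ : IsFoxPairing 𝒜 n ρ) (h : IsRepBracket 𝒜 B n br)
    (hg : ∀ x b y c, br (gen 𝒜 B x b) (gen 𝒜 B y c) = genBrk 𝒜 B ρ n bul x b y c)
    {r : ℤ} {z : A} (hz : z ∈ 𝒜 r) (a d : B) :
    IsBrkOf (r + n : ℤ) z ((pairBrkMerge 𝒜 B ρ n bul d).ofConv a)
      (postComp (br (gen 𝒜 B z d)) ((rhoConv 𝒜 B ρ).ofConv a)) := by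
  refine dbl_hom_ext fun p q x y hx hy => ?_
  rw [postComp_apply, rhoConv_apply, ofConv_smul, LinearMap.smul_apply, Parity.pull_apply]
  change _ = _ • (cosliceₗ _ _ (hopfParity 𝒜) z ((pairBrkMerge 𝒜 B ρ n bul d).ofConv a)).ofConv
    ((dblParity 𝒜).tw _ _)
  rw [((isHom_of_mem 𝒜 hx).stmul (isHom_of_mem 𝒜 hy)).tw, map_smul]
  change _ = _ • (_ • ((pairBrkMerge 𝒜 B ρ n bul d).ofConv a).ofConv
    ((hopfParity 𝒜).stmul (dblParity 𝒜) x ((hopfParity 𝒜).stmul (hopfParity 𝒜) y z)))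
  rw [pairBrkMerge_apply, ← hg, h.antisymm r _ _ _ (gen_mem 𝒜 B hz d)
    (gen_mem 𝒜 B (hρ.map_mem p q x y hx hy) a), neg_one_smul K]
  congr 3
  push_cast
  generalize (p : ZMod 2) = p
  generalize (q : ZMod 2) = q
  generalize (r : ZMod 2) = r
  generalize (n : ZMod 2) = n
  revert p q r n
  decide

theorem postComp_genSnd (h : IsRepBracket 𝒜 B n br)
    (hg : ∀ x b y c, br (gen 𝒜 B x b) (gen 𝒜 B y c) = genBrk 𝒜 B ρ n bul x b y c)
    {r : ℤ} {z : A} (hz : z ∈ 𝒜 r) (c d : B) :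
    IsBrkOf (r + n : ℤ) z (sgn K ((r + n : ℤ) * n : ZMod 2) •
        (brkLeft bul (rho₂₃ 𝒜 B ρ) (gen₂ 𝒜 B n) (gen₃ 𝒜 B) d).ofConv c)
      (postComp (br (gen 𝒜 B z d)) (genSnd 𝒜 B 0 c)) := by
  have e : (brkLeft bul (rho₂₃ 𝒜 B ρ) (gen₂ 𝒜 B n) (gen₃ 𝒜 B) d).ofConv c =
      Parity.pull _ (Parity.sndHom _ _) ((pairBrk 𝒜 B ρ n bul c).ofConv d) :=
    (brk_map bul (Parity.pull _ (Parity.sndHom (hopfParity 𝒜) (dblParity 𝒜)))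
      (rhoConv 𝒜 B ρ) _ _ c d).symm
  rw [e]
  refine dbl_hom_ext fun p q x y hx hy => ?_
  rw [postComp_apply, genSnd_apply, Parity.pull_apply, Parity.sndHom_stmul, map_smul, chiTw_apply,
    Parity.tw_zero, LinearMap.id_apply, map_smul, ofConv_smul, LinearMap.smul_apply,
    Parity.pull_apply]
  change _ = _ • (cosliceₗ _ _ (hopfParity 𝒜) z (sgn K ((r + n : ℤ) * n : ZMod 2) •
    Parity.pull _ (Parity.sndHom _ _) ((pairBrk 𝒜 B ρ n bul c).ofConv d))).ofConv
    ((dblParity 𝒜).tw _ _)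
  rw [((isHom_of_mem 𝒜 hx).stmul (isHom_of_mem 𝒜 hy)).tw, map_smul, map_smul, ofConv_smul,
    LinearMap.smul_apply]
  change _ = _ • (_ • _ • ((pairBrk 𝒜 B ρ n bul c).ofConv d).ofConv
    (Parity.sndHom _ _ ((hopfParity 𝒜).stmul (dblParity 𝒜) x
      ((hopfParity 𝒜).stmul (hopfParity 𝒜) y z))))
  rw [Parity.sndHom_stmul, map_smul, ← genBrk_apply, ← hg, h.antisymm r _ _ _ (gen_mem 𝒜 B hz d)
    (gen_mem 𝒜 B hy c)]
  by_cases hp : p = 0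
  · subst hp
    rw [neg_one_smul K, smul_neg, smul_smul, smul_smul, smul_smul, mul_comm (counit (R := K) x),
      ← sgn_add]
    congr 4
    push_cast
    generalize (q : ZMod 2) = q
    generalize (r : ZMod 2) = r
    generalize (n : ZMod 2) = n
    clear hx hy hz h e hg
    revert q r n
    decide
  · rw [GradedHopfAlgebra.counit_eq_zero (𝒜 := 𝒜) p x hx hp]
    simp only [zero_smul, smul_zero]

theorem tri_brkOf_left {e : ZMod 2} {r : ZMod 2} {z : A} (hz : (hopfParity 𝒜).IsHom r z)
    {f : Cv K B (TrpConv 𝒜 B)} {F : Cv K B (WithConv (Dbl 𝒜 →ₗ[K] RepAlg 𝒜 B))}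
    (hF : ∀ a, IsBrkOf e z (f.ofConv a) (F.ofConv a))
    (X Y : B →ₐ[K] WithConv (Dbl 𝒜 →ₗ[K] RepAlg 𝒜 B)) (t : B ⊗[K] (B ⊗[K] B)) :
    IsBrkOf e z (tri f
      (AlgHom.cv ((Parity.pull _ (Parity.projLeft _ _ _)).comp
        ((Parity.pull _ ((dblParity 𝒜).twHom (r + e))).comp X)))
      (AlgHom.cv ((Parity.pull _ (Parity.projLeft _ _ _)).comp
        ((Parity.pull _ ((dblParity 𝒜).twHom (r + e))).comp Y))) t)
      (tri F (AlgHom.cv X) (AlgHom.cv Y) t) := by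
  have key : ∀ a (u : WithConv (Dbl 𝒜 →ₗ[K] RepAlg 𝒜 B)), F.ofConv a * u =
      (-1 : K) • Parity.pull _ ((dblParity 𝒜).twHom e) (cosliceₗ _ _ (hopfParity 𝒜) z (f.ofConv a *
        Parity.pull _ (Parity.projLeft _ _ _) (Parity.pull _ ((dblParity 𝒜).twHom (r + e)) u))) := by
    intro a u
    have h := Parity.coslice_mul_projLeft (f.ofConv a)
      (Parity.pull _ ((dblParity 𝒜).twHom (r + e)) u) hz
    have h' := congrArg (Parity.pull _ ((dblParity 𝒜).twHom e)) h
    rw [map_mul, Parity.pull_twHom_twHom, Parity.pull_twHom_twHom,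
      CharTwo.add_self_eq_zero, Parity.pull_twHom_zero] at h'
    rw [hF a, smul_mul_assoc]
    exact congrArg _ h'.symm
  refine LinearMap.congr_fun (f := tri F (AlgHom.cv X) (AlgHom.cv Y)) (g := (-1 : K) •
    ((Parity.pull _ ((dblParity 𝒜).twHom e)).toLinearMap ∘ₗ cosliceₗ _ _ (hopfParity 𝒜) z ∘ₗ
      tri f (AlgHom.cv ((Parity.pull _ (Parity.projLeft _ _ _)).comp
        ((Parity.pull _ ((dblParity 𝒜).twHom (r + e))).comp X)))
      (AlgHom.cv ((Parity.pull _ (Parity.projLeft _ _ _)).comp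
        ((Parity.pull _ ((dblParity 𝒜).twHom (r + e))).comp Y)))))
    (TensorProduct.ext_threefold' fun a b c => ?_) t
  rw [LinearMap.smul_apply, LinearMap.comp_apply, LinearMap.comp_apply, tri_tmul, tri_tmul]
  have m := map_mul ((Parity.pull (RepAlg 𝒜 B) (Parity.projLeft (hopfParity 𝒜) (hopfParity 𝒜)
    (hopfParity 𝒜))).comp (Parity.pull _ ((dblParity 𝒜).twHom (r + e)))) (X b) (Y c)
  exact (key a (X b * Y c)).trans (congrArg (fun u => (-1 : K) •
    Parity.pull _ ((dblParity 𝒜).twHom e) (cosliceₗ _ _ (hopfParity 𝒜) z (f.ofConv a * u))) m)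

theorem tri_brkOf_right {e : ZMod 2} {z : A}
    {f : Cv K B (TrpConv 𝒜 B)} {F P : Cv K B (WithConv (Dbl 𝒜 →ₗ[K] RepAlg 𝒜 B))}
    (hF : ∀ a, IsBrkOf e z (f.ofConv a) (F.ofConv a))
    (X : B →ₐ[K] WithConv (Dbl 𝒜 →ₗ[K] RepAlg 𝒜 B)) (t : B ⊗[K] (B ⊗[K] B)) :
    IsBrkOf e z (tri (Cv.mapHom (Parity.pull _ (Parity.projLeft _ _ _)) P)
      (AlgHom.cv ((Parity.pull _ (Parity.projLeft _ _ _)).comp X)) f t)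
      (tri (Cv.mapHom (Parity.pull _ ((dblParity 𝒜).twHom e)) P)
        (AlgHom.cv ((Parity.pull _ ((dblParity 𝒜).twHom e)).comp X)) F t) := by
  have key : ∀ a (u : WithConv (Dbl 𝒜 →ₗ[K] RepAlg 𝒜 B)),
      Parity.pull _ ((dblParity 𝒜).twHom e) u * F.ofConv a =
      (-1 : K) • Parity.pull _ ((dblParity 𝒜).twHom e) (cosliceₗ _ _ (hopfParity 𝒜) z
        (Parity.pull _ (Parity.projLeft _ _ _) u * f.ofConv a)) := by
    intro a u
    have h := Parity.coslice_projLeft_mul u (f.ofConv a) z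
    have h' := congrArg (Parity.pull _ ((dblParity 𝒜).twHom e)) h
    rw [map_mul] at h'
    rw [hF a, mul_smul_comm]
    exact congrArg _ h'.symm
  refine LinearMap.congr_fun (f := tri (Cv.mapHom (Parity.pull _ ((dblParity 𝒜).twHom e)) P)
        (AlgHom.cv ((Parity.pull _ ((dblParity 𝒜).twHom e)).comp X)) F) (g := (-1 : K) •
    ((Parity.pull _ ((dblParity 𝒜).twHom e)).toLinearMap ∘ₗ cosliceₗ _ _ (hopfParity 𝒜) z ∘ₗ
      tri (Cv.mapHom (Parity.pull _ (Parity.projLeft _ _ _)) P)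
      (AlgHom.cv ((Parity.pull _ (Parity.projLeft _ _ _)).comp X)) f))
    (TensorProduct.ext_threefold' fun a b c => ?_) t
  rw [LinearMap.smul_apply, LinearMap.comp_apply, LinearMap.comp_apply, tri_tmul, tri_tmul,
    ← mul_assoc, ← mul_assoc]
  have m := map_mul (Parity.pull (RepAlg 𝒜 B) (Parity.projLeft (hopfParity 𝒜) (hopfParity 𝒜)
    (hopfParity 𝒜))) (P.ofConv a) (X b)
  have m' := map_mul (Parity.pull (RepAlg 𝒜 B) ((dblParity 𝒜).twHom e)) (P.ofConv a) (X b)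
  exact (congrArg (· * F.ofConv c) m').symm.trans ((key c (P.ofConv a * X b)).trans
    (congrArg (fun u => (-1 : K) • Parity.pull _ ((dblParity 𝒜).twHom e)
      (cosliceₗ _ _ (hopfParity 𝒜) z (u * f.ofConv c))) m))

theorem IsBrkOf.apply {e : ZMod 2} {z : A} {f : TrpConv 𝒜 B}
    {g : WithConv (Dbl 𝒜 →ₗ[K] RepAlg 𝒜 B)} (h : IsBrkOf e z f g) {p q : ZMod 2} {x y : A}
    (hx : (hopfParity 𝒜).IsHom p x) (hy : (hopfParity 𝒜).IsHom q y) :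
    g.ofConv ((hopfParity 𝒜).stmul (hopfParity 𝒜) x y) = -(sgn K (e * (p + q)) • f.ofConv
      ((hopfParity 𝒜).stmul (dblParity 𝒜) x ((hopfParity 𝒜).stmul (hopfParity 𝒜) y z))) := by
  rw [h, ofConv_smul, LinearMap.smul_apply, Parity.pull_apply, neg_one_smul K]
  change -(cosliceₗ _ _ (hopfParity 𝒜) z f).ofConv ((dblParity 𝒜).tw _ _) = _
  rw [(hx.stmul hy).tw, map_smul]
  rfl

end Nested

theorem tri_smul_third {K B R : Type*} [CommRing K] [CommRing B] [HopfAlgebra K B] [Ring R]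
    [Algebra K R] (F G H : Cv K B R) (κ : K) (t : B ⊗[K] (B ⊗[K] B)) :
    tri F G (κ • H) t = κ • tri F G H t := by
  refine LinearMap.congr_fun (f := tri F G (κ • H)) (g := κ • tri F G H)
    (TensorProduct.ext_threefold' fun a b c => ?_) t
  simp only [tri_tmul, LinearMap.smul_apply, ofConv_smul, mul_smul_comm]

/-- `slice` as a linear map. -/
def sliceₗ {K C M S : Type*} [CommRing K] [AddCommGroup C] [Module K C] [AddCommGroup M]
    [Module K M] [Coalgebra K C] [Coalgebra K M] [Ring S] [Algebra K S]
    (α : Parity K C) (β : Parity K M) (c : C) :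
    WithConv (SProd α β →ₗ[K] S) →ₗ[K] WithConv (M →ₗ[K] S) := precomp (Parity.stmul α β c)

theorem br_genBrk_aux {K M : Type*} [CommRing K] [AddCommGroup M] [Module K M]
    (p q r n : ℤ) {L T₁ T₂ T₃ I Q W N : M}
    (key : L = T₁ + sgn K (((p + n : ℤ) : ZMod 2) * n) • (T₂ + T₃))
    (h₁ : T₁ = -(sgn K (((p + n : ℤ) : ZMod 2) * (q + r)) • I))
    (h₃ : T₃ = -(sgn K (((p + n : ℤ) : ZMod 2) * (q + r)) •
      sgn K (((p + n : ℤ) : ZMod 2) * n) • Q))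
    (h₂ : W = sgn K ((n : ZMod 2) * p) • T₂) (h₂' : N = sgn K (n : ZMod 2) • W) :
    L = N - sgn K (((p : ZMod 2) + n) * (q + r)) • (I + Q) := by
  rw [key, h₁, h₃, h₂', h₂, smul_add, smul_neg, smul_smul, smul_smul, smul_smul, ← sgn_add,
    ← sgn_add, ← sgn_add, smul_add, Int.cast_add]
  have e₁ : ∀ n p : ZMod 2, n + n * p = (p + n) * n := by decide
  have e₂ : ∀ n p s : ZMod 2, (p + n) * n + (p + n) * s + (p + n) * n = (p + n) * s := by decide
  rw [e₁, e₂]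
  abel

section Nested

variable {K A : Type*} [CommRing K] [Ring A] [Algebra K A]
variable {𝒜 : ℤ → Submodule K A} [GradedAlgebra 𝒜] [Coalgebra K A] [GradedHopfAlgebra 𝒜]
variable {B : Type*} [CommRing B] [HopfAlgebra K B]
variable {ρ : A →ₗ[K] A →ₗ[K] A} {n : ℤ} {bul : B →ₗ[K] B →ₗ[K] K}
variable {br : RepAlg 𝒜 B →ₗ[K] RepAlg 𝒜 B →ₗ[K] RepAlg 𝒜 B}

theorem pull_tw_gen₂ (q r : ZMod 2) :
    (Parity.pull _ ((trpParity 𝒜).twHom q)).comp (gen₂ 𝒜 B r) = gen₂ 𝒜 B (r + q) :=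
  AlgHom.ext fun b => by
    have h := Parity.pull_tw_snd (α := hopfParity 𝒜) (β := dblParity 𝒜) q
      (genFst 𝒜 B (hopfParity 𝒜) r b)
    rw [pull_tw_genFst] at h
    exact h

theorem brk_twPair (b c : B) :
    (brk bul (twPair n (rho₁₂ 𝒜 B ρ)) (gen₁ 𝒜 B 0) (gen₂ 𝒜 B n) b).ofConv c =
      Parity.pull _ ((trpParity 𝒜).twHom n) (Parity.pull _ (Parity.projLeft _ _ _)
        ((pairBrk 𝒜 B ρ n bul b).ofConv c)) := by
  have h := brk_map bul ((Parity.pull (RepAlg 𝒜 B) ((trpParity 𝒜).twHom n)).comp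
    (Parity.pull _ (Parity.projLeft (hopfParity 𝒜) (hopfParity 𝒜) (hopfParity 𝒜))))
    (rhoConv 𝒜 B ρ) (genFst 𝒜 B (hopfParity 𝒜) n) (genSnd 𝒜 B 0) b c
  rw [AlgHom.comp_assoc, AlgHom.comp_assoc, pull_projLeft_genFst, pull_projLeft_genSnd,
    pull_tw_gen₁, pull_tw_gen₂, CharTwo.add_self_eq_zero, zero_add] at h
  exact h.symm

theorem slice_brk_twPair
    (hg : ∀ x b y c, br (gen 𝒜 B x b) (gen 𝒜 B y c) = genBrk 𝒜 B ρ n bul x b y c)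
    {p : ℤ} {x : A} (hx : x ∈ 𝒜 p) (b c : B) :
    sliceₗ _ _ x ((brk bul (twPair n (rho₁₂ 𝒜 B ρ)) (gen₁ 𝒜 B 0) (gen₂ 𝒜 B n) b).ofConv c) =
      sgn K ((n : ZMod 2) * p) •
        postComp (br (gen 𝒜 B x b)) (genFst 𝒜 B (hopfParity 𝒜) n c) := by
  rw [brk_twPair]
  refine dbl_hom_ext fun q r y z hy hz => ?_
  rw [ofConv_smul, LinearMap.smul_apply, postComp_apply, genFst_apply, Parity.pull_apply,
    Parity.fstHom_stmul, map_smul, chiTw_apply, (isHom_of_mem 𝒜 hy).tw]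
  change ((pairBrk 𝒜 B ρ n bul b).ofConv c).ofConv (Parity.projLeft _ _ _
    ((trpParity 𝒜).tw n ((hopfParity 𝒜).stmul (dblParity 𝒜) x
      ((hopfParity 𝒜).stmul (hopfParity 𝒜) y z)))) = _
  rw [((isHom_of_mem 𝒜 hx).stmul ((isHom_of_mem 𝒜 hy).stmul (isHom_of_mem 𝒜 hz))).tw, map_smul,
    Parity.projLeft_stmul]
  simp only [map_smul, LinearMap.smul_apply]
  rw [hg, genBrk_apply]
  by_cases hr : r = 0
  · subst hr
    rw [smul_smul, smul_smul, smul_smul, mul_right_comm, ← sgn_add, Int.cast_zero, add_zero, mul_add]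
  · rw [GradedHopfAlgebra.counit_eq_zero (𝒜 := 𝒜) r z hz hr]
    simp only [zero_smul, smul_zero]

theorem slice_tri
    (hg : ∀ x b y c, br (gen 𝒜 B x b) (gen 𝒜 B y c) = genBrk 𝒜 B ρ n bul x b y c)
    {p : ℤ} {x : A} (hx : x ∈ 𝒜 p) (b : B) (t : B ⊗[K] (B ⊗[K] B)) :
    sliceₗ _ _ x (tri (twPair n (rho₂₃ 𝒜 B ρ))
      (brk bul (twPair n (rho₁₂ 𝒜 B ρ)) (gen₁ 𝒜 B 0) (gen₂ 𝒜 B n) b) (AlgHom.cv (gen₃ 𝒜 B)) t) =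
    sgn K ((n : ZMod 2) * p) •
      tri (Cv.mapHom (Parity.pull _ ((dblParity 𝒜).twHom (p + n : ℤ))) (rhoConv 𝒜 B ρ))
        (Cv.mapLin (postComp (br (gen 𝒜 B x b))) (AlgHom.cv (genFst 𝒜 B (hopfParity 𝒜) n)))
        (AlgHom.cv (genSnd 𝒜 B 0)) t := by
  refine LinearMap.congr_fun (f := sliceₗ _ _ x ∘ₗ tri (twPair n (rho₂₃ 𝒜 B ρ))
      (brk bul (twPair n (rho₁₂ 𝒜 B ρ)) (gen₁ 𝒜 B 0) (gen₂ 𝒜 B n) b) (AlgHom.cv (gen₃ 𝒜 B)))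
    (g := sgn K ((n : ZMod 2) * p) •
      tri (Cv.mapHom (Parity.pull _ ((dblParity 𝒜).twHom (p + n : ℤ))) (rhoConv 𝒜 B ρ))
        (Cv.mapLin (postComp (br (gen 𝒜 B x b))) (AlgHom.cv (genFst 𝒜 B (hopfParity 𝒜) n)))
        (AlgHom.cv (genSnd 𝒜 B 0))) (TensorProduct.ext_threefold' fun a c d => ?_) t
  have e : (twPair n (rho₂₃ 𝒜 B ρ)).ofConv a = Parity.pull _ (Parity.sndHom _ _)
      (Parity.pull _ ((dblParity 𝒜).twHom n) ((rhoConv 𝒜 B ρ).ofConv a)) :=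
    Parity.pull_tw_snd _ _
  rw [LinearMap.comp_apply, LinearMap.smul_apply, tri_tmul, tri_tmul, e]
  have h₁ := Parity.slice_snd_mul ((brk bul (twPair n (rho₁₂ 𝒜 B ρ)) (gen₁ 𝒜 B 0)
    (gen₂ 𝒜 B n) b).ofConv c * Parity.pull _ (Parity.sndHom _ _) (genSnd 𝒜 B 0 d))
    (Parity.pull _ ((dblParity 𝒜).twHom n) ((rhoConv 𝒜 B ρ).ofConv a)) (isHom_of_mem 𝒜 hx)
  have h₂ := Parity.slice_mul_snd ((brk bul (twPair n (rho₁₂ 𝒜 B ρ)) (gen₁ 𝒜 B 0)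
    (gen₂ 𝒜 B n) b).ofConv c) (genSnd 𝒜 B 0 d) x
  have h₃ := slice_brk_twPair (bul := bul) hg hx b c
  rw [h₂, Parity.pull_twHom_twHom] at h₁
  refine h₁.trans ?_
  rw [Int.cast_add, add_comm (p : ZMod 2)]
  refine (congrArg (fun u => Parity.pull _ ((dblParity 𝒜).twHom (n + p)) ((rhoConv 𝒜 B ρ).ofConv a)
    * (u * genSnd 𝒜 B 0 d)) h₃).trans ?_
  rw [smul_mul_assoc, mul_smul_comm]
  rfl

theorem br_genBrk (hA : IsGradedCocommutative 𝒜) (hρ : IsFoxPairing 𝒜 n ρ)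
    (h : IsRepBracket 𝒜 B n br)
    (hg : ∀ x b y c, br (gen 𝒜 B x b) (gen 𝒜 B y c) = genBrk 𝒜 B ρ n bul x b y c)
    {p q r : ℤ} {x y z : A} (hx : x ∈ 𝒜 p) (hy : y ∈ 𝒜 q) (hz : z ∈ 𝒜 r) (b c d : B) :
    br (gen 𝒜 B x b) (br (gen 𝒜 B y c) (gen 𝒜 B z d)) =
      (nestBrk 𝒜 B ρ n bul b c d).ofConv ((hopfParity 𝒜).stmul (dblParity 𝒜) x
        ((hopfParity 𝒜).stmul (hopfParity 𝒜) y z)) -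
      sgn K (((p : ZMod 2) + n) * (q + r)) •
        ((mergeBrk 𝒜 B ρ n bul c d b).ofConv ((hopfParity 𝒜).stmul (dblParity 𝒜) y
          ((hopfParity 𝒜).stmul (hopfParity 𝒜) z x)) +
        (nestBrk 𝒜 B ρ n bul c d b).ofConv ((hopfParity 𝒜).stmul (dblParity 𝒜) y
          ((hopfParity 𝒜).stmul (hopfParity 𝒜) z x))) := by
  have hx' := isHom_of_mem 𝒜 hx
  have hy' := isHom_of_mem 𝒜 hy
  have hz' := isHom_of_mem 𝒜 hz
  have key := congrArg (fun f : WithConv (Dbl 𝒜 →ₗ[K] RepAlg 𝒜 B) =>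
    f.ofConv ((hopfParity 𝒜).stmul (hopfParity 𝒜) y z))
    (postComp_tri hρ (h.isRepDer p _ (gen_mem 𝒜 B hx b)) (uni bul c d))
  have t₁ := (tri_brkOf_left (f := pairBrkMerge 𝒜 B ρ n bul b)
    (F := Cv.mapLin (postComp (br (gen 𝒜 B x b))) (rhoConv 𝒜 B ρ)) hx' (fun a => postComp_rhoConv (bul := bul) hρ h hg hx a b)
    (genFst 𝒜 B (hopfParity 𝒜) n) (genSnd 𝒜 B 0) (uni bul c d)).apply hy' hz'
  have t₃ := (tri_brkOf_right (f := sgn K ((p + n : ℤ) * n : ZMod 2) •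
      brkLeft bul (rho₂₃ 𝒜 B ρ) (gen₂ 𝒜 B n) (gen₃ 𝒜 B) b)
    (F := Cv.mapLin (postComp (br (gen 𝒜 B x b))) (AlgHom.cv (genSnd 𝒜 B 0)))
    (P := rhoConv 𝒜 B ρ) (fun a => postComp_genSnd (bul := bul) h hg hx a b)
    (genFst 𝒜 B (hopfParity 𝒜) n) (uni bul c d)).apply hy' hz'
  have t₂ := congrArg (fun f : WithConv (Dbl 𝒜 →ₗ[K] RepAlg 𝒜 B) =>
    f.ofConv ((hopfParity 𝒜).stmul (hopfParity 𝒜) y z))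
    (slice_tri (bul := bul) hg hx b (uni bul c d))
  have e : (p : ZMod 2) + ((p + n : ℤ) : ZMod 2) = n := by
    rw [Int.cast_add, ← add_assoc, CharTwo.add_self_eq_zero, zero_add]
  have g₁ : (Parity.pull (RepAlg 𝒜 B) ((dblParity 𝒜).twHom n)).comp
      (genFst 𝒜 B (hopfParity 𝒜) n) = genFst 𝒜 B (hopfParity 𝒜) 0 := AlgHom.ext fun b => by
    rw [← CharTwo.add_self_eq_zero (n : ZMod 2)]
    exact pull_tw_genFst 𝒜 B _ _ _ b
  have g₂ : (Parity.pull (RepAlg 𝒜 B) ((dblParity 𝒜).twHom n)).comp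
      (genSnd 𝒜 B 0) = genSnd 𝒜 B n := AlgHom.ext fun b => by
    rw [← zero_add (n : ZMod 2)]
    exact (pull_tw_genSnd 𝒜 B _ _ b).trans (by rw [zero_add, zero_add])
  rw [e, g₁, g₂, pull_projLeft_genFst, pull_projLeft_genSnd] at t₁
  rw [pull_projLeft_genFst, tri_smul_third] at t₃
  have t₂' := congrArg (fun f : TrpConv 𝒜 B => f.ofConv ((hopfParity 𝒜).stmul (dblParity 𝒜) x
        ((hopfParity 𝒜).stmul (hopfParity 𝒜) y z))) (nestBrk_eq (bul := bul) hA hρ b c d)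
  have key' := br_genBrk_aux (K := K) (M := RepAlg 𝒜 B) p q r n key t₁ t₃ t₂ t₂'
  rw [hg]
  exact key'

end Nested

section Abstract

variable {K B R : Type*} [CommRing K] [CommRing B] [HopfAlgebra K B] [Ring R] [Algebra K R]

/-- `f` is the bracket with `Z(d)` built from the bilinear map `V`. -/
def IsBilBrk (bul : B →ₗ[K] B →ₗ[K] K) (V : B →ₗ[K] B →ₗ[K] R) (Z : B →ₐ[K] R) (d : B)
    (f : Cv K B R) : Prop :=
  ∀ e, f.ofConv e = bilTri V (AlgHom.cv Z) (uni bul e d)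

theorem IsBilBrk.fox {t : B} {ht : IsTraceLike K t} {V : B →ₗ[K] B →ₗ[K] R} {X Y Z : B →ₐ[K] R}
    {d : B} {f : Cv K B R} (hf : IsBilBrk (traceForm ht) V Z d f) (hXY : AreCommuting X Y)
    (hXZ : AreCommuting X Z) (hYZ : AreCommuting Y Z) (b c : B)
    (π : Sweedler₆ (K := K) (t + HopfAlgebra.antipode K t)) :
    tri f (AlgHom.cv X) (AlgHom.cv Y) (uni (traceForm ht) b c) =
      ∑ i, triEval V X Y Z (π.el i 0) (π.el i 4) (π.el i 2) *
        (X (curly (traceForm ht) b (π.el i 1)) * (Y (curly (traceForm ht) c (π.el i 5)) *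
          Z (curly (traceForm ht) d (π.el i 3)))) :=
  bilTri_fox ht V hXY hXZ hYZ hf b c π

end Abstract

section Jacobiator

variable {K A : Type*} [CommRing K] [Ring A] [Algebra K A]
variable {𝒜 : ℤ → Submodule K A} [GradedAlgebra 𝒜] [Coalgebra K A] [GradedHopfAlgebra 𝒜]
variable {B : Type*} [CommRing B] [HopfAlgebra K B]
variable {ρ : A →ₗ[K] A →ₗ[K] A} {n : ℤ} {bul : B →ₗ[K] B →ₗ[K] K}
variable {br : RepAlg 𝒜 B →ₗ[K] RepAlg 𝒜 B →ₗ[K] RepAlg 𝒜 B}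

theorem jacobiator_aux {K M : Type*} [CommRing K] [AddCommGroup M] [Module K M] (p q r n : ZMod 2)
    {X Y Z Nx Ny Nz Ix Iy Iz : M} (hX : X = Nx - sgn K ((p + n) * (q + r)) • (Iy + Ny))
    (hY : Y = Ny - sgn K ((q + n) * (r + p)) • (Iz + Nz))
    (hZ : Z = Nz - sgn K ((r + n) * (p + q)) • (Ix + Nx)) :
    sgn K ((p + n) * (r + n)) • X + sgn K ((p + n) * (q + n)) • Y +
      sgn K ((q + n) * (r + n)) • Z =
    -(sgn K ((p + n) * (r + n)) • Ix + sgn K ((p + n) * (q + n)) • Iy +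
      sgn K ((q + n) * (r + n)) • Iz) := by
  have e : ∀ p q r n : ZMod 2, (p + n) * (r + n) + (p + n) * (q + r) = (p + n) * (q + n) ∧
      (p + n) * (q + n) + (q + n) * (r + p) = (q + n) * (r + n) ∧
      (q + n) * (r + n) + (r + n) * (p + q) = (p + n) * (r + n) := by decide
  obtain ⟨e₁, e₂, e₃⟩ := e p q r n
  rw [hX, hY, hZ, smul_sub, smul_sub, smul_sub, smul_smul, smul_smul, smul_smul, ← sgn_add,
    ← sgn_add, ← sgn_add, e₁, e₂, e₃]
  simp only [smul_add]
  abel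

theorem jacobiator_gen (hA : IsGradedCocommutative 𝒜) (hρ : IsFoxPairing 𝒜 n ρ)
    (h : IsRepBracket 𝒜 B n br)
    (hg : ∀ x b y c, br (gen 𝒜 B x b) (gen 𝒜 B y c) = genBrk 𝒜 B ρ n bul x b y c)
    {p q r : ℤ} {x y z : A} (hx : x ∈ 𝒜 p) (hy : y ∈ 𝒜 q) (hz : z ∈ 𝒜 r) (b c d : B) :
    jacobiator n br p q r (gen 𝒜 B x b) (gen 𝒜 B y c) (gen 𝒜 B z d) =
      -(sgn K (((p : ZMod 2) + n) * (r + n)) •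
          (mergeBrk 𝒜 B ρ n bul b c d).ofConv ((hopfParity 𝒜).stmul (dblParity 𝒜) x
            ((hopfParity 𝒜).stmul (hopfParity 𝒜) y z)) +
        sgn K (((p : ZMod 2) + n) * (q + n)) •
          (mergeBrk 𝒜 B ρ n bul c d b).ofConv ((hopfParity 𝒜).stmul (dblParity 𝒜) y
            ((hopfParity 𝒜).stmul (hopfParity 𝒜) z x)) +
        sgn K (((q : ZMod 2) + n) * (r + n)) •
          (mergeBrk 𝒜 B ρ n bul d b c).ofConv ((hopfParity 𝒜).stmul (dblParity 𝒜) z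
            ((hopfParity 𝒜).stmul (hopfParity 𝒜) x y))) :=
  jacobiator_aux (K := K) (M := RepAlg 𝒜 B) _ _ _ _ (br_genBrk hA hρ h hg hx hy hz b c d)
    (br_genBrk hA hρ h hg hy hz hx c d b) (br_genBrk hA hρ h hg hz hx hy d b c)

variable (𝒜 B ρ n) in
/-- The maps `x ⊗ y ⊗ z ↦ ρ(ρ(x, y)', z)_a ρ(x, y)''_b`, up to signs. -/
def doublePairing : B →ₗ[K] B →ₗ[K] TrpConv 𝒜 B :=
  ((LinearMap.mul K (WithConv (Dbl 𝒜 →ₗ[K] RepAlg 𝒜 B))).compl₁₂ (rhoConv 𝒜 B ρ).ofConv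
    (genFst 𝒜 B (hopfParity 𝒜) n).toLinearMap).compr₂ (precomp (mergePairing 𝒜 ρ))

theorem doublePairing_apply (a b : B) : doublePairing 𝒜 B ρ n a b = precomp (mergePairing 𝒜 ρ)
    ((rhoConv 𝒜 B ρ).ofConv a * genFst 𝒜 B (hopfParity 𝒜) n b) := rfl

theorem slice_slice_mergePairing (f : WithConv (Dbl 𝒜 →ₗ[K] RepAlg 𝒜 B)) (x y : A) :
    Parity.slice (Parity.slice (precomp (mergePairing 𝒜 ρ) f) x) y = Parity.slice f (ρ x y) :=
  WithConv.ext (LinearMap.ext fun z => congrArg f.ofConv (mergePairing_stmul 𝒜 ρ x y z))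

theorem mergePairing_mul_snd (f : WithConv (Dbl 𝒜 →ₗ[K] RepAlg 𝒜 B))
    (u : WithConv (A →ₗ[K] RepAlg 𝒜 B)) :
    precomp (mergePairing 𝒜 ρ) (f * Parity.pull _ (Parity.sndHom _ _) u) =
      precomp (mergePairing 𝒜 ρ) f *
        Parity.pull _ (Parity.sndHom _ _) (Parity.pull _ (Parity.sndHom _ _) u) := by
  refine Parity.slice_ext fun x => Parity.slice_ext fun y => ?_
  have h₁ := Parity.slice_mul_snd (precomp (mergePairing 𝒜 ρ) f)
    (Parity.pull _ (Parity.sndHom (hopfParity 𝒜) (hopfParity 𝒜)) u) x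
  have h₂ := Parity.slice_mul_snd (Parity.slice (precomp (mergePairing 𝒜 ρ) f) x) u y
  rw [slice_slice_mergePairing, Parity.slice_mul_snd]
  exact ((congrArg (fun f => Parity.slice f y) h₁).trans
    (h₂.trans (congrArg (· * u) (slice_slice_mergePairing f x y)))).symm

theorem pairBrkMerge_isBilBrk (d : B) : IsBilBrk (R := TrpConv 𝒜 B) bul (doublePairing 𝒜 B ρ n)
    (gen₃ 𝒜 B) d (pairBrkMerge 𝒜 B ρ n bul d) := fun e => by
  refine LinearMap.congr_fun (f := precomp (mergePairing 𝒜 ρ) ∘ₗ tri (rhoConv 𝒜 B ρ)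
    (AlgHom.cv (genFst 𝒜 B (hopfParity 𝒜) n)) (AlgHom.cv (genSnd 𝒜 B 0)))
    (g := bilTri (doublePairing 𝒜 B ρ n) (AlgHom.cv (gen₃ 𝒜 B)))
    (TensorProduct.ext_threefold' fun a b c => ?_) (uni bul e d)
  rw [LinearMap.comp_apply, tri_tmul, bilTri_tmul, ← mul_assoc]
  exact mergePairing_mul_snd _ _

variable (𝒜 B ρ n) in
/-- The values of the maps `Ϝ` in the representation algebra. -/
def digammaConv (a₁ a₂ a₃ : B) : TrpConv 𝒜 B :=
  triEval (doublePairing 𝒜 B ρ n) (gen₁ 𝒜 B 0) (gen₂ 𝒜 B n) (gen₃ 𝒜 B) a₁ a₂ a₃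

theorem gen₁_gen₂_areCommuting (hA : IsGradedCocommutative 𝒜) (i j : ZMod 2) :
    AreCommuting (R := TrpConv 𝒜 B) (gen₁ 𝒜 B i) (gen₂ 𝒜 B j) := fun b c =>
  conv_even_comm 𝒜 (trpParity_cocomm hA) (gen₁_hasParity 𝒜 B _ b) (gen₂_hasParity 𝒜 B _ c)

theorem gen₁_gen₃_areCommuting (hA : IsGradedCocommutative 𝒜) (i : ZMod 2) :
    AreCommuting (R := TrpConv 𝒜 B) (gen₁ 𝒜 B i) (gen₃ 𝒜 B) := fun b c =>
  conv_even_comm 𝒜 (trpParity_cocomm hA) (gen₁_hasParity 𝒜 B _ b) (gen₃_hasParity 𝒜 B c)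

theorem gen₂_gen₃_areCommuting (hA : IsGradedCocommutative 𝒜) (i : ZMod 2) :
    AreCommuting (R := TrpConv 𝒜 B) (gen₂ 𝒜 B i) (gen₃ 𝒜 B) := fun b c =>
  conv_even_comm 𝒜 (trpParity_cocomm hA) (gen₂_hasParity 𝒜 B _ b) (gen₃_hasParity 𝒜 B c)

theorem mergeBrk_eq (hA : IsGradedCocommutative 𝒜) {t : B} (ht : IsTraceLike K t) (b c d : B)
    (π : Sweedler₆ (K := K) (t + HopfAlgebra.antipode K t)) :
    mergeBrk 𝒜 B ρ n (traceForm ht) b c d =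
      ∑ i, digammaConv 𝒜 B ρ n (π.el i 0) (π.el i 4) (π.el i 2) *
        (gen₁ 𝒜 B 0 (curly (traceForm ht) b (π.el i 1)) *
          (gen₂ 𝒜 B n (curly (traceForm ht) c (π.el i 5)) *
            gen₃ 𝒜 B (curly (traceForm ht) d (π.el i 3)))) := by
  have h₁₂ := gen₁_gen₂_areCommuting (B := B) hA 0 n
  have h₁₃ := gen₁_gen₃_areCommuting (B := B) hA 0
  have h₂₃ := gen₂_gen₃_areCommuting (B := B) hA n
  exact IsBilBrk.fox (R := TrpConv 𝒜 B) (pairBrkMerge_isBilBrk (ρ := ρ) (n := n)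
    (bul := traceForm ht) d) h₁₂ h₁₃ h₂₃ b c π

theorem gen_gen_gen_apply {q : ZMod 2} {y : A} (hy : (hopfParity 𝒜).IsHom q y) (m : ZMod 2)
    (x z : A) (b c d : B) :
    (gen₁ 𝒜 B 0 b * (gen₂ 𝒜 B m c * gen₃ 𝒜 B d)).ofConv ((hopfParity 𝒜).stmul (dblParity 𝒜) x
      ((hopfParity 𝒜).stmul (hopfParity 𝒜) y z)) =
      sgn K (m * q) • (gen 𝒜 B x b * (gen 𝒜 B y c * gen 𝒜 B z d)) := by
  have e : gen₂ 𝒜 B m c * gen₃ 𝒜 B d = Parity.pull _ (Parity.sndHom _ _)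
      (genFst 𝒜 B (hopfParity 𝒜) m c * genSnd 𝒜 B 0 d) :=
    (map_mul (Parity.pull (RepAlg 𝒜 B) (Parity.sndHom (hopfParity 𝒜) (dblParity 𝒜)))
      (genFst 𝒜 B (hopfParity 𝒜) m c) (genSnd 𝒜 B 0 d)).symm
  rw [e]
  refine (Parity.pull_fst_mul_pull_snd _ _ _ _).trans ?_
  rw [genFst_apply, genSnd_apply, Parity.pull_fst_mul_pull_snd]
  change gen 𝒜 B ((hopfParity 𝒜).tw 0 x) b * (gen 𝒜 B ((hopfParity 𝒜).tw m y) c *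
    gen 𝒜 B ((hopfParity 𝒜).tw 0 z) d) = _
  rw [Parity.tw_zero, hy.tw, LinearMap.id_apply, LinearMap.id_apply]
  simp only [map_smul, LinearMap.smul_apply, smul_mul_assoc, mul_smul_comm]

end Jacobiator

/-- The sums over `a₁⁽¹⁾ ⊗ a₁⁽²⁾ ⊗ a₁⁽³⁾` and `a₂⁽¹⁾ ⊗ a₂⁽²⁾ ⊗ a₂⁽³⁾`. -/
def triSum (K : Type*) {B : Type*} [CommRing K] [CommRing B] [HopfAlgebra K B] (M : Type*)
    [AddCommMonoid M] (a₁ a₂ : B) : (B × B × B → B × B × B → M) →+ M where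
  toFun f := ∑ i ∈ (ℛ K a₁).index, ∑ j ∈ (ℛ K ((ℛ K a₁).right i)).index,
    ∑ k ∈ (ℛ K a₂).index, ∑ l ∈ (ℛ K ((ℛ K a₂).right k)).index,
      f ((ℛ K a₁).left i, (ℛ K ((ℛ K a₁).right i)).left j, (ℛ K ((ℛ K a₁).right i)).right j)
        ((ℛ K a₂).left k, (ℛ K ((ℛ K a₂).right k)).left l, (ℛ K ((ℛ K a₂).right k)).right l)
  map_zero' := by simp
  map_add' f g := by simp [Finset.sum_add_distrib]

theorem map_triSum {K B M N F : Type*} [CommRing K] [CommRing B] [HopfAlgebra K B]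
    [AddCommMonoid M] [AddCommMonoid N] [FunLike F M N] [AddMonoidHomClass F M N] (φ : F)
    (a₁ a₂ : B) (f : B × B × B → B × B × B → M) :
    φ (triSum K M a₁ a₂ f) = triSum K N a₁ a₂ fun a b => φ (f a b) := by
  simp [triSum]

theorem triSum_sum {K B M ι : Type*} [CommRing K] [CommRing B] [HopfAlgebra K B]
    [AddCommMonoid M] (s : Finset ι) (a₁ a₂ : B) (f : ι → B × B × B → B × B × B → M) :
    triSum K M a₁ a₂ (fun a b => ∑ i ∈ s, f i a b) = ∑ i ∈ s, triSum K M a₁ a₂ (f i) := by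
  rw [← map_sum]
  congr 1
  funext a b
  simp only [Finset.sum_apply]

theorem triSum_mul {K B R : Type*} [CommRing K] [CommRing B] [HopfAlgebra K B] [Ring R]
    (a₁ a₂ : B) (f g : B × B × B → R) :
    (∑ i ∈ (ℛ K a₁).index, ∑ j ∈ (ℛ K ((ℛ K a₁).right i)).index,
        f ((ℛ K a₁).left i, (ℛ K ((ℛ K a₁).right i)).left j,
          (ℛ K ((ℛ K a₁).right i)).right j)) *
      (∑ i ∈ (ℛ K a₂).index, ∑ j ∈ (ℛ K ((ℛ K a₂).right i)).index,
        g ((ℛ K a₂).left i, (ℛ K ((ℛ K a₂).right i)).left j,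
          (ℛ K ((ℛ K a₂).right i)).right j)) =
      triSum K R a₁ a₂ fun a b => f a * g b := by
  change _ = ∑ i ∈ (ℛ K a₁).index, ∑ j ∈ (ℛ K ((ℛ K a₁).right i)).index,
    ∑ k ∈ (ℛ K a₂).index, ∑ l ∈ (ℛ K ((ℛ K a₂).right k)).index, _
  rw [Finset.sum_mul (s := (ℛ K a₁).index)]
  refine Finset.sum_congr rfl fun i _ => ?_
  rw [Finset.sum_mul (s := (ℛ K ((ℛ K a₁).right i)).index)]
  refine Finset.sum_congr rfl fun j _ => ?_
  simp only [Finset.mul_sum]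

/-- Evaluation at a point. -/
def evalₗ {K C S : Type*} [CommRing K] [AddCommGroup C] [Module K C] [Ring S] [Algebra K S] (c : C) :
    WithConv (C →ₗ[K] S) →ₗ[K] S where
  toFun f := f.ofConv c
  map_add' _ _ := rfl
  map_smul' _ _ := rfl

theorem supercomm_digamma {K S : Type*} [CommRing K] [Ring S] [Algebra K S]
    {𝒮 : ZMod 2 → Submodule K S} (h : IsSuperComm 𝒮) {i j k u v t : ZMod 2} {x y z r s q : S}
    (hx : x ∈ 𝒮 i) (hy : y ∈ 𝒮 j) (hz : z ∈ 𝒮 k) (hr : r ∈ 𝒮 u) (hs : s ∈ 𝒮 v) (hq : q ∈ 𝒮 t)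
    (w : S) : x * (y * z) * (r * (s * (q * w))) =
      sgn K (j * i + u * (i + k) + v * t) • (y * (r * x) * (z * (q * s) * w)) := by
  have e : ∀ i j k u v t : ZMod 2, j * i + u * (i + k) + v * t = i * j + v * t + i * u + k * u := by
    decide
  rw [e, sgn_add, sgn_add, sgn_add, mul_smul, mul_smul, mul_smul]
  have e₁ : x * (y * z) * (r * (s * (q * w))) = x * y * (z * r) * (s * q) * w := by
    simp only [mul_assoc]
  have e₂ : y * x * (r * z) * (q * s) * w = y * (x * r) * (z * (q * s) * w) := by
    simp only [mul_assoc]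
  rw [e₁, h.comm hx hy, h.comm hs hq, h.comm hz hr]
  simp only [smul_mul_assoc, mul_smul_comm]
  rw [e₂, h.comm hx hr]
  simp only [smul_mul_assoc, mul_smul_comm, smul_smul]
  congr 1
  ring

namespace Parity

variable {K C M S : Type*} [CommRing K] [AddCommGroup C] [Module K C] [AddCommGroup M] [Module K M]
variable [Coalgebra K C] [Coalgebra K M] [Ring S] [Algebra K S] {α : Parity K C} {β : Parity K M}

theorem pull_fst_mul_eq (u : WithConv (C →ₗ[K] S)) (f : WithConv (SProd α β →ₗ[K] S)) (c : C)
    (m : M) : (pull S (fstHom α β) u * f).ofConv (stmul α β c m) =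
      (u * toConv (f.ofConv ∘ₗ (stmul α β).flip m)).ofConv c := by
  obtain ⟨X⟩ := nonempty_homExpansion α (comul (R := K) c)
  rw [pull_fst_mul_apply X, X.conv_apply]
  rfl

end Parity

theorem conv_apply₃ {K A S : Type*} [CommRing K] [Ring A] [Algebra K A]
    {𝒜 : ℤ → Submodule K A} [GradedAlgebra 𝒜] [Coalgebra K A] [Ring S] [Algebra K S] {x : A}
    (R : Expansion₃ 𝒜 (comul.lTensor A (comul (R := K) x))) (f g h : WithConv (A →ₗ[K] S)) :
    (f * (g * h)).ofConv x = ∑ l, f.ofConv (R.fst l) * (g.ofConv (R.snd l) * h.ofConv (R.thd l)) := by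
  have e : ∀ t : A ⊗[K] A, LinearMap.mul' K S (TensorProduct.map f.ofConv (g * h).ofConv t) =
      LinearMap.mul' K S (TensorProduct.map f.ofConv (LinearMap.mul' K S ∘ₗ
        TensorProduct.map g.ofConv h.ofConv) (comul.lTensor A t)) := by
    intro t
    induction t with
    | zero => simp
    | add s t hs ht => simp only [map_add, hs, ht]
    | tmul a b => simp [LinearMap.convMul_apply]
  rw [LinearMap.convMul_apply, e]
  conv_lhs => rw [← R.sum_eq]
  simp

theorem conv_apply₂ {K A S : Type*} [CommRing K] [Ring A] [Algebra K A]
    {𝒜 : ℤ → Submodule K A} [GradedAlgebra 𝒜] [Coalgebra K A] [Ring S] [Algebra K S] {x : A}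
    (R : Expansion₂ 𝒜 (comul (R := K) x)) (f g : WithConv (A →ₗ[K] S)) :
    (f * g).ofConv x = ∑ l, f.ofConv (R.fst l) * g.ofConv (R.snd l) := by
  rw [LinearMap.convMul_apply]
  conv_lhs => rw [← R.sum_eq]
  simp

section Expansions

variable {K A : Type*} [CommRing K] [Ring A] [Algebra K A]
variable (𝒜 : ℤ → Submodule K A) [GradedAlgebra 𝒜]

theorem nonempty_expansion₂ (t : A ⊗[K] A) : Nonempty (Expansion₂ 𝒜 t) := by
  have zero : Nonempty (Expansion₂ 𝒜 (0 : A ⊗[K] A)) :=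
    ⟨⟨0, nofun, nofun, nofun, nofun, nofun, nofun, by simp⟩⟩
  have add : ∀ s t : A ⊗[K] A, Nonempty (Expansion₂ 𝒜 s) → Nonempty (Expansion₂ 𝒜 t) →
      Nonempty (Expansion₂ 𝒜 (s + t)) := by
    rintro s t ⟨X⟩ ⟨Y⟩
    refine ⟨⟨X.size + Y.size, Fin.append X.fst Y.fst, Fin.append X.snd Y.snd,
      Fin.append X.deg₁ Y.deg₁, Fin.append X.deg₂ Y.deg₂, fun i => ?_, fun i => ?_, ?_⟩⟩
    · refine Fin.addCases (fun i => ?_) (fun i => ?_) i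
      · simpa using X.fst_mem i
      · simpa using Y.fst_mem i
    · refine Fin.addCases (fun i => ?_) (fun i => ?_) i
      · simpa using X.snd_mem i
      · simpa using Y.snd_mem i
    · simp [Fin.sum_univ_add, X.sum_eq, Y.sum_eq]
  induction t with
  | zero => exact zero
  | add s t hs ht => exact add s t hs ht
  | tmul x y =>
    refine graded_induction 𝒜 (p := fun x => Nonempty (Expansion₂ 𝒜 (x ⊗ₜ y))) (fun p x hx => ?_)
      (fun x x' h h' => by rw [TensorProduct.add_tmul]; exact add _ _ h h') x
    refine graded_induction 𝒜 (p := fun y => Nonempty (Expansion₂ 𝒜 (x ⊗ₜ y))) (fun q y hy => ?_)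
      (fun x x' h h' => by rw [TensorProduct.tmul_add]; exact add _ _ h h') y
    exact ⟨⟨1, fun _ => x, fun _ => y, fun _ => p, fun _ => q, fun _ => hx, fun _ => hy, by simp⟩⟩

theorem nonempty_expansion₃ (t : A ⊗[K] (A ⊗[K] A)) : Nonempty (Expansion₃ 𝒜 t) := by
  have zero : Nonempty (Expansion₃ 𝒜 (0 : A ⊗[K] (A ⊗[K] A))) :=
    ⟨⟨0, nofun, nofun, nofun, nofun, nofun, nofun, nofun, nofun, nofun, by simp⟩⟩
  have add : ∀ s t : A ⊗[K] (A ⊗[K] A), Nonempty (Expansion₃ 𝒜 s) → Nonempty (Expansion₃ 𝒜 t) →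
      Nonempty (Expansion₃ 𝒜 (s + t)) := by
    rintro s t ⟨X⟩ ⟨Y⟩
    refine ⟨⟨X.size + Y.size, Fin.append X.fst Y.fst, Fin.append X.snd Y.snd,
      Fin.append X.thd Y.thd, Fin.append X.deg₁ Y.deg₁, Fin.append X.deg₂ Y.deg₂,
      Fin.append X.deg₃ Y.deg₃, fun i => ?_, fun i => ?_, fun i => ?_, ?_⟩⟩
    · refine Fin.addCases (fun i => ?_) (fun i => ?_) i
      · simpa using X.fst_mem i
      · simpa using Y.fst_mem i
    · refine Fin.addCases (fun i => ?_) (fun i => ?_) i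
      · simpa using X.snd_mem i
      · simpa using Y.snd_mem i
    · refine Fin.addCases (fun i => ?_) (fun i => ?_) i
      · simpa using X.thd_mem i
      · simpa using Y.thd_mem i
    · simp [Fin.sum_univ_add, X.sum_eq, Y.sum_eq]
  induction t with
  | zero => exact zero
  | add s t hs ht => exact add s t hs ht
  | tmul x t =>
    obtain ⟨T⟩ := nonempty_expansion₂ 𝒜 t
    refine graded_induction 𝒜 (p := fun x => Nonempty (Expansion₃ 𝒜 (x ⊗ₜ t))) (fun p x hx => ?_)
      (fun x x' h h' => by rw [TensorProduct.add_tmul]; exact add _ _ h h') x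
    exact ⟨⟨T.size, fun _ => x, T.fst, T.snd, fun _ => p, T.deg₁, T.deg₂, fun _ => hx, T.fst_mem,
      T.snd_mem, by rw [← TensorProduct.tmul_sum, T.sum_eq]⟩⟩

end Expansions

section Digamma

variable {K A : Type*} [CommRing K] [Ring A] [Algebra K A]
variable {𝒜 : ℤ → Submodule K A} [GradedAlgebra 𝒜] [Coalgebra K A] [GradedHopfAlgebra 𝒜]
variable {B : Type*} [CommRing B] [HopfAlgebra K B]
variable {ρ : A →ₗ[K] A →ₗ[K] A} {n : ℤ}

theorem IsFoxPairing.apply_stmul_mem (hρ : IsFoxPairing 𝒜 n ρ) {d : ZMod 2}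
    {f : Dbl 𝒜 →ₗ[K] RepAlg 𝒜 B} (hf : (dblParity 𝒜).HasParity (repParity 𝒜 B) d f)
    {i j k : ZMod 2} {x y z : A} (hx : (hopfParity 𝒜).IsHom i x) (hy : (hopfParity 𝒜).IsHom j y)
    (hz : (hopfParity 𝒜).IsHom k z) :
    f ((hopfParity 𝒜).stmul (hopfParity 𝒜) (ρ x y) z) ∈ repParity 𝒜 B (i + j + n + k + d) := by
  refine hopfParity_hom_mem 𝒜 hx _ (f ∘ₗ ((hopfParity 𝒜).stmul (hopfParity 𝒜)).flip z ∘ₗ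
    ρ.flip y) _ fun p hp x hx => ?_
  refine hopfParity_hom_mem 𝒜 hy _ (f ∘ₗ ((hopfParity 𝒜).stmul (hopfParity 𝒜)).flip z ∘ₗ ρ x) _
    fun q hq y hy => ?_
  have h := hf _ _ ((isHom_of_mem 𝒜 (hρ.map_mem p q x y hx hy)).stmul hz)
  rw [← hp, ← hq]
  push_cast at h
  exact h

theorem doublePairing_hasParity (hρ : IsFoxPairing 𝒜 n ρ) (a b : B) :
    (trpParity 𝒜).HasParity (repParity 𝒜 B) 0 (doublePairing 𝒜 B ρ n a b).ofConv := by
  have hW : (dblParity 𝒜).HasParity (repParity 𝒜 B) (n + 0)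
      ((rhoConv 𝒜 B ρ).ofConv a * genFst 𝒜 B (hopfParity 𝒜) n b).ofConv :=
    (rhoConv_hasParity B hρ a).mul (isSuperComm 𝒜 B) (genFst_hasParity 𝒜 B _ _ b)
  rw [doublePairing_apply]
  generalize (rhoConv 𝒜 B ρ).ofConv a * genFst 𝒜 B (hopfParity 𝒜) n b = W at hW
  refine Parity.hasParity_of_stmul fun i j x m hx hm => ?_
  have h : (dblParity 𝒜).HasParity (repParity 𝒜 B) i
      (Parity.slice (precomp (mergePairing 𝒜 ρ) W) x).ofConv := by
    refine Parity.hasParity_of_stmul fun j k y z hy hz => ?_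
    have e : (Parity.slice (precomp (mergePairing 𝒜 ρ) W) x).ofConv
        ((hopfParity 𝒜).stmul (hopfParity 𝒜) y z) =
        W.ofConv ((hopfParity 𝒜).stmul (hopfParity 𝒜) (ρ x y) z) :=
      congrArg W.ofConv (mergePairing_stmul 𝒜 ρ x y z)
    have h := hρ.apply_stmul_mem hW hx hy hz
    have e' : ∀ i j k n : ZMod 2, i + j + n + k + (n + 0) = j + k + i := by decide
    rw [e'] at h
    rw [e]
    exact h
  rw [add_zero, add_comm i]
  exact h j m hm

theorem doublePairing_stmul (hA : IsGradedCocommutative 𝒜) (hρ : IsFoxPairing 𝒜 n ρ) (a b : B)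
    (x y z : A) : (doublePairing 𝒜 B ρ n a b).ofConv ((hopfParity 𝒜).stmul (dblParity 𝒜) x
      ((hopfParity 𝒜).stmul (hopfParity 𝒜) y z)) =
      (chi 𝒜 B b * toConv ((gen 𝒜 B).flip a ∘ₗ ρ.flip z)).ofConv (ρ x y) := by
  have e : (rhoConv 𝒜 B ρ).ofConv a * genFst 𝒜 B (hopfParity 𝒜) n b =
      genFst 𝒜 B (hopfParity 𝒜) 0 b * (rhoConv 𝒜 B ρ).ofConv a := by
    rw [Parity.conv_comm_even (dblParity_cocomm hA) (isSuperComm 𝒜 B)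
      (genFst_hasParity 𝒜 B (hopfParity 𝒜) n b) (rhoConv_hasParity B hρ a), pull_tw_genFst,
      CharTwo.add_self_eq_zero]
  refine (congrArg ((rhoConv 𝒜 B ρ).ofConv a * genFst 𝒜 B (hopfParity 𝒜) n b).ofConv
    (mergePairing_stmul 𝒜 ρ x y z)).trans ?_
  rw [e, genFst_apply, Parity.pull_fst_mul_eq, chiTw_zero]
  congr 3

theorem doublePairing_expansion (hA : IsGradedCocommutative 𝒜) (hρ : IsFoxPairing 𝒜 n ρ)
    {x y z : A} (R : Expansion₃ 𝒜 (comul.lTensor A (comul (R := K) (ρ x y))))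
    (Q : ∀ l, Expansion₂ 𝒜 (comul (R := K) (ρ (R.thd l) z))) (a b c d : B) :
    (doublePairing 𝒜 B ρ n (a * HopfAlgebra.antipode K b) (HopfAlgebra.antipode K c * d)).ofConv
      ((hopfParity 𝒜).stmul (dblParity 𝒜) x ((hopfParity 𝒜).stmul (hopfParity 𝒜) y z)) =
    ∑ l, ∑ m, gen 𝒜 B (GradedHopfAlgebra.antipode 𝒜 (R.fst l)) c * (gen 𝒜 B (R.snd l) d *
      (gen 𝒜 B (GradedHopfAlgebra.antipode 𝒜 ((Q l).fst m)) b * gen 𝒜 B ((Q l).snd m) a)) := by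
  rw [doublePairing_stmul hA hρ, map_mul, mul_assoc, conv_apply₃ R]
  refine Finset.sum_congr rfl fun l _ => ?_
  have e : (toConv ((gen 𝒜 B).flip (a * HopfAlgebra.antipode K b) ∘ₗ ρ.flip z)).ofConv (R.thd l) =
      (chi 𝒜 B (HopfAlgebra.antipode K b) * chi 𝒜 B a).ofConv (ρ (R.thd l) z) := by
    rw [← map_mul, mul_comm _ a]
    rfl
  rw [e, conv_apply₂ (Q l), Finset.mul_sum, Finset.mul_sum]
  refine Finset.sum_congr rfl fun m _ => ?_
  rw [gen_antipode, gen_antipode]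
  rfl

variable (𝒜 B) in
/-- The map `x ⊗ y ⊗ z ↦ x_a y_b z_c`. -/
def genTri (a b c : B) : A ⊗[K] (A ⊗[K] A) →ₗ[K] RepAlg 𝒜 B :=
  LinearMap.mul' K _ ∘ₗ TensorProduct.map ((gen 𝒜 B).flip a)
    (LinearMap.mul' K _ ∘ₗ TensorProduct.map ((gen 𝒜 B).flip b) ((gen 𝒜 B).flip c))

theorem genTri_tmul (a b c : B) (x y z : A) : genTri 𝒜 B a b c (x ⊗ₜ (y ⊗ₜ z)) =
    gen 𝒜 B x a * (gen 𝒜 B y b * gen 𝒜 B z c) := by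
  simp [genTri]

theorem gen_mul (x y : A) (a : B) : gen 𝒜 B (x * y) a =
    ∑ i ∈ (ℛ K a).index, gen 𝒜 B x ((ℛ K a).left i) * gen 𝒜 B y ((ℛ K a).right i) :=
  (congrArg (fun f : Cv K B (RepAlg 𝒜 B) => f.ofConv a) (genConv_mul 𝒜 B x y)).trans
    (Cv.mul_apply (ℛ K a) _ _)

theorem genTri_mul_mul (a b c : B) (x y z u v w t : A) :
    genTri 𝒜 B a b c ((x * y * z) ⊗ₜ ((u * v * w) ⊗ₜ t)) =
      triSum K (RepAlg 𝒜 B) a b fun l m =>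
        gen 𝒜 B x l.1 * (gen 𝒜 B y l.2.1 * gen 𝒜 B z l.2.2) *
          (gen 𝒜 B u m.1 * (gen 𝒜 B v m.2.1 * gen 𝒜 B w m.2.2) * gen 𝒜 B t c) := by
  have h : ∀ (x y z : A) (a : B), gen 𝒜 B (x * y * z) a =
      ∑ i ∈ (ℛ K a).index, ∑ j ∈ (ℛ K ((ℛ K a).right i)).index,
        gen 𝒜 B x ((ℛ K a).left i) * (gen 𝒜 B y ((ℛ K ((ℛ K a).right i)).left j) *
          gen 𝒜 B z ((ℛ K ((ℛ K a).right i)).right j)) := by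
    intro x y z a
    rw [mul_assoc, gen_mul]
    simp only [gen_mul y z, Finset.mul_sum]
  rw [genTri_tmul, ← mul_assoc, h, h]
  refine (congrArg (· * gen 𝒜 B t c) (triSum_mul (K := K) (B := B) (R := RepAlg 𝒜 B) a b
    (fun l => gen 𝒜 B x l.1 * (gen 𝒜 B y l.2.1 * gen 𝒜 B z l.2.2))
    (fun l => gen 𝒜 B u l.1 * (gen 𝒜 B v l.2.1 * gen 𝒜 B w l.2.2)))).trans ?_
  refine (map_triSum (AddMonoidHom.mulRight (gen 𝒜 B t c)) a b _).trans ?_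
  simp only [AddMonoidHom.mulRight_apply, mul_assoc]

end Digamma

section DigammaConv

variable {K A : Type*} [CommRing K] [Ring A] [Algebra K A]
variable {𝒜 : ℤ → Submodule K A} [GradedAlgebra 𝒜] [Coalgebra K A] [GradedHopfAlgebra 𝒜]
variable {B : Type*} [CommRing B] [HopfAlgebra K B]
variable {ρ : A →ₗ[K] A →ₗ[K] A} {n : ℤ}

theorem mul_conv_even_comm (hA : IsGradedCocommutative 𝒜) {V f g h : TrpConv 𝒜 B}
    (hV : (trpParity 𝒜).HasParity (repParity 𝒜 B) 0 V.ofConv)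
    (hf : (trpParity 𝒜).HasParity (repParity 𝒜 B) 0 f.ofConv)
    (hg : (trpParity 𝒜).HasParity (repParity 𝒜 B) 0 g.ofConv)
    (hh : (trpParity 𝒜).HasParity (repParity 𝒜 B) 0 h.ofConv) :
    V * (f * (g * h)) = f * (g * h) * V := by
  have h₁ : (trpParity 𝒜).HasParity (repParity 𝒜 B) 0 (g * h).ofConv := by
    have := hg.mul (isSuperComm 𝒜 B) hh
    rwa [add_zero] at this
  have h₂ : (trpParity 𝒜).HasParity (repParity 𝒜 B) 0 (f * (g * h)).ofConv := by
    have := hf.mul (isSuperComm 𝒜 B) h₁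
    rwa [add_zero] at this
  exact conv_even_comm 𝒜 (trpParity_cocomm hA) hV h₂

theorem digammaConv_eq_triSum (hA : IsGradedCocommutative 𝒜) (hρ : IsFoxPairing 𝒜 n ρ)
    (a₁ a₂ a₃ : B) : digammaConv 𝒜 B ρ n a₁ a₂ a₃ = triSum K (TrpConv 𝒜 B) a₁ a₂ fun l m =>
      (gen₁ 𝒜 B 0 l.2.2 * (gen₂ 𝒜 B n l.1 * gen₃ 𝒜 B m.1)) *
        doublePairing 𝒜 B ρ n (a₃ * HopfAlgebra.antipode K m.2.1)
          (HopfAlgebra.antipode K l.2.1 * m.2.2) := by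
  have e : digammaConv 𝒜 B ρ n a₁ a₂ a₃ = triSum K (TrpConv 𝒜 B) a₁ a₂ fun l m =>
      doublePairing 𝒜 B ρ n (a₃ * HopfAlgebra.antipode K m.2.1)
          (HopfAlgebra.antipode K l.2.1 * m.2.2) *
        (gen₁ 𝒜 B 0 l.2.2 * (gen₂ 𝒜 B n l.1 * gen₃ 𝒜 B m.1)) := rfl
  have h : ∀ a b c d e : B, doublePairing 𝒜 B ρ n d e *
      (gen₁ 𝒜 B 0 a * (gen₂ 𝒜 B n b * gen₃ 𝒜 B c)) =
      (gen₁ 𝒜 B 0 a * (gen₂ 𝒜 B n b * gen₃ 𝒜 B c)) * doublePairing 𝒜 B ρ n d e := by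
    intro a b c d e
    have hV := doublePairing_hasParity hρ d e
    have hf := gen₁_hasParity 𝒜 B 0 a
    have hg := gen₂_hasParity 𝒜 B n b
    have hh := gen₃_hasParity 𝒜 B c
    generalize doublePairing 𝒜 B ρ n d e = V at hV ⊢
    generalize gen₁ 𝒜 B 0 a = f at hf ⊢
    generalize gen₂ 𝒜 B n b = g at hg ⊢
    generalize gen₃ 𝒜 B c = h at hh ⊢
    exact mul_conv_even_comm hA hV hf hg hh
  rw [e]
  congr 1
  funext l m
  exact h _ _ _ _ _

theorem gen_digamma {i j k u v t : ℤ} {x y z r s q : A} (hx : x ∈ 𝒜 i) (hy : y ∈ 𝒜 j)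
    (hz : z ∈ 𝒜 k) (hr : r ∈ 𝒜 u) (hs : s ∈ 𝒜 v) (hq : q ∈ 𝒜 t) (w : A) (l m : B × B × B)
    (c : B) :
    gen 𝒜 B x l.2.2 * (gen 𝒜 B y l.1 * gen 𝒜 B z m.1) *
        (gen 𝒜 B r l.2.1 * (gen 𝒜 B s m.2.2 * (gen 𝒜 B q m.2.1 * gen 𝒜 B w c))) =
      sgn K ((j : ZMod 2) * i + u * (i + k) + v * t) •
        (gen 𝒜 B y l.1 * (gen 𝒜 B r l.2.1 * gen 𝒜 B x l.2.2) *
          (gen 𝒜 B z m.1 * (gen 𝒜 B q m.2.1 * gen 𝒜 B s m.2.2) * gen 𝒜 B w c)) :=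
  supercomm_digamma (isSuperComm 𝒜 B) (gen_mem_repParity 𝒜 B hx _) (gen_mem_repParity 𝒜 B hy _)
    (gen_mem_repParity 𝒜 B hz _) (gen_mem_repParity 𝒜 B hr _) (gen_mem_repParity 𝒜 B hs _)
    (gen_mem_repParity 𝒜 B hq _) _

theorem digammaConv_apply (hA : IsGradedCocommutative 𝒜) (hρ : IsFoxPairing 𝒜 n ρ)
    (a₁ a₂ a₃ : B) (x y z : A) :
    (digammaConv 𝒜 B ρ n a₁ a₂ a₃).ofConv ((hopfParity 𝒜).stmul (dblParity 𝒜) x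
      ((hopfParity 𝒜).stmul (hopfParity 𝒜) y z)) =
      genTri 𝒜 B a₁ a₂ a₃ (digamma 𝒜 n ρ (x ⊗ₜ (y ⊗ₜ z))) := by
  obtain ⟨X⟩ := nonempty_expansion₂ 𝒜 (comul (R := K) x)
  obtain ⟨Y⟩ := nonempty_expansion₂ 𝒜 (comul (R := K) y)
  obtain ⟨Z⟩ := nonempty_expansion₂ 𝒜 (comul (R := K) z)
  have R : ∀ i j, Expansion₃ 𝒜 (comul.lTensor A (comul (R := K) (ρ (X.snd i) (Y.snd j)))) :=
    fun i j => (nonempty_expansion₃ 𝒜 _).some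
  have Q : ∀ i j k l, Expansion₂ 𝒜 (comul (R := K) (ρ ((R i j).thd l) (Z.snd k))) :=
    fun i j k l => (nonempty_expansion₂ 𝒜 _).some
  have term : ∀ l m : B × B × B,
      ((gen₁ 𝒜 B 0 l.2.2 * (gen₂ 𝒜 B n l.1 * gen₃ 𝒜 B m.1)) *
        doublePairing 𝒜 B ρ n (a₃ * HopfAlgebra.antipode K m.2.1)
          (HopfAlgebra.antipode K l.2.1 * m.2.2)).ofConv
        ((hopfParity 𝒜).stmul (dblParity 𝒜) x ((hopfParity 𝒜).stmul (hopfParity 𝒜) y z)) =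
      ∑ i, ∑ j, ∑ k, ∑ u, ∑ v,
        (Y.deg₁ j * (X.deg₁ i + X.deg₂ i + n) + Z.deg₁ k * (X.deg₂ i + Y.deg₂ j)
          + (X.deg₁ i + Z.deg₁ k) * (R i j).deg₁ u
          + (R i j).deg₂ u * (Q i j k u).deg₁ v).negOnePow •
        (gen 𝒜 B (Y.fst j) l.1 * (gen 𝒜 B (GradedHopfAlgebra.antipode 𝒜 ((R i j).fst u)) l.2.1 *
          gen 𝒜 B (X.fst i) l.2.2) *
          (gen 𝒜 B (Z.fst k) m.1 *
            (gen 𝒜 B (GradedHopfAlgebra.antipode 𝒜 ((Q i j k u).fst v)) m.2.1 *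
              gen 𝒜 B ((R i j).snd u) m.2.2) * gen 𝒜 B ((Q i j k u).snd v) a₃)) := by
    intro l m
    refine (Parity.conv_stmul_stmul X.hom Y.hom Z.hom _ _).trans ?_
    refine Finset.sum_congr rfl fun i _ => Finset.sum_congr rfl fun j _ =>
      Finset.sum_congr rfl fun k _ => ?_
    have e₁ := gen_gen_gen_apply (B := B) (isHom_of_mem 𝒜 (Y.fst_mem j)) n (X.fst i) (Z.fst k)
      l.2.2 l.1 m.1
    have e₂ := doublePairing_expansion (B := B) hA hρ (R i j) (Q i j k) a₃ m.2.1 l.2.1 m.2.2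
    refine (congrArg₂ (fun a b : RepAlg 𝒜 B => sgn K ((X.deg₂ i : ZMod 2) * (Y.deg₁ j + Z.deg₁ k) +
      Y.deg₂ j * Z.deg₁ k) • (a * b)) e₁ e₂).trans ?_
    simp only [Finset.mul_sum, Finset.smul_sum]
    refine Finset.sum_congr rfl fun u _ => Finset.sum_congr rfl fun v _ => ?_
    rw [smul_mul_assoc, gen_digamma (X.fst_mem i) (Y.fst_mem j) (Z.fst_mem k)
      (GradedHopfAlgebra.antipode_mem _ _ ((R i j).fst_mem u)) ((R i j).snd_mem u)
      (GradedHopfAlgebra.antipode_mem _ _ ((Q i j k u).fst_mem v)), smul_smul, smul_smul,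
      ← sgn_add, ← sgn_add, negOnePow_smul (K := K)]
    push_cast
    congr 2
    ring
  rw [digammaConv_eq_triSum hA hρ]
  refine (map_triSum (evalₗ ((hopfParity 𝒜).stmul (dblParity 𝒜) x
    ((hopfParity 𝒜).stmul (hopfParity 𝒜) y z))) a₁ a₂ _).trans ?_
  refine (congrArg (triSum K (RepAlg 𝒜 B) a₁ a₂) (funext fun l => funext fun m =>
    term l m)).trans ?_
  rw [digamma_apply 𝒜 n ρ x y z X Y Z R Q]
  simp only [map_sum, triSum_sum]
  refine Finset.sum_congr rfl fun i _ => Finset.sum_congr rfl fun j _ =>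
    Finset.sum_congr rfl fun k _ => Finset.sum_congr rfl fun u _ =>
    Finset.sum_congr rfl fun v _ => ?_
  rw [LinearMap.map_smul_of_tower, genTri_mul_mul]
  exact (map_triSum (DistribSMul.toAddMonoidHom (RepAlg 𝒜 B) _) a₁ a₂ _).symm

end DigammaConv

section TripleConv

variable {K A : Type*} [CommRing K] [Ring A] [Algebra K A]
variable {𝒜 : ℤ → Submodule K A} [GradedAlgebra 𝒜] [Coalgebra K A] [GradedHopfAlgebra 𝒜]
variable {B : Type*} [CommRing B] [HopfAlgebra K B]
variable {ρ : A →ₗ[K] A →ₗ[K] A} {n : ℤ}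

theorem genTri_perm312 (a b c : B) :
    genTri 𝒜 B a b c ∘ₗ perm312 𝒜 0 = genTri 𝒜 B b c a := by
  refine TensorProduct.ext_threefold' fun x y z => ?_
  refine graded_induction 𝒜 (p := fun x => (genTri 𝒜 B a b c ∘ₗ perm312 𝒜 0) (x ⊗ₜ (y ⊗ₜ z)) =
    genTri 𝒜 B b c a (x ⊗ₜ (y ⊗ₜ z))) (fun p x hx => ?_) (fun x x' h h' => by
      simp only [TensorProduct.add_tmul, map_add, h, h']) x
  refine graded_induction 𝒜 (p := fun y => (genTri 𝒜 B a b c ∘ₗ perm312 𝒜 0) (x ⊗ₜ (y ⊗ₜ z)) =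
    genTri 𝒜 B b c a (x ⊗ₜ (y ⊗ₜ z))) (fun q y hy => ?_) (fun x x' h h' => by
      simp only [TensorProduct.add_tmul, TensorProduct.tmul_add, map_add, h, h']) y
  refine graded_induction 𝒜 (p := fun z => (genTri 𝒜 B a b c ∘ₗ perm312 𝒜 0) (x ⊗ₜ (y ⊗ₜ z)) =
    genTri 𝒜 B b c a (x ⊗ₜ (y ⊗ₜ z))) (fun r z hz => ?_) (fun x x' h h' => by
      simp only [TensorProduct.tmul_add, map_add, h, h']) z
  rw [LinearMap.comp_apply, perm312, LinearMap.comp_apply, behind, LinearMap.lTensor_tmul,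
    signedFlip_of_mem 𝒜 0 hy hz, tmul_units_smul, LinearMap.map_smul_of_tower,
    swapHead_of_mem A 𝒜 0 hx hz, smul_smul, LinearMap.map_smul_of_tower, genTri_tmul, genTri_tmul,
    ← mul_assoc (gen 𝒜 B x b), (isSuperComm 𝒜 B).comm ((isSuperComm 𝒜 B).mul_mem
      (gen_mem_repParity 𝒜 B hx b) (gen_mem_repParity 𝒜 B hy c)) (gen_mem_repParity 𝒜 B hz a),
    ← Int.negOnePow_add, negOnePow_smul (K := K)]
  push_cast
  congr 2
  ring

theorem perm231_of_mem (n : ℤ) {p q r : ℤ} {x y z : A} (hx : x ∈ 𝒜 p) (hy : y ∈ 𝒜 q)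
    (hz : z ∈ 𝒜 r) : perm231 𝒜 n (x ⊗ₜ (y ⊗ₜ z)) =
      ((p + n) * (q + r)).negOnePow • (y ⊗ₜ[K] (z ⊗ₜ[K] x)) := by
  rw [perm231, LinearMap.comp_apply, swapHead_of_mem A 𝒜 n hx hy, LinearMap.map_smul_of_tower,
    behind, LinearMap.lTensor_tmul, signedFlip_of_mem 𝒜 n hx hz, tmul_units_smul, smul_smul,
    ← Int.negOnePow_add]
  have e : (p + n) * (q + n) + (p + n) * (r + n) = (p + n) * (q + r) + ((p + n) * n + (p + n) * n) := by
    ring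
  rw [e, Int.negOnePow_add _ ((p + n) * n + _), Int.negOnePow_even _ ⟨_, rfl⟩, mul_one]

variable (𝒜) in
/-- A linear map on the tensor cube as a map on the signed tensor cube. -/
def trpConv : (A ⊗[K] (A ⊗[K] A) →ₗ[K] RepAlg 𝒜 B) →ₗ[K] TrpConv 𝒜 B where
  toFun F := toConv (F ∘ₗ ((hopfParity 𝒜).sp (hopfParity 𝒜)).symm.toLinearMap.lTensor A ∘ₗ
    ((hopfParity 𝒜).sp (dblParity 𝒜)).symm.toLinearMap)
  map_add' _ _ := rfl
  map_smul' _ _ := rfl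

theorem digammaConv_eq (hA : IsGradedCocommutative 𝒜) (hρ : IsFoxPairing 𝒜 n ρ) (a₁ a₂ a₃ : B) :
    digammaConv 𝒜 B ρ n a₁ a₂ a₃ = trpConv 𝒜 (genTri 𝒜 B a₁ a₂ a₃ ∘ₗ digamma 𝒜 n ρ) :=
  Parity.slice_ext fun x => Parity.slice_ext fun y => WithConv.ext (LinearMap.ext fun z =>
    digammaConv_apply hA hρ a₁ a₂ a₃ x y z)

variable (𝒜 n) in
/-- The maps `x ⊗ y ⊗ z ↦ x_b y_c z_d`, up to signs. -/
def genTriple (b c d : B) : TrpConv 𝒜 B := gen₁ 𝒜 B 0 b * (gen₂ 𝒜 B n c * gen₃ 𝒜 B d)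

theorem trpConv_mul_genTriple_apply (F : A ⊗[K] (A ⊗[K] A) →ₗ[K] RepAlg 𝒜 B) {x y z : A}
    (X : Expansion₂ 𝒜 (comul (R := K) x)) (Y : Expansion₂ 𝒜 (comul (R := K) y))
    (Z : Expansion₂ 𝒜 (comul (R := K) z)) (b c d : B) :
    (trpConv 𝒜 F * genTriple 𝒜 n b c d).ofConv ((hopfParity 𝒜).stmul (dblParity 𝒜) x
      ((hopfParity 𝒜).stmul (hopfParity 𝒜) y z)) = ∑ i, ∑ j, ∑ k,
      sgn K ((X.deg₂ i : ZMod 2) * (Y.deg₁ j + Z.deg₁ k) + Y.deg₂ j * (Z.deg₁ k + n)) •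
      (F (X.fst i ⊗ₜ (Y.fst j ⊗ₜ Z.fst k)) *
        (gen 𝒜 B (X.snd i) b * (gen 𝒜 B (Y.snd j) c * gen 𝒜 B (Z.snd k) d))) := by
  refine (Parity.conv_stmul_stmul X.hom Y.hom Z.hom _ _).trans ?_
  refine Finset.sum_congr rfl fun i _ => Finset.sum_congr rfl fun j _ =>
    Finset.sum_congr rfl fun k _ => ?_
  have e := gen_gen_gen_apply (B := B) (isHom_of_mem 𝒜 (Y.snd_mem j)) n (X.snd i) (Z.snd k) b c d
  refine (congrArg (fun a : RepAlg 𝒜 B => sgn K ((X.deg₂ i : ZMod 2) * (Y.deg₁ j + Z.deg₁ k) +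
    Y.deg₂ j * Z.deg₁ k) • (F (X.fst i ⊗ₜ (Y.fst j ⊗ₜ Z.fst k)) * a)) e).trans ?_
  rw [mul_smul_comm, smul_smul, ← sgn_add]
  congr 2
  ring

theorem trpConv_perm231 (F : A ⊗[K] (A ⊗[K] A) →ₗ[K] RepAlg 𝒜 B) {p q r : ℤ} {x y z : A}
    (hx : x ∈ 𝒜 p) (hy : y ∈ 𝒜 q) (hz : z ∈ 𝒜 r) (b c d : B) :
    sgn K (((p : ZMod 2) + n) * (r + n)) •
      (trpConv 𝒜 (F ∘ₗ perm231 𝒜 n) * genTriple 𝒜 n b c d).ofConv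
        ((hopfParity 𝒜).stmul (dblParity 𝒜) x ((hopfParity 𝒜).stmul (hopfParity 𝒜) y z)) =
    sgn K (((q : ZMod 2) + n) * (p + n)) •
      (trpConv 𝒜 F * genTriple 𝒜 n c d b).ofConv
        ((hopfParity 𝒜).stmul (dblParity 𝒜) y ((hopfParity 𝒜).stmul (hopfParity 𝒜) z x)) := by
  obtain ⟨X, hX⟩ := exists_expansion₂ hx
  obtain ⟨Y, hY⟩ := exists_expansion₂ hy
  obtain ⟨Z, hZ⟩ := exists_expansion₂ hz
  rw [trpConv_mul_genTriple_apply _ X Y Z, trpConv_mul_genTriple_apply _ Y Z X]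
  simp only [Finset.smul_sum]
  rw [Finset.sum_comm]
  refine Finset.sum_congr rfl fun j _ => ?_
  rw [Finset.sum_comm]
  refine Finset.sum_congr rfl fun k _ => Finset.sum_congr rfl fun i _ => ?_
  rw [LinearMap.comp_apply, perm231_of_mem n (X.fst_mem i) (Y.fst_mem j) (Z.fst_mem k),
    LinearMap.map_smul_of_tower, negOnePow_smul (K := K), smul_mul_assoc, smul_smul, smul_smul,
    smul_smul, ← sgn_add, ← sgn_add]
  have e : gen 𝒜 B (X.snd i) b * (gen 𝒜 B (Y.snd j) c * gen 𝒜 B (Z.snd k) d) =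
      sgn K ((X.deg₂ i : ZMod 2) * (Y.deg₂ j + Z.deg₂ k)) •
        (gen 𝒜 B (Y.snd j) c * (gen 𝒜 B (Z.snd k) d * gen 𝒜 B (X.snd i) b)) := by
    have h := (isSuperComm 𝒜 B).comm (gen_mem_repParity 𝒜 B (X.snd_mem i) b)
      ((isSuperComm 𝒜 B).mul_mem (gen_mem_repParity 𝒜 B (Y.snd_mem j) c)
        (gen_mem_repParity 𝒜 B (Z.snd_mem k) d))
    rw [h, mul_assoc]
  rw [e, mul_smul_comm, smul_smul, ← sgn_add, ← sgn_add]
  congr 2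
  rw [← hX i, ← hY j, ← hZ k]
  push_cast
  generalize (X.deg₁ i : ZMod 2) = x₁
  generalize (X.deg₂ i : ZMod 2) = x₂
  generalize (Y.deg₁ j : ZMod 2) = y₁
  generalize (Y.deg₂ j : ZMod 2) = y₂
  generalize (Z.deg₁ k : ZMod 2) = z₁
  generalize (Z.deg₂ k : ZMod 2) = z₂
  generalize (n : ZMod 2) = n
  clear e
  revert x₁ x₂ y₁ y₂ z₁ z₂ n
  decide

end TripleConv

section Rotate

variable {K B : Type*} [CommRing K] [CommRing B] [HopfAlgebra K B]

theorem Sweedler₆.sum_rotate {T : Type*} [CommRing T] [Algebra K T] {p : B}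
    (hp : IsCosymmetric K p) (π : Sweedler₆ (K := K) p) (f g h l m u : B →ₗ[K] T) :
    ∑ i, f (π.el i 1) * (g (π.el i 2) * (h (π.el i 3) * (l (π.el i 4) * (m (π.el i 5) *
        u (π.el i 0))))) =
      ∑ i, f (π.el i 0) * (g (π.el i 1) * (h (π.el i 2) * (l (π.el i 3) * (m (π.el i 4) *
        u (π.el i 5))))) := by
  have e₁ := π.conv_apply (T := T) (toConv u) (toConv f) (toConv g) (toConv h) (toConv l) (toConv m)
  have e₂ := π.conv_apply (T := T) (toConv f) (toConv g) (toConv h) (toConv l) (toConv m) (toConv u)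
  have e₃ := hp.conv_comm (toConv u) (toConv f * (toConv g * (toConv h * (toConv l * toConv m))))
    fun b c => mul_comm _ _
  simp only [mul_assoc] at e₃
  refine Eq.trans (Finset.sum_congr rfl fun i _ => ?_) (e₁.symm.trans (e₃.trans e₂))
  simp only
  ring

theorem Sweedler₆.sum_rotate_algHom {P : Type*} [CommRing P] [Algebra K P] {p : B}
    (hp : IsCosymmetric K p) (π : Sweedler₆ (K := K) p) (f g h : B →ₐ[K] P) :
    ∑ i, (f (π.el i 1) * (g (π.el i 2) * h (π.el i 3))) ⊗ₜ[K]
        (f (π.el i 4) * (g (π.el i 5) * h (π.el i 0))) =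
      ∑ i, (f (π.el i 0) * (g (π.el i 1) * h (π.el i 2))) ⊗ₜ[K]
        (f (π.el i 3) * (g (π.el i 4) * h (π.el i 5))) := by
  let l := (Algebra.TensorProduct.includeLeft : P →ₐ[K] P ⊗[K] P)
  let r := (Algebra.TensorProduct.includeRight : P →ₐ[K] P ⊗[K] P)
  have e : ∀ a b c a' b' c' : B, l (f a) * (l (g b) * (l (h c) * (r (f a') * (r (g b') *
      r (h c'))))) = (f a * (g b * h c)) ⊗ₜ[K] (f a' * (g b' * h c')) := by
    intro a b c a' b' c'
    simp [l, r]
  have h := π.sum_rotate hp (l.comp f).toLinearMap (l.comp g).toLinearMap (l.comp h).toLinearMap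
    (r.comp f).toLinearMap (r.comp g).toLinearMap (r.comp h).toLinearMap
  simpa only [AlgHom.toLinearMap_apply, AlgHom.comp_apply, e] using h

theorem Sweedler₆.sum_rotate_tmul {p : B} (hp : IsCosymmetric K p) (π : Sweedler₆ (K := K) p) :
    ∑ i, π.el i 1 ⊗ₜ[K] (π.el i 2 ⊗ₜ[K] (π.el i 3 ⊗ₜ[K] (π.el i 4 ⊗ₜ[K]
        (π.el i 5 ⊗ₜ[K] π.el i 0)))) =
      ∑ i, π.el i 0 ⊗ₜ[K] (π.el i 1 ⊗ₜ[K] (π.el i 2 ⊗ₜ[K] (π.el i 3 ⊗ₜ[K]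
        (π.el i 4 ⊗ₜ[K] π.el i 5)))) := by
  let r := (Algebra.TensorProduct.includeRight : B ⊗[K] B →ₐ[K] B ⊗[K] (B ⊗[K] B))
  have h := π.sum_rotate_algHom hp
    (Algebra.TensorProduct.includeLeft : B →ₐ[K] B ⊗[K] (B ⊗[K] B))
    (r.comp (Algebra.TensorProduct.includeLeft : B →ₐ[K] B ⊗[K] B))
    (r.comp (Algebra.TensorProduct.includeRight : B →ₐ[K] B ⊗[K] B))
  have e : ∀ a b c : B, (Algebra.TensorProduct.includeLeft : B →ₐ[K] B ⊗[K] (B ⊗[K] B)) a *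
      (r.comp (Algebra.TensorProduct.includeLeft : B →ₐ[K] B ⊗[K] B) b *
        r.comp (Algebra.TensorProduct.includeRight : B →ₐ[K] B ⊗[K] B) c) =
      a ⊗ₜ[K] (b ⊗ₜ[K] c) := by
    intro a b c
    simp [r]
  simp only [e] at h
  have h' := congrArg (fun t => (TensorProduct.assoc K B B (B ⊗[K] (B ⊗[K] B))).toLinearMap.lTensor B
    (TensorProduct.assoc K B (B ⊗[K] B) (B ⊗[K] (B ⊗[K] B)) t)) h
  simpa only [map_sum, TensorProduct.assoc_tmul, LinearMap.lTensor_tmul,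
    LinearEquiv.coe_coe] using h'

/-- The cyclic rotation of an expansion of the iterated comultiplication. -/
def Sweedler₆.rotate {p : B} (hp : IsCosymmetric K p) (π : Sweedler₆ (K := K) p) :
    Sweedler₆ (K := K) p where
  size := π.size
  el i k := π.el i (k + 1)
  sum_eq := (π.sum_rotate_tmul hp).trans π.sum_eq

theorem nonempty_sweedler₆ (b : B) : Nonempty (Sweedler₆ (K := K) b) := by
  suffices h : ∀ t : B ⊗[K] (B ⊗[K] (B ⊗[K] (B ⊗[K] (B ⊗[K] B)))), ∃ (m : ℕ)
      (f : Fin m → Fin 6 → B), ∑ i, f i 0 ⊗ₜ[K] (f i 1 ⊗ₜ[K] (f i 2 ⊗ₜ[K] (f i 3 ⊗ₜ[K]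
        (f i 4 ⊗ₜ[K] f i 5)))) = t by
    obtain ⟨m, f, h⟩ := h _
    exact ⟨⟨m, f, h⟩⟩
  have add : ∀ s t : B ⊗[K] (B ⊗[K] (B ⊗[K] (B ⊗[K] (B ⊗[K] B)))),
      (∃ (m : ℕ) (f : Fin m → Fin 6 → B), ∑ i, f i 0 ⊗ₜ[K] (f i 1 ⊗ₜ[K] (f i 2 ⊗ₜ[K]
        (f i 3 ⊗ₜ[K] (f i 4 ⊗ₜ[K] f i 5)))) = s) →
      (∃ (m : ℕ) (f : Fin m → Fin 6 → B), ∑ i, f i 0 ⊗ₜ[K] (f i 1 ⊗ₜ[K] (f i 2 ⊗ₜ[K]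
        (f i 3 ⊗ₜ[K] (f i 4 ⊗ₜ[K] f i 5)))) = t) →
      ∃ (m : ℕ) (f : Fin m → Fin 6 → B), ∑ i, f i 0 ⊗ₜ[K] (f i 1 ⊗ₜ[K] (f i 2 ⊗ₜ[K]
        (f i 3 ⊗ₜ[K] (f i 4 ⊗ₜ[K] f i 5)))) = s + t := by
    rintro s t ⟨m, f, rfl⟩ ⟨m', f', rfl⟩
    exact ⟨m + m', Fin.append f f', by simp [Fin.sum_univ_add]⟩
  intro t
  induction t with
  | zero => exact ⟨0, Fin.elim0, by simp⟩
  | add s t hs ht => exact add s t hs ht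
  | tmul x t =>
    induction t with
    | zero => exact ⟨0, Fin.elim0, by simp⟩
    | add s t hs ht => rw [TensorProduct.tmul_add]; exact add _ _ hs ht
    | tmul y t =>
      induction t with
      | zero => exact ⟨0, Fin.elim0, by simp⟩
      | add s t hs ht =>
        rw [TensorProduct.tmul_add, TensorProduct.tmul_add]
        exact add _ _ hs ht
      | tmul z t =>
        obtain ⟨m, f, g, h, rfl⟩ := exists_sum_tmul_tmul t
        exact ⟨m, fun i => ![x, y, z, f i, g i, h i], by simp [TensorProduct.tmul_sum]⟩

end Rotate

section Tritensor

variable {K A : Type*} [CommRing K] [Ring A] [Algebra K A]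
variable {𝒜 : ℤ → Submodule K A} [GradedAlgebra 𝒜] [Coalgebra K A] [GradedHopfAlgebra 𝒜]
variable {B : Type*} [CommRing B] [HopfAlgebra K B]
variable {ρ : A →ₗ[K] A →ₗ[K] A} {n : ℤ}

theorem mergeBrk_eq_sum (hA : IsGradedCocommutative 𝒜) (hρ : IsFoxPairing 𝒜 n ρ) {t : B}
    (ht : IsTraceLike K t) (b c d : B)
    (π : Sweedler₆ (K := K) (t + HopfAlgebra.antipode K t)) :
    mergeBrk 𝒜 B ρ n (traceForm ht) b c d = ∑ i,
      trpConv 𝒜 (genTri 𝒜 B (π.el i 0) (π.el i 4) (π.el i 2) ∘ₗ digamma 𝒜 n ρ) *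
        genTriple 𝒜 n (curly (traceForm ht) b (π.el i 1)) (curly (traceForm ht) c (π.el i 5))
          (curly (traceForm ht) d (π.el i 3)) := by
  rw [mergeBrk_eq hA ht b c d π]
  refine Finset.sum_congr rfl fun i _ => ?_
  rw [digammaConv_eq hA hρ]
  rfl

theorem genTri_comp_tritensor (a b c : B) : genTri 𝒜 B a b c ∘ₗ tritensor 𝒜 n ρ =
    genTri 𝒜 B a b c ∘ₗ digamma 𝒜 n ρ +
      (genTri 𝒜 B b c a ∘ₗ digamma 𝒜 n ρ) ∘ₗ perm231 𝒜 n +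
      ((genTri 𝒜 B c a b ∘ₗ digamma 𝒜 n ρ) ∘ₗ perm231 𝒜 n) ∘ₗ perm231 𝒜 n := by
  refine LinearMap.ext fun t => ?_
  have h : tritensor 𝒜 n ρ t = digamma 𝒜 n ρ t + perm312 𝒜 0 (digamma 𝒜 n ρ (perm231 𝒜 n t)) +
      perm312 𝒜 0 (perm312 𝒜 0 (digamma 𝒜 n ρ (perm231 𝒜 n (perm231 𝒜 n t)))) := by
    simp only [tritensor, Finset.sum_range_succ, Finset.sum_range_zero, pow_succ, pow_zero, zero_add,
      one_mul, mul_one, LinearMap.add_apply, Module.End.mul_apply]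
  have h₁ := LinearMap.congr_fun (genTri_perm312 (𝒜 := 𝒜) a b c)
  have h₂ := LinearMap.congr_fun (genTri_perm312 (𝒜 := 𝒜) b c a)
  simp only [LinearMap.comp_apply] at h₁ h₂
  simp only [LinearMap.add_apply, LinearMap.comp_apply, h, map_add, h₁, h₂]

theorem tritensor_term (F F' F'' G : A ⊗[K] (A ⊗[K] A) →ₗ[K] RepAlg 𝒜 B)
    (hG : G = F + F' ∘ₗ perm231 𝒜 n + (F'' ∘ₗ perm231 𝒜 n) ∘ₗ perm231 𝒜 n) {p q r : ℤ} {x y z : A}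
    (hx : x ∈ 𝒜 p) (hy : y ∈ 𝒜 q) (hz : z ∈ 𝒜 r) (b c d : B) :
    sgn K (((p : ZMod 2) + n) * (r + n)) •
      (trpConv 𝒜 G * genTriple 𝒜 n b c d).ofConv ((hopfParity 𝒜).stmul (dblParity 𝒜) x
        ((hopfParity 𝒜).stmul (hopfParity 𝒜) y z)) =
    sgn K (((p : ZMod 2) + n) * (r + n)) •
        (trpConv 𝒜 F * genTriple 𝒜 n b c d).ofConv ((hopfParity 𝒜).stmul (dblParity 𝒜) x
          ((hopfParity 𝒜).stmul (hopfParity 𝒜) y z)) +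
      sgn K (((p : ZMod 2) + n) * (q + n)) •
        (trpConv 𝒜 F' * genTriple 𝒜 n c d b).ofConv ((hopfParity 𝒜).stmul (dblParity 𝒜) y
          ((hopfParity 𝒜).stmul (hopfParity 𝒜) z x)) +
      sgn K (((q : ZMod 2) + n) * (r + n)) •
        (trpConv 𝒜 F'' * genTriple 𝒜 n d b c).ofConv ((hopfParity 𝒜).stmul (dblParity 𝒜) z
          ((hopfParity 𝒜).stmul (hopfParity 𝒜) x y)) := by
  have h₁ := trpConv_perm231 (n := n) F' hx hy hz b c d
  have h₂ := trpConv_perm231 (n := n) (F'' ∘ₗ perm231 𝒜 n) hx hy hz b c d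
  have h₃ := trpConv_perm231 (n := n) F'' hy hz hx c d b
  rw [mul_comm ((p : ZMod 2) + n) (q + n), mul_comm ((q : ZMod 2) + n) (r + n), ← h₁, ← h₃, ← h₂,
    ← smul_add, ← smul_add]
  obtain ⟨X⟩ := nonempty_expansion₂ 𝒜 (comul (R := K) x)
  obtain ⟨Y⟩ := nonempty_expansion₂ 𝒜 (comul (R := K) y)
  obtain ⟨Z⟩ := nonempty_expansion₂ 𝒜 (comul (R := K) z)
  simp only [trpConv_mul_genTriple_apply _ X Y Z, ← Finset.sum_add_distrib, ← smul_add, ← add_mul,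
    hG, LinearMap.add_apply]

variable {bul : B →ₗ[K] B →ₗ[K] K} {br : RepAlg 𝒜 B →ₗ[K] RepAlg 𝒜 B →ₗ[K] RepAlg 𝒜 B}

theorem jacobiator_gen_eq_sum (hA : IsGradedCocommutative 𝒜) (hρ : IsFoxPairing 𝒜 n ρ) {t : B}
    (ht : IsTraceLike K t) (h : IsRepBracket 𝒜 B n br)
    (hg : ∀ x b y c, br (gen 𝒜 B x b) (gen 𝒜 B y c) = genBrk 𝒜 B ρ n (traceForm ht) x b y c)
    {p q r : ℤ} {x y z : A} (hx : x ∈ 𝒜 p) (hy : y ∈ 𝒜 q) (hz : z ∈ 𝒜 r) (b c d : B)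
    (π : Sweedler₆ (K := K) (t + HopfAlgebra.antipode K t)) :
    jacobiator n br p q r (gen 𝒜 B x b) (gen 𝒜 B y c) (gen 𝒜 B z d) =
      -∑ i, sgn K (((p : ZMod 2) + n) * (r + n)) •
        (trpConv 𝒜 (genTri 𝒜 B (π.el i 0) (π.el i 4) (π.el i 2) ∘ₗ tritensor 𝒜 n ρ) *
          genTriple 𝒜 n (curly (traceForm ht) b (π.el i 1)) (curly (traceForm ht) c (π.el i 5))
            (curly (traceForm ht) d (π.el i 3))).ofConv ((hopfParity 𝒜).stmul (dblParity 𝒜) x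
              ((hopfParity 𝒜).stmul (hopfParity 𝒜) y z)) := by
  have hp : IsCosymmetric K (t + HopfAlgebra.antipode K t) :=
    ht.cosymmetric.add ht.cosymmetric.antipode
  have e : ∀ i, _ := fun i => tritensor_term (n := n)
    (genTri 𝒜 B (π.el i 0) (π.el i 4) (π.el i 2) ∘ₗ digamma 𝒜 n ρ)
    (genTri 𝒜 B (π.el i 4) (π.el i 2) (π.el i 0) ∘ₗ digamma 𝒜 n ρ)
    (genTri 𝒜 B (π.el i 2) (π.el i 0) (π.el i 4) ∘ₗ digamma 𝒜 n ρ) _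
    (genTri_comp_tritensor (π.el i 0) (π.el i 4) (π.el i 2)) hx hy hz
    (curly (traceForm ht) b (π.el i 1)) (curly (traceForm ht) c (π.el i 5))
    (curly (traceForm ht) d (π.el i 3))
  simp only [e, Finset.sum_add_distrib, ← Finset.smul_sum]
  rw [jacobiator_gen hA hρ h hg hx hy hz b c d, mergeBrk_eq_sum hA hρ ht b c d π,
    mergeBrk_eq_sum hA hρ ht c d b ((((π.rotate hp).rotate hp).rotate hp).rotate hp),
    mergeBrk_eq_sum hA hρ ht d b c ((π.rotate hp).rotate hp)]
  simp only [ofConv_sum, LinearMap.sum_apply]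
  rfl

theorem satisfiesJacobiatorFormula (hA : IsGradedCocommutative 𝒜) (hρ : IsFoxPairing 𝒜 n ρ) {t : B}
    (ht : IsTraceLike K t) (h : IsRepBracket 𝒜 B n br)
    (hg : ∀ x b y c, br (gen 𝒜 B x b) (gen 𝒜 B y c) = genBrk 𝒜 B ρ n (traceForm ht) x b y c) :
    SatisfiesJacobiatorFormula 𝒜 n ρ (traceForm ht) (t + HopfAlgebra.antipode K t) br := by
  intro p q r x y z b c d hx hy hz X Y Z T π
  have e := jacobiator_gen_eq_sum hA hρ ht h hg hx hy hz b c d π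
  have e₁ : jacobiator n br p q r (gen 𝒜 B x b) (gen 𝒜 B y c) (gen 𝒜 B z d) =
      ((p + n) * (r + n)).negOnePow • br (gen 𝒜 B x b) (br (gen 𝒜 B y c) (gen 𝒜 B z d)) +
      ((r + n) * (q + n)).negOnePow • br (gen 𝒜 B z d) (br (gen 𝒜 B x b) (gen 𝒜 B y c)) +
      ((q + n) * (p + n)).negOnePow • br (gen 𝒜 B y c) (br (gen 𝒜 B z d) (gen 𝒜 B x b)) := by
    rw [negOnePow_smul (K := K), negOnePow_smul (K := K), negOnePow_smul (K := K)]
    push_cast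
    rw [mul_comm ((r : ZMod 2) + n), mul_comm ((q : ZMod 2) + n) (p + n), add_right_comm]
    rfl
  rw [← e₁, e]
  congr 1
  simp only [trpConv_mul_genTriple_apply _ X Y Z, Finset.smul_sum]
  rw [Finset.sum_comm]
  refine Finset.sum_congr rfl fun i _ => ?_
  rw [Finset.sum_comm]
  refine Finset.sum_congr rfl fun j _ => ?_
  rw [Finset.sum_comm]
  refine Finset.sum_congr rfl fun k _ => ?_
  rw [Finset.sum_comm]
  refine Finset.sum_congr rfl fun m _ => ?_
  rw [LinearMap.comp_apply]
  conv_lhs => rw [← (T i j k).sum_eq]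
  simp only [map_sum, Finset.sum_mul, Finset.smul_sum]
  refine Finset.sum_congr rfl fun l _ => ?_
  rw [genTri_tmul, smul_smul, ← sgn_add, negOnePow_smul (K := K)]
  push_cast
  simp only [mul_assoc]
  congr 2
  ring

theorem jacobiator_gen_eq_zero (hA : IsGradedCocommutative 𝒜) (hρ : IsFoxPairing 𝒜 n ρ) {t : B}
    (ht : IsTraceLike K t) (h : IsRepBracket 𝒜 B n br)
    (hg : ∀ x b y c, br (gen 𝒜 B x b) (gen 𝒜 B y c) = genBrk 𝒜 B ρ n (traceForm ht) x b y c)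
    (hG : IsGerstenhaberFoxPairing 𝒜 n ρ) {p q r : ℤ} {x y z : A} (hx : x ∈ 𝒜 p) (hy : y ∈ 𝒜 q)
    (hz : z ∈ 𝒜 r) (b c d : B) :
    jacobiator n br p q r (gen 𝒜 B x b) (gen 𝒜 B y c) (gen 𝒜 B z d) = 0 := by
  obtain ⟨π⟩ := nonempty_sweedler₆ (K := K) (t + HopfAlgebra.antipode K t)
  rw [IsGerstenhaberFoxPairing] at hG
  rw [jacobiator_gen_eq_sum hA hρ ht h hg hx hy hz b c d π]
  simp [hG]

end Tritensor

end FoxRep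

end

theorem mainTheorem2 {K A B : Type*} [CommRing K]
    [Ring A] [Algebra K A] (𝒜 : ℤ → Submodule K A) [GradedAlgebra 𝒜] [Coalgebra K A]
    [FoxRep.GradedHopfAlgebra 𝒜] (hA : FoxRep.IsGradedCocommutative 𝒜)
    (n : ℤ) (ρ : A →ₗ[K] A →ₗ[K] A) (hρ : FoxRep.IsFoxPairing 𝒜 n ρ)
    (hρa : FoxRep.IsAntisymmetricFoxPairing 𝒜 n ρ)
    [CommRing B] [HopfAlgebra K B] (t : B) (ht : FoxRep.IsTraceLike K t) :
    ∃ br : FoxRep.RepAlg 𝒜 B →ₗ[K] FoxRep.RepAlg 𝒜 B →ₗ[K] FoxRep.RepAlg 𝒜 B,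
      -- `br` is the unique `n`-graded bracket given by the main formula; it is antisymmetric
      (FoxRep.IsGradedBracket (FoxRep.repGrading 𝒜 B) n br ∧
        FoxRep.SatisfiesMainFormula 𝒜 n ρ (FoxRep.traceForm ht) br) ∧
      (∀ br' : FoxRep.RepAlg 𝒜 B →ₗ[K] FoxRep.RepAlg 𝒜 B →ₗ[K] FoxRep.RepAlg 𝒜 B,
        FoxRep.IsGradedBracket (FoxRep.repGrading 𝒜 B) n br' ∧
          FoxRep.SatisfiesMainFormula 𝒜 n ρ (FoxRep.traceForm ht) br' → br' = br) ∧
      FoxRep.IsAntisymmetricBracket (FoxRep.repGrading 𝒜 B) n br ∧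
      -- the Jacobiator in terms of the tritensor map, with `p = t + s(t)`
      FoxRep.SatisfiesJacobiatorFormula 𝒜 n ρ (FoxRep.traceForm ht)
        (t + HopfAlgebra.antipode K t) br ∧
      -- if `ρ` is Gerstenhaber, then so is the bracket
      (FoxRep.IsGerstenhaberFoxPairing 𝒜 n ρ →
        FoxRep.IsGerstenhaberBracket (FoxRep.repGrading 𝒜 B) n br) := by
  obtain ⟨br, h, hg⟩ := FoxRep.exists_isRepBracket hA hρ hρa (FoxRep.isBalanced_traceForm ht)
    (FoxRep.traceForm_isCounitDer ht) (FoxRep.traceForm_symm ht)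
  refine ⟨br, ⟨h.isGradedBracket, FoxRep.satisfiesMainFormula_iff.2 hg⟩, fun br' h' => ?_,
    h.isAntisymmetricBracket, FoxRep.satisfiesJacobiatorFormula hA hρ ht h hg, fun hG => ?_⟩
  · refine h'.1.ext h.isGradedBracket fun x b y c => ?_
    rw [FoxRep.satisfiesMainFormula_iff.1 h'.2, hg]
  · exact h.isGerstenhaberBracket fun p q r x y z b c d hx hy hz =>
      FoxRep.jacobiator_gen_eq_zero hA hρ ht h hg hG hx hy hz b c d
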